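/- Let $\Sigma$ be a finite, totally ordered alphabet with two distinguished distinct letters $\mathbf 0,\mathbf 1$. Let $\Sigma_\circ=\Sigma\cup\{\circ\}$, where $\circ$ stands for an empty cell and is ordered below all letters. A tape content is a partial class function $x$ from $\mathrm{Ord}$ to $\Sigma$ (we write $x(\eta)=\circ$ where $x$ is undefined), and $\Sigma^{<\mathrm{Ord}}$ is the class of tape contents whose domain is an ordinal ("words"). A program is a partial function $q\colon \mathrm{Ord}\times\Sigma_\circ\dashrightarrow\mathrm{Ord}\times\Sigma_\circ\times\{\text{left},\text{stay},\text{right}\}$; it is finite if its domain is finite, and transfinite if its domain is a set. The computation of $q$ on a tape content $x$ is the $\mathrm{Ord}$-sequence of snapshots $(x_\gamma,\alpha_\gamma,\beta_\gamma)$ (tape content, state, head position) with $(x_0,\alpha_0,\beta_0)=(x,0,0)$, defined as follows. At a successor time $\gamma+1$: if $q(\alpha_\gamma,x_\gamma(\beta_\gamma))$ is undefined, the snapshot is repeated; if it is $(\delta,\sigma,\mathbf m)$, then $\alpha_{\gamma+1}=\delta$, the content of cell $\beta_\gamma$ becomes $\sigma$ and the other cells are unchanged, and the head moves according to $\mathbf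 m$: right to $\beta_\gamma+1$, stay, or left to the predecessor of $\beta_\gamma$ (to cell $0$ if $\beta_\gamma$ is $0$ or a limit). At a limit time $\lambda$: $x_\lambda(\eta)=\liminf_{\xi<\lambda}x_\xi(\eta)$, $\alpha_\lambda=\liminf_{\xi<\lambda}\alpha_\xi$, and $\beta_\lambda=\liminf\{\beta_\xi : \xi<\lambda,\ \alpha_\xi=\alpha_\lambda\}$, where the last expression means $\sup_{\zeta<\lambda}\inf\{\beta_\xi:\zeta\le\xi<\lambda,\ \alpha_\xi=\alpha_\lambda\}$ with $\inf\emptyset=0$. The computation halts if some $\alpha_\gamma=1$; then $I(q)(x):=x_\gamma$ for the least such $\gamma$. Otherwise $I(q)(x)$ is undefined. Let $(p,w)\mapsto p*w$ be the following bijection $\Sigma^{<\mathrm{Ord}}\times\Sigma^{<\mathrm{Ord}}\to\Sigma^{<\mathrm{Ord}}$: $p*w$ is the word $\mathbf 1\,p(0)\,\mathbf 1\,p(1)\,\mathbf 1\,p(2)\cdots$ (the letter $\mathbf 1$ in front of every letter of $p$) followed by $t(w)$, where $t(\varnothing)=\mathbf 1$, $t(\mathbf 0^{n+1})=\mathbf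 0^{n}$ and $t(\mathbf 0^n\mathbf 1u)=\mathbf 0^{n+1}\mathbf 1u$ for $n\in\mathbb N$ and every word $u$, and $t(w)=w$ for all other words $w$. A partial function $f\colon\Sigma^{<\mathrm{Ord}}\dashrightarrow\Sigma^{<\mathrm{Ord}}$ is symmetrically computable if there is a transfinite program $q$ such that for all $w\in\Sigma^{<\mathrm{Ord}}$, $I(q)(w)=f(w)$ (both sides undefined, or both defined and equal). It is Koepke computable in parameter $p\in\Sigma^{<\mathrm{Ord}}$ if there is a finite program $q$ such that for all $w\in\Sigma^{<\mathrm{Ord}}$, $I(q)(p*w)=f(w)$ in the same sense. **Proposition.** A partial function $f\colon\Sigma^{<\mathrm{Ord}}\dashrightarrow\Sigma^{<\mathrm{Ord}}$ is symmetrically computable if and only if there is a $p\in\Sigma^{<\mathrm{Ord}}$ such that $f$ is Koepke computable in parameter $p$. -/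

import Mathlib

universe u v

namespace OrdTM

/-! ### Tapes and words -/

/-- A tape content over the alphabet `A`, i.e. a partial function from the ordinals to `A`. The value
`⊥` says that the cell is empty (the partial function is undefined there); it is placed below all
letters of the ordered alphabet. -/
abbrev Tape (A : Type v) : Type (max (u + 1) v) := Ordinal.{u} → WithBot A

/-- The words of ordinal length over `A`: the tape contents whose domain is an ordinal `len`. -/
structure Word (A : Type v) : Type (max (u + 1) v) where
  tape : Tape.{u} A
  len : Ordinal.{u}
  ne_bot_iff : ∀ β, tape β ≠ ⊥ ↔ β < len

namespace Word

variable {A : Type v}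

theorem ext_tape {w w' : Word.{u} A} (h : w.tape = w'.tape) : w = w' := by
  have hl : w.len = w'.len := by
    refine le_antisymm (le_of_forall_lt fun c hc => ?_) (le_of_forall_lt fun c hc => ?_)
    · rw [← w'.ne_bot_iff, ← h, w.ne_bot_iff]; exact hc
    · rw [← w.ne_bot_iff, h, w'.ne_bot_iff]; exact hc
  cases w; cases w'; simp_all

theorem eq_bot_iff (w : Word.{u} A) (β : Ordinal.{u}) : w.tape β = ⊥ ↔ w.len ≤ β := by
  rw [← not_lt, ← w.ne_bot_iff, not_not]

/-- The word of length one with letter `a`. -/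
noncomputable def letter (a : A) : Word.{u} A where
  tape γ := if γ = 0 then (a : WithBot A) else ⊥
  len := 1
  ne_bot_iff γ := by rw [Order.lt_one_iff]; split_ifs <;> simp_all

/-- Concatenation of words. -/
noncomputable def append (a b : Word.{u} A) : Word.{u} A where
  tape γ := if γ < a.len then a.tape γ else b.tape (γ - a.len)
  len := a.len + b.len
  ne_bot_iff γ := by
    split_ifs with h
    · simp only [a.ne_bot_iff, h, true_iff]
      exact h.trans_le le_self_add
    · rw [b.ne_bot_iff, ← add_lt_add_iff_left a.len, Ordinal.add_sub_cancel_of_le (not_lt.1 h)]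

/-- The word without its first letter. -/
noncomputable def dropFirst (w : Word.{u} A) : Word.{u} A where
  tape γ := w.tape (1 + γ)
  len := w.len - 1
  ne_bot_iff γ := by rw [w.ne_bot_iff, Ordinal.lt_sub]

/-- The word `one w₀ one w₁ one w₂ …`, in which the letter `one` is written in front of every letter
of `w`. Every ordinal `γ` is `2 * (γ / 2) + γ % 2`, so `w` occupies the odd places. -/
noncomputable def marked (one : A) (w : Word.{u} A) : Word.{u} A where
  tape γ := if γ < 2 * w.len then (if γ % 2 = 0 then (one : WithBot A) else w.tape (γ / 2)) else ⊥
  len := 2 * w.len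
  ne_bot_iff γ := by
    split_ifs with h h2
    · simp [h]
    · simp only [w.ne_bot_iff, h, iff_true]
      rwa [← Ordinal.lt_mul_iff_div_lt two_ne_zero]
    · simp [h]

/-- `w` is one of the finite words `zero zero … zero`, including the empty word. -/
def IsZeros (zero : A) (w : Word.{u} A) : Prop :=
  w.len < Ordinal.omega0 ∧ ∀ β < w.len, w.tape β = zero

/-- `w` begins with finitely many (possibly no) letters `zero`, followed by a letter `one`. -/
def StartsZerosOne (zero one : A) (w : Word.{u} A) : Prop :=
  ∃ n : ℕ, w.tape n = one ∧ ∀ m < n, w.tape m = zero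

open Classical in
/-- A bijection from the words onto the words that do not begin with `one`, together with the word
`one`: the empty word goes to `one`, from the other words `zero … zero` one letter is removed, words
`zero … zero one …` get one more letter `zero`, and all other words are fixed. -/
noncomputable def tail (zero one : A) (w : Word.{u} A) : Word.{u} A :=
  if w.IsZeros zero then (if w.len = 0 then letter one else w.dropFirst)
  else if w.StartsZerosOne zero one then (letter zero).append w
  else w

/-- The pairing `p * w` of words: `one p₀ one p₁ one p₂ …` followed by `tail w`. It is a bijection from
pairs of words onto words, see `star_bijective`. -/
noncomputable def star (zero one : A) (p w : Word.{u} A) : Word.{u} A :=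
  (p.marked one).append (w.tail zero one)

theorem append_right_inj {a b c : Word.{u} A} (h : a.append b = a.append c) : b = c := by
  apply ext_tape
  funext γ
  have := congrArg (fun x : Word.{u} A => x.tape (a.len + γ)) h
  simpa [append] using this

theorem dropFirst_cons (a : A) (w : Word.{u} A) : ((letter a).append w).dropFirst = w := by
  apply ext_tape
  funext γ
  simp [append, letter, dropFirst]

theorem cons_dropFirst {a : A} {w : Word.{u} A} (h : w.tape 0 = a) :
    (letter a).append w.dropFirst = w := by
  apply ext_tape
  funext γ
  simp only [append, letter, dropFirst, Order.lt_one_iff]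
  split_ifs with h0
  · rw [h0, h]
  · rw [Ordinal.add_sub_cancel_of_le]
    exact Order.one_le_iff_ne_zero.2 h0

theorem cons_zero (a : A) (w : Word.{u} A) : ((letter a).append w).tape 0 = a := by
  simp [append, letter]

theorem cons_one_add (a : A) (w : Word.{u} A) (γ : Ordinal.{u}) :
    ((letter a).append w).tape (1 + γ) = w.tape γ := by
  simp [append, letter]

theorem cons_succ (a : A) (w : Word.{u} A) (n : ℕ) :
    ((letter a).append w).tape ((n + 1 : ℕ) : Ordinal.{u}) = w.tape n := by
  rw [add_comm, Nat.cast_add, Nat.cast_one, cons_one_add]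

theorem isZeros_cons {zero : A} {w : Word.{u} A} :
    ((letter zero).append w).IsZeros zero ↔ w.IsZeros zero := by
  have hl : ((letter zero).append w).len = 1 + w.len := rfl
  constructor
  · rintro ⟨h1, h2⟩
    refine ⟨lt_of_le_of_lt le_add_self (hl ▸ h1), fun β hβ => ?_⟩
    rw [← cons_one_add zero w β]
    exact h2 _ (by rw [hl]; gcongr)
  · rintro ⟨h1, h2⟩
    refine ⟨?_, fun β hβ => ?_⟩
    · rw [hl]
      exact Ordinal.isPrincipal_add_omega0 Ordinal.one_lt_omega0 h1
    · rcases eq_or_ne β 0 with rfl | h0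
      · exact cons_zero _ _
      · have h3 := Ordinal.add_sub_cancel_of_le (Order.one_le_iff_ne_zero.2 h0)
        rw [← h3, cons_one_add]
        apply h2
        rw [hl, ← h3] at hβ
        simpa using hβ

theorem startsZerosOne_cons {zero one : A} (h01 : zero ≠ one) {w : Word.{u} A} :
    ((letter zero).append w).StartsZerosOne zero one ↔ w.StartsZerosOne zero one := by
  constructor
  · rintro ⟨n, h1, h2⟩
    cases n with
    | zero =>
      rw [Nat.cast_zero, cons_zero] at h1
      exact absurd (WithBot.coe_inj.1 h1) h01
    | succ n =>
      refine ⟨n, by rwa [cons_succ] at h1, fun m hm => ?_⟩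
      have := h2 (m + 1) (by omega)
      rwa [cons_succ] at this
  · rintro ⟨n, h1, h2⟩
    refine ⟨n + 1, by rwa [cons_succ], fun m hm => ?_⟩
    cases m with
    | zero => rw [Nat.cast_zero, cons_zero]
    | succ m => rw [cons_succ]; exact h2 m (by omega)

theorem not_isZeros_of_startsZerosOne {zero one : A} (h01 : zero ≠ one) {w : Word.{u} A}
    (h : w.StartsZerosOne zero one) : ¬ w.IsZeros zero := by
  rintro ⟨-, h2⟩
  obtain ⟨n, h1, -⟩ := h
  have : (n : Ordinal.{u}) < w.len := by rw [← w.ne_bot_iff, h1]; simp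
  rw [h2 _ this] at h1
  exact h01 (WithBot.coe_inj.1 h1)

theorem IsZeros.cases {zero : A} {w : Word.{u} A} (h : w.IsZeros zero) :
    w.len = 0 ∨ ∃ w' : Word.{u} A, w = (letter zero).append w' ∧ w'.IsZeros zero := by
  rcases eq_or_ne w.len 0 with h0 | h0
  · exact Or.inl h0
  · have h1 := cons_dropFirst (h.2 0 (Order.one_le_iff_pos.1 (Order.one_le_iff_ne_zero.2 h0)))
    refine Or.inr ⟨_, h1.symm, ?_⟩
    rw [← isZeros_cons, h1]
    exact h

theorem tail_of_len_eq_zero {zero one : A} {w : Word.{u} A} (h : w.len = 0) :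
    w.tail zero one = letter one := by
  have : w.IsZeros zero := ⟨h ▸ Ordinal.omega0_pos, fun β hβ => by simp [h] at hβ⟩
  rw [tail, if_pos this, if_pos h]

theorem tail_cons_of_isZeros {zero one : A} {w : Word.{u} A} (h : w.IsZeros zero) :
    ((letter zero).append w).tail zero one = w := by
  rw [tail, if_pos (isZeros_cons.2 h), if_neg, dropFirst_cons]
  simp [append, letter]

theorem tail_of_startsZerosOne {zero one : A} (h01 : zero ≠ one) {w : Word.{u} A}
    (h : w.StartsZerosOne zero one) : w.tail zero one = (letter zero).append w := by
  rw [tail, if_neg (not_isZeros_of_startsZerosOne h01 h), if_pos h]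

theorem tail_of_not {zero one : A} {w : Word.{u} A} (h : ¬ w.IsZeros zero)
    (h' : ¬ w.StartsZerosOne zero one) : w.tail zero one = w := by
  rw [tail, if_neg h, if_neg h']

theorem letter_startsZerosOne (zero one : A) :
    (letter one : Word.{u} A).StartsZerosOne zero one :=
  ⟨0, by simp [letter], by simp⟩

theorem tail_cases {zero one : A} (h01 : zero ≠ one) (w : Word.{u} A) :
    (w.len = 0 ∧ w.tail zero one = letter one) ∨
    (w = (letter zero).append (w.tail zero one) ∧ (w.tail zero one).IsZeros zero) ∨
    (w.StartsZerosOne zero one ∧ w.tail zero one = (letter zero).append w ∧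
      (w.tail zero one).StartsZerosOne zero one) ∨
    (¬ w.IsZeros zero ∧ ¬ w.StartsZerosOne zero one ∧ w.tail zero one = w) := by
  by_cases hz : w.IsZeros zero
  · rcases hz.cases with h0 | ⟨w', rfl, hw'⟩
    · exact Or.inl ⟨h0, tail_of_len_eq_zero h0⟩
    · right; left
      rw [tail_cons_of_isZeros hw']
      exact ⟨rfl, hw'⟩
  · by_cases ho : w.StartsZerosOne zero one
    · right; right; left
      rw [tail_of_startsZerosOne h01 ho]
      exact ⟨ho, rfl, (startsZerosOne_cons h01).2 ho⟩
    · exact Or.inr (Or.inr (Or.inr ⟨hz, ho, tail_of_not hz ho⟩))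

theorem eq_of_len_eq_zero {w w' : Word.{u} A} (h : w.len = 0) (h' : w'.len = 0) : w = w' := by
  apply ext_tape
  funext γ
  rw [(w.eq_bot_iff γ).2 (by simp [h]), (w'.eq_bot_iff γ).2 (by simp [h'])]

theorem tail_injective {zero one : A} (h01 : zero ≠ one) :
    Function.Injective (tail.{u} zero one) := by
  have key : ∀ w w' : Word.{u} A, w.tail zero one = letter one → w'.len = 0 → w = w' := by
    intro w w' h h'
    rcases tail_cases h01 w with ⟨h0, -⟩ | ⟨-, h2⟩ | ⟨-, h2, -⟩ | ⟨-, h2, h3⟩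
    · exact eq_of_len_eq_zero h0 h'
    · rw [h] at h2
      exact absurd h2 (not_isZeros_of_startsZerosOne h01 (letter_startsZerosOne zero one))
    · have := cons_zero zero w
      rw [← h2, h] at this
      simp only [letter, if_true] at this
      exact absurd (WithBot.coe_inj.1 this).symm h01
    · rw [h] at h3
      exact absurd (h3 ▸ letter_startsZerosOne zero one) h2
  intro w w' h
  rcases tail_cases h01 w with ⟨h0, h1⟩ | ⟨h1, h2⟩ | ⟨h1, h2, h3⟩ | ⟨h1, h2, h3⟩
  · exact (key w' w (h ▸ h1) h0).symm
  all_goals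
    rcases tail_cases h01 w' with ⟨h0', h1'⟩ | ⟨h1', h2'⟩ | ⟨h1', h2', h3'⟩ | ⟨h1', h2', h3'⟩
  · exact key w w' (h.trans h1') h0'
  · rw [h1, h1', h]
  · exact absurd h2 (not_isZeros_of_startsZerosOne h01 (h ▸ h3'))
  · exact absurd h2 (by rwa [h, h3'])
  · exact key w w' (h.trans h1') h0'
  · exact absurd h2' (not_isZeros_of_startsZerosOne h01 (h ▸ h3))
  · exact append_right_inj (h2.symm.trans (h.trans h2'))
  · exact absurd h3 (by rwa [h, h3'])
  · exact key w w' (h.trans h1') h0'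
  · exact absurd h2' (by rwa [← h, h3])
  · exact absurd h3' (by rwa [← h, h3])
  · rw [← h3, ← h3', h]

theorem tail_zero {zero one : A} (h01 : zero ≠ one) {w : Word.{u} A}
    (h : (w.tail zero one).tape 0 = one) : w.tail zero one = letter one := by
  have h01' : ((zero : A) : WithBot A) ≠ one := fun e => h01 (WithBot.coe_inj.1 e)
  rcases tail_cases h01 w with ⟨-, h1⟩ | ⟨-, h2⟩ | ⟨-, h2, -⟩ | ⟨-, h2, h3⟩
  · exact h1
  · have : (0 : Ordinal.{u}) < (w.tail zero one).len := by rw [← ne_bot_iff, h]; simp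
    rw [h2.2 0 this] at h
    exact absurd h h01'
  · rw [h2, cons_zero] at h
    exact absurd h h01'
  · rw [h3] at h
    exact absurd ⟨0, by simpa using h, by simp⟩ h2

theorem exists_tail_eq {zero one : A} (h01 : zero ≠ one) {r : Word.{u} A}
    (h : r.tape 0 = one → r = letter one) : ∃ w : Word.{u} A, w.tail zero one = r := by
  by_cases hz : r.IsZeros zero
  · exact ⟨_, tail_cons_of_isZeros hz⟩
  by_cases ho : r.StartsZerosOne zero one
  · by_cases h1 : r.tape 0 = one
    · refine ⟨⟨fun _ => ⊥, 0, by simp⟩, ?_⟩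
      rw [tail_of_len_eq_zero rfl, h h1]
    · obtain ⟨n, hn, hm⟩ := id ho
      have h0 : r.tape 0 = zero := by
        cases n with
        | zero => exact absurd (by simpa using hn) h1
        | succ n => simpa using hm 0 (by omega)
      refine ⟨r.dropFirst, ?_⟩
      have h2 := cons_dropFirst h0
      rw [tail_of_startsZerosOne h01, h2]
      rw [← startsZerosOne_cons h01, h2]
      exact ho
  · exact ⟨r, tail_of_not hz ho⟩

theorem star_even {zero one : A} {p w : Word.{u} A} {μ : Ordinal.{u}} (h : μ < p.len) :
    (star zero one p w).tape (2 * μ) = one := by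
  have h1 : 2 * μ < 2 * p.len := by gcongr
  have h2 : (star zero one p w).tape (2 * μ) = (p.marked one).tape (2 * μ) := if_pos h1
  rw [h2]
  simp [marked, h1]

theorem star_odd {zero one : A} {p w : Word.{u} A} {μ : Ordinal.{u}} (h : μ < p.len) :
    (star zero one p w).tape (2 * μ + 1) = p.tape μ := by
  have h1 : 2 * μ + 1 < 2 * p.len := by
    have h2 : 2 * (μ + 1) ≤ 2 * p.len := by gcongr; exact Order.add_one_le_of_lt h
    refine lt_of_lt_of_le ?_ h2
    rw [mul_add_one]
    gcongr
    exact one_lt_two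
  have h2 : (star zero one p w).tape (2 * μ + 1) = (p.marked one).tape (2 * μ + 1) := if_pos h1
  have h3 : (2 * μ + 1) % 2 = (1 : Ordinal.{u}) := by
    rw [Ordinal.mul_add_mod_self, Ordinal.mod_eq_of_lt one_lt_two]
  have h4 : (2 * μ + 1) / 2 = μ := by
    rw [Ordinal.mul_add_div _ two_ne_zero, Ordinal.div_eq_zero_of_lt one_lt_two, add_zero]
  rw [h2]
  simp [marked, h1, h3, h4]

theorem star_rest {zero one : A} (p w : Word.{u} A) (γ : Ordinal.{u}) :
    (star zero one p w).tape (2 * p.len + γ) = (w.tail zero one).tape γ := by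
  simp [star, append, marked]

theorem star_len_le {zero one : A} (h01 : zero ≠ one) {p w p' w' : Word.{u} A}
    (h : star zero one p w = star zero one p' w') : p'.len ≤ p.len := by
  by_contra! hlt
  have h1 := star_even (zero := zero) (one := one) (w := w') hlt
  have h2 := star_odd (zero := zero) (one := one) (w := w') hlt
  have h3 := star_rest (zero := zero) (one := one) p w 0
  have h4 := star_rest (zero := zero) (one := one) p w 1
  rw [add_zero, h, h1] at h3
  rw [h, h2, tail_zero h01 h3.symm] at h4
  exact (p'.ne_bot_iff _).2 hlt (by simp [h4, letter])

theorem star_injective {zero one : A} (h01 : zero ≠ one) {p w p' w' : Word.{u} A}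
    (h : star zero one p w = star zero one p' w') : p = p' ∧ w = w' := by
  have hl : p.len = p'.len := le_antisymm (star_len_le h01 h.symm) (star_len_le h01 h)
  have hp : p = p' := by
    apply ext_tape
    funext μ
    by_cases hμ : μ < p.len
    · rw [← star_odd (zero := zero) (one := one) (w := w) hμ, h, star_odd (hl ▸ hμ)]
    · rw [(p.eq_bot_iff μ).2 (not_lt.1 hμ), (p'.eq_bot_iff μ).2 (hl ▸ not_lt.1 hμ)]
  subst hp
  exact ⟨rfl, tail_injective h01 (append_right_inj h)⟩

theorem star_surjective {zero one : A} (h01 : zero ≠ one) (x : Word.{u} A) :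
    ∃ p w : Word.{u} A, star zero one p w = x := by
  let S : Set Ordinal.{u} := {μ | x.tape (2 * μ) = one → x.tape (2 * μ + 1) = ⊥}
  have hS : S.Nonempty := by
    refine ⟨x.len, fun _ => (x.eq_bot_iff _).2 ?_⟩
    exact (Ordinal.le_mul_right _ two_pos).trans le_self_add
  set ν := sInf S with hν
  have hmem : ν ∈ S := csInf_mem hS
  have hlt : ∀ μ < ν, x.tape (2 * μ) = one ∧ x.tape (2 * μ + 1) ≠ ⊥ := by
    intro μ hμ
    have := notMem_of_lt_csInf' hμ
    simpa [S] using this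
  let p : Word.{u} A :=
    ⟨fun μ => if μ < ν then x.tape (2 * μ + 1) else ⊥, ν, fun μ => by
      split_ifs with h
      · simp [h, (hlt μ h).2]
      · simp [h]⟩
  let r : Word.{u} A := ⟨fun γ => x.tape (2 * ν + γ), x.len - 2 * ν, fun γ => by
    rw [x.ne_bot_iff, Ordinal.lt_sub]⟩
  have hr : r.tape 0 = one → r = letter one := by
    intro h0
    have h0' : x.tape (2 * ν) = one := by simpa [r] using h0
    have h1 := hmem h0'
    apply ext_tape
    funext γ
    rcases eq_or_ne γ 0 with rfl | h
    · simp [h0, letter]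
    · have : r.tape γ = ⊥ := by
        have h2 : r.tape 1 = ⊥ := h1
        rw [eq_bot_iff] at h2 ⊢
        exact h2.trans (Order.one_le_iff_ne_zero.2 h)
      simp [this, letter, h]
  obtain ⟨w, hw⟩ := exists_tail_eq h01 hr
  refine ⟨p, w, ext_tape ?_⟩
  funext γ
  by_cases hγ : γ < 2 * ν
  · have hdiv : γ / 2 < ν := (Ordinal.lt_mul_iff_div_lt two_ne_zero).1 hγ
    have hdm := Ordinal.div_add_mod γ 2
    have hmod : γ % 2 = 0 ∨ γ % 2 = 1 := by
      have h2 : γ % 2 < 1 + 1 := by rw [one_add_one_eq_two]; exact Ordinal.mod_lt γ two_ne_zero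
      rcases (Order.lt_add_one_iff.1 h2).lt_or_eq with h | h
      · exact Or.inl (Order.lt_one_iff.1 h)
      · exact Or.inr h
    rcases hmod with hm | hm
    · rw [hm, add_zero] at hdm
      rw [← hdm, star_even (p := p) hdiv, (hlt _ hdiv).1]
    · rw [hm] at hdm
      rw [← hdm, star_odd (p := p) hdiv]
      exact if_pos hdiv
  · rw [← Ordinal.add_sub_cancel_of_le (not_lt.1 hγ)]
    exact (star_rest p w _).trans (by rw [hw])

theorem star_bijective {zero one : A} (h01 : zero ≠ one) :
    Function.Bijective fun q : Word.{u} A × Word.{u} A => star zero one q.1 q.2 := by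
  refine ⟨fun q q' h => ?_, fun x => ?_⟩
  · obtain ⟨h1, h2⟩ := star_injective h01 h
    exact Prod.ext h1 h2
  · obtain ⟨p, w, h⟩ := star_surjective h01 x
    exact ⟨(p, w), h⟩

end Word

/-! ### Programs and snapshots -/

/-- The three motion tokens. -/
inductive Motion
  | left
  | stay
  | right

/-- A program: a partial function which to a state and the content of the current cell assigns the
next state, the new content of the cell and a motion of the head. -/
abbrev Program (A : Type v) : Type (max (u + 1) v) :=
  Ordinal.{u} × WithBot A → Option (Ordinal.{u} × WithBot A × Motion)

/-- The domain of a program. -/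
def Program.dom {A : Type v} (p : Program.{u} A) : Set (Ordinal.{u} × WithBot A) :=
  {c | p c ≠ none}

/-- A program is finite if its domain is finite. -/
def Program.IsFinite {A : Type v} (p : Program.{u} A) : Prop := p.dom.Finite

/-- A program is transfinite if its domain is a set (as opposed to a proper class of ordinals). -/
def Program.IsTransfinite {A : Type v} (p : Program.{u} A) : Prop := Small.{u} p.dom

/-- A snapshot: tape content, state and position of the head. -/
structure Snapshot (A : Type v) : Type (max (u + 1) v) where
  tape : Tape.{u} A
  state : Ordinal.{u}
  head : Ordinal.{u}

/-! ### Computations -/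

open Classical in
/-- The new position of the head. A left move from a limit cell, and from cell `0`, ends in cell `0`
(`Ordinal.pred 0 = 0`). -/
noncomputable def Motion.move (β : Ordinal.{u}) : Motion → Ordinal.{u}
  | left => if Order.IsSuccLimit β then 0 else Ordinal.pred β
  | stay => β
  | right => β + 1

section Computation

variable {A : Type v}

open Classical in
/-- The successor step of a computation. If the program is undefined, the snapshot is repeated. -/
noncomputable def succStep (p : Program.{u} A) (s : Snapshot.{u} A) : Snapshot.{u} A :=
  match p (s.state, s.tape s.head) with
  | none => s
  | some (δ, σ, m) => ⟨Function.update s.tape s.head σ, δ, m.move s.head⟩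

/-- The inferior limit of the ordinals `b ξ`, where `ξ < l` ranges over the indices in `X`:
`sup_{ζ < l} inf {b ξ | ζ ≤ ξ < l, ξ ∈ X}`, with `inf ∅ = 0`. -/
noncomputable def ordLiminf {l : Ordinal.{u}} (X : Set (Set.Iio l)) (b : Set.Iio l → Ordinal.{u}) :
    Ordinal.{u} :=
  ⨆ ζ : Set.Iio l, sInf (b '' {ξ | ξ ∈ X ∧ ζ ≤ ξ})

variable [Fintype A] [LinearOrder A]

open Classical in
/-- The inferior limit of a sequence of cell contents: the largest content that is a lower bound of
a final segment of the sequence. -/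
noncomputable def symLiminf {l : Ordinal.{u}} (a : Set.Iio l → WithBot A) : WithBot A :=
  (Finset.univ.filter fun c : WithBot A => ∃ ζ : Set.Iio l, ∀ ξ, ζ ≤ ξ → c ≤ a ξ).sup id

/-- The transfinite transition at limit times: tape contents and state are inferior limits, and the
position of the head is the inferior limit over the times at which the machine was in the limit
state. -/
noncomputable def limitStep {l : Ordinal.{u}} (s : Set.Iio l → Snapshot.{u} A) : Snapshot.{u} A where
  tape η := symLiminf fun ξ => (s ξ).tape η
  state := ordLiminf Set.univ fun ξ => (s ξ).state
  head := ordLiminf {ξ | (s ξ).state = ordLiminf Set.univ fun ξ' => (s ξ').state}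
    fun ξ => (s ξ).head

/-- The computation of program `p` with initial snapshot `s`. -/
noncomputable def computation (p : Program.{u} A) (s : Snapshot.{u} A) (γ : Ordinal.{u}) :
    Snapshot.{u} A :=
  Ordinal.limitRecOn γ s (fun _ t => succStep p t) fun _ _ t => limitStep fun ξ => t ξ.1 ξ.2

/-- The times at which the computation of `p` on the tape content `x` (starting in state `0` with the
head on cell `0`) is in the halt state `1`. -/
def haltTimes (p : Program.{u} A) (x : Tape.{u} A) : Set Ordinal.{u} :=
  {γ | (computation p ⟨x, 0, 0⟩ γ).state = 1}

/-- The transfinite interpretation: the partial function on tape contents whose value is the tape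
content at the halting time. -/
noncomputable def interp (p : Program.{u} A) (x : Tape.{u} A) : Part (Tape.{u} A) :=
  ⟨(haltTimes p x).Nonempty, fun _ => (computation p ⟨x, 0, 0⟩ (sInf (haltTimes p x))).tape⟩

/-- A partial function on words is symmetrically computable if it is the restriction to words of the
interpretation of a transfinite program. -/
def SymmetricallyComputable (f : Word.{u} A →. Word.{u} A) : Prop :=
  ∃ q : Program.{u} A, q.IsTransfinite ∧ ∀ w, interp q w.tape = (f w).map Word.tape

/-- A partial function on words is Koepke computable in parameter `p` if a finite program computes
`f w` on input `p * w`, for every word `w`, and diverges there if `f w` is undefined. -/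
def KoepkeComputableIn (zero one : A) (p : Word.{u} A) (f : Word.{u} A →. Word.{u} A) : Prop :=
  ∃ q : Program.{u} A, q.IsFinite ∧
    ∀ w, interp q (Word.star zero one p w).tape = (f w).map Word.tape

end Computation

end OrdTM

set_option linter.unusedSectionVars false
set_option linter.style.haveILetI false
set_option linter.unusedVariables false
set_option linter.unusedSimpArgs false

/-! From left to right, let `q` be a transfinite program. Its domain is a set, so the states that it
can reach are bounded by some ordinal `θ`, and its transition function on the states up to `θ` is a
table of bits that fits into a word, the parameter. A fixed finite program interprets this table.
What it has to remember is kept on the tape in a form compatible with inferior limits: ordinals are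
stored in unary, because the cellwise inferior limit of unary representations represents the
inferior limit of the ordinals. The tape and the state of `q` then pass through limits by
themselves. The head needs more, since its limit position refers only to the times at which `q` was
in the limit state. Hence the tape holds, for every state `α`, the inferior limit `H α` of the head
positions in state `α` so far (`headLiminf`). A step changes only one row of this table, the
inferior limit of the tables is the table at the limit (`rlim_headLiminf`), and at a limit time the
head is found in the row of the limit state.

The simulation is a loop whose rounds take many machine steps, so a limit also feels what happens
inside the rounds. Two conditions remove this influence (`loopLimit_cfg`): the state at the loop
head is the least one used in the loop, and during a round every cell is at least the minimum of its
contents at the two adjacent loop heads. The small imperative language `Cmd` carries both conditions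
in `Sem`. For instance, a row of the head table is first raised and then cut down, and never erased
in between.

The input occupies consecutive cells and leaves no room for work. It is moved to the odd cells
(`leadsE_spread`), and the tape is then viewed as a sequence of supercells with finitely many slots,
one for each variable. At the end the gaps in the output are closed (`compress_correct`).

From right to left, let `p` and a finite program `q` be given. A transfinite program can afford one
node for each letter of the marked parameter, so it can write `p * w` from `w`; then it runs a copy
of `q` on the states `base + α`. At a limit of such nodes the machine enters a state in which it has
never been, and then the head is on cell `0`, because `inf ∅ = 0`. Waiting for `ω` steps in
increasing states uses the same effect to bring the head home before the copy of `q` starts. That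
the relevant states are new is proved without inspecting all intermediate states:
`exists_first_visit` compares `P` with the programs that get stuck in one of the states in question.
Since no state `base + α` has occurred before the start, the limits of the copy agree with those of
`q` (`IsRun.imitate`). -/

namespace OrdTM

open Ordinal Order

/-! ### Inferior limits of ordinals and of cell contents. -/

section Liminf

/-- `v` is the inferior limit of the ordinals `f μ` for `μ < l`. -/
def RLim (f : Ordinal.{u} → Ordinal.{u}) (l v : Ordinal.{u}) : Prop :=
  (∀ b < v, ∃ ν < l, ∀ μ, ν ≤ μ → μ < l → b < f μ) ∧ ∀ ν < l, ∃ μ, ν ≤ μ ∧ μ < l ∧ f μ ≤ v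

/-- `v` is the inferior limit of the contents `f μ` for `μ < l`. -/
def TLim {S : Type v} [LE S] (f : Ordinal.{u} → S) (l : Ordinal.{u}) (v : S) : Prop :=
  (∃ ν < l, ∀ μ, ν ≤ μ → μ < l → v ≤ f μ) ∧ ∀ ν < l, ∃ μ, ν ≤ μ ∧ μ < l ∧ f μ ≤ v

theorem bddAbove_range_Iio {l : Ordinal.{u}} (f : Set.Iio l → Ordinal.{u}) :
    BddAbove (Set.range f) := by
  exact Ordinal.bddAbove_of_small

/-- The second hypothesis makes `X` cofinal in `l`. So all infima are taken over nonempty sets, and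
the convention `inf ∅ = 0` plays no role. -/
theorem ordLiminf_eq {l : Ordinal.{u}} {X : Set (Set.Iio l)} {b : Set.Iio l → Ordinal.{u}}
    {v : Ordinal.{u}} (h1 : ∀ a < v, ∃ ζ : Set.Iio l, ∀ ξ, ζ ≤ ξ → ξ ∈ X → a < b ξ)
    (h2 : ∀ ζ : Set.Iio l, ∃ ξ, ζ ≤ ξ ∧ ξ ∈ X ∧ b ξ ≤ v) : ordLiminf X b = v := by
  apply le_antisymm
  · refine ciSup_le' fun ζ => ?_
    obtain ⟨ξ, h, hX, hb⟩ := h2 ζ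
    exact le_trans (csInf_le' (Set.mem_image_of_mem b ⟨hX, h⟩)) hb
  · refine le_of_forall_lt fun a ha => ?_
    obtain ⟨ζ, hζ⟩ := h1 a ha
    refine lt_of_lt_of_le ?_ (le_ciSup (bddAbove_range_Iio _) ζ)
    obtain ⟨ξ, h, hX, hb⟩ := h2 ζ
    have hne : (b '' {ξ | ξ ∈ X ∧ ζ ≤ ξ}).Nonempty := ⟨_, ξ, ⟨hX, h⟩, rfl⟩
    obtain ⟨x, ⟨hx, hx'⟩, hx2⟩ := csInf_mem hne
    rw [← hx2]
    exact hζ x hx' hx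

theorem rlim_ordLiminf {l : Ordinal.{u}} (f : Ordinal.{u} → Ordinal.{u}) (hl : 0 < l) :
    RLim f l (ordLiminf Set.univ fun ξ : Set.Iio l => f ξ) := by
  have hne : ∀ ζ : Set.Iio l,
      ((fun ξ : Set.Iio l => f ξ) '' {ξ | ξ ∈ Set.univ ∧ ζ ≤ ξ}).Nonempty :=
    fun ζ => ⟨_, ζ, ⟨trivial, le_rfl⟩, rfl⟩
  constructor
  · intro b hb
    haveI : Nonempty (Set.Iio l) := ⟨⟨0, hl⟩⟩
    obtain ⟨ζ, hζ⟩ := exists_lt_of_lt_ciSup hb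
    refine ⟨ζ, ζ.2, fun μ h1 h2 => hζ.trans_le ?_⟩
    exact csInf_le' ⟨⟨μ, h2⟩, ⟨trivial, h1⟩, rfl⟩
  · intro ν hν
    obtain ⟨x, ⟨-, hx'⟩, hx2⟩ := csInf_mem (hne ⟨ν, hν⟩)
    refine ⟨x, hx', x.2, ?_⟩
    dsimp only at hx2
    rw [hx2]
    exact le_ciSup (bddAbove_range_Iio (fun ζ : Set.Iio l =>
      sInf ((fun ξ : Set.Iio l => f ξ) '' {ξ | ξ ∈ Set.univ ∧ ζ ≤ ξ}))) ⟨ν, hν⟩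

theorem RLim.congr {f g : Ordinal.{u} → Ordinal.{u}} {l v : Ordinal.{u}} (h : RLim f l v)
    (hfg : ∀ μ < l, f μ = g μ) : RLim g l v := by
  refine ⟨fun b hb => ?_, fun ν hν => ?_⟩
  · obtain ⟨ν, h1, h2⟩ := h.1 b hb
    exact ⟨ν, h1, fun μ h3 h4 => by rw [← hfg μ h4]; exact h2 μ h3 h4⟩
  · obtain ⟨μ, h1, h2, h3⟩ := h.2 ν hν
    exact ⟨μ, h1, h2, by rwa [← hfg μ h2]⟩

theorem rlim_const {f : Ordinal.{u} → Ordinal.{u}} {l v : Ordinal.{u}} (hl : IsSuccLimit l)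
    (ν : Ordinal.{u}) (hν : ν < l) (h : ∀ μ, ν ≤ μ → μ < l → f μ = v) : RLim f l v := by
  refine ⟨fun b hb => ⟨ν, hν, fun μ h1 h2 => by rwa [h μ h1 h2]⟩, fun ν' hν' => ?_⟩
  exact ⟨max ν ν', le_max_right _ _, max_lt hν hν', (h _ (le_max_left _ _) (max_lt hν hν')).le⟩

/-- Increasing sequences converge to their supremum. -/
theorem rlim_of_isNormal {f : Ordinal.{u} → Ordinal.{u}} {l : Ordinal.{u}} (hl : IsSuccLimit l)
    (hf : IsNormal f) : RLim f l (f l) := by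
  refine ⟨fun b hb => ?_, fun ν hν => ⟨ν, le_rfl, hν, hf.strictMono.monotone hν.le⟩⟩
  obtain ⟨ν, h1, h2⟩ := (hf.lt_iff_exists_lt hl).1 hb
  exact ⟨ν, h1, fun μ h3 _ => h2.trans_le (hf.strictMono.monotone h3)⟩

theorem tlim_const {S : Type v} [Preorder S] {f : Ordinal.{u} → S} {l : Ordinal.{u}} {v : S}
    (ν : Ordinal.{u}) (hν : ν < l) (h : ∀ μ, ν ≤ μ → μ < l → f μ = v) : TLim f l v := by
  refine ⟨⟨ν, hν, fun μ h1 h2 => (h μ h1 h2).ge⟩, fun ν' hν' => ?_⟩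
  exact ⟨max ν ν', le_max_right _ _, max_lt hν hν', (h _ (le_max_left _ _) (max_lt hν hν')).le⟩

theorem TLim.congr {S : Type v} [LE S] {f g : Ordinal.{u} → S} {l : Ordinal.{u}} {v : S}
    (h : TLim f l v) (hfg : ∀ μ < l, f μ = g μ) : TLim g l v := by
  obtain ⟨⟨ν, h1, h2⟩, h3⟩ := h
  refine ⟨⟨ν, h1, fun μ h4 h5 => by rw [← hfg μ h5]; exact h2 μ h4 h5⟩, fun ν hν => ?_⟩
  obtain ⟨μ, h1, h2, h3⟩ := h3 ν hν
  exact ⟨μ, h1, h2, by rwa [← hfg μ h2]⟩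

/-- Unary representations turn inferior limits of ordinals into inferior limits of contents. -/
theorem RLim.tlim_unary {S : Type v} [Preorder S] {f : Ordinal.{u} → Ordinal.{u}}
    {l v : Ordinal.{u}} (h : RLim f l v) (hl : 0 < l) (η : Ordinal.{u}) {a b : S} (hab : b ≤ a) :
    TLim (fun μ => if η < f μ then a else b) l (if η < v then a else b) := by
  constructor
  · split_ifs with hv
    · obtain ⟨ν, h1, h2⟩ := h.1 η hv
      exact ⟨ν, h1, fun μ h3 h4 => (if_pos (h2 μ h3 h4)).ge⟩
    · refine ⟨0, hl, fun μ _ _ => ?_⟩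
      dsimp only
      split_ifs
      · exact hab
      · exact le_rfl
  · intro ν hν
    obtain ⟨μ, h1, h2, h3⟩ := h.2 ν hν
    refine ⟨μ, h1, h2, ?_⟩
    dsimp only
    split_ifs with h4 h5 h5
    · exact le_rfl
    · exact absurd (h4.trans_le h3) h5
    · exact hab
    · exact le_rfl

variable {A : Type v} [Fintype A] [LinearOrder A]

theorem tlim_symLiminf {l : Ordinal.{u}} (hl : 0 < l) (f : Ordinal.{u} → WithBot A) :
    TLim f l (symLiminf fun ξ : Set.Iio l => f ξ) := by
  classical
  set F : Finset (WithBot A) :=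
    Finset.univ.filter fun c : WithBot A => ∃ ζ : Set.Iio l, ∀ ξ : Set.Iio l, ζ ≤ ξ → c ≤ f ξ with hF
  have hdef : (symLiminf fun ξ : Set.Iio l => f ξ) = F.sup id := by
    rw [symLiminf, hF]
  have hbot : (⊥ : WithBot A) ∈ F := by simp [hF]; exact ⟨0, hl⟩
  have hmem : F.sup id ∈ F := by
    obtain ⟨x, hx, hx2⟩ := Finset.exists_mem_eq_sup F ⟨_, hbot⟩ id
    rw [hx2]; exact hx
  rw [hdef]
  constructor
  · obtain ⟨ζ, hζ⟩ := (Finset.mem_filter.1 hmem).2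
    exact ⟨ζ, ζ.2, fun μ h1 h2 => hζ ⟨μ, h2⟩ h1⟩
  · intro ν hν
    by_contra! hcon
    -- From `ν` on all values lie above the supremum of the eventual lower bounds. By finiteness
    -- there is a least content above this supremum; it is an eventual lower bound too, a
    -- contradiction.
    have hne : (Finset.univ.filter fun c : WithBot A => F.sup id < c).Nonempty :=
      ⟨f ν, by simpa using hcon ν le_rfl hν⟩
    obtain ⟨c, hc, hmin⟩ := Finset.exists_min_image _ id hne
    have hc' : F.sup id < c := by simpa using hc
    have : c ∈ F := by
      rw [hF, Finset.mem_filter]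
      refine ⟨Finset.mem_univ _, ⟨ν, hν⟩, fun ξ hξ => ?_⟩
      exact hmin (f ξ) (by simpa using hcon ξ hξ ξ.2)
    exact absurd (Finset.le_sup (f := id) this) (not_le.2 hc')

theorem TLim.unique {S : Type v} [PartialOrder S] {f : Ordinal.{u} → S} {l : Ordinal.{u}} {v w : S}
    (h : TLim f l v) (h' : TLim f l w) : v = w := by
  have key : ∀ {v w : S}, TLim f l v → TLim f l w → v ≤ w := by
    intro v w h h'
    obtain ⟨ν, h1, h2⟩ := h.1
    obtain ⟨μ, h3, h4, h5⟩ := h'.2 ν h1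
    exact (h2 μ h3 h4).trans h5
  exact le_antisymm (key h h') (key h' h)

theorem symLiminf_eq {l : Ordinal.{u}} (hl : 0 < l) {f : Ordinal.{u} → WithBot A} {v : WithBot A}
    (h : TLim f l v) : (symLiminf fun ξ : Set.Iio l => f ξ) = v :=
  (tlim_symLiminf hl f).unique h

end Liminf

/-! ### Runs, segments of runs, and limits of loops. -/

section Runs

variable {A : Type v} [Fintype A] [LinearOrder A]

/-- The sequence `c` of snapshots obeys the rules of computations of `P`. -/
def IsRun (P : Program.{u} A) (c : Ordinal.{u} → Snapshot.{u} A) : Prop :=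
  (∀ γ, c (γ + 1) = succStep P (c γ)) ∧
    ∀ l, IsSuccLimit l → c l = limitStep fun ξ : Set.Iio l => c ξ

theorem isRun_computation (P : Program.{u} A) (s : Snapshot.{u} A) :
    IsRun P (computation P s) := by
  refine ⟨fun γ => ?_, fun l hl => ?_⟩
  · simp only [computation, limitRecOn_add_one]
  · conv_lhs => rw [computation, limitRecOn_limit _ _ _ _ hl]
    rfl

theorem computation_zero (P : Program.{u} A) (s : Snapshot.{u} A) : computation P s 0 = s := by
  simp only [computation, limitRecOn_zero]

theorem IsRun.step_eq {P : Program.{u} A} {c : Ordinal.{u} → Snapshot.{u} A} (h : IsRun P c)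
    {γ : Ordinal.{u}} {T : Tape.{u} A} {s hd s' : Ordinal.{u}} {σ' : WithBot A} {m : Motion}
    (hc : c γ = ⟨T, s, hd⟩) (hP : P (s, T hd) = some (s', σ', m)) :
    c (γ + 1) = ⟨Function.update T hd σ', s', m.move hd⟩ := by
  rw [h.1, hc, succStep]
  simp only [hP]

/-- The limit state is assumed to be attained cofinally often, at times with the head at most at
`t.head`. So the inferior limit of the states is an eventual minimum, and the one of the head
positions ranges over a cofinal set of times. -/
theorem IsRun.limit_eq {P : Program.{u} A} {c : Ordinal.{u} → Snapshot.{u} A} (h : IsRun P c)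
    {l : Ordinal.{u}} (hl : IsSuccLimit l) (t : Snapshot.{u} A)
    (st1 : ∃ ν < l, ∀ ξ, ν ≤ ξ → ξ < l → t.state ≤ (c ξ).state)
    (st2 : ∀ ν < l, ∃ ξ, ν ≤ ξ ∧ ξ < l ∧ (c ξ).state = t.state ∧ (c ξ).head ≤ t.head)
    (hd1 : ∀ b < t.head, ∃ ν < l, ∀ ξ, ν ≤ ξ → ξ < l → (c ξ).state = t.state → b < (c ξ).head)
    (tp : ∀ η, TLim (fun ξ => (c ξ).tape η) l (t.tape η)) : c l = t := by
  have hst : (ordLiminf Set.univ fun ξ : Set.Iio l => (c ξ).state) = t.state := by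
    apply ordLiminf_eq
    · intro a ha
      obtain ⟨ν, h1, h2⟩ := st1
      exact ⟨⟨ν, h1⟩, fun ξ h3 _ => ha.trans_le (h2 ξ h3 ξ.2)⟩
    · intro ζ
      obtain ⟨ξ, h1, h2, h3, -⟩ := st2 ζ ζ.2
      exact ⟨⟨ξ, h2⟩, h1, trivial, h3.le⟩
  rw [h.2 l hl, limitStep]
  obtain ⟨T, s, hd⟩ := t
  simp only [Snapshot.mk.injEq]
  refine ⟨funext fun η => ?_, hst, ?_⟩
  · exact symLiminf_eq (l := l) hl.bot_lt (tp η)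
  · apply ordLiminf_eq
    · intro a ha
      obtain ⟨ν, h1, h2⟩ := hd1 a ha
      refine ⟨⟨ν, h1⟩, fun ξ h3 h4 => h2 ξ h3 ξ.2 ?_⟩
      exact (show (c ξ).state = _ from h4).trans hst
    · intro ζ
      obtain ⟨ξ, h1, h2, h3, h4⟩ := st2 ζ ζ.2
      exact ⟨⟨ξ, h2⟩, h1, h3.trans hst.symm, h4⟩

open Classical in
/-- Transfinite iteration of segments of a sequence: if `I μ` can always be improved to `I (μ + 1)`
and is preserved at limits, then `I Λ` is reached. -/
theorem exists_iterate {S : Type*} (c : Ordinal.{u} → S) (Λ γ : Ordinal.{u})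
    (I Φ : Ordinal.{u} → S → Prop) (h0 : I 0 (c γ))
    (hstep : ∀ μ < Λ, ∀ δ, γ ≤ δ → I μ (c δ) →
      ∃ δ', δ < δ' ∧ I (μ + 1) (c δ') ∧ ∀ ξ, δ ≤ ξ → ξ < δ' → Φ μ (c ξ))
    (hlim : ∀ l ≤ Λ, IsSuccLimit l → ∀ τ : Ordinal.{u} → Ordinal.{u}, IsNormal τ → τ 0 = γ →
      (∀ μ < l, I μ (c (τ μ))) → (∀ μ < l, ∀ ξ, τ μ ≤ ξ → ξ < τ (μ + 1) → Φ μ (c ξ)) →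
      I l (c (τ l))) :
    ∃ γ', γ + Λ ≤ γ' ∧ I Λ (c γ') ∧ ∀ ξ, γ ≤ ξ → ξ < γ' → ∃ μ < Λ, Φ μ (c ξ) := by
  let Q : Ordinal.{u} → Ordinal.{u} → Ordinal.{u} → Prop := fun μ δ δ' =>
    δ < δ' ∧ I (μ + 1) (c δ') ∧ ∀ ξ, δ ≤ ξ → ξ < δ' → Φ μ (c ξ)
  -- The default `δ + 1` only keeps `τ` strictly increasing where no good time exists; it is never
  -- used as long as the invariant holds.
  let nxt : Ordinal.{u} → Ordinal.{u} → Ordinal.{u} := fun μ δ =>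
    if h : ∃ δ', Q μ δ δ' then h.choose else δ + 1
  have nxt_lt : ∀ μ δ, δ < nxt μ δ := by
    intro μ δ
    simp only [nxt]
    split_ifs with h
    · exact h.choose_spec.1
    · exact lt_add_one δ
  let τ : Ordinal.{u} → Ordinal.{u} := fun μ =>
    limitRecOn μ γ (fun μ t => nxt μ t) fun l _ t => ⨆ x : Set.Iio l, t x.1 x.2
  have τ0 : τ 0 = γ := limitRecOn_zero ..
  have τs : ∀ μ, τ (μ + 1) = nxt μ (τ μ) := fun μ => limitRecOn_add_one ..
  have τl : ∀ l, IsSuccLimit l → τ l = ⨆ x : Set.Iio l, τ x.1 := fun l hl =>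
    limitRecOn_limit _ _ _ _ hl
  have hτ : IsNormal τ := by
    apply IsNormal.of_succ_lt
    · intro a
      rw [succ_eq_add_one, τs]
      exact nxt_lt _ _
    · intro l hl
      rw [τl l hl]
      haveI : Nonempty (Set.Iio l) := ⟨⟨0, hl.bot_lt⟩⟩
      have := isLUB_ciSup (bddAbove_range_Iio fun x : Set.Iio l => τ x.1)
      convert this using 1
      ext x
      simp
  have hγ : ∀ μ, γ ≤ τ μ := fun μ => by
    rw [← τ0]; exact hτ.strictMono.monotone (zero_le)
  have hQ : ∀ μ < Λ, I μ (c (τ μ)) → Q μ (τ μ) (τ (μ + 1)) := by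
    intro μ hμ hI
    have h := hstep μ hμ (τ μ) (hγ μ) hI
    rw [τs]
    simp only [nxt]
    rw [dif_pos h]
    exact h.choose_spec
  have hI : ∀ μ ≤ Λ, I μ (c (τ μ)) := by
    intro μ
    induction μ using limitRecOn with
    | zero => intro _; rwa [τ0]
    | add_one μ ih =>
      intro h
      have hlt : μ < Λ := (lt_add_one μ).trans_le h
      exact (hQ μ hlt (ih hlt.le)).2.1
    | limit l hl ih =>
      intro h
      refine hlim l h hl τ hτ τ0 (fun μ hμ => ih μ hμ (hμ.le.trans h)) fun μ hμ => ?_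
      exact (hQ μ (hμ.trans_le h) (ih μ hμ (hμ.le.trans h))).2.2
  -- Every round takes at least one step, so `Λ` rounds last at least `Λ` steps. The divergence
  -- proof for loops rests on this bound.
  refine ⟨τ Λ, ?_, hI Λ le_rfl, ?_⟩
  · clear hI hQ hstep hlim
    induction Λ using limitRecOn with
    | zero => rw [add_zero, τ0]
    | add_one μ ih =>
      rw [τs, ← add_assoc]
      exact add_one_le_of_lt (ih.trans_lt (nxt_lt _ _))
    | limit l hl ih =>
      rw [add_le_iff_of_isSuccLimit hl]
      intro b hb
      exact (ih b hb).trans (hτ.strictMono.monotone hb.le)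
  · intro ξ h1 h2
    obtain ⟨μ, h3, h4⟩ := hτ.exists_map_le_lt_map_succ (x := ξ) (by rwa [bot_eq_zero, τ0])
    have hμ : μ < Λ := hτ.strictMono.lt_iff_lt.1 (h3.trans_lt h2)
    exact ⟨μ, hμ, (hQ μ hμ (hI μ hμ.le)).2.2 ξ h3 h4⟩

/-- If the run `c` is at some time in snapshot `s`, then later it is in snapshot `t`, and `Φ` holds in
between. -/
def Leads (c : Ordinal.{u} → Snapshot.{u} A) (s t : Snapshot.{u} A) (Φ : Snapshot.{u} A → Prop) :
    Prop :=
  ∀ γ, c γ = s → ∃ γ', γ < γ' ∧ c γ' = t ∧ ∀ ξ, γ ≤ ξ → ξ < γ' → Φ (c ξ)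

/-- As `Leads`, but the segment may be empty. -/
def LeadsE (c : Ordinal.{u} → Snapshot.{u} A) (s t : Snapshot.{u} A) (Φ : Snapshot.{u} A → Prop) :
    Prop :=
  ∀ γ, c γ = s → ∃ γ', γ ≤ γ' ∧ c γ' = t ∧ ∀ ξ, γ ≤ ξ → ξ < γ' → Φ (c ξ)

section LeadsLemmas

variable {c : Ordinal.{u} → Snapshot.{u} A} {s t r : Snapshot.{u} A} {Φ Ψ : Snapshot.{u} A → Prop}

theorem LeadsE.refl : LeadsE c s s Φ := fun γ h =>
  ⟨γ, le_rfl, h, fun _ h1 h2 => absurd h2 (not_lt.2 h1)⟩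

theorem Leads.toE (h : Leads c s t Φ) : LeadsE c s t Φ := fun γ h0 => by
  obtain ⟨γ', h1, h2, h3⟩ := h γ h0
  exact ⟨γ', h1.le, h2, h3⟩

theorem Leads.mono (h : Leads c s t Φ) (hΦ : ∀ m, Φ m → Ψ m) : Leads c s t Ψ := fun γ h0 => by
  obtain ⟨γ', h1, h2, h3⟩ := h γ h0
  exact ⟨γ', h1, h2, fun ξ h4 h5 => hΦ _ (h3 ξ h4 h5)⟩

theorem LeadsE.mono (h : LeadsE c s t Φ) (hΦ : ∀ m, Φ m → Ψ m) : LeadsE c s t Ψ := fun γ h0 => by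
  obtain ⟨γ', h1, h2, h3⟩ := h γ h0
  exact ⟨γ', h1, h2, fun ξ h4 h5 => hΦ _ (h3 ξ h4 h5)⟩

theorem LeadsE.trans (h : LeadsE c s t Φ) (h' : LeadsE c t r Φ) : LeadsE c s r Φ := fun γ h0 => by
  obtain ⟨γ', h1, h2, h3⟩ := h γ h0
  obtain ⟨γ'', h1', h2', h3'⟩ := h' γ' h2
  refine ⟨γ'', h1.trans h1', h2', fun ξ h4 h5 => ?_⟩
  rcases lt_or_ge ξ γ' with h6 | h6
  · exact h3 ξ h4 h6
  · exact h3' ξ h6 h5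

theorem Leads.transE (h : Leads c s t Φ) (h' : LeadsE c t r Φ) : Leads c s r Φ := fun γ h0 => by
  obtain ⟨γ', h1, h2, h3⟩ := h γ h0
  obtain ⟨γ'', h1', h2', h3'⟩ := h' γ' h2
  refine ⟨γ'', h1.trans_le h1', h2', fun ξ h4 h5 => ?_⟩
  rcases lt_or_ge ξ γ' with h6 | h6
  · exact h3 ξ h4 h6
  · exact h3' ξ h6 h5

theorem LeadsE.transS (h : LeadsE c s t Φ) (h' : Leads c t r Φ) : Leads c s r Φ := fun γ h0 => by
  obtain ⟨γ', h1, h2, h3⟩ := h γ h0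
  obtain ⟨γ'', h1', h2', h3'⟩ := h' γ' h2
  refine ⟨γ'', h1.trans_lt h1', h2', fun ξ h4 h5 => ?_⟩
  rcases lt_or_ge ξ γ' with h6 | h6
  · exact h3 ξ h4 h6
  · exact h3' ξ h6 h5

theorem Leads.trans (h : Leads c s t Φ) (h' : Leads c t r Φ) : Leads c s r Φ :=
  h.transE h'.toE

theorem IsRun.leads_step {P : Program.{u} A} (h : IsRun P c) {T : Tape.{u} A}
    {q hd q' : Ordinal.{u}} {σ' : WithBot A} {m : Motion}
    (hP : P (q, T hd) = some (q', σ', m)) (hΦ : Φ ⟨T, q, hd⟩) :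
    Leads c ⟨T, q, hd⟩ ⟨Function.update T hd σ', q', m.move hd⟩ Φ := fun γ h0 => by
  refine ⟨γ + 1, lt_add_one γ, h.step_eq h0 hP, fun ξ h1 h2 => ?_⟩
  rw [le_antisymm (lt_add_one_iff.1 h2) h1, h0]
  exact hΦ

end LeadsLemmas

/-- `t` is the snapshot at a limit of a loop whose heads are the snapshots `s μ` and whose `μ`-th
round satisfies `Φ μ`. -/
structure LoopLimit (s : Ordinal.{u} → Snapshot.{u} A) (Φ : Ordinal.{u} → Snapshot.{u} A → Prop)
    (l : Ordinal.{u}) (t : Snapshot.{u} A) : Prop where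
  state_le : ∃ ν < l, ∀ μ, ν ≤ μ → μ < l → ∀ m, Φ μ m → t.state ≤ m.state
  head_le : ∀ ν < l, ∃ μ, ν ≤ μ ∧ μ < l ∧ (s μ).state = t.state ∧ (s μ).head ≤ t.head
  lt_head : ∀ b < t.head, ∃ ν < l, ∀ μ, ν ≤ μ → μ < l → ∀ m, Φ μ m → m.state = t.state → b < m.head
  le_tape : ∀ η, ∃ ν < l, ∀ μ, ν ≤ μ → μ < l → ∀ m, Φ μ m → t.tape η ≤ m.tape η
  tape_le : ∀ η, ∀ ν < l, ∃ μ, ν ≤ μ ∧ μ < l ∧ (s μ).tape η ≤ t.tape η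

/-- The times `τ μ` at which the rounds begin form a normal sequence, so what holds in all late
rounds holds at all late times, and the conditions of `LoopLimit` on rounds become those of
`IsRun.limit_eq` on times. The invariant is a predicate and not a sequence of snapshots, because the
head position between two rounds need not be determined by the number of the round. -/
theorem IsRun.loop {P : Program.{u} A} {c : Ordinal.{u} → Snapshot.{u} A} (h : IsRun P c)
    (Λ : Ordinal.{u}) (I Φ : Ordinal.{u} → Snapshot.{u} A → Prop)
    (hstep : ∀ μ < Λ, ∀ s, I μ s → ∃ s', I (μ + 1) s' ∧ Leads c s s' (Φ μ))
    (hlim : ∀ l ≤ Λ, IsSuccLimit l → ∀ s : Ordinal.{u} → Snapshot.{u} A, (∀ μ < l, I μ (s μ)) →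
      ∃ t, I l t ∧ LoopLimit s Φ l t)
    (γ : Ordinal.{u}) (h0 : I 0 (c γ)) :
    ∃ γ', γ + Λ ≤ γ' ∧ I Λ (c γ') ∧ ∀ ξ, γ ≤ ξ → ξ < γ' → ∃ μ < Λ, Φ μ (c ξ) := by
  refine exists_iterate c Λ γ I Φ h0 ?_ ?_
  · intro μ hμ δ _ hI
    obtain ⟨s', h1, h2⟩ := hstep μ hμ _ hI
    obtain ⟨δ', h3, h4, h5⟩ := h2 δ rfl
    exact ⟨δ', h3, by rwa [h4], h5⟩
  · intro l hlΛ hl τ hτ τ0 hI hΦ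
    obtain ⟨t, ht, hL⟩ := hlim l hlΛ hl (fun μ => c (τ μ)) hI
    -- A time between `τ ν` and `τ l` lies in a round with number between `ν` and `l`.
    have hmid : ∀ ν < l, ∀ ξ, τ ν ≤ ξ → ξ < τ l → ∃ μ, ν ≤ μ ∧ μ < l ∧ Φ μ (c ξ) := by
      intro ν hν ξ h1 h2
      obtain ⟨μ, h3, h4⟩ := hτ.exists_map_le_lt_map_succ (x := ξ)
        ((hτ.strictMono.monotone bot_le).trans h1)
      have h5 : μ < l := hτ.strictMono.lt_iff_lt.1 (h3.trans_lt h2)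
      have h6 : ν < succ μ := hτ.strictMono.lt_iff_lt.1 (h1.trans_lt h4)
      exact ⟨μ, lt_succ_iff.1 h6, h5, hΦ μ h5 ξ h3 h4⟩
    have hcof : ∀ ν < τ l, ∃ ν' < l, ν ≤ τ ν' := fun ν hν => by
      obtain ⟨ν', h1, h2⟩ := (hτ.lt_iff_exists_lt hl).1 hν
      exact ⟨ν', h1, h2.le⟩
    have : c (τ l) = t := by
      refine h.limit_eq (hτ.map_isSuccLimit hl) t ?_ ?_ ?_ fun η => ⟨?_, ?_⟩
      · obtain ⟨ν, h1, h2⟩ := hL.state_le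
        refine ⟨τ ν, hτ.strictMono h1, fun ξ h3 h4 => ?_⟩
        obtain ⟨μ, h5, h6, h7⟩ := hmid ν h1 ξ h3 h4
        exact h2 μ h5 h6 _ h7
      · intro ν hν
        obtain ⟨ν', h1, h2⟩ := hcof ν hν
        obtain ⟨μ, h3, h4, h5, h6⟩ := hL.head_le ν' h1
        exact ⟨τ μ, h2.trans (hτ.strictMono.monotone h3), hτ.strictMono h4, h5, h6⟩
      · intro b hb
        obtain ⟨ν, h1, h2⟩ := hL.lt_head b hb
        refine ⟨τ ν, hτ.strictMono h1, fun ξ h3 h4 => ?_⟩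
        obtain ⟨μ, h5, h6, h7⟩ := hmid ν h1 ξ h3 h4
        exact h2 μ h5 h6 _ h7
      · obtain ⟨ν, h1, h2⟩ := hL.le_tape η
        refine ⟨τ ν, hτ.strictMono h1, fun ξ h3 h4 => ?_⟩
        obtain ⟨μ, h5, h6, h7⟩ := hmid ν h1 ξ h3 h4
        exact h2 μ h5 h6 _ h7
      · intro ν hν
        obtain ⟨ν', h1, h2⟩ := hcof ν hν
        obtain ⟨μ, h3, h4, h5⟩ := hL.tape_le η ν' h1
        exact ⟨τ μ, h2.trans (hτ.strictMono.monotone h3), hτ.strictMono h4, h5⟩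
    rw [this]
    exact ht

/-- The loop rule for a given sequence of loop heads. -/
theorem IsRun.leadsE_loop {P : Program.{u} A} {c : Ordinal.{u} → Snapshot.{u} A} (h : IsRun P c)
    (Λ : Ordinal.{u}) (s : Ordinal.{u} → Snapshot.{u} A)
    (Φ : Ordinal.{u} → Snapshot.{u} A → Prop) (Ψ : Snapshot.{u} A → Prop)
    (hstep : ∀ μ < Λ, Leads c (s μ) (s (μ + 1)) (Φ μ))
    (hlim : ∀ l ≤ Λ, IsSuccLimit l → LoopLimit s Φ l (s l))
    (hΨ : ∀ μ < Λ, ∀ m, Φ μ m → Ψ m) : LeadsE c (s 0) (s Λ) Ψ := fun γ h0 => by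
  obtain ⟨γ', h1, h2, h3⟩ := h.loop Λ (fun μ t => t = s μ) Φ
    (fun μ hμ t ht => ⟨_, rfl, ht ▸ hstep μ hμ⟩)
    (fun l hl hl' s' hs' => ⟨_, rfl, by
      obtain ⟨a1, a2, a3, a4, a5⟩ := hlim l hl hl'
      refine ⟨a1, fun ν hν => ?_, a3, a4, fun η ν hν => ?_⟩
      · obtain ⟨μ, b1, b2, b3⟩ := a2 ν hν
        exact ⟨μ, b1, b2, by rwa [hs' μ b2]⟩
      · obtain ⟨μ, b1, b2, b3⟩ := a5 η ν hν
        exact ⟨μ, b1, b2, by rwa [hs' μ b2]⟩⟩) γ h0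
  refine ⟨γ', le_self_add.trans h1, h2, fun ξ h4 h5 => ?_⟩
  obtain ⟨μ, h6, h7⟩ := h3 ξ h4 h5
  exact hΨ μ h6 _ h7

end Runs

/-! ### Left moves at zero, successor and limit cells. -/

section Moves

@[simp]
theorem move_left_add_one (β : Ordinal.{u}) : Motion.left.move (β + 1) = β := by
  have : ¬ IsSuccLimit (β + 1) := fun h => by
    rw [← succ_eq_add_one] at h; exact not_isSuccLimit_succ _ h
  simp [Motion.move, this]

@[simp]
theorem move_left_zero : Motion.left.move (0 : Ordinal.{u}) = 0 := by
  simp [Motion.move]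

theorem move_left_limit {β : Ordinal.{u}} (h : IsSuccLimit β) : Motion.left.move β = 0 := by
  simp [Motion.move, h]

@[simp]
theorem move_right (β : Ordinal.{u}) : Motion.right.move β = β + 1 := rfl

@[simp]
theorem move_stay (β : Ordinal.{u}) : Motion.stay.move β = β := rfl

theorem zero_or_succ_or_limit (β : Ordinal.{u}) : β = 0 ∨ (∃ α, β = α + 1) ∨ IsSuccLimit β := by
  rcases zero_or_succ_or_isSuccLimit β with h | ⟨α, h⟩ | h
  · exact Or.inl h
  · exact Or.inr (Or.inl ⟨α, h.symm⟩)
  · exact Or.inr (Or.inr h)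

theorem move_left_lt {β : Ordinal.{u}} (h : β ≠ 0) : Motion.left.move β < β := by
  rcases zero_or_succ_or_limit β with h1 | ⟨α, rfl⟩ | h1
  · exact absurd h1 h
  · rw [move_left_add_one]; exact lt_add_one α
  · rw [move_left_limit h1]; exact h1.bot_lt

theorem move_left_le (β : Ordinal.{u}) : Motion.left.move β ≤ β := by
  rcases eq_or_ne β 0 with rfl | h
  · simp
  · exact (move_left_lt h).le

end Moves

/-! ### Parity of ordinals and blocks of length `ω`. -/

section Arithmetic

theorem even_mod_two (μ : Ordinal.{u}) : 2 * μ % 2 = 0 := by simp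

theorem odd_mod_two (μ : Ordinal.{u}) : (2 * μ + 1) % 2 = 1 := by
  rw [mul_add_mod_self, mod_eq_of_lt one_lt_two]

theorem odd_div_two (μ : Ordinal.{u}) : (2 * μ + 1) / 2 = μ := by
  rw [mul_add_div _ two_ne_zero, div_eq_zero_of_lt one_lt_two, add_zero]

theorem even_div_two (μ : Ordinal.{u}) : 2 * μ / 2 = μ := mul_div_cancel _ two_ne_zero

theorem even_or_odd (γ : Ordinal.{u}) : ∃ μ, γ = 2 * μ ∨ γ = 2 * μ + 1 := by
  refine ⟨γ / 2, ?_⟩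
  have h := div_add_mod γ 2
  have h2 : γ % 2 < 1 + 1 := by rw [one_add_one_eq_two]; exact mod_lt γ two_ne_zero
  rcases (lt_add_one_iff.1 h2).lt_or_eq with h3 | h3
  · rw [lt_one_iff.1 h3, add_zero] at h; exact Or.inl h.symm
  · rw [h3] at h; exact Or.inr h.symm

/-- A limit has the form `ω * k`, and `2 * ω = ω`. Hence doubling of positions moves letters only
within their blocks of length `ω`, so spreading and compressing can be done block by block. -/
theorem two_mul_limit {l : Ordinal.{u}} (hl : IsSuccLimit l) : 2 * l = l := by
  obtain ⟨k, rfl⟩ := isSuccPrelimit_iff_omega0_dvd.1 hl.isSuccPrelimit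
  rw [← mul_assoc]
  congr 1
  exact natCast_mul_omega0 (n := 2) two_pos

theorem le_two_mul (m : Ordinal.{u}) : m ≤ 2 * m := Ordinal.le_mul_right _ two_pos

theorem mul_isNormal {k : Ordinal.{u}} (hk : 0 < k) : IsNormal (k * · : Ordinal.{u} → Ordinal.{u}) :=
  Ordinal.isNormal_mul_right hk

theorem add_isNormal (a : Ordinal.{u}) : IsNormal (a + · : Ordinal.{u} → Ordinal.{u}) :=
  Ordinal.isNormal_add_right a

theorem exists_nat_add {a γ : Ordinal.{u}} (h1 : a ≤ γ) (h2 : γ < a + ω) : ∃ n : ℕ, γ = a + n := by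
  rw [← Ordinal.add_sub_cancel_of_le h1, add_lt_add_iff_left] at h2
  obtain ⟨n, hn⟩ := lt_omega0.1 h2
  exact ⟨n, by rw [← hn, Ordinal.add_sub_cancel_of_le h1]⟩

theorem nat_add_omega0 (n : ℕ) : (n : Ordinal.{u}) + ω = ω :=
  Ordinal.natCast_add_omega0 n

theorem add_nat_add_omega0 (a : Ordinal.{u}) (n : ℕ) : a + n + ω = a + ω := by
  rw [add_assoc, nat_add_omega0]

/-- `2 * m` and `m` lie in the same block of length `ω`. -/
theorem two_mul_add_omega0 (m : Ordinal.{u}) : 2 * m + ω = m + ω := by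
  have h := div_add_mod m ω
  obtain ⟨n, hn⟩ := lt_omega0.1 (mod_lt m omega0_ne_zero)
  rw [hn] at h
  have h2 : (2 : Ordinal.{u}) * ω = ω := two_mul_limit isSuccLimit_omega0
  rw [← h, mul_add, ← mul_assoc, h2]
  have : (2 : Ordinal.{u}) * n = ((2 * n : ℕ) : Ordinal.{u}) := by push_cast; rfl
  rw [this, add_nat_add_omega0, add_nat_add_omega0]

theorem add_omega0_le {m l : Ordinal.{u}} (hl : IsSuccLimit l) (h : m < l) : m + ω ≤ l := by
  rw [add_le_iff_of_isSuccLimit isSuccLimit_omega0]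
  intro b hb
  obtain ⟨n, rfl⟩ := lt_omega0.1 hb
  exact (hl.add_natCast_lt h n).le

end Arithmetic

/-! ### Values attained cofinally often. -/

section MoreRuns

variable {A : Type v} [Fintype A] [LinearOrder A]

theorem IsRun.leads_keep {P : Program.{u} A} {c : Ordinal.{u} → Snapshot.{u} A} (h : IsRun P c)
    {Φ : Snapshot.{u} A → Prop} {T : Tape.{u} A} {q hd q' : Ordinal.{u}} {m : Motion}
    (hP : P (q, T hd) = some (q', T hd, m)) (hΦ : Φ ⟨T, q, hd⟩) :
    Leads c ⟨T, q, hd⟩ ⟨T, q', m.move hd⟩ Φ := by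
  have := h.leads_step hP hΦ
  rwa [Function.update_eq_self] at this

/-- The value `0` is trivially a lower bound, and for `v = w + 1` the strict bounds `w < f μ` are
the bounds `v ≤ f μ`. At a limit value only bounds below `v` are available. -/
theorem RLim.eventually_le {f : Ordinal.{u} → Ordinal.{u}} {l v : Ordinal.{u}} (h : RLim f l v)
    (hl : 0 < l) (hv : ¬ IsSuccLimit v) : ∃ ν < l, ∀ μ, ν ≤ μ → μ < l → v ≤ f μ := by
  rcases zero_or_succ_or_limit v with rfl | ⟨w, rfl⟩ | h1
  · exact ⟨0, hl, fun _ _ _ => zero_le⟩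
  · obtain ⟨ν, h2, h3⟩ := h.1 w (lt_add_one w)
    exact ⟨ν, h2, fun μ h4 h5 => add_one_le_of_lt (h3 μ h4 h5)⟩
  · exact absurd h1 hv

/-- A sequence in a finite type, ranked by natural numbers, has a least value that is attained
cofinally often. -/
theorem exists_least_cofinal {B : Type v} (rk : B → ℕ) (f : Ordinal.{u} → B) {l : Ordinal.{u}}
    (hl : 0 < l) (N : ℕ) (hN : ∀ μ < l, rk (f μ) < N) :
    ∃ n : ℕ, (∃ ν < l, ∀ μ, ν ≤ μ → μ < l → n ≤ rk (f μ)) ∧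
      ∀ ν < l, ∃ μ, ν ≤ μ ∧ μ < l ∧ rk (f μ) = n := by
  have h := rlim_ordLiminf (l := l) (fun μ => ((rk (f μ) : ℕ) : Ordinal.{u})) hl
  set v := ordLiminf Set.univ fun ξ : Set.Iio l => ((rk (f ξ) : ℕ) : Ordinal.{u})
  have hv : v < N := by
    by_contra! hcon
    rcases Nat.eq_zero_or_pos N with rfl | hpos
    · exact absurd (hN 0 hl) (Nat.not_lt_zero _)
    · obtain ⟨ν, h1, h2⟩ := h.1 ((N - 1 : ℕ)) (lt_of_lt_of_le (by exact_mod_cast Nat.sub_lt hpos one_pos) hcon)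
      have h3 := h2 ν le_rfl h1
      dsimp only at h3
      have h4 := hN ν h1
      have h5 : N - 1 < rk (f ν) := by exact_mod_cast h3
      omega
  obtain ⟨n, hn⟩ := lt_omega0.1 (hv.trans (natCast_lt_omega0 N))
  rw [hn] at h
  have hnl : ¬ IsSuccLimit ((n : ℕ) : Ordinal.{u}) := fun hc =>
    absurd (natCast_lt_of_isSuccLimit hc n) (lt_irrefl _)
  obtain ⟨ν, h1, h2⟩ := h.eventually_le hl hnl
  have h2' : ∀ μ, ν ≤ μ → μ < l → n ≤ rk (f μ) := fun μ h3 h4 => by exact_mod_cast h2 μ h3 h4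
  refine ⟨n, ⟨ν, h1, h2'⟩, fun ν' hν' => ?_⟩
  obtain ⟨μ, h3, h4, h5⟩ := h.2 (max ν ν') (max_lt h1 hν')
  dsimp only at h5
  exact ⟨μ, (le_max_right _ _).trans h3, h4, le_antisymm (by exact_mod_cast h5)
    (h2' μ ((le_max_left _ _).trans h3) h4)⟩

end MoreRuns

/-! ### Spreading the input to the odd cells. -/

section Spread

variable {A : Type v} [Fintype A] [LinearOrder A]

/-- The index of a letter. -/
noncomputable def idx (a : A) : ℕ := (Fintype.equivFin A a : ℕ)

theorem idx_lt (a : A) : idx a < Fintype.card A := (Fintype.equivFin A a).2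

theorem idx_injective : Function.Injective (idx (A := A)) := fun a b h =>
  (Fintype.equivFin A).injective (Fin.ext h)

variable (A) in
/-- The states of the automaton that spreads a word: `even` and `odd` check the part that has been
spread, `push a`, `look a` and `peek a` shift the rest of a block (carrying `a`), the other states
return to cell `0`. -/
inductive SpreadState
  | even
  | odd
  | back
  | back'
  | turn
  | home
  | home'
  | look (a : A)
  | peek (a : A)
  | push (a : A)

/-- The number of a state; the loop states come first. -/
noncomputable def SpreadState.num : SpreadState A → ℕ
  | even => 0
  -- The number `1` belongs to the halting state and is left out. The state `even` is the initial
  -- state, and being `0` it is also the state at limits of walks and of rounds.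
  | odd => 2
  | back => 3
  | back' => 4
  | turn => 5
  | home => 6
  | home' => 7
  | look a => 8 + idx a
  | peek a => 8 + Fintype.card A + idx a
  | push a => 8 + 2 * Fintype.card A + idx a

/-- The transitions of the automaton that spreads a word; at the end it writes `one` into cell `0` and
enters state `e`. -/
noncomputable def SpreadState.tr (one : A) (e : Ordinal.{u}) :
    SpreadState A → WithBot A → Ordinal.{u} × WithBot A × Motion
  | even, σ => WithBot.recBotCoe (num (A := A) odd, ⊥, .right) (fun a => (num (push a), ⊥, .right)) σ
  | odd, σ => WithBot.recBotCoe (num (A := A) turn, ⊥, .left) (fun a => (num (A := A) even, a, .right)) σ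
  | back, σ => WithBot.recBotCoe (num (A := A) back', ⊥, .left) (fun a => (num (A := A) back, a, .left)) σ
  | back', σ => WithBot.recBotCoe (num (A := A) even, ⊥, .stay) (fun a => (num (A := A) back, a, .left)) σ
  | turn, σ => (num (A := A) home, σ, .left)
  | home, σ => WithBot.recBotCoe (num (A := A) home', ⊥, .left) (fun a => (num (A := A) home, a, .left)) σ
  | home', σ => WithBot.recBotCoe (e, one, .stay) (fun a => (num (A := A) home, a, .left)) σ
  -- This detour detects limit cells: the left neighbour of a successor cell has just received a
  -- letter, but a left move from a limit cell ends in cell `0`, which is empty by then.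
  | look b, σ => (num (peek b), σ, .left)
  | peek b, σ => WithBot.recBotCoe (num (A := A) even, ⊥, .stay) (fun a => (num (push b), a, .right)) σ
  | push b, σ => WithBot.recBotCoe (num (A := A) back, b, .left) (fun a => (num (look a), b, .right)) σ

/-- The tape with the letters of `x` in the odd cells. -/
noncomputable def spread (x : Tape.{u} A) : Tape.{u} A := fun γ => if γ % 2 = 0 then ⊥ else x (γ / 2)

/-- The tape after the first `m` letters of `x` have been spread. -/
noncomputable def spreadStage (x : Tape.{u} A) (m : Ordinal.{u}) : Tape.{u} A := fun γ =>
  if γ < 2 * m then spread x γ else if γ < 2 * m + ω then x (m + (γ - 2 * m)) else x γ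

/-- The tape while letters `m + k` with `k < i` have been shifted. -/
noncomputable def spreadSweep (x : Tape.{u} A) (m i : Ordinal.{u}) : Tape.{u} A := fun γ =>
  if γ = 2 * m then ⊥ else if 2 * m < γ ∧ γ < 2 * m + 1 + i then x (m + (γ - (2 * m + 1)))
    else spreadStage x m γ

theorem spreadStage_lt {x : Tape.{u} A} {m γ : Ordinal.{u}} (h : γ < 2 * m) :
    spreadStage x m γ = spread x γ := if_pos h

theorem spreadStage_nat {x : Tape.{u} A} (m : Ordinal.{u}) (n : ℕ) :
    spreadStage x m (2 * m + n) = x (m + n) := by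
  rw [spreadStage, if_neg (not_lt.2 le_self_add), if_pos, Ordinal.add_sub_cancel]
  gcongr
  exact natCast_lt_omega0 n

theorem spreadStage_ge {x : Tape.{u} A} {m γ : Ordinal.{u}} (h : 2 * m + ω ≤ γ) :
    spreadStage x m γ = x γ := by
  rw [spreadStage, if_neg (not_lt.2 (le_self_add.trans h)), if_neg (not_lt.2 h)]

theorem spread_even (x : Tape.{u} A) (μ : Ordinal.{u}) : spread x (2 * μ) = ⊥ := by
  simp [spread]

theorem spread_odd (x : Tape.{u} A) (μ : Ordinal.{u}) : spread x (2 * μ + 1) = x μ := by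
  rw [spread, odd_mod_two, if_neg one_ne_zero, odd_div_two]

theorem spreadStage_zero (x : Tape.{u} A) : spreadStage x 0 = x := by
  funext γ
  simp [spreadStage]

/-- Since `2 * l = l`, after limitly many rounds the letters not yet spread are still in their
original cells. -/
theorem spreadStage_limit (x : Tape.{u} A) {l γ : Ordinal.{u}} (hl : IsSuccLimit l) (h : l ≤ γ) :
    spreadStage x l γ = x γ := by
  rw [spreadStage, two_mul_limit hl, if_neg (not_lt.2 h), Ordinal.add_sub_cancel_of_le h]
  split_ifs <;> rfl

theorem spreadStage_len (x : Word.{u} A) : spreadStage x.tape x.len = spread x.tape := by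
  funext γ
  rcases lt_or_ge γ (2 * x.len) with h | h
  · exact spreadStage_lt h
  · have h1 : spread x.tape γ = ⊥ := by
      rw [spread]
      split_ifs
      · rfl
      · rw [x.eq_bot_iff]
        rwa [← mul_le_iff_le_div two_ne_zero]
    rw [h1]
    rcases lt_or_ge γ (2 * x.len + ω) with h2 | h2
    · obtain ⟨n, rfl⟩ := exists_nat_add h h2
      rw [spreadStage_nat, x.eq_bot_iff]
      exact le_self_add
    · rw [spreadStage_ge h2, x.eq_bot_iff]
      exact (le_two_mul _).trans h

theorem spreadSweep_zero (x : Tape.{u} A) (m : Ordinal.{u}) :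
    spreadSweep x m 0 = Function.update (spreadStage x m) (2 * m) ⊥ := by
  funext γ
  rw [spreadSweep, Function.update_apply, add_zero]
  split_ifs with h1 h2
  · rfl
  · exact absurd (lt_add_one_iff.1 h2.2) (not_le.2 h2.1)
  · rfl

theorem spreadSweep_add_one (x : Tape.{u} A) (m : Ordinal.{u}) (i : ℕ) :
    spreadSweep x m ((i + 1 : ℕ) : Ordinal.{u}) =
      Function.update (spreadSweep x m i) (2 * m + 1 + i) (x (m + i)) := by
  funext γ
  have h0 : 2 * m < 2 * m + 1 + i := (lt_add_one _).trans_le le_self_add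
  rw [Function.update_apply, spreadSweep, spreadSweep]
  push_cast
  rw [← add_assoc]
  by_cases h1 : γ = 2 * m + 1 + i
  · subst h1
    rw [if_neg h0.ne', if_pos ⟨h0, lt_add_one _⟩, if_pos rfl, Ordinal.add_sub_cancel]
  · have h2 : γ < 2 * m + 1 + i + 1 ↔ γ < 2 * m + 1 + i := by
      rw [lt_add_one_iff, le_iff_lt_or_eq]; simp [h1]
    simp only [h2, h1, if_false]

theorem spreadSweep_omega0 (x : Tape.{u} A) (m : Ordinal.{u}) :
    spreadSweep x m ω = spreadStage x (m + 1) := by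
  funext γ
  have e1 : 2 * (m + 1) = 2 * m + 2 := by rw [mul_add, mul_one]
  have e2 : 2 * (m + 1) + ω = 2 * m + ω := by
    rw [e1]; exact_mod_cast add_nat_add_omega0 (2 * m) 2
  have e3 : 2 * m + 1 + ω = 2 * m + ω := by exact_mod_cast add_nat_add_omega0 (2 * m) 1
  rw [spreadSweep, e3]
  rcases lt_or_ge γ (2 * m) with h | h
  · have h' : γ < 2 * (m + 1) := by rw [e1]; exact h.trans_le le_self_add
    rw [if_neg h.ne, if_neg (fun hc => absurd h hc.1.not_gt), spreadStage_lt h, spreadStage_lt h']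
  rcases h.eq_or_lt with rfl | h1
  · rw [if_pos rfl, spreadStage_lt, spread_even]
    rw [e1]; exact lt_add_of_pos_right _ two_pos
  rcases lt_or_ge γ (2 * m + ω) with h2 | h2
  · obtain ⟨n, rfl⟩ := exists_nat_add h h2
    have hn : n ≠ 0 := by rintro rfl; simp at h1
    obtain ⟨k, rfl⟩ := Nat.exists_eq_succ_of_ne_zero hn
    have e4 : 2 * m + ((k.succ : ℕ) : Ordinal.{u}) = 2 * m + 1 + k := by
      rw [add_assoc]; congr 1; norm_cast; omega
    rw [if_neg h1.ne', if_pos ⟨h1, h2⟩, e4, Ordinal.add_sub_cancel]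
    rcases k with _ | k
    · rw [Nat.cast_zero, add_zero, add_zero, spreadStage_lt, spread_odd]
      rw [e1]; gcongr; exact one_lt_two
    · have e5 : 2 * m + 1 + ((k + 1 : ℕ) : Ordinal.{u}) = 2 * (m + 1) + k := by
        rw [e1, add_assoc, add_assoc]; congr 1; norm_cast; omega
      rw [e5, spreadStage_nat, add_assoc]; congr 2; norm_cast; omega
  · rw [if_neg h1.ne', if_neg (fun hc => absurd hc.2 (not_lt.2 h2)), spreadStage_ge h2,
      spreadStage_ge (by rwa [e2])]

/-- Past the end of the word both the old and the shifted contents are empty, so a sweep that stops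
there has already produced the result of a full sweep. -/
theorem spreadSweep_end (x : Word.{u} A) (m : Ordinal.{u}) (i : ℕ)
    (h : x.tape (m + 1 + i) = ⊥) :
    spreadSweep x.tape m ((i + 1 : ℕ) : Ordinal.{u}) = spreadStage x.tape (m + 1) := by
  rw [← spreadSweep_omega0]
  funext γ
  rw [spreadSweep, spreadSweep]
  split_ifs with h1 h2 h3 h3
  · rfl
  · rfl
  · exact absurd ⟨h2.1, h2.2.trans (by gcongr; exact natCast_lt_omega0 _)⟩ h3
  · have h4 : 2 * m + 1 + ((i + 1 : ℕ) : Ordinal.{u}) ≤ γ := by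
      by_contra! hc; exact h2 ⟨h3.1, hc⟩
    obtain ⟨n, hn⟩ := exists_nat_add (a := 2 * m + 1) (le_self_add.trans h4) h3.2
    subst hn
    have h5 : i + 1 ≤ n := by
      rw [add_le_add_iff_left] at h4; exact_mod_cast h4
    rw [Ordinal.add_sub_cancel, add_assoc, show (1 : Ordinal.{u}) + n = ((1 + n : ℕ) : Ordinal.{u}) by
      push_cast; rfl, spreadStage_nat]
    rw [x.eq_bot_iff] at h
    have h6 : m + 1 + i ≤ m + n := by
      rw [add_assoc, add_le_add_iff_left]; norm_cast; omega
    rw [(x.eq_bot_iff _).2, (x.eq_bot_iff _).2 (h.trans h6)]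
    refine (h.trans h6).trans ?_
    rw [add_le_add_iff_left]; norm_cast; omega
  · rfl

variable {P : Program.{u} A} {c : Ordinal.{u} → Snapshot.{u} A} {one : A} {e : Ordinal.{u}}

/-- Going left until two empty cells are read in succession ends in cell `0`. -/
theorem leadsE_home (hrun : IsRun P c) {Φ : Snapshot.{u} A → Prop} {T : Tape.{u} A}
    {g g' : Ordinal.{u}} (h1 : ∀ a : A, P (g, (a : WithBot A)) = some (g, (a : WithBot A), Motion.left))
    (h2 : P (g, ⊥) = some (g', ⊥, Motion.left))
    (h3 : ∀ a : A, P (g', (a : WithBot A)) = some (g, (a : WithBot A), Motion.left))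
    (hΦ : ∀ h, Φ ⟨T, g, h⟩ ∧ Φ ⟨T, g', h⟩) (h : Ordinal.{u}) (h0 : T 0 = ⊥)
    (hT : ∀ γ < h, T γ = ⊥ → T (γ + 1) ≠ ⊥) : LeadsE c ⟨T, g, h⟩ ⟨T, g', 0⟩ Φ := by
  induction h using WellFoundedLT.induction with
  | ind h ih =>
  have hlet : ∀ {σ : WithBot A}, σ ≠ ⊥ → ∃ a : A, σ = a := fun hσ =>
    ⟨_, (WithBot.coe_unbot _ hσ).symm⟩
  by_cases hb : T h = ⊥
  · have s1 : Leads c ⟨T, g, h⟩ ⟨T, g', Motion.left.move h⟩ Φ :=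
      hrun.leads_keep (by rw [hb, h2]) (hΦ h).1
    -- To the left of an empty successor cell there is a letter, and the search goes on. From cell
    -- `0` and from a limit cell the move ends in cell `0`, where an empty cell is read for the
    -- second time.
    rcases zero_or_succ_or_limit h with rfl | ⟨h', rfl⟩ | hl
    · rw [move_left_zero] at s1; exact s1.toE
    · rw [move_left_add_one] at s1
      have h5 : T h' ≠ ⊥ := fun hc => hT h' (lt_add_one h') hc hb
      obtain ⟨a, ha⟩ := hlet h5
      have s2 : Leads c ⟨T, g', h'⟩ ⟨T, g, Motion.left.move h'⟩ Φ :=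
        hrun.leads_keep (by rw [ha, h3]) (hΦ h').2
      have hle := move_left_le h'
      refine (s1.trans s2).toE.trans (ih _ (hle.trans_lt (lt_add_one h')) fun γ hγ => ?_)
      exact hT γ (hγ.trans (hle.trans_lt (lt_add_one h')))
    · rw [move_left_limit hl] at s1; exact s1.toE
  · obtain ⟨a, ha⟩ := hlet hb
    have hne : h ≠ 0 := fun hc => hb (hc ▸ h0)
    have s1 : Leads c ⟨T, g, h⟩ ⟨T, g, Motion.left.move h⟩ Φ :=
      hrun.leads_keep (by rw [ha, h1]) (hΦ h).1
    have hlt := move_left_lt hne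
    exact s1.toE.trans (ih _ hlt fun γ hγ => hT γ (hγ.trans hlt))

/-- In the `m`-th round, only the block of cell `2 * m` is changed. -/
def SpreadMid (x : Tape.{u} A) (m : Ordinal.{u}) (s : Snapshot.{u} A) : Prop :=
  s.state ≠ 1 ∧ ∀ η, (η < 2 * m ∨ 2 * m + ω ≤ η) → s.tape η = spreadStage x m η

theorem SpreadState.num_ne_one (s : SpreadState A) : ((s.num : ℕ) : Ordinal.{u}) ≠ 1 := by
  have : s.num ≠ 1 := by cases s <;> simp [num]; all_goals omega
  exact_mod_cast this

theorem spreadMid_stage (x : Tape.{u} A) (m h : Ordinal.{u}) (s : SpreadState A) :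
    SpreadMid x m ⟨spreadStage x m, s.num, h⟩ := ⟨s.num_ne_one, fun _ _ => rfl⟩

theorem spreadMid_sweep (x : Tape.{u} A) (m h : Ordinal.{u}) (s : SpreadState A) {i : Ordinal.{u}}
    (hi : i ≤ ω) : SpreadMid x m ⟨spreadSweep x m i, s.num, h⟩ := by
  refine ⟨s.num_ne_one, fun η hη => ?_⟩
  have e3 : 2 * m + 1 + ω = 2 * m + ω := by exact_mod_cast add_nat_add_omega0 (2 * m) 1
  have h1 : 2 * m + 1 + i ≤ 2 * m + ω := by rw [← e3]; gcongr
  dsimp only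
  rw [spreadSweep, if_neg, if_neg]
  · rintro ⟨h2, h3⟩
    rcases hη with h4 | h4
    · exact absurd h2 h4.not_gt
    · exact absurd (h3.trans_le h1) (not_lt.2 h4)
  · rintro rfl
    rcases hη with h4 | h4
    · exact lt_irrefl _ h4
    · exact absurd (lt_add_of_pos_right (2 * m) omega0_pos) (not_lt.2 h4)

/-- A sweep visits each cell to be changed once, so every cell settles before `ω`. -/
theorem spreadSweep_eventually (x : Tape.{u} A) (m η : Ordinal.{u}) :
    ∃ ν < ω, ∀ i, ν < i → i ≤ ω → spreadSweep x m i η = spreadSweep x m ω η := by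
  by_cases h : 2 * m < η ∧ η < 2 * m + 1 + ω
  · obtain ⟨n, rfl⟩ := exists_nat_add (a := 2 * m + 1) (add_one_le_of_lt h.1) h.2
    refine ⟨n, natCast_lt_omega0 n, fun i h1 h2 => ?_⟩
    have h' : 2 * m < 2 * m + 1 + (n : Ordinal.{u}) ∧ 2 * m + 1 + (n : Ordinal.{u}) < 2 * m + 1 + i :=
      ⟨h.1, by gcongr⟩
    simp only [spreadSweep]
    rw [if_pos h, if_pos h']
  · refine ⟨0, omega0_pos, fun i h1 h2 => ?_⟩
    have h' : ¬ (2 * m < η ∧ η < 2 * m + 1 + i) :=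
      fun hc => h ⟨hc.1, hc.2.trans_le (by gcongr)⟩
    simp only [spreadSweep]
    rw [if_neg h, if_neg h']

/-- At limits of the walk the state is `even`, which has the least number, and in this state the
head is only on the cells `2 * μ`. So the limit position is the supremum of these. -/
theorem leadsE_spread_walk (hrun : IsRun P c)
    (hC : ∀ (s : SpreadState A) σ, P ((s.num : Ordinal.{u}), σ) = some (s.tr one e σ))
    {Φ : Snapshot.{u} A → Prop} {T x : Tape.{u} A} (m : Ordinal.{u})
    (hT : ∀ γ < 2 * m, T γ = spread x γ) (hx : ∀ μ < m, x μ ≠ ⊥)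
    (hΦ : ∀ (s : SpreadState A) h, Φ ⟨T, s.num, h⟩) :
    LeadsE c ⟨T, SpreadState.num (A := A) .even, 0⟩ ⟨T, SpreadState.num (A := A) .even, 2 * m⟩ Φ := by
  have key := hrun.leadsE_loop m (fun μ => ⟨T, SpreadState.num (A := A) .even, 2 * μ⟩)
    (fun μ s => Φ s ∧ s.tape = T ∧ (s.state = SpreadState.num (A := A) .even → s.head = 2 * μ)) Φ
    ?_ ?_ (fun μ _ m hm => hm.1)
  · simpa using key
  · intro μ hμ
    have h1 : 2 * μ < 2 * m := by gcongr
    have h2 : 2 * μ + 1 < 2 * m := by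
      refine lt_of_lt_of_le ?_ (show 2 * (μ + 1) ≤ 2 * m by gcongr; exact add_one_le_of_lt hμ)
      rw [mul_add_one]; gcongr; exact one_lt_two
    obtain ⟨a, ha⟩ : ∃ a : A, x μ = a := ⟨_, (WithBot.coe_unbot _ (hx μ hμ)).symm⟩
    have s1 := hrun.leads_keep (q := (SpreadState.num (A := A) .even)) (T := T) (hd := 2 * μ)
      (q' := (SpreadState.num (A := A) .odd)) (m := .right)
      (Φ := fun s => Φ s ∧ s.tape = T ∧
        (s.state = SpreadState.num (A := A) .even → s.head = 2 * μ))
      (by rw [hC, hT _ h1, spread_even]; rfl) ⟨hΦ _ _, rfl, fun _ => rfl⟩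
    have s2 := hrun.leads_keep (q := (SpreadState.num (A := A) .odd)) (T := T) (hd := 2 * μ + 1)
      (q' := (SpreadState.num (A := A) .even)) (m := .right)
      (Φ := fun s => Φ s ∧ s.tape = T ∧
        (s.state = SpreadState.num (A := A) .even → s.head = 2 * μ))
      (by rw [hC, hT _ h2, spread_odd, ha]; rfl)
      ⟨hΦ _ _, rfl, fun h => by simp [SpreadState.num] at h⟩
    have := s1.trans s2
    rwa [move_right, add_assoc, one_add_one_eq_two, ← mul_add_one] at this
  · intro l _ hl
    refine ⟨⟨0, hl.bot_lt, fun μ _ _ m hm => ?_⟩, fun ν hν => ⟨ν, le_rfl, hν, rfl, ?_⟩, ?_, ?_, ?_⟩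
    · simp [SpreadState.num]
    · dsimp only; gcongr
    · intro b hb
      obtain ⟨ν, h1, h2⟩ := ((mul_isNormal two_pos).lt_iff_exists_lt hl).1 hb
      refine ⟨ν, h1, fun μ h3 _ s hs hst => ?_⟩
      rw [hs.2.2 hst]
      exact h2.trans_le (by gcongr)
    · exact fun η => ⟨0, hl.bot_lt, fun μ _ _ s hs => by rw [hs.2.1]⟩
    · exact fun η ν hν => ⟨ν, le_rfl, hν, le_rfl⟩

section Round

variable (x : Word.{u} A) (m : Ordinal.{u})

theorem leads_spread_push (hrun : IsRun P c)
    (hC : ∀ (s : SpreadState A) σ, P ((s.num : Ordinal.{u}), σ) = some (s.tr one e σ))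
    (i : ℕ) {a d : A} (ha : x.tape (m + i) = a) (hd : x.tape (m + 1 + i) = d) :
    Leads c ⟨spreadSweep x.tape m i, (SpreadState.push a).num, 2 * m + 1 + i⟩
      ⟨spreadSweep x.tape m ((i + 1 : ℕ) : Ordinal.{u}), (SpreadState.look d).num,
        2 * m + 1 + ((i + 1 : ℕ) : Ordinal.{u})⟩
      (fun s => s = ⟨spreadSweep x.tape m i, (SpreadState.push a).num, 2 * m + 1 + i⟩) := by
  have h0 : 2 * m < 2 * m + 1 + i := (lt_add_one _).trans_le le_self_add
  have hcell : spreadSweep x.tape m i (2 * m + 1 + i) = d := by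
    rw [spreadSweep, if_neg h0.ne', if_neg (fun hc => lt_irrefl _ hc.2), add_assoc,
      show (1 : Ordinal.{u}) + i = ((1 + i : ℕ) : Ordinal.{u}) by push_cast; rfl, spreadStage_nat]
    rw [← hd, add_assoc]; push_cast; rfl
  have := hrun.leads_step (T := spreadSweep x.tape m i) (q := (SpreadState.push a).num)
    (hd := 2 * m + 1 + i) (σ' := a) (m := .right) (q' := (SpreadState.look d).num)
    (Φ := fun s => s = ⟨spreadSweep x.tape m i, (SpreadState.push a).num, 2 * m + 1 + i⟩)
    (by rw [hcell, hC]; rfl) rfl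
  rw [← ha, ← spreadSweep_add_one, move_right] at this
  rw [Nat.cast_add, Nat.cast_one, ← add_assoc (2 * m + 1)]
  rw [Nat.cast_add, Nat.cast_one] at this
  exact this

theorem leads_spread_look (hrun : IsRun P c)
    (hC : ∀ (s : SpreadState A) σ, P ((s.num : Ordinal.{u}), σ) = some (s.tr one e σ))
    (i : ℕ) {a d : A} (ha : x.tape (m + i) = a) :
    Leads c ⟨spreadSweep x.tape m ((i + 1 : ℕ) : Ordinal.{u}), (SpreadState.look d).num,
        2 * m + 1 + ((i + 1 : ℕ) : Ordinal.{u})⟩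
      ⟨spreadSweep x.tape m ((i + 1 : ℕ) : Ordinal.{u}), (SpreadState.push d).num,
        2 * m + 1 + ((i + 1 : ℕ) : Ordinal.{u})⟩
      (fun s => s.tape = spreadSweep x.tape m ((i + 1 : ℕ) : Ordinal.{u}) ∧
        (s.state = (SpreadState.look d).num ∧ s.head = 2 * m + 1 + ((i + 1 : ℕ) : Ordinal.{u}) ∨
          s.state = (SpreadState.peek d).num)) := by
  have s1 := hrun.leads_keep (T := spreadSweep x.tape m ((i + 1 : ℕ) : Ordinal.{u}))
    (q := (SpreadState.look d).num) (hd := 2 * m + 1 + ((i + 1 : ℕ) : Ordinal.{u}))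
    (m := .left) (q' := (SpreadState.peek d).num)
    (Φ := fun s => s.tape = spreadSweep x.tape m ((i + 1 : ℕ) : Ordinal.{u}) ∧
        (s.state = (SpreadState.look d).num ∧ s.head = 2 * m + 1 + ((i + 1 : ℕ) : Ordinal.{u}) ∨
          s.state = (SpreadState.peek d).num)) (by rw [hC]; rfl) ⟨rfl, Or.inl ⟨rfl, rfl⟩⟩
  have e1 : 2 * m + 1 + ((i + 1 : ℕ) : Ordinal.{u}) = 2 * m + 1 + i + 1 := by
    push_cast; rw [add_assoc, add_assoc, add_assoc]
  have hcell : spreadSweep x.tape m ((i + 1 : ℕ) : Ordinal.{u}) (2 * m + 1 + i) = a := by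
    rw [spreadSweep_add_one, Function.update_self, ha]
  have s2 := hrun.leads_keep (T := spreadSweep x.tape m ((i + 1 : ℕ) : Ordinal.{u}))
    (q := (SpreadState.peek d).num) (hd := 2 * m + 1 + i)
    (m := .right) (q' := (SpreadState.push d).num)
    (Φ := fun s => s.tape = spreadSweep x.tape m ((i + 1 : ℕ) : Ordinal.{u}) ∧
        (s.state = (SpreadState.look d).num ∧ s.head = 2 * m + 1 + ((i + 1 : ℕ) : Ordinal.{u}) ∨
          s.state = (SpreadState.peek d).num)) (by rw [hC, hcell]; rfl) ⟨rfl, Or.inr rfl⟩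
  have s3 := s1
  rw [show Motion.left.move (2 * m + 1 + ((i + 1 : ℕ) : Ordinal.{u})) = 2 * m + 1 + i by
    rw [e1, move_left_add_one]] at s3
  have := s3.trans s2
  rwa [move_right, ← e1] at this

/-- The sweep if the word ends in the current block. -/
theorem leadsE_spread_sweep_end (hm : m < x.len) (hrun : IsRun P c)
    (hC : ∀ (s : SpreadState A) σ, P ((s.num : Ordinal.{u}), σ) = some (s.tr one e σ))
    {a : A} (ha : x.tape m = a) (i : ℕ) (hi : x.tape (m + 1 + i) = ⊥)
    (hlt : ∀ k < i, x.tape (m + 1 + k) ≠ ⊥) :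
    LeadsE c ⟨spreadSweep x.tape m 0, (SpreadState.push a).num, 2 * m + 1⟩
      ⟨spreadStage x.tape (m + 1), SpreadState.num (A := A) .even, 0⟩ (SpreadMid x.tape m) := by
  have hle : ∀ k : ℕ, ((k : ℕ) : Ordinal.{u}) ≤ ω := fun k => (natCast_lt_omega0 k).le
  have hcast : ∀ k : ℕ, m + 1 + k = m + ((k + 1 : ℕ) : Ordinal.{u}) := fun k => by
    rw [add_assoc]; congr 1; norm_cast; omega
  have main : ∀ k ≤ i, ∃ b : A, x.tape (m + k) = b ∧
      LeadsE c ⟨spreadSweep x.tape m 0, (SpreadState.push a).num, 2 * m + 1⟩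
        ⟨spreadSweep x.tape m k, (SpreadState.push b).num, 2 * m + 1 + k⟩ (SpreadMid x.tape m) := by
    intro k
    induction k with
    | zero => intro _; exact ⟨a, by simpa using ha, by simpa using LeadsE.refl⟩
    | succ k ih =>
      intro hk
      obtain ⟨b, hb, hL⟩ := ih (by omega)
      obtain ⟨d, hd⟩ : ∃ d : A, x.tape (m + 1 + k) = d :=
        ⟨_, (WithBot.coe_unbot _ (hlt k (by omega))).symm⟩
      refine ⟨d, by rw [← hcast, hd], hL.trans ?_⟩
      refine ((leads_spread_push x m hrun hC k hb hd).mono ?_).toE.trans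
        ((leads_spread_look x m hrun hC k hb).mono ?_).toE
      · rintro s rfl
        exact spreadMid_sweep _ _ _ _ (hle k)
      · rintro ⟨T, q, h⟩ ⟨rfl, ⟨rfl, -⟩ | rfl⟩ <;> exact spreadMid_sweep _ _ _ _ (hle _)
  obtain ⟨b, hb, hL⟩ := main i le_rfl
  refine hL.trans ?_
  have h0 : 2 * m < 2 * m + 1 + i := (lt_add_one _).trans_le le_self_add
  have hcell : spreadSweep x.tape m i (2 * m + 1 + i) = ⊥ := by
    rw [spreadSweep, if_neg h0.ne', if_neg (fun hc => lt_irrefl _ hc.2), add_assoc,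
      show (1 : Ordinal.{u}) + i = ((1 + i : ℕ) : Ordinal.{u}) by push_cast; rfl, spreadStage_nat]
    rw [← hi, add_assoc]; push_cast; rfl
  have s1 := hrun.leads_step (T := spreadSweep x.tape m i) (q := (SpreadState.push b).num)
    (hd := 2 * m + 1 + i) (σ' := b) (m := .left) (q' := SpreadState.num (A := A) .back)
    (Φ := SpreadMid x.tape m) (by rw [hcell, hC]; rfl) (spreadMid_sweep _ _ _ _ (hle _))
  have e1 : 2 * m + 1 + (i : Ordinal.{u}) = 2 * m + i + 1 := by
    rw [add_assoc, add_assoc]; congr 1; norm_cast; omega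
  have hmv : Motion.left.move (2 * m + 1 + (i : Ordinal.{u})) = 2 * m + i := by
    rw [e1, move_left_add_one]
  have hmid : ∀ (s : SpreadState A) h,
      SpreadMid x.tape m ⟨spreadStage x.tape (m + 1), s.num, h⟩ := fun s h => by
    rw [← spreadSweep_omega0]; exact spreadMid_sweep _ _ _ _ le_rfl
  rw [← hb, ← spreadSweep_add_one, spreadSweep_end x m i hi, hmv] at s1
  have h2m : 2 * (m + 1) = 2 * m + 2 := by rw [mul_add, mul_one]
  have hzero : spreadStage x.tape (m + 1) 0 = ⊥ := by
    rw [spreadStage_lt, ← mul_zero 2, spread_even]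
    rw [h2m]; exact two_pos.trans_le le_add_self
  have s2 := leadsE_home hrun (g := SpreadState.num (A := A) .back)
    (g' := SpreadState.num (A := A) .back') (Φ := SpreadMid x.tape m) (T := spreadStage x.tape (m + 1))
    (fun a => by rw [hC]; rfl) (by rw [hC]; rfl) (fun a => by rw [hC]; rfl)
    (fun h => ⟨hmid _ _, hmid _ _⟩) (2 * m + i) hzero (by
      intro γ hγ hb
      rcases lt_or_ge γ (2 * (m + 1)) with h1 | h1
      · obtain ⟨μ, rfl | rfl⟩ := even_or_odd γ
        · have hμ : μ ≤ m := by
            have : μ < m + 1 := (mul_lt_mul_iff_right₀ two_pos).1 h1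
            exact lt_add_one_iff.1 this
          rw [spreadStage_lt, spread_odd, x.ne_bot_iff]
          · exact hμ.trans_lt hm
          · rw [h2m]
            calc 2 * μ + 1 ≤ 2 * m + 1 := by gcongr
              _ < 2 * m + 2 := by gcongr; exact one_lt_two
        · rw [spreadStage_lt h1, spread_odd, x.eq_bot_iff] at hb
          have hμ : μ < m + 1 := (mul_lt_mul_iff_right₀ two_pos).1 ((lt_add_one _).trans h1)
          exact absurd (hb.trans (lt_add_one_iff.1 hμ)) (not_le.2 hm)
      · have h3 : γ < 2 * (m + 1) + ω := by
          rw [h2m]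
          refine hγ.trans ?_
          rw [add_assoc]
          gcongr
          exact (natCast_lt_omega0 i).trans_le le_add_self
        obtain ⟨n, rfl⟩ := exists_nat_add h1 h3
        rw [spreadStage_nat] at hb
        have h4 : n < i := by
          rw [h2m, add_assoc, add_lt_add_iff_left] at hγ
          have : 2 + n < i := by exact_mod_cast hγ
          omega
        exact absurd hb (hlt n h4))
  have s3 := hrun.leads_keep (T := spreadStage x.tape (m + 1)) (q := SpreadState.num (A := A) .back')
    (hd := 0) (m := .stay) (q' := SpreadState.num (A := A) .even)
    (Φ := SpreadMid x.tape m) (by rw [hzero, hC]; rfl) (hmid _ _)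
  exact s1.toE.trans (s2.trans s3.toE)

/-- The sweep if the word does not end in the current block. -/
theorem leadsE_spread_sweep_omega (hrun : IsRun P c)
    (hC : ∀ (s : SpreadState A) σ, P ((s.num : Ordinal.{u}), σ) = some (s.tr one e σ))
    {a : A} (ha : x.tape m = a) (hall : m + ω ≤ x.len) :
    LeadsE c ⟨spreadSweep x.tape m 0, (SpreadState.push a).num, 2 * m + 1⟩
      ⟨spreadStage x.tape (m + 1), SpreadState.num (A := A) .even, 0⟩ (SpreadMid x.tape m) := by
  have hle : ∀ k : ℕ, ((k : ℕ) : Ordinal.{u}) ≤ ω := fun k => (natCast_lt_omega0 k).le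
  have hcast : ∀ k : ℕ, m + 1 + k = m + ((k + 1 : ℕ) : Ordinal.{u}) := fun k => by
    rw [add_assoc]; congr 1; norm_cast; omega
  have hex : ∀ μ : Ordinal.{u}, ∃ b : A, μ < ω → x.tape (m + μ) = b := fun μ => by
    by_cases hμ : μ < ω
    · have : x.tape (m + μ) ≠ ⊥ := (x.ne_bot_iff _).2 (lt_of_lt_of_le (by gcongr) hall)
      exact ⟨_, fun _ => (WithBot.coe_unbot _ this).symm⟩
    · exact ⟨a, fun h => absurd h hμ⟩
  choose lt hlt using hex
  have hlt' : ∀ k : ℕ, x.tape (m + k) = lt k := fun k => hlt k (natCast_lt_omega0 k)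
  -- The states `look d` have smaller numbers than the states `peek d` and `push d`, so the state at
  -- the limit of the sweep is `look` of the letter with the least index among those carried
  -- cofinally often. Which letter this is does not matter, because it is dropped.
  obtain ⟨n, ⟨ν0, hν0, hn1⟩, hn2⟩ := exists_least_cofinal idx (fun μ => lt (μ + 1)) omega0_pos
    (Fintype.card A) (fun μ _ => idx_lt _)
  obtain ⟨μ0, -, -, hμ0⟩ := hn2 0 omega0_pos
  set cs := lt (μ0 + 1) with hcs
  let s : Ordinal.{u} → Snapshot.{u} A := fun μ =>
    if μ < ω then ⟨spreadSweep x.tape m (μ + 1), (SpreadState.look (lt (μ + 1))).num,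
      2 * m + 1 + (μ + 1)⟩ else ⟨spreadSweep x.tape m ω, (SpreadState.look cs).num, 2 * m + 1 + ω⟩
  let Φ : Ordinal.{u} → Snapshot.{u} A → Prop := fun μ t =>
    SpreadMid x.tape m t ∧ (∃ i, μ < i ∧ i ≤ ω ∧ t.tape = spreadSweep x.tape m i) ∧
      ((t.state = (SpreadState.look (lt (μ + 1))).num ∧ t.head = 2 * m + 1 + (μ + 1)) ∨
        ((8 + Fintype.card A : ℕ) : Ordinal.{u}) ≤ t.state)
  have hsn : ∀ k : ℕ, s k = ⟨spreadSweep x.tape m ((k + 1 : ℕ) : Ordinal.{u}),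
      (SpreadState.look (lt ((k + 1 : ℕ) : Ordinal.{u}))).num,
      2 * m + 1 + ((k + 1 : ℕ) : Ordinal.{u})⟩ := fun k => by
    simp only [s]
    rw [if_pos (natCast_lt_omega0 k)]
    push_cast
    rfl
  have hω : s ω = ⟨spreadSweep x.tape m ω, (SpreadState.look cs).num, 2 * m + 1 + ω⟩ :=
    if_neg (lt_irrefl _)
  have loop := hrun.leadsE_loop ω s Φ (SpreadMid x.tape m) ?_ ?_ (fun μ _ t ht => ht.1)
  rotate_left
  · intro μ hμ
    obtain ⟨k, rfl⟩ := lt_omega0.1 hμ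
    have e1 : ((k : Ordinal.{u}) + 1) = ((k + 1 : ℕ) : Ordinal.{u}) := by push_cast; rfl
    rw [e1, hsn, hsn]
    have hkk : ((k : ℕ) : Ordinal.{u}) < ((k + 1 : ℕ) : Ordinal.{u}) := by
      exact_mod_cast Nat.lt_succ_self k
    refine ((leads_spread_look x m hrun hC k (hlt' k)).mono ?_).trans
      ((leads_spread_push x m hrun hC (k + 1) (hlt' (k + 1)) (by
        rw [hcast, hlt'])).mono ?_)
    · rintro ⟨T, q, h⟩ ⟨rfl, hq⟩
      refine ⟨?_, ⟨_, hkk, hle _, rfl⟩, ?_⟩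
      · rcases hq with ⟨rfl, -⟩ | rfl <;> exact spreadMid_sweep _ _ _ _ (hle _)
      · rcases hq with ⟨rfl, rfl⟩ | rfl
        · left; rw [e1]; exact ⟨rfl, rfl⟩
        · right
          simp only [SpreadState.num]; norm_cast; omega
    · rintro t rfl
      refine ⟨spreadMid_sweep _ _ _ _ (hle _), ⟨_, hkk, hle _, rfl⟩, Or.inr ?_⟩
      simp only [SpreadState.num]; norm_cast; omega
  · intro l hl hl'
    obtain rfl : l = ω := le_antisymm hl (omega0_le_of_isSuccLimit hl')
    rw [hω]
    refine ⟨⟨ν0, hν0, fun μ h1 h2 t ht => ?_⟩, fun ν hν => ?_, fun b hb => ?_, fun η => ?_,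
      fun η ν hν => ?_⟩
    · have h3 := hn1 μ h1 h2
      rcases ht.2.2 with ⟨h4, -⟩ | h4
      · rw [h4]; simp only [SpreadState.num]; norm_cast; omega
      · refine le_trans ?_ h4
        have := idx_lt cs
        simp only [SpreadState.num]; norm_cast; omega
    · obtain ⟨μ, h1, h2, h3⟩ := hn2 ν hν
      refine ⟨μ, h1, h2, ?_, ?_⟩
      · simp only [s]; rw [if_pos h2]; simp only [SpreadState.num, h3, hμ0]
      · simp only [s]; rw [if_pos h2]
        have : μ + 1 ≤ ω := (isSuccLimit_omega0.add_one_lt h2).le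
        dsimp only; gcongr
    · obtain ⟨ν, h1, h2⟩ := ((add_isNormal (2 * m + 1)).lt_iff_exists_lt isSuccLimit_omega0).1 hb
      refine ⟨ν, h1, fun μ h3 h4 t ht hts => ?_⟩
      rcases ht.2.2 with ⟨-, h5⟩ | h5
      · rw [h5]
        exact h2.trans_le (add_le_add_right (h3.trans (lt_add_one μ).le) _)
      · rw [hts] at h5
        have := idx_lt cs
        simp only [SpreadState.num] at h5
        have h6 : 8 + Fintype.card A ≤ 8 + idx cs := by exact_mod_cast h5
        omega
    · obtain ⟨ν, h1, h2⟩ := spreadSweep_eventually x.tape m η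
      refine ⟨ν, h1, fun μ h3 h4 t ht => ?_⟩
      obtain ⟨i, h5, h6, h7⟩ := ht.2.1
      rw [h7]
      dsimp only
      rw [h2 i (h3.trans_lt h5) h6]
    · obtain ⟨ν', h1, h2⟩ := spreadSweep_eventually x.tape m η
      refine ⟨max ν ν', le_max_left _ _, max_lt hν h1, ?_⟩
      simp only [s]
      rw [if_pos (max_lt hν h1)]
      dsimp only
      rw [h2 _ ((le_max_right ν ν').trans_lt (lt_add_one _))
        (isSuccLimit_omega0.add_one_lt (max_lt hν h1)).le]
  have e0 := hsn 0
  rw [Nat.cast_zero] at e0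
  rw [e0, hω] at loop
  have h00 : x.tape (m + (0 : ℕ)) = a := by simpa using ha
  have s0 := (leads_spread_push x m hrun hC 0 h00 (by rw [hcast 0, hlt'])).mono
    (Ψ := SpreadMid x.tape m) (fun t ht => by rw [ht]; exact spreadMid_sweep _ _ _ _ (hle _))
  have hzero : spreadSweep x.tape m ω 0 = ⊥ := by
    rw [spreadSweep_omega0, spreadStage_lt, ← mul_zero 2, spread_even]
    rw [mul_add_one]; exact two_pos.trans_le le_add_self
  -- The move from the limit cell ends in cell `0`; it is empty, so `peek` enters `even` and the
  -- next round begins there.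
  have s1 := hrun.leads_keep (T := spreadSweep x.tape m ω) (q := (SpreadState.look cs).num)
    (hd := 2 * m + 1 + ω) (m := .left) (q' := (SpreadState.peek cs).num)
    (Φ := SpreadMid x.tape m) (by rw [hC]; rfl) (spreadMid_sweep _ _ _ _ le_rfl)
  have s2 := hrun.leads_keep (T := spreadSweep x.tape m ω) (q := (SpreadState.peek cs).num)
    (hd := 0) (m := .stay) (q' := SpreadState.num (A := A) .even)
    (Φ := SpreadMid x.tape m) (by rw [hzero, hC]; rfl) (spreadMid_sweep _ _ _ _ le_rfl)
  rw [move_left_limit (isSuccLimit_add _ isSuccLimit_omega0)] at s1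
  rw [← spreadSweep_omega0]
  refine LeadsE.trans ?_ (loop.trans (s1.toE.trans s2.toE))
  have := s0.toE
  simpa using this

theorem leads_spread_round (hm : m < x.len) (hrun : IsRun P c)
    (hC : ∀ (s : SpreadState A) σ, P ((s.num : Ordinal.{u}), σ) = some (s.tr one e σ)) :
    Leads c ⟨spreadStage x.tape m, SpreadState.num (A := A) .even, 0⟩
      ⟨spreadStage x.tape (m + 1), SpreadState.num (A := A) .even, 0⟩ (SpreadMid x.tape m) := by
  have walk := leadsE_spread_walk (Φ := SpreadMid x.tape m) hrun hC (x := x.tape) m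
    (fun γ hγ => spreadStage_lt (x := x.tape) hγ)
    (fun μ hμ => (x.ne_bot_iff _).2 (hμ.trans hm)) (fun s h => spreadMid_stage _ _ _ _)
  obtain ⟨a, ha⟩ : ∃ a : A, x.tape m = a := ⟨_, (WithBot.coe_unbot _ ((x.ne_bot_iff _).2 hm)).symm⟩
  have hcell : spreadStage x.tape m (2 * m) = a := by
    have := spreadStage_nat (x := x.tape) m 0
    simpa [ha] using this
  have s1 := hrun.leads_step (T := spreadStage x.tape m) (q := SpreadState.num (A := A) .even)
    (hd := 2 * m) (σ' := ⊥) (m := .right) (q' := (SpreadState.push a).num)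
    (Φ := SpreadMid x.tape m) (by rw [hcell, hC]; rfl) (spreadMid_stage _ _ _ _)
  rw [← spreadSweep_zero, move_right] at s1
  refine walk.transS (s1.transE ?_)
  -- The sweep of round `m` stays in the block of cell `2 * m`. It is infinite exactly if the word
  -- reaches the end of the corresponding block.
  by_cases hall : m + ω ≤ x.len
  · exact leadsE_spread_sweep_omega x m hrun hC ha hall
  · push Not at hall
    obtain ⟨n, hn⟩ := exists_nat_add hm.le hall
    have hn0 : n ≠ 0 := by rintro rfl; simp [hn] at hm
    obtain ⟨i, rfl⟩ := Nat.exists_eq_succ_of_ne_zero hn0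
    have e1 : ∀ k : ℕ, m + 1 + (k : Ordinal.{u}) = m + ((k + 1 : ℕ) : Ordinal.{u}) := fun k => by
      rw [add_assoc]; congr 1; norm_cast; omega
    refine leadsE_spread_sweep_end x m hm hrun hC ha i ?_ fun k hk => ?_
    · rw [x.eq_bot_iff, hn, e1]
    · rw [x.ne_bot_iff, hn, e1, add_lt_add_iff_left]
      exact_mod_cast Nat.succ_lt_succ hk

/-- The automaton spreads the word `x`. -/
theorem leadsE_spread (hrun : IsRun P c)
    (hC : ∀ (s : SpreadState A) σ, P ((s.num : Ordinal.{u}), σ) = some (s.tr one e σ)) :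
    LeadsE c ⟨x.tape, 0, 0⟩ ⟨Function.update (spread x.tape) 0 one, e, 0⟩
      (fun s => s.state ≠ 1) := by
  have loop := hrun.leadsE_loop x.len
    (fun m => ⟨spreadStage x.tape m, SpreadState.num (A := A) .even, 0⟩) (SpreadMid x.tape)
    (fun s => s.state ≠ 1) (fun m hm => leads_spread_round x m hm hrun hC) ?_ (fun m _ s hs => hs.1)
  rotate_left
  · intro l hl hl'
    -- Every cell is constant before the limit. A cell below `l` has been passed after round `η +
    -- 1`; a cell from `l` on lies beyond the blocks of all rounds before `l`.
    have hev : ∀ η, ∃ ν < l, ∀ μ, ν ≤ μ → μ < l → (η < 2 * μ ∨ 2 * μ + ω ≤ η) ∧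
        spreadStage x.tape μ η = spreadStage x.tape l η := by
      intro η
      rcases lt_or_ge η l with h | h
      · refine ⟨η + 1, hl'.add_one_lt h, fun μ h1 h2 => ?_⟩
        have h3 : η < 2 * μ := (lt_add_one η).trans_le (h1.trans (le_two_mul _))
        refine ⟨Or.inl h3, ?_⟩
        rw [spreadStage_lt h3, spreadStage_lt (by rwa [two_mul_limit hl'])]
      · refine ⟨0, hl'.bot_lt, fun μ _ h2 => ?_⟩
        have h3 : 2 * μ + ω ≤ η := by
          rw [two_mul_add_omega0]; exact (add_omega0_le hl' h2).trans h
        exact ⟨Or.inr h3, by rw [spreadStage_ge h3, spreadStage_limit _ hl' h]⟩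
    refine ⟨⟨0, hl'.bot_lt, fun μ _ _ s hs => ?_⟩, fun ν hν => ⟨ν, le_rfl, hν, rfl, le_rfl⟩,
      fun b hb => absurd hb not_lt_zero, fun η => ?_, fun η ν hν => ?_⟩
    · simp [SpreadState.num]
    · obtain ⟨ν, h1, h2⟩ := hev η
      refine ⟨ν, h1, fun μ h3 h4 s hs => ?_⟩
      rw [hs.2 η (h2 μ h3 h4).1, (h2 μ h3 h4).2]
    · obtain ⟨ν', h1, h2⟩ := hev η
      exact ⟨max ν ν', le_max_left _ _, max_lt hν h1,
        (h2 _ (le_max_right _ _) (max_lt hν h1)).2.le⟩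
  have hne := SpreadState.num_ne_one.{u} (A := A)
  have walk := leadsE_spread_walk (Φ := fun s => s.state ≠ 1) hrun hC (T := spread x.tape)
    (x := x.tape) x.len (fun γ hγ => rfl) (fun μ hμ => (x.ne_bot_iff _).2 hμ) (fun s h => hne s)
  have hb : ∀ γ, 2 * x.len ≤ γ → spread x.tape γ = ⊥ := fun γ hγ => by
    rw [spread]
    split_ifs
    · rfl
    · rw [x.eq_bot_iff]
      rwa [← mul_le_iff_le_div two_ne_zero]
  have s1 := hrun.leads_keep (T := spread x.tape) (q := SpreadState.num (A := A) .even)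
    (hd := 2 * x.len) (m := .right) (q' := SpreadState.num (A := A) .odd)
    (Φ := fun s => s.state ≠ 1) (by rw [hb _ le_rfl, hC]; rfl) (hne _)
  have s2 := hrun.leads_keep (T := spread x.tape) (q := SpreadState.num (A := A) .odd)
    (hd := 2 * x.len + 1) (m := .left) (q' := SpreadState.num (A := A) .turn)
    (Φ := fun s => s.state ≠ 1) (by rw [hb _ le_self_add, hC]; rfl) (hne _)
  have s3 := hrun.leads_keep (T := spread x.tape) (q := SpreadState.num (A := A) .turn)
    (hd := 2 * x.len) (m := .left) (q' := SpreadState.num (A := A) .home)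
    (Φ := fun s => s.state ≠ 1) (by rw [hC]; rfl) (hne _)
  have hzero : spread x.tape 0 = ⊥ := by rw [← mul_zero 2, spread_even]
  have s4 := leadsE_home hrun (g := SpreadState.num (A := A) .home)
    (g' := SpreadState.num (A := A) .home') (Φ := fun s => s.state ≠ 1) (T := spread x.tape)
    (fun a => by rw [hC]; rfl) (by rw [hC]; rfl) (fun a => by rw [hC]; rfl)
    (fun h => ⟨hne _, hne _⟩) (Motion.left.move (2 * x.len)) hzero (by
      intro γ hγ hbot
      have hγ' := hγ.trans_le (move_left_le _)
      obtain ⟨μ, rfl | rfl⟩ := even_or_odd γ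
      · rw [spread_odd, x.ne_bot_iff]
        exact (mul_lt_mul_iff_right₀ two_pos).1 hγ'
      · rw [spread_odd, x.eq_bot_iff] at hbot
        exact absurd ((mul_lt_mul_iff_right₀ two_pos).1 ((lt_add_one _).trans hγ'))
          (not_lt.2 hbot))
  have s5 := hrun.leads_step (T := spread x.tape) (q := SpreadState.num (A := A) .home') (hd := 0)
    (σ' := one) (m := .stay) (q' := e) (Φ := fun s => s.state ≠ 1)
    (by rw [hzero, hC]; rfl) (hne _)
  rw [spreadStage_len, spreadStage_zero] at loop
  rw [move_left_add_one] at s2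
  have := loop.trans (walk.trans (s1.toE.trans (s2.toE.trans (s3.toE.trans (s4.trans s5.toE)))))
  simpa [SpreadState.num] using this

end Round

end Spread

/-! ### Closing the gaps of a word in the even cells: stages and motions. -/

section Compress

variable {A : Type v} [Fintype A] [LinearOrder A]

variable (A) in
/-- The states of the automaton that compresses a word: `scan` looks for the first empty cell, `hole`,
`skip`, `take` and `put a` shift the rest of the block to the left, and `back`, `back'` return. -/
inductive CompressState
  | scan
  | hole
  | next
  | skip
  | take
  | back
  | back'
  | put (a : A)

/-- The number of a state; the loop states come first. -/
noncomputable def CompressState.num : CompressState A → ℕ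
  | scan => 8 + 3 * Fintype.card A
  | hole => 9 + 3 * Fintype.card A
  | next => 10 + 3 * Fintype.card A
  | skip => 11 + 3 * Fintype.card A
  | take => 12 + 3 * Fintype.card A
  | back => 13 + 3 * Fintype.card A
  | back' => 14 + 3 * Fintype.card A
  | put a => 15 + 3 * Fintype.card A + idx a

/-- The transitions of the automaton that compresses a word; at the end it enters state `e`. -/
noncomputable def CompressState.tr (e : Ordinal.{u}) :
    CompressState A → WithBot A → Ordinal.{u} × WithBot A × Motion
  | scan, σ => WithBot.recBotCoe (num (A := A) next, ⊥, .right) (fun a => (num (A := A) scan, a, .right)) σ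
  | next, σ => WithBot.recBotCoe (e, ⊥, .stay) (fun a => (num (put a), ⊥, .left)) σ
  | put a, _ => (num (A := A) hole, a, .right)
  | hole, σ => WithBot.recBotCoe (num (A := A) skip, ⊥, .right) (fun a => (num (A := A) scan, a, .left)) σ
  | skip, σ => (num (A := A) take, σ, .right)
  | take, σ => WithBot.recBotCoe (num (A := A) back, ⊥, .left) (fun a => (num (put a), ⊥, .left)) σ
  | back, σ => WithBot.recBotCoe (num (A := A) back, ⊥, .left) (fun a => (num (A := A) back', a, .left)) σ
  | back', σ => WithBot.recBotCoe (num (A := A) back, ⊥, .left) (fun a => (num (A := A) scan, a, .stay)) σ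

/-- The tape with the letters of `r` in the even cells. -/
noncomputable def gapped (r : Tape.{u} A) : Tape.{u} A := fun γ => if γ % 2 = 0 then r (γ / 2) else ⊥

/-- The tape after `m` rounds. -/
noncomputable def compressStage (r : Tape.{u} A) (m : Ordinal.{u}) : Tape.{u} A := fun γ =>
  if γ < m then r γ else if γ < m + ω then (if (γ - m) % 2 = 0 then r (m + (γ - m) / 2) else ⊥)
    else gapped r γ

theorem compressStage_lt {r : Tape.{u} A} {m γ : Ordinal.{u}} (h : γ < m) :
    compressStage r m γ = r γ := if_pos h

theorem compressStage_ge {r : Tape.{u} A} {m γ : Ordinal.{u}} (h : m + ω ≤ γ) :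
    compressStage r m γ = gapped r γ := by
  rw [compressStage, if_neg (not_lt.2 (le_self_add.trans h)), if_neg (not_lt.2 h)]

theorem compressStage_even (r : Tape.{u} A) (m : Ordinal.{u}) (n : ℕ) :
    compressStage r m (m + ((2 * n : ℕ) : Ordinal.{u})) = r (m + n) := by
  have e : ((2 * n : ℕ) : Ordinal.{u}) = 2 * (n : Ordinal.{u}) := by push_cast; rfl
  rw [compressStage, if_neg (not_lt.2 le_self_add), if_pos, Ordinal.add_sub_cancel, e,
    if_pos (even_mod_two _), even_div_two]
  gcongr
  exact natCast_lt_omega0 _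

theorem compressStage_odd (r : Tape.{u} A) (m : Ordinal.{u}) (n : ℕ) :
    compressStage r m (m + ((2 * n + 1 : ℕ) : Ordinal.{u})) = ⊥ := by
  have e : ((2 * n + 1 : ℕ) : Ordinal.{u}) = 2 * (n : Ordinal.{u}) + 1 := by push_cast; rfl
  rw [compressStage, if_neg (not_lt.2 le_self_add), if_pos, Ordinal.add_sub_cancel, e,
    if_neg (by rw [odd_mod_two]; exact one_ne_zero)]
  gcongr
  exact natCast_lt_omega0 _

theorem compressStage_zero (r : Tape.{u} A) : compressStage r 0 = gapped r := by
  funext γ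
  simp [compressStage, gapped]

/-- As `l = 2 * l`, the even cells from `l` on already hold the letters from `l` on, with gaps
starting afresh. So nothing special happens at a limit stage. -/
theorem compressStage_limit (r : Tape.{u} A) {l γ : Ordinal.{u}} (hl : IsSuccLimit l) (h : l ≤ γ) :
    compressStage r l γ = gapped r γ := by
  have e : γ = 2 * l + (γ - l) := by rw [two_mul_limit hl, Ordinal.add_sub_cancel_of_le h]
  have e1 : γ % 2 = (γ - l) % 2 := by conv_lhs => rw [e, mul_add_mod_self]
  have e2 : γ / 2 = l + (γ - l) / 2 := by conv_lhs => rw [e, mul_add_div _ two_ne_zero]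
  rw [compressStage, if_neg (not_lt.2 h), gapped, e1, e2]
  split_ifs <;> rfl

theorem gapped_even (r : Tape.{u} A) (μ : Ordinal.{u}) : gapped r (2 * μ) = r μ := by
  rw [gapped, even_mod_two, if_pos rfl, even_div_two]

theorem gapped_odd (r : Tape.{u} A) (μ : Ordinal.{u}) : gapped r (2 * μ + 1) = ⊥ := by
  rw [gapped, odd_mod_two, if_neg one_ne_zero]

theorem gapped_eq_bot (r : Word.{u} A) {γ : Ordinal.{u}} (h : 2 * r.len ≤ γ) :
    gapped r.tape γ = ⊥ := by
  rw [gapped]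
  split_ifs
  · rw [r.eq_bot_iff]
    rwa [← mul_le_iff_le_div two_ne_zero]
  · rfl

/-- Every natural number offset is even or odd. -/
theorem exists_nat_add_parity {a γ : Ordinal.{u}} (h1 : a ≤ γ) (h2 : γ < a + ω) :
    ∃ n : ℕ, γ = a + ((2 * n : ℕ) : Ordinal.{u}) ∨ γ = a + ((2 * n + 1 : ℕ) : Ordinal.{u}) := by
  obtain ⟨n, rfl⟩ := exists_nat_add h1 h2
  obtain ⟨k, hk | hk⟩ := Nat.even_or_odd' n
  · exact ⟨k, Or.inl (by rw [hk])⟩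
  · exact ⟨k, Or.inr (by rw [hk])⟩

/-- In stage `m` the cells up to `m` are correct, including `m` itself. So the last letter of a word
of successor length needs no round of its own, and `pred` leaves limit lengths unchanged. -/
theorem compressStage_pred_len (r : Word.{u} A) :
    compressStage r.tape (pred r.len) = r.tape := by
  funext γ
  have hle : r.len ≤ pred r.len + 1 := self_le_succ_pred _
  rcases lt_or_ge γ (pred r.len) with h | h
  · exact compressStage_lt h
  rcases lt_or_ge γ (pred r.len + ω) with h2 | h2
  · obtain ⟨n, rfl | rfl⟩ := exists_nat_add_parity h h2
    · rw [compressStage_even]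
      rcases Nat.eq_zero_or_pos n with rfl | hn
      · simp
      · have h3 : ∀ k : ℕ, 0 < k → r.tape (pred r.len + k) = ⊥ := fun k hk => by
          rw [r.eq_bot_iff]
          refine hle.trans ?_
          gcongr
          exact_mod_cast hk
        rw [h3 n hn, h3 (2 * n) (by omega)]
    · rw [compressStage_odd, eq_comm, r.eq_bot_iff]
      refine hle.trans ?_
      gcongr
      norm_cast; omega
  · have h3 : r.len < pred r.len + ω := hle.trans_lt (by gcongr; exact one_lt_omega0)
    rw [compressStage_ge h2, (r.eq_bot_iff _).2 (h3.le.trans h2), gapped_eq_bot]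
    refine le_trans ?_ h2
    calc 2 * r.len ≤ 2 * (pred r.len + 1) := by gcongr
      _ = 2 * pred r.len + 2 := by rw [mul_add_one]
      _ ≤ 2 * pred r.len + ω := by gcongr; exact (natCast_lt_omega0 2).le
      _ = _ := two_mul_add_omega0 _

/-- Two neighbouring letters can occur only to the left of cell `m + 1`. This is how the automaton
recognises, on the way back, that it has reached the finished part. -/
theorem compressStage_adjacent (r : Tape.{u} A) {m γ : Ordinal.{u}} (h : m ≤ γ)
    (h1 : compressStage r m γ ≠ ⊥) : compressStage r m (γ + 1) = ⊥ := by
  rcases lt_or_ge γ (m + ω) with h2 | h2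
  · obtain ⟨n, rfl | rfl⟩ := exists_nat_add_parity h h2
    · have := compressStage_odd r m n
      push_cast at this ⊢
      rwa [add_assoc]
    · exact absurd (compressStage_odd r m n) h1
  · rw [compressStage_ge h2] at h1
    rw [compressStage_ge (h2.trans (lt_add_one γ).le)]
    obtain ⟨μ, rfl | rfl⟩ := even_or_odd γ
    · exact gapped_odd r μ
    · exact absurd (gapped_odd r μ) h1

theorem compressStage_gap (r : Tape.{u} A) (m : Ordinal.{u}) : compressStage r m (m + 1) = ⊥ := by
  have := compressStage_odd r m 0
  simpa using this

/-- The tape when the cells below `b` have been shifted in round `m`. -/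
noncomputable def compressSweep (r : Tape.{u} A) (m b : Ordinal.{u}) : Tape.{u} A := fun γ =>
  if γ < b then compressStage r (m + 1) γ else compressStage r m γ

/-- In round `m`, cells have the old or the new content. -/
def CompressMid (r : Tape.{u} A) (m : Ordinal.{u}) (s : Snapshot.{u} A) : Prop :=
  ((8 + 3 * Fintype.card A : ℕ) : Ordinal.{u}) ≤ s.state ∧
    ∀ η, s.tape η = compressStage r m η ∨ s.tape η = compressStage r (m + 1) η

variable {P : Program.{u} A} {c : Ordinal.{u} → Snapshot.{u} A} {e : Ordinal.{u}}

theorem CompressState.le_num (s : CompressState A) :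
    ((8 + 3 * Fintype.card A : ℕ) : Ordinal.{u}) ≤ ((s.num : ℕ) : Ordinal.{u}) := by
  cases s <;> simp only [num] <;> norm_cast <;> omega

theorem compressMid_sweep (r : Tape.{u} A) (m b h : Ordinal.{u}) (s : CompressState A) :
    CompressMid r m ⟨compressSweep r m b, s.num, h⟩ := by
  refine ⟨s.le_num, fun η => ?_⟩
  simp only [compressSweep]
  split_ifs
  · exact Or.inr rfl
  · exact Or.inl rfl

theorem compressMid_stage (r : Tape.{u} A) (m h : Ordinal.{u}) (s : CompressState A) :
    CompressMid r m ⟨compressStage r m, s.num, h⟩ := ⟨s.le_num, fun _ => Or.inl rfl⟩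

theorem compressMid_stage_succ (r : Tape.{u} A) (m h : Ordinal.{u}) (s : CompressState A) :
    CompressMid r m ⟨compressStage r (m + 1), s.num, h⟩ := ⟨s.le_num, fun _ => Or.inr rfl⟩

/-- A state that moves right over letters walks over all letters. -/
theorem leadsE_walk (hrun : IsRun P c) {Φ : Snapshot.{u} A → Prop} {T : Tape.{u} A}
    {q : Ordinal.{u}} (hq : ∀ a : A, P (q, (a : WithBot A)) = some (q, (a : WithBot A), Motion.right))
    (h k : Ordinal.{u}) (hT : ∀ γ, h ≤ γ → γ < h + k → T γ ≠ ⊥) (hΦ : ∀ h, Φ ⟨T, q, h⟩) :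
    LeadsE c ⟨T, q, h⟩ ⟨T, q, h + k⟩ Φ := by
  have key := hrun.leadsE_loop k (fun μ => ⟨T, q, h + μ⟩) (fun μ s => s = ⟨T, q, h + μ⟩) Φ
    ?_ ?_ (fun μ _ m hm => hm ▸ hΦ _)
  · simpa using key
  · intro μ hμ
    have h1 : T (h + μ) ≠ ⊥ := hT _ le_self_add (by gcongr)
    have s1 := hrun.leads_keep (q := q) (T := T) (hd := h + μ) (q' := q) (m := .right)
      (Φ := fun s => s = ⟨T, q, h + μ⟩)
      (by rw [← WithBot.coe_unbot _ h1, hq]) rfl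
    rwa [move_right, add_assoc] at s1
  · intro l _ hl
    refine ⟨⟨0, hl.bot_lt, fun μ _ _ m hm => hm ▸ le_rfl⟩, fun ν hν => ⟨ν, le_rfl, hν, rfl, ?_⟩,
      ?_, ?_, ?_⟩
    · dsimp only; gcongr
    · intro b hb
      obtain ⟨ν, h1, h2⟩ := ((add_isNormal h).lt_iff_exists_lt hl).1 hb
      refine ⟨ν, h1, fun μ h3 _ s hs hst => ?_⟩
      rw [hs]
      exact h2.trans_le (by dsimp only; gcongr)
    · exact fun η => ⟨0, hl.bot_lt, fun μ _ _ s hs => by rw [hs]⟩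
    · exact fun η ν hν => ⟨ν, le_rfl, hν, le_rfl⟩

theorem exists_coe_of_ne_bot {σ : WithBot A} (h : σ ≠ ⊥) : ∃ a : A, σ = a :=
  ⟨_, (WithBot.coe_unbot _ h).symm⟩

/-- Going left until two letters are read in succession ends at or before cell `m`. -/
theorem leadsE_compress_back (hrun : IsRun P c)
    (hD : ∀ (s : CompressState A) σ, P ((s.num : Ordinal.{u}), σ) = some (s.tr e σ))
    {Φ : Snapshot.{u} A → Prop} (r : Word.{u} A) (m : Ordinal.{u}) (hm : m < r.len)
    (hΦ : ∀ (s : CompressState A) h, Φ ⟨compressStage r.tape m, s.num, h⟩) (h : Ordinal.{u}) :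
    ∃ h' ≤ m, LeadsE c ⟨compressStage r.tape m, CompressState.num (A := A) .back, h⟩
      ⟨compressStage r.tape m, CompressState.num (A := A) .scan, h'⟩ Φ := by
  set T := compressStage r.tape m with hTdef
  have hT0 : T 0 ≠ ⊥ := by
    rcases eq_or_ne m 0 with rfl | h0
    · rw [hTdef, compressStage_zero, ← mul_zero 2, gapped_even, r.ne_bot_iff]; exact hm
    · have : 0 < m := Order.one_le_iff_pos.1 (Order.one_le_iff_ne_zero.2 h0)
      rw [hTdef, compressStage_lt this, r.ne_bot_iff]
      exact this.trans hm
  induction h using WellFoundedLT.induction with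
  | ind h ih =>
  by_cases hb : T h = ⊥
  · have hne : h ≠ 0 := fun hc => hT0 (hc ▸ hb)
    obtain ⟨h', h1, h2⟩ := ih _ (move_left_lt hne)
    exact ⟨h', h1, (hrun.leads_keep (by rw [hb, hD]; rfl) (hΦ _ _)).toE.trans h2⟩
  · obtain ⟨a, ha⟩ := exists_coe_of_ne_bot hb
    have s1 := hrun.leads_keep (T := T) (q := CompressState.num (A := A) .back) (hd := h) (m := .left)
      (q' := CompressState.num (A := A) .back') (Φ := Φ) (by rw [ha, hD]; rfl) (hΦ _ _)
    by_cases hb2 : T (Motion.left.move h) = ⊥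
    · have hne : h ≠ 0 := by rintro rfl; rw [move_left_zero] at hb2; exact hT0 hb2
      have hlt : Motion.left.move (Motion.left.move h) < h :=
        (move_left_le _).trans_lt (move_left_lt hne)
      obtain ⟨h', h1, h2⟩ := ih _ hlt
      exact ⟨h', h1, s1.toE.trans
        ((hrun.leads_keep (by rw [hb2, hD]; rfl) (hΦ _ _)).toE.trans h2)⟩
    · obtain ⟨b, hb3⟩ := exists_coe_of_ne_bot hb2
      have s2 := hrun.leads_keep (T := T) (q := CompressState.num (A := A) .back')
        (hd := Motion.left.move h) (m := .stay) (q' := CompressState.num (A := A) .scan) (Φ := Φ)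
        (by rw [hb3, hD]; rfl) (hΦ _ _)
      refine ⟨Motion.left.move h, ?_, s1.toE.trans s2.toE⟩
      rcases zero_or_succ_or_limit h with rfl | ⟨h', rfl⟩ | hl
      · simp
      · rw [move_left_add_one] at hb2 ⊢
        by_contra! hc
        exact hb (compressStage_adjacent r.tape hc.le hb2)
      · rw [move_left_limit hl]; exact zero_le

end Compress

/-! ### Closing the gaps: sweeps, rounds and correctness. -/

section Compress

variable {A : Type v} [Fintype A] [LinearOrder A]
variable {P : Program.{u} A} {c : Ordinal.{u} → Snapshot.{u} A} {e : Ordinal.{u}}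

theorem compressStage_succ_even (r : Tape.{u} A) (m : Ordinal.{u}) (i : ℕ) :
    compressStage r (m + 1) (m + ((1 + 2 * i : ℕ) : Ordinal.{u}))
      = r (m + ((1 + i : ℕ) : Ordinal.{u})) := by
  have := compressStage_even r (m + 1) i
  rw [add_assoc, add_assoc] at this
  push_cast at this ⊢
  exact this

theorem compressStage_succ_odd (r : Tape.{u} A) (m : Ordinal.{u}) (i : ℕ) :
    compressStage r (m + 1) (m + ((2 + 2 * i : ℕ) : Ordinal.{u})) = ⊥ := by
  have := compressStage_odd r (m + 1) i
  rw [add_assoc] at this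
  convert this using 2
  rw [← Nat.cast_one, ← Nat.cast_add]
  congr 2
  ring

theorem compressStage_even' (r : Tape.{u} A) (m : Ordinal.{u}) (i : ℕ) :
    compressStage r m (m + ((2 + 2 * i : ℕ) : Ordinal.{u}))
      = r (m + ((1 + i : ℕ) : Ordinal.{u})) := by
  have := compressStage_even r m (1 + i)
  rwa [mul_add, mul_one] at this

theorem compressSweep_start (r : Tape.{u} A) (m : Ordinal.{u}) :
    compressSweep r m (m + ((1 : ℕ) : Ordinal.{u})) = compressStage r m := by
  funext γ
  rw [compressSweep]
  split_ifs with h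
  · rw [Nat.cast_one] at h
    rw [compressStage_lt h]
    rcases (lt_add_one_iff.1 h).lt_or_eq with h1 | rfl
    · rw [compressStage_lt h1]
    · have := compressStage_even r γ 0
      simpa using this.symm
  · rfl

theorem compressSweep_update (r : Tape.{u} A) (m : Ordinal.{u}) (i : ℕ) :
    Function.update (Function.update (compressSweep r m (m + ((1 + 2 * i : ℕ) : Ordinal.{u})))
        (m + ((2 + 2 * i : ℕ) : Ordinal.{u})) ⊥) (m + ((1 + 2 * i : ℕ) : Ordinal.{u}))
        (r (m + ((1 + i : ℕ) : Ordinal.{u})))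
      = compressSweep r m (m + ((3 + 2 * i : ℕ) : Ordinal.{u})) := by
  funext γ
  have e2 : m + ((2 + 2 * i : ℕ) : Ordinal.{u}) = m + ((1 + 2 * i : ℕ) : Ordinal.{u}) + 1 := by
    rw [add_assoc, ← Nat.cast_succ]; congr 2; omega
  have e3 : m + ((3 + 2 * i : ℕ) : Ordinal.{u}) = m + ((2 + 2 * i : ℕ) : Ordinal.{u}) + 1 := by
    rw [add_assoc, ← Nat.cast_succ]; congr 2; omega
  have l2 : m + ((1 + 2 * i : ℕ) : Ordinal.{u}) < m + ((2 + 2 * i : ℕ) : Ordinal.{u}) := by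
    rw [e2]; exact lt_add_one _
  have l3 : m + ((2 + 2 * i : ℕ) : Ordinal.{u}) < m + ((3 + 2 * i : ℕ) : Ordinal.{u}) := by
    rw [e3]; exact lt_add_one _
  by_cases h1 : γ = m + ((1 + 2 * i : ℕ) : Ordinal.{u})
  · rw [h1, Function.update_self, compressSweep, if_pos (l2.trans l3), compressStage_succ_even]
  rw [Function.update_of_ne h1]
  by_cases h2 : γ = m + ((2 + 2 * i : ℕ) : Ordinal.{u})
  · rw [h2, Function.update_self, compressSweep, if_pos l3, compressStage_succ_odd]
  rw [Function.update_of_ne h2, compressSweep, compressSweep]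
  have : γ < m + ((1 + 2 * i : ℕ) : Ordinal.{u}) ↔ γ < m + ((3 + 2 * i : ℕ) : Ordinal.{u}) := by
    rw [e3, lt_add_one_iff, le_iff_lt_or_eq, or_iff_left h2, e2, lt_add_one_iff, le_iff_lt_or_eq,
      or_iff_left h1]
  simp only [this]

/-- The mids of a swap. -/
def SwapMid (r : Tape.{u} A) (m : Ordinal.{u}) (i : ℕ) (s : Snapshot.{u} A) : Prop :=
  CompressMid r m s ∧
    (∀ η < m + ((1 + 2 * i : ℕ) : Ordinal.{u}), s.tape η = compressStage r (m + 1) η)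

theorem swapMid_sweep (r : Tape.{u} A) (m h : Ordinal.{u}) (i : ℕ) (s : CompressState A) :
    SwapMid r m i ⟨compressSweep r m (m + ((1 + 2 * i : ℕ) : Ordinal.{u})), s.num, h⟩ :=
  ⟨compressMid_sweep .., fun _ hη => if_pos hη⟩

/-- Moving a letter one cell to the left. -/
theorem leads_compress_put (hrun : IsRun P c)
    (hD : ∀ (s : CompressState A) σ, P ((s.num : Ordinal.{u}), σ) = some (s.tr e σ))
    (r : Word.{u} A) (m : Ordinal.{u}) (i : ℕ) (q : CompressState A)
    (hq : ∀ d : A, q.tr e d = (((CompressState.num (.put d) : ℕ) : Ordinal.{u}), ⊥, Motion.left))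
    (hqn : 10 + 3 * Fintype.card A ≤ q.num) (hm : m + ((1 + i : ℕ) : Ordinal.{u}) < r.len) :
    Leads c
      ⟨compressSweep r.tape m (m + ((1 + 2 * i : ℕ) : Ordinal.{u})), q.num,
        m + ((2 + 2 * i : ℕ) : Ordinal.{u})⟩
      ⟨compressSweep r.tape m (m + ((3 + 2 * i : ℕ) : Ordinal.{u})), CompressState.num (A := A) .hole,
        m + ((2 + 2 * i : ℕ) : Ordinal.{u})⟩
      (fun s => SwapMid r.tape m i s ∧ ((10 + 3 * Fintype.card A : ℕ) : Ordinal.{u}) ≤ s.state) := by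
  obtain ⟨d, hd⟩ := exists_coe_of_ne_bot ((r.ne_bot_iff _).2 hm)
  have e2 : m + ((2 + 2 * i : ℕ) : Ordinal.{u}) = m + ((1 + 2 * i : ℕ) : Ordinal.{u}) + 1 := by
    rw [add_assoc, ← Nat.cast_succ]; congr 2; omega
  have l2 : m + ((1 + 2 * i : ℕ) : Ordinal.{u}) < m + ((2 + 2 * i : ℕ) : Ordinal.{u}) := by
    rw [e2]; exact lt_add_one _
  have s1 := hrun.leads_step
    (T := compressSweep r.tape m (m + ((1 + 2 * i : ℕ) : Ordinal.{u}))) (q := q.num)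
    (hd := m + ((2 + 2 * i : ℕ) : Ordinal.{u})) (q' := CompressState.num (.put d)) (σ' := ⊥)
    (m := .left)
    (Φ := fun s => SwapMid r.tape m i s ∧ ((10 + 3 * Fintype.card A : ℕ) : Ordinal.{u}) ≤ s.state)
    (by rw [compressSweep, if_neg (not_lt.2 l2.le), compressStage_even', hd, hD, hq])
    ⟨swapMid_sweep .., Nat.cast_le.2 hqn⟩
  have s2 := hrun.leads_step
    (T := Function.update (compressSweep r.tape m (m + ((1 + 2 * i : ℕ) : Ordinal.{u})))
      (m + ((2 + 2 * i : ℕ) : Ordinal.{u})) ⊥) (q := CompressState.num (.put d))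
    (hd := m + ((1 + 2 * i : ℕ) : Ordinal.{u})) (q' := CompressState.num (A := A) .hole) (σ' := d)
    (m := .right)
    (Φ := fun s => SwapMid r.tape m i s ∧ ((10 + 3 * Fintype.card A : ℕ) : Ordinal.{u}) ≤ s.state)
    (by rw [hD]; rfl)
    ⟨⟨⟨CompressState.le_num _, fun η => ?_⟩, fun η hη => ?_⟩, ?_⟩
  · rw [move_right, ← e2, ← hd, compressSweep_update] at s2
    have e4 : Motion.left.move (m + ((2 + 2 * i : ℕ) : Ordinal.{u}))
      = m + ((1 + 2 * i : ℕ) : Ordinal.{u}) := by rw [e2, move_left_add_one]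
    rw [e4] at s1
    exact s1.trans s2
  · by_cases h2 : η = m + ((2 + 2 * i : ℕ) : Ordinal.{u})
    · right; dsimp only; rw [h2, Function.update_self, compressStage_succ_odd]
    · dsimp only; rw [Function.update_of_ne h2, compressSweep]
      split_ifs
      · exact Or.inr rfl
      · exact Or.inl rfl
  · dsimp only
    rw [Function.update_of_ne (hη.trans l2).ne, compressSweep, if_pos hη]
  · simp only [CompressState.num]; norm_cast; omega

/-- The first swap of a round. -/
theorem leads_compress_first (hrun : IsRun P c)
    (hD : ∀ (s : CompressState A) σ, P ((s.num : Ordinal.{u}), σ) = some (s.tr e σ))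
    (r : Word.{u} A) (m : Ordinal.{u}) (hm : m + 1 < r.len) :
    Leads c ⟨compressStage r.tape m, CompressState.num (A := A) .scan, m + 1⟩
      ⟨compressSweep r.tape m (m + ((3 : ℕ) : Ordinal.{u})), CompressState.num (A := A) .hole,
        m + ((2 : ℕ) : Ordinal.{u})⟩ (CompressMid r.tape m) := by
  have s1 := hrun.leads_keep (T := compressStage r.tape m) (hd := m + 1) (m := .right)
    (q := CompressState.num (A := A) .scan) (q' := CompressState.num (A := A) .next)
    (Φ := CompressMid r.tape m) (by rw [compressStage_gap, hD]; rfl) (compressMid_stage ..)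
  have s2 := leads_compress_put hrun hD r m 0 .next (fun d => rfl) le_rfl (by simpa using hm)
  simp only [mul_zero, add_zero, compressSweep_start] at s2
  rw [move_right, add_assoc, one_add_one_eq_two] at s1
  exact s1.trans (s2.mono fun s hs => hs.1.1)

theorem compressSweep_take (r : Tape.{u} A) (m : Ordinal.{u}) (i : ℕ) :
    compressSweep r m (m + ((3 + 2 * i : ℕ) : Ordinal.{u})) (m + ((2 + 2 * i : ℕ) : Ordinal.{u})) = ⊥ := by
  rw [compressSweep, if_pos, compressStage_succ_odd]
  gcongr; omega

/-- The mids of a swap in the sweep loop. -/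
def SweepMid (r : Tape.{u} A) (m : Ordinal.{u}) (i : ℕ) (s : Snapshot.{u} A) : Prop :=
  SwapMid r m i s ∧
    ((s.state = CompressState.num (A := A) .hole ∧ s.head = m + ((2 * i : ℕ) : Ordinal.{u}))
      ∨ ((10 + 3 * Fintype.card A : ℕ) : Ordinal.{u}) ≤ s.state)

/-- From the hole to the next letter. -/
theorem leads_compress_skip (hrun : IsRun P c)
    (hD : ∀ (s : CompressState A) σ, P ((s.num : Ordinal.{u}), σ) = some (s.tr e σ))
    (r : Word.{u} A) (m : Ordinal.{u}) (i : ℕ) :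
    Leads c
      ⟨compressSweep r.tape m (m + ((1 + 2 * (i + 1) : ℕ) : Ordinal.{u})),
        CompressState.num (A := A) .hole, m + ((2 * (i + 1) : ℕ) : Ordinal.{u})⟩
      ⟨compressSweep r.tape m (m + ((1 + 2 * (i + 1) : ℕ) : Ordinal.{u})),
        CompressState.num (A := A) .take, m + ((2 + 2 * (i + 1) : ℕ) : Ordinal.{u})⟩
      (SweepMid r.tape m (i + 1)) := by
  have s1 := hrun.leads_keep
    (T := compressSweep r.tape m (m + ((1 + 2 * (i + 1) : ℕ) : Ordinal.{u})))
    (hd := m + ((2 * (i + 1) : ℕ) : Ordinal.{u})) (m := .right)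
    (q := CompressState.num (A := A) .hole) (q' := CompressState.num (A := A) .skip)
    (Φ := SweepMid r.tape m (i + 1)) (by
      have := compressSweep_take r.tape m i
      rw [show 1 + 2 * (i + 1) = 3 + 2 * i by ring, show 2 * (i + 1) = 2 + 2 * i by ring]
      rw [this, hD]; rfl)
    ⟨swapMid_sweep .., Or.inl ⟨rfl, rfl⟩⟩
  have s2 := hrun.leads_keep
    (T := compressSweep r.tape m (m + ((1 + 2 * (i + 1) : ℕ) : Ordinal.{u})))
    (hd := m + ((2 * (i + 1) : ℕ) : Ordinal.{u}) + 1) (m := .right)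
    (q := CompressState.num (A := A) .skip) (q' := CompressState.num (A := A) .take)
    (Φ := SweepMid r.tape m (i + 1)) (by rw [hD]; rfl)
    ⟨swapMid_sweep .., Or.inr (by simp only [CompressState.num]; norm_cast; omega)⟩
  have := s1.trans s2
  rw [move_right, add_assoc, add_assoc, one_add_one_eq_two] at this
  rw [add_comm 2 (2 * (i + 1))]
  exact_mod_cast this

/-- One swap of a sweep. -/
theorem leads_compress_swap (hrun : IsRun P c)
    (hD : ∀ (s : CompressState A) σ, P ((s.num : Ordinal.{u}), σ) = some (s.tr e σ))
    (r : Word.{u} A) (m : Ordinal.{u}) (i : ℕ) (hm : m + ((2 + i : ℕ) : Ordinal.{u}) < r.len) :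
    Leads c
      ⟨compressSweep r.tape m (m + ((1 + 2 * (i + 1) : ℕ) : Ordinal.{u})),
        CompressState.num (A := A) .hole, m + ((2 * (i + 1) : ℕ) : Ordinal.{u})⟩
      ⟨compressSweep r.tape m (m + ((1 + 2 * (i + 1 + 1) : ℕ) : Ordinal.{u})),
        CompressState.num (A := A) .hole, m + ((2 * (i + 1 + 1) : ℕ) : Ordinal.{u})⟩
      (SweepMid r.tape m (i + 1)) := by
  have s2 := leads_compress_put hrun hD r m (i + 1) .take (fun d => rfl)
    (by simp only [CompressState.num]; omega)
    (by convert hm using 3; omega)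
  have := (leads_compress_skip hrun hD r m i).trans (s2.mono fun s hs => ⟨hs.1, Or.inr hs.2⟩)
  rw [show 1 + 2 * (i + 1 + 1) = 3 + 2 * (i + 1) by ring,
    show 2 * (i + 1 + 1) = 2 + 2 * (i + 1) by ring]
  exact this

/-- Several swaps of a sweep. -/
theorem leadsE_compress_swaps (hrun : IsRun P c)
    (hD : ∀ (s : CompressState A) σ, P ((s.num : Ordinal.{u}), σ) = some (s.tr e σ))
    (r : Word.{u} A) (m : Ordinal.{u}) (n : ℕ)
    (hm : ∀ i < n, m + ((2 + i : ℕ) : Ordinal.{u}) < r.len) :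
    LeadsE c
      ⟨compressSweep r.tape m (m + ((3 : ℕ) : Ordinal.{u})), CompressState.num (A := A) .hole,
        m + ((2 : ℕ) : Ordinal.{u})⟩
      ⟨compressSweep r.tape m (m + ((1 + 2 * (n + 1) : ℕ) : Ordinal.{u})),
        CompressState.num (A := A) .hole, m + ((2 * (n + 1) : ℕ) : Ordinal.{u})⟩
      (CompressMid r.tape m) := by
  induction n with
  | zero => exact LeadsE.refl
  | succ n ih =>
    exact (ih fun i hi => hm i (by omega)).trans
      ((leads_compress_swap hrun hD r m n (hm n (by omega))).mono fun s hs => hs.1.1).toE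

theorem compressSweep_omega0 (r : Tape.{u} A) (m : Ordinal.{u}) :
    compressSweep r m (m + ω) = compressStage r (m + 1) := by
  funext γ
  rw [compressSweep]
  split_ifs with h
  · rfl
  · rw [compressStage_ge (not_lt.1 h), compressStage_ge]
    have := add_nat_add_omega0 m 1
    rw [Nat.cast_one] at this
    rw [this]
    exact not_lt.1 h

/-- Behind the last letter the stages `m` and `m + 1` are both empty, so the finite sweep agrees
with the infinite one. -/
theorem compressSweep_finite (r : Word.{u} A) (m : Ordinal.{u}) (n : ℕ)
    (hn : r.len ≤ m + ((n + 2 : ℕ) : Ordinal.{u})) :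
    compressSweep r.tape m (m + ((1 + 2 * (n + 1) : ℕ) : Ordinal.{u}))
      = compressStage r.tape (m + 1) := by
  rw [← compressSweep_omega0]
  have hle : ∀ k : ℕ, n + 2 ≤ k → r.tape (m + k) = ⊥ := fun k hk => by
    rw [r.eq_bot_iff]
    exact hn.trans (by gcongr)
  have hω : ∀ k : ℕ, m + (k : Ordinal.{u}) < m + ω := fun k => by gcongr; exact natCast_lt_omega0 _
  funext γ
  rw [compressSweep, compressSweep]
  split_ifs with h1 h2 h2
  · rfl
  · exact absurd (h1.trans (hω _)) h2
  · obtain ⟨k, rfl⟩ := exists_nat_add ((le_self_add).trans (not_lt.1 h1)) h2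
    have hk : 1 + 2 * (n + 1) ≤ k := by
      by_contra! hc
      exact h1 (by gcongr)
    obtain ⟨j, hj | hj⟩ := Nat.even_or_odd' k
    · rw [hj, compressStage_even, hle j (by omega)]
      obtain ⟨j, rfl⟩ : ∃ i, j = i + 1 := ⟨j - 1, by omega⟩
      have := compressStage_succ_odd r.tape m j
      rw [show 2 * (j + 1) = 2 + 2 * j by ring, this]
    · rw [hj, compressStage_odd, add_comm (2 * j) 1, compressStage_succ_even, hle _ (by omega)]
  · rfl

/-- A sweep over infinitely many letters. -/
theorem leadsE_compress_omega (hrun : IsRun P c)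
    (hD : ∀ (s : CompressState A) σ, P ((s.num : Ordinal.{u}), σ) = some (s.tr e σ))
    (r : Word.{u} A) (m : Ordinal.{u}) (hm : m + ω ≤ r.len) :
    LeadsE c
      ⟨compressSweep r.tape m (m + ((3 : ℕ) : Ordinal.{u})), CompressState.num (A := A) .hole,
        m + ((2 : ℕ) : Ordinal.{u})⟩
      ⟨compressStage r.tape (m + 1), CompressState.num (A := A) .hole, m + ω⟩
      (CompressMid r.tape m) := by
  have hω : ∀ k : ℕ, m + (k : Ordinal.{u}) < m + ω := fun k => by gcongr; exact natCast_lt_omega0 _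
  have c1 : ∀ i : ℕ, (2 : Ordinal.{u}) + 2 * (i : Ordinal.{u}) = ((2 * (i + 1) : ℕ) : Ordinal.{u}) := by
    intro i
    rw [show 2 * (i + 1) = 2 + 2 * i by ring]; push_cast; rfl
  have c2 : ∀ i : ℕ, (3 : Ordinal.{u}) + 2 * (i : Ordinal.{u})
      = ((1 + 2 * (i + 1) : ℕ) : Ordinal.{u}) := by
    intro i
    rw [show 1 + 2 * (i + 1) = 3 + 2 * i by ring]; push_cast; rfl
  have c3 : (2 : Ordinal.{u}) + 2 * ω = ω := by
    rw [two_mul_limit isSuccLimit_omega0]; exact nat_add_omega0 2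
  have c4 : (3 : Ordinal.{u}) + 2 * ω = ω := by
    rw [two_mul_limit isSuccLimit_omega0]; exact nat_add_omega0 3
  have key := hrun.leadsE_loop ω
    (fun μ => ⟨compressSweep r.tape m (m + (3 + 2 * μ)), CompressState.num (A := A) .hole,
      m + (2 + 2 * μ)⟩) (fun μ s => ∃ i : ℕ, μ = i ∧ SweepMid r.tape m (i + 1) s)
    (CompressMid r.tape m) ?_ ?_ (fun μ hμ s hs => by
      obtain ⟨i, -, h2⟩ := hs
      exact h2.1.1)
  · rw [mul_zero, add_zero, add_zero, c3, c4, compressSweep_omega0] at key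
    exact key
  · intro μ hμ
    obtain ⟨i, rfl⟩ := lt_omega0.1 hμ
    have := leads_compress_swap hrun hD r m i ((hω _).trans_le hm)
    rw [← Nat.cast_succ, c1, c1, c2, c2]
    exact this.mono fun s hs => ⟨i, rfl, hs⟩
  · intro l hl1 hl
    obtain rfl : l = ω := le_antisymm hl1 (omega0_le_of_isSuccLimit hl)
    rw [c3, c4]
    have hev : ∀ η, ∃ ν < ω, ∀ i : ℕ, ν ≤ (i : Ordinal.{u}) → ∀ s, SweepMid r.tape m (i + 1) s →
        s.tape η = compressSweep r.tape m (m + ω) η := by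
      intro η
      rw [compressSweep_omega0]
      rcases lt_or_ge η (m + ω) with h | h
      · rcases lt_or_ge η m with h2 | h2
        · exact ⟨0, omega0_pos, fun i _ s hs => hs.1.2 η (h2.trans_le le_self_add)⟩
        · obtain ⟨n, rfl⟩ := exists_nat_add h2 h
          refine ⟨n, natCast_lt_omega0 n, fun i hi s hs => hs.1.2 _ ?_⟩
          have : n ≤ i := by exact_mod_cast hi
          gcongr; omega
      · refine ⟨0, omega0_pos, fun i _ s hs => ?_⟩
        rcases hs.1.1.2 η with h1 | h1
        · rw [h1, compressStage_ge h, compressStage_ge]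
          have := add_nat_add_omega0 m 1
          rw [Nat.cast_one] at this
          rwa [this]
        · exact h1
    refine ⟨⟨0, omega0_pos, ?_⟩, ?_, ?_, ?_, ?_⟩
    -- Among the states used in the sweep `hole` has the least number, so it is the limit state;
    -- `scan` is smaller but does not occur.
    · rintro μ - - s ⟨i, -, hs⟩
      rcases hs.2 with h1 | h1
      · exact h1.1.ge
      · refine le_trans ?_ h1
        simp only [CompressState.num]
        norm_cast; omega
    · intro ν hν
      obtain ⟨i, rfl⟩ := lt_omega0.1 hν
      refine ⟨i, le_rfl, hν, rfl, ?_⟩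
      dsimp only
      rw [c1]
      exact (hω _).le
    · intro b hb
      obtain ⟨n, hn⟩ : ∃ n : ℕ, b < m + n := by
        rcases lt_or_ge b m with h2 | h2
        · exact ⟨0, by simpa using h2⟩
        · obtain ⟨n, rfl⟩ := exists_nat_add h2 hb
          exact ⟨n + 1, by gcongr; omega⟩
      refine ⟨n, natCast_lt_omega0 n, ?_⟩
      rintro μ hμ - s ⟨i, rfl, hs⟩ hst
      have : n ≤ i := by exact_mod_cast hμ
      rcases hs.2 with h1 | h1
      · rw [h1.2]
        exact hn.trans_le (by gcongr; omega)
      · rw [hst] at h1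
        simp only [CompressState.num] at h1
        norm_cast at h1
        omega
    · intro η
      obtain ⟨ν, h1, h2⟩ := hev η
      refine ⟨ν, h1, ?_⟩
      rintro μ hμ - s ⟨i, rfl, hs⟩
      exact (h2 i hμ s hs).ge
    · intro η ν hν
      obtain ⟨ν', h1, h2⟩ := hev η
      obtain ⟨i, hi⟩ := lt_omega0.1 (max_lt hν h1)
      refine ⟨i, hi ▸ le_max_left _ _, natCast_lt_omega0 i, ?_⟩
      rw [c2]
      exact (h2 i (hi ▸ le_max_right _ _) _ ⟨swapMid_sweep r.tape m _ (i + 1) .hole,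
        Or.inl ⟨rfl, rfl⟩⟩).le

/-- The snapshots between two rounds. -/
def CompressHead (r : Word.{u} A) (m : Ordinal.{u}) (s : Snapshot.{u} A) : Prop :=
  ∃ h ≤ m, s = ⟨compressStage r.tape m, CompressState.num (A := A) .scan, h⟩ ∧
    (h = 0 ∨ r.len < m + ω)

theorem compressStage_walk (r : Word.{u} A) {m γ : Ordinal.{u}} (hm : m < r.len) (h : γ < m + 1) :
    compressStage r.tape m γ ≠ ⊥ := by
  rw [← compressSweep_start, compressSweep, if_pos (by simpa using h), compressStage_lt h,
    r.ne_bot_iff]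
  exact (lt_add_one_iff.1 h).trans_lt hm

/-- The first gap is at cell `m + 1`, and all later letters of the block are moved one cell to the
left. Three cases arise for the return: the word ends inside the block, goes on behind it, or ends
exactly with it. -/
theorem leads_compress_round (hrun : IsRun P c)
    (hD : ∀ (s : CompressState A) σ, P ((s.num : Ordinal.{u}), σ) = some (s.tr e σ))
    (r : Word.{u} A) (m : Ordinal.{u}) (hm : m + 1 < r.len) (s : Snapshot.{u} A)
    (hs : CompressHead r m s) :
    ∃ s', CompressHead r (m + 1) s' ∧ Leads c s s' (CompressMid r.tape m) := by
  obtain ⟨h, hh, rfl, -⟩ := hs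
  have hm1 : m + 1 + ω = m + ω := by simpa using add_nat_add_omega0 m 1
  have w1 := leadsE_walk hrun (Φ := CompressMid r.tape m) (T := compressStage r.tape m)
    (q := CompressState.num (A := A) .scan) (fun a => by rw [hD]; rfl) h (m + 1 - h)
    (fun γ _ h2 => compressStage_walk r ((lt_add_one m).trans hm) (by
      rwa [Ordinal.add_sub_cancel_of_le (hh.trans (lt_add_one m).le)] at h2))
    (fun _ => compressMid_stage ..)
  rw [Ordinal.add_sub_cancel_of_le (hh.trans (lt_add_one m).le)] at w1
  have w2 := w1.transS (leads_compress_first hrun hD r m hm)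
  rcases lt_or_ge r.len (m + ω) with hlen | hlen
  · obtain ⟨k, hk⟩ := exists_nat_add (((lt_add_one m).trans hm).le) hlen
    -- Of the letters from `m` on, the first one stays, the second is moved by the first swap, and
    -- `n` remain.
    obtain ⟨n, rfl⟩ : ∃ n, k = n + 2 := ⟨k - 2, by
      rw [hk] at hm
      have : (1 : Ordinal.{u}) < k := by simpa using hm
      have : 1 < k := by exact_mod_cast this
      omega⟩
    have w3 := w2.transE (leadsE_compress_swaps hrun hD r m n (fun i hi => by
      rw [hk]; exact add_lt_add_right (Nat.cast_lt.2 (by omega)) m))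
    have w4 := w3.trans ((leads_compress_skip hrun hD r m n).mono fun s hs => hs.1.1)
    have w5 := hrun.leads_keep
      (T := compressSweep r.tape m (m + ((1 + 2 * (n + 1) : ℕ) : Ordinal.{u})))
      (hd := m + ((2 + 2 * (n + 1) : ℕ) : Ordinal.{u})) (m := .left)
      (q := CompressState.num (A := A) .take) (q' := CompressState.num (A := A) .back)
      (Φ := CompressMid r.tape m) (by
        rw [compressSweep, if_neg (not_lt.2 (add_le_add_right (Nat.cast_le.2 (by omega)) m)), compressStage_even', (r.eq_bot_iff _).2, hD]
        · rfl
        · rw [hk]; exact add_le_add_right (Nat.cast_le.2 (by omega)) m) (compressMid_sweep ..)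
    have w6 := w4.trans w5
    rw [compressSweep_finite r m n hk.le] at w6
    obtain ⟨h', h1, h2⟩ := leadsE_compress_back hrun hD (Φ := CompressMid r.tape m) r (m + 1) hm
      (fun s h => compressMid_stage_succ ..) (Motion.left.move (m + ((2 + 2 * (n + 1) : ℕ) : Ordinal.{u})))
    exact ⟨_, ⟨h', h1, rfl, Or.inr (hm1.symm ▸ hlen)⟩, w6.transE h2⟩
  · have hl : IsSuccLimit (m + ω) := isSuccLimit_add _ isSuccLimit_omega0
    have hg : ∀ γ, m + ω ≤ γ → compressStage r.tape (m + 1) γ = gapped r.tape γ := fun γ h =>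
      compressStage_ge (by rwa [hm1])
    have w3 := w2.transE (leadsE_compress_omega hrun hD r m hlen)
    refine ⟨⟨compressStage r.tape (m + 1), CompressState.num (A := A) .scan, 0⟩,
      ⟨0, zero_le, rfl, Or.inl rfl⟩, w3.trans ?_⟩
    rcases hlen.lt_or_eq with hlt | heq
    -- The word goes on. Cell `m + ω` is a limit, hence even, and holds a letter; on a letter `hole`
    -- moves left and lands in cell `0`.
    · have hv : compressStage r.tape (m + 1) (m + ω) ≠ ⊥ := by
        rw [hg _ le_rfl, ← two_mul_limit hl, gapped_even, r.ne_bot_iff]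
        exact hlt
      obtain ⟨a, ha⟩ := exists_coe_of_ne_bot hv
      have := hrun.leads_keep (T := compressStage r.tape (m + 1)) (hd := m + ω) (m := .left)
        (q := CompressState.num (A := A) .hole) (q' := CompressState.num (A := A) .scan)
        (Φ := CompressMid r.tape m) (by rw [ha, hD]; rfl) (compressMid_stage_succ ..)
      rwa [move_left_limit hl] at this
    -- The word ends at `m + ω`. The automaton finds empty cells, turns back, drops from the limit
    -- cell to cell `0`, and since a left move keeps it there it reads the letter of cell `0` twice.
    · have hb : ∀ γ, m + ω ≤ γ → compressStage r.tape (m + 1) γ = ⊥ := fun γ h => by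
        rw [hg γ h, gapped_eq_bot]
        rwa [← heq, two_mul_limit hl]
      obtain ⟨a, ha⟩ := exists_coe_of_ne_bot (compressStage_walk r hm
        (γ := 0) (by simp))
      have s1 := hrun.leads_keep (T := compressStage r.tape (m + 1)) (hd := m + ω) (m := .right)
        (q := CompressState.num (A := A) .hole) (q' := CompressState.num (A := A) .skip)
        (Φ := CompressMid r.tape m) (by rw [hb _ le_rfl, hD]; rfl) (compressMid_stage_succ ..)
      have s2 := hrun.leads_keep (T := compressStage r.tape (m + 1)) (hd := m + ω + 1) (m := .right)
        (q := CompressState.num (A := A) .skip) (q' := CompressState.num (A := A) .take)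
        (Φ := CompressMid r.tape m) (by rw [hD]; rfl) (compressMid_stage_succ ..)
      have s3 := hrun.leads_keep (T := compressStage r.tape (m + 1)) (hd := m + ω + 1 + 1) (m := .left)
        (q := CompressState.num (A := A) .take) (q' := CompressState.num (A := A) .back)
        (Φ := CompressMid r.tape m)
        (by rw [hb _ (by rw [add_assoc]; exact le_self_add), hD]; rfl) (compressMid_stage_succ ..)
      have s4 := hrun.leads_keep (T := compressStage r.tape (m + 1)) (hd := m + ω + 1) (m := .left)
        (q := CompressState.num (A := A) .back) (q' := CompressState.num (A := A) .back)
        (Φ := CompressMid r.tape m) (by rw [hb _ le_self_add, hD]; rfl) (compressMid_stage_succ ..)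
      have s5 := hrun.leads_keep (T := compressStage r.tape (m + 1)) (hd := m + ω) (m := .left)
        (q := CompressState.num (A := A) .back) (q' := CompressState.num (A := A) .back)
        (Φ := CompressMid r.tape m) (by rw [hb _ le_rfl, hD]; rfl) (compressMid_stage_succ ..)
      have s6 := hrun.leads_keep (T := compressStage r.tape (m + 1)) (hd := 0) (m := .left)
        (q := CompressState.num (A := A) .back) (q' := CompressState.num (A := A) .back')
        (Φ := CompressMid r.tape m) (by rw [ha, hD]; rfl) (compressMid_stage_succ ..)
      have s7 := hrun.leads_keep (T := compressStage r.tape (m + 1)) (hd := 0) (m := .stay)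
        (q := CompressState.num (A := A) .back') (q' := CompressState.num (A := A) .scan)
        (Φ := CompressMid r.tape m) (by rw [ha, hD]; rfl) (compressMid_stage_succ ..)
      rw [move_left_add_one] at s3 s4
      rw [move_left_limit hl] at s5
      rw [move_left_zero] at s6
      exact s1.trans (s2.trans (s3.trans (s4.trans (s5.trans (s6.trans s7)))))

/-- The automaton that compresses a word ends with the word on the tape. -/
theorem compress_correct (hrun : IsRun P c)
    (hD : ∀ (s : CompressState A) σ, P ((s.num : Ordinal.{u}), σ) = some (s.tr e σ))
    (r : Word.{u} A) (γ : Ordinal.{u})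
    (hγ : c γ = ⟨gapped r.tape, CompressState.num (A := A) .scan, 0⟩) :
    ∃ γ' h, γ ≤ γ' ∧ c γ' = ⟨r.tape, e, h⟩ ∧ ∀ ξ, γ ≤ ξ → ξ < γ' → (c ξ).state ≠ 1 := by
  have hne : ∀ s : Snapshot.{u} A, ((8 + 3 * Fintype.card A : ℕ) : Ordinal.{u}) ≤ s.state →
      s.state ≠ 1 := by
    intro s hs h1
    rw [h1] at hs
    have : 8 + 3 * Fintype.card A ≤ 1 := by exact_mod_cast hs
    omega
  -- There are `pred r.len` rounds: one gap less than letters for a word of successor length, and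
  -- `r.len` gaps for a limit length.
  obtain ⟨γ1, h1, ⟨h, h2, h3, -⟩, h4⟩ := hrun.loop (pred r.len) (CompressHead r)
    (fun m s => CompressMid r.tape m s)
    (fun m hm s hs => leads_compress_round hrun hD r m (by
      rwa [lt_pred_iff_succ_lt] at hm) s hs)
    (fun l hlΛ hl s hs => by
      have hll : l ≤ r.len := hlΛ.trans (pred_le_self _)
      have hev : ∀ η, ∃ ν < l, ∀ m, ν ≤ m → m < l →
          compressStage r.tape m η = compressStage r.tape l η := by
        intro η
        rcases lt_or_ge η l with h | h
        · refine ⟨η + 1, hl.add_one_lt h, fun m h1 h2 => ?_⟩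
          rw [compressStage_lt h, compressStage_lt ((lt_add_one η).trans_le h1)]
        · refine ⟨0, hl.bot_lt, fun m _ h2 => ?_⟩
          rw [compressStage_limit _ hl h, compressStage_ge ((add_omega0_le hl h2).trans h)]
      refine ⟨⟨compressStage r.tape l, CompressState.num (A := A) .scan, 0⟩,
        ⟨0, zero_le, rfl, Or.inl rfl⟩, ⟨0, hl.bot_lt, fun μ _ _ m hm => hm.1⟩, ?_, ?_, ?_, ?_⟩
      · intro ν hν
        obtain ⟨h, h1, h2, h3⟩ := hs ν hν
        refine ⟨ν, le_rfl, hν, by rw [h2], ?_⟩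
        rcases h3 with rfl | h3
        · rw [h2]
        -- Before a limit `l ≤ r.len` every block is full, so each round has ended in cell `0`. Only
        -- in the last block may the head stop elsewhere, and there no limit of rounds follows.
        · exact absurd ((add_omega0_le hl hν).trans hll) (not_le.2 h3)
      · intro b hb
        exact absurd hb not_lt_zero
      · intro η
        obtain ⟨ν, h1, h2⟩ := hev η
        refine ⟨ν, h1, fun μ h3 h4 m hm => ?_⟩
        rcases hm.2 η with h5 | h5
        · rw [h5, h2 μ h3 h4]
        · rw [h5, h2 (μ + 1) (h3.trans (lt_add_one μ).le) (hl.add_one_lt h4)]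
      · intro η ν hν
        obtain ⟨ν', h1, h2⟩ := hev η
        have h3 := max_lt hν h1
        refine ⟨_, le_max_left _ _, h3, ?_⟩
        obtain ⟨h, -, h5, -⟩ := hs _ h3
        rw [h5]
        exact (h2 _ (le_max_right _ _) h3).le)
    γ (by
      refine ⟨0, le_rfl, ?_, Or.inl rfl⟩
      rw [hγ, compressStage_zero])
  rw [compressStage_pred_len] at h3
  have hhl : h ≤ r.len := h2.trans (pred_le_self _)
  have hr : ∀ (s : CompressState A) h, (fun s : Snapshot.{u} A => s.state ≠ 1) ⟨r.tape, s.num, h⟩ :=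
    fun s h => hne _ s.le_num
  have w1 := leadsE_walk hrun (Φ := fun s => s.state ≠ 1) (T := r.tape)
    (q := CompressState.num (A := A) .scan) (fun a => by rw [hD]; rfl) h (r.len - h)
    (fun γ _ h2 => by rwa [Ordinal.add_sub_cancel_of_le hhl, ← r.ne_bot_iff] at h2)
    (fun h => hr .scan h)
  rw [Ordinal.add_sub_cancel_of_le hhl] at w1
  have w2 := hrun.leads_keep (T := r.tape) (hd := r.len) (m := .right)
    (q := CompressState.num (A := A) .scan) (q' := CompressState.num (A := A) .next)
    (Φ := fun s => s.state ≠ 1) (by rw [(r.eq_bot_iff _).2 le_rfl, hD]; rfl) (hr .scan _)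
  have w3 := hrun.leads_keep (T := r.tape) (hd := r.len + 1) (m := .stay)
    (q := CompressState.num (A := A) .next) (q' := e)
    (Φ := fun s => s.state ≠ 1) (by rw [(r.eq_bot_iff _).2 le_self_add, hD]; rfl) (hr .next _)
  obtain ⟨γ2, a1, a2, a3⟩ := (w1.transS (w2.trans w3)) γ1 h3
  refine ⟨γ2, _, (le_self_add.trans h1).trans a1.le, a2, fun ξ h5 h6 => ?_⟩
  rcases lt_or_ge ξ γ1 with h7 | h7
  · obtain ⟨μ, -, h8⟩ := h4 ξ h5 h7
    exact hne _ h8.1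
  · exact a3 ξ h7 h6

/-- The same, when the automaton first has to return to the beginning of the tape. -/
theorem compress_correct_back (hrun : IsRun P c)
    (hD : ∀ (s : CompressState A) σ, P ((s.num : Ordinal.{u}), σ) = some (s.tr e σ))
    (r : Word.{u} A) (hr : 0 < r.len) (γ h : Ordinal.{u})
    (hγ : c γ = ⟨gapped r.tape, CompressState.num (A := A) .back, h⟩) :
    ∃ γ' h, γ ≤ γ' ∧ c γ' = ⟨r.tape, e, h⟩ ∧ ∀ ξ, γ ≤ ξ → ξ < γ' → (c ξ).state ≠ 1 := by
  obtain ⟨h', h1, h2⟩ := leadsE_compress_back hrun hD (Φ := fun s => s.state ≠ 1) r 0 hr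
    (fun s h h1 => by
      have h2 := s.le_num
      dsimp only at h1
      rw [h1] at h2
      have : 8 + 3 * Fintype.card A ≤ 1 := by exact_mod_cast h2
      omega) h
  rw [le_zero_iff.1 h1] at h2
  rw [← compressStage_zero] at hγ
  obtain ⟨γ1, a1, a2, a3⟩ := h2 γ hγ
  rw [compressStage_zero] at a2
  obtain ⟨γ2, h'', b1, b2, b3⟩ := compress_correct hrun hD r γ1 a2
  refine ⟨γ2, h'', a1.trans b1, b2, fun ξ h5 h6 => ?_⟩
  rcases lt_or_ge ξ γ1 with h7 | h7
  · exact a3 ξ h5 h7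
  · exact b3 ξ h7 h6

end Compress

/-! ### Supercells and the execution of one instruction on them. -/

section Supercells

variable {A : Type v} [Fintype A] [LinearOrder A] {K : ℕ} [NeZero K]

variable (K) in
theorem natCast_pos' : (0 : Ordinal.{u}) < (K : Ordinal.{u}) := by
  exact_mod_cast Nat.pos_of_ne_zero (NeZero.ne K)

variable (K) in
theorem natCast_ne_zero' : (K : Ordinal.{u}) ≠ 0 := (natCast_pos' K).ne'

open Classical in
variable (K) in
/-- The slot of a cell in its supercell. -/
noncomputable def slotOf (γ : Ordinal.{u}) : Fin K :=
  if h : ∃ i : Fin K, ((i : ℕ) : Ordinal.{u}) = γ % K then h.choose else 0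

theorem fin_cast_lt (i : Fin K) : ((i : ℕ) : Ordinal.{u}) < (K : Ordinal.{u}) :=
  Nat.cast_lt.2 i.2

theorem slotOf_mul_add (η : Ordinal.{u}) (i : Fin K) :
    slotOf K ((K : Ordinal.{u}) * η + ((i : ℕ) : Ordinal.{u})) = i := by
  have h : ∃ j : Fin K, ((j : ℕ) : Ordinal.{u}) = ((K : Ordinal.{u}) * η + ((i : ℕ) : Ordinal.{u})) % K :=
    ⟨i, by rw [mul_add_mod_self, mod_eq_of_lt (fin_cast_lt i)]⟩
  rw [slotOf, dif_pos h]
  have h2 := h.choose_spec.trans (show _ = ((i : ℕ) : Ordinal.{u}) by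
    rw [mul_add_mod_self, mod_eq_of_lt (fin_cast_lt i)])
  exact Fin.ext (Nat.cast_inj.1 h2)

theorem mul_add_fin_div (η : Ordinal.{u}) (i : Fin K) :
    ((K : Ordinal.{u}) * η + ((i : ℕ) : Ordinal.{u})) / K = η := by
  rw [mul_add_div _ (natCast_ne_zero' K), div_eq_zero_of_lt (fin_cast_lt i), add_zero]

variable (K) in
theorem exists_slot (γ : Ordinal.{u}) :
    ∃ (η : Ordinal.{u}) (i : Fin K), γ = (K : Ordinal.{u}) * η + ((i : ℕ) : Ordinal.{u}) := by
  have h := mod_lt γ (natCast_ne_zero' K)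
  obtain ⟨n, hn⟩ := lt_omega0.1 (h.trans (natCast_lt_omega0 K))
  rw [hn, Nat.cast_lt] at h
  exact ⟨γ / K, ⟨n, h⟩, by rw [← hn, div_add_mod]⟩

theorem slot_inj {η η' : Ordinal.{u}} {i i' : Fin K} :
    (K : Ordinal.{u}) * η + ((i : ℕ) : Ordinal.{u}) = (K : Ordinal.{u}) * η' + ((i' : ℕ) : Ordinal.{u})
      ↔ η = η' ∧ i = i' := by
  constructor
  · intro h
    have h1 := congrArg (· / (K : Ordinal.{u})) h
    have h2 := congrArg (slotOf K) h
    simp only [mul_add_fin_div] at h1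
    rw [slotOf_mul_add, slotOf_mul_add] at h2
    exact ⟨h1, h2⟩
  · rintro ⟨rfl, rfl⟩; rfl

/-- The tape whose cells are the slots of the given supercells. -/
noncomputable def flatten (U : Ordinal.{u} → Fin K → WithBot A) : Tape.{u} A :=
  fun γ => U (γ / K) (slotOf K γ)

@[simp]
theorem flatten_apply (U : Ordinal.{u} → Fin K → WithBot A) (η : Ordinal.{u}) (i : Fin K) :
    flatten U ((K : Ordinal.{u}) * η + ((i : ℕ) : Ordinal.{u})) = U η i := by
  rw [flatten, mul_add_fin_div, slotOf_mul_add]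

theorem flatten_mono {U V : Ordinal.{u} → Fin K → WithBot A} (h : U ≤ V) : flatten U ≤ flatten V :=
  fun _ => h _ _

open Classical in
theorem update_flatten (U : Ordinal.{u} → Fin K → WithBot A) (η : Ordinal.{u}) (i : Fin K)
    (a : WithBot A) :
    Function.update (flatten U) ((K : Ordinal.{u}) * η + ((i : ℕ) : Ordinal.{u})) a =
      flatten fun η' i' => if η' = η ∧ i' = i then a else U η' i' := by
  funext γ
  obtain ⟨η', i', rfl⟩ := exists_slot K γ
  rw [flatten_apply, Function.update_apply, flatten_apply]
  simp only [slot_inj]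

variable (A K) in
/-- The phases of the execution of an instruction on supercells. -/
inductive Phase
  | read (i : Fin (K + 1)) (buf : Fin K → WithBot A)
  | write (i : Fin K) (v : (Fin K → WithBot A) × Option Bool)
  | forward (i : Fin (K + 1))
  | home (b : Bool) (i : Fin K)

variable (A K) in
/-- The phase in which an instruction starts. -/
def Phase.start : Phase A K := .read 0 fun _ => ⊥

variable (A K) in
/-- An encoding of phases. -/
def Phase.toSum : Phase A K →
    (Fin (K + 1) × (Fin K → WithBot A)) ⊕ (Fin K × ((Fin K → WithBot A) × Option Bool)) ⊕
      Fin (K + 1) ⊕ (Bool × Fin K)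
  | .read i buf => .inl (i, buf)
  | .write i v => .inr (.inl (i, v))
  | .forward i => .inr (.inr (.inl i))
  | .home b i => .inr (.inr (.inr (b, i)))

theorem Phase.toSum_injective : Function.Injective (Phase.toSum A K) := by
  intro a b h
  cases a <;> cases b <;> simp_all [Phase.toSum]

instance : Finite (Phase A K) := Finite.of_injective _ Phase.toSum_injective

-- The phase in which an instruction starts gets the number `0`, because a scan over limitly many
-- supercells has to be in this phase at the limit, and the limit state is an inferior limit.
variable (A K) in
theorem Phase.exists_num : ∃ N : ℕ, ∃ e : Phase A K ≃ Fin N, ((e (Phase.start A K) : Fin N) : ℕ) = 0 := by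
  obtain ⟨n, ⟨e⟩⟩ := Finite.exists_equiv_fin (Phase A K)
  have hn : 0 < n := Fin.pos (e (Phase.start A K))
  exact ⟨n, e.trans (Equiv.swap (e (Phase.start A K)) ⟨0, hn⟩), by simp⟩

variable (A K) in
/-- The number of phases. -/
noncomputable def Phase.count : ℕ := (Phase.exists_num A K).choose

variable (A K) in
/-- The numbering of phases. -/
noncomputable def Phase.equiv : Phase A K ≃ Fin (Phase.count A K) :=
  (Phase.exists_num A K).choose_spec.choose

theorem Phase.equiv_start : ((Phase.equiv A K (Phase.start A K) : Fin _) : ℕ) = 0 :=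
  (Phase.exists_num A K).choose_spec.choose_spec

instance : NeZero (Phase.count A K) :=
  ⟨fun h => by have := (Phase.equiv A K (Phase.start A K)).2; omega⟩

/-- An instruction on supercells: walk to the right over the supercells and rewrite them until `g` says
to stop; then go home, if `homing` holds, and exit. -/
structure Instr (A : Type v) (K : ℕ) : Type (max (u + 1) v) where
  g : (Fin K → WithBot A) → (Fin K → WithBot A) × Option Bool
  exit : Bool → Ordinal.{u}
  homing : Bool := true

variable (A K) in
/-- The state for phase `ph` at node `n`. -/
noncomputable def nodeState (n : Ordinal.{u}) (ph : Phase A K) : Ordinal.{u} :=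
  ((15 + 4 * Fintype.card A : ℕ) : Ordinal.{u}) +
    ((Phase.count A K : Ordinal.{u}) * n + ((Phase.equiv A K ph : ℕ) : Ordinal.{u}))

variable (A K) in
/-- The first state of node `n`. -/
noncomputable def nodeStart (n : Ordinal.{u}) : Ordinal.{u} := nodeState A K n (Phase.start A K)

theorem nodeStart_eq (n : Ordinal.{u}) : nodeStart A K n =
    ((15 + 4 * Fintype.card A : ℕ) : Ordinal.{u}) + (Phase.count A K : Ordinal.{u}) * n := by
  rw [nodeStart, nodeState, Phase.equiv_start, Nat.cast_zero, add_zero]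

theorem nodeStart_le (n : Ordinal.{u}) (ph : Phase A K) : nodeStart A K n ≤ nodeState A K n ph := by
  rw [nodeStart_eq, nodeState]
  gcongr
  exact le_self_add

theorem nodeState_inj {n n' : Ordinal.{u}} {ph ph' : Phase A K}
    (h : nodeState A K n ph = nodeState A K n' ph') : n = n' ∧ ph = ph' := by
  rw [nodeState, nodeState, add_right_inj] at h
  obtain ⟨h1, h2⟩ := slot_inj.1 h
  exact ⟨h1, (Phase.equiv A K).injective h2⟩

theorem nodeStart_ne {n : Ordinal.{u}} {ph : Phase A K} (h : ph ≠ Phase.start A K) :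
    nodeState A K n ph ≠ nodeStart A K n := fun h1 => h (nodeState_inj h1).2

/-- Continuity lets a transfinite chain of nodes pass through a limit: the inferior limit of the
states is the first state of the limit node. -/
theorem nodeStart_isNormal : IsNormal (nodeStart A K : Ordinal.{u} → Ordinal.{u}) := by
  have : (nodeStart A K : Ordinal.{u} → Ordinal.{u}) =
      (fun x => ((15 + 4 * Fintype.card A : ℕ) : Ordinal.{u}) + x) ∘
      fun n => (Phase.count A K : Ordinal.{u}) * n := funext nodeStart_eq
  rw [this]
  exact (add_isNormal _).comp (mul_isNormal (natCast_pos' _))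

theorem one_lt_nodeStart (n : Ordinal.{u}) : 1 < nodeStart A K n := by
  rw [nodeStart_eq]
  refine lt_of_lt_of_le ?_ le_self_add
  exact_mod_cast (by omega : 1 < 15 + 4 * Fintype.card A)

/-- The transitions of an instruction at node `n`. -/
noncomputable def Instr.tr (I : Instr.{u} A K) (n : Ordinal.{u}) :
    Phase A K → WithBot A → Ordinal.{u} × WithBot A × Motion
  | .read i buf, σ =>
    if h : (i : ℕ) < K then
      (nodeState A K n (.read ⟨i + 1, Nat.succ_lt_succ h⟩ (Function.update buf ⟨i, h⟩ σ)), σ, .right)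
    else (nodeState A K n
      (.write ⟨K - 1, Nat.sub_lt (Nat.pos_of_ne_zero (NeZero.ne K)) one_pos⟩ (I.g buf)), σ, .left)
  | .write i v, σ =>
    if (i : ℕ) = 0 then
      (match v.2 with
        | none => nodeState A K n (.forward 0)
        | some b => nodeState A K n (.home b 0), v.1 i, .stay)
    else (nodeState A K n (.write ⟨i - 1, (Nat.sub_le _ _).trans_lt i.2⟩ v), v.1 i, .left)
  | .forward i, σ =>
    if h : (i : ℕ) < K then (nodeState A K n (.forward ⟨i + 1, Nat.succ_lt_succ h⟩), σ, .right)
    else (nodeStart A K n, σ, .stay)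
  | .home b i, σ =>
    if (i : ℕ) = 0 ∧ (σ ≠ ⊥ ∨ I.homing = false) then (I.exit b, σ, .stay)
    else (nodeState A K n (.home b (i + 1)), σ, .left)

/-- The program `P` executes the instruction `I` at node `n`. -/
def Implements (P : Program.{u} A) (n : Ordinal.{u}) (I : Instr.{u} A K) : Prop :=
  ∀ ph σ, P (nodeState A K n ph, σ) = some (I.tr n ph σ)

variable {P : Program.{u} A} {c : Ordinal.{u} → Snapshot.{u} A} {n : Ordinal.{u}} {I : Instr.{u} A K}
  {Φ : Snapshot.{u} A → Prop}

/-- The condition on `Φ` records that the start state is met only on the first cell of a supercell.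
These are the times that determine the head position at a limit of the scan. -/
theorem leads_read (hrun : IsRun P c) (hI : Implements P n I) (U : Ordinal.{u} → Fin K → WithBot A)
    (η : Ordinal.{u}) (hΦ : ∀ ph h, (ph = Phase.start A K → h = (K : Ordinal.{u}) * η) →
      Φ ⟨flatten U, nodeState A K n ph, h⟩) :
    Leads c ⟨flatten U, nodeStart A K n, (K : Ordinal.{u}) * η⟩
      ⟨flatten U, nodeState A K n
        (.write ⟨K - 1, Nat.sub_lt (Nat.pos_of_ne_zero (NeZero.ne K)) one_pos⟩ (I.g (U η))),
        (K : Ordinal.{u}) * η + ((K - 1 : ℕ) : Ordinal.{u})⟩ Φ := by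
  have key : ∀ i (hi : i < K + 1), LeadsE c ⟨flatten U, nodeStart A K n, (K : Ordinal.{u}) * η⟩
      ⟨flatten U, nodeState A K n (.read ⟨i, hi⟩ fun j => if (j : ℕ) < i then U η j else ⊥),
        (K : Ordinal.{u}) * η + (i : Ordinal.{u})⟩ Φ := by
    intro i
    induction i with
    | zero =>
      intro hi
      simp only [Nat.cast_zero, add_zero, Nat.not_lt_zero, if_false]
      exact LeadsE.refl
    | succ i ih =>
      intro hi
      have hi' : i < K := by omega
      refine (ih (by omega)).trans ?_
      have := hrun.leads_keep (T := flatten U) (hd := (K : Ordinal.{u}) * η + (i : Ordinal.{u}))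
        (m := .right) (Φ := Φ)
        (q := nodeState A K n (.read ⟨i, by omega⟩ fun j => if (j : ℕ) < i then U η j else ⊥))
        (q' := nodeState A K n (.read ⟨i + 1, hi⟩ fun j => if (j : ℕ) < i + 1 then U η j else ⊥))
        (by
          have e1 := flatten_apply U η ⟨i, hi'⟩
          dsimp only at e1
          rw [hI, e1, Instr.tr, dif_pos hi']
          congr 5
          funext j
          rw [Function.update_apply]
          by_cases hj : j = ⟨i, hi'⟩
          · subst hj; simp
          · have : (j : ℕ) ≠ i := fun h => hj (Fin.ext h)
            rw [if_neg hj]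
            congr 1
            apply propext; omega)
        (hΦ _ _ (fun h => by
          rw [Phase.start] at h
          simp only [Phase.read.injEq, Fin.ext_iff, Fin.val_zero] at h
          simp [h.1]))
      rw [move_right, add_assoc] at this
      exact_mod_cast this.toE
  have h1 := key K (Nat.lt_succ_self K)
  simp only [Fin.is_lt, if_true] at h1
  have h2 := hrun.leads_keep (T := flatten U) (hd := (K : Ordinal.{u}) * η + (K : Ordinal.{u}))
    (m := .left) (Φ := Φ) (q := nodeState A K n (.read ⟨K, Nat.lt_succ_self K⟩ fun j => U η j))
    (q' := nodeState A K n
        (.write ⟨K - 1, Nat.sub_lt (Nat.pos_of_ne_zero (NeZero.ne K)) one_pos⟩ (I.g (U η))))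
    (by rw [hI, Instr.tr, dif_neg (lt_irrefl K)])
    (hΦ _ _ (fun h => by
      rw [Phase.start] at h
      simp only [Phase.read.injEq, Fin.ext_iff, Fin.val_zero] at h
      exact absurd h.1 (NeZero.ne K)))
  have e : (K : Ordinal.{u}) * η + (K : Ordinal.{u})
      = (K : Ordinal.{u}) * η + ((K - 1 : ℕ) : Ordinal.{u}) + 1 := by
    rw [add_assoc, ← Nat.cast_succ]
    congr 2
    have := Nat.pos_of_ne_zero (NeZero.ne K)
    omega
  have e2 : Motion.left.move ((K : Ordinal.{u}) * η + (K : Ordinal.{u}))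
    = (K : Ordinal.{u}) * η + ((K - 1 : ℕ) : Ordinal.{u}) := by rw [e, move_left_add_one]
  rw [e2] at h2
  exact h1.transS h2

open Classical in
/-- The supercells when those below `η`, and the slots of `η` from `i` on, have been rewritten. -/
noncomputable def scanCells (U U' : Ordinal.{u} → Fin K → WithBot A) (η : Ordinal.{u}) (i : ℕ) :
    Ordinal.{u} → Fin K → WithBot A :=
  fun η' s => if η' < η ∨ (η' = η ∧ i ≤ (s : ℕ)) then U' η' s else U η' s

theorem scanCells_or (U U' : Ordinal.{u} → Fin K → WithBot A) (η : Ordinal.{u}) (i : ℕ)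
    (η' : Ordinal.{u}) (s : Fin K) :
    scanCells U U' η i η' s = U η' s ∨ scanCells U U' η i η' s = U' η' s := by
  rw [scanCells]; split_ifs
  · exact Or.inr rfl
  · exact Or.inl rfl

theorem scanCells_lt (U U' : Ordinal.{u} → Fin K → WithBot A) {η η' : Ordinal.{u}} (i : ℕ)
    (h : η' < η) : scanCells U U' η i η' = U' η' := funext fun s => if_pos (Or.inl h)

theorem scanCells_gt (U U' : Ordinal.{u} → Fin K → WithBot A) {η η' : Ordinal.{u}} (i : ℕ)
    (h : η < η') : scanCells U U' η i η' = U η' := funext fun s => if_neg (by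
      rintro (h1 | h1)
      · exact h.not_gt h1
      · exact h.ne' h1.1)

theorem scanCells_self (U U' : Ordinal.{u} → Fin K → WithBot A) (η : Ordinal.{u}) :
    scanCells U U' η K η = U η := funext fun s => if_neg (by
      rintro (h1 | h1)
      · exact lt_irrefl _ h1
      · exact absurd s.2 (not_lt.2 h1.2))

theorem scanCells_next (U U' : Ordinal.{u} → Fin K → WithBot A) (η : Ordinal.{u}) :
    scanCells U U' η 0 = scanCells U U' (η + 1) K := by
  funext η' s
  rw [scanCells, scanCells]
  congr 1
  have h1 : ¬ (K ≤ (s : ℕ)) := not_le.2 s.2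
  simp only [h1, and_false, or_false, Nat.zero_le, and_true, lt_add_one_iff,
    le_iff_lt_or_eq (a := η')]

theorem scanCells_write (U U' : Ordinal.{u} → Fin K → WithBot A) (η : Ordinal.{u}) (i : Fin K) :
    Function.update (flatten (scanCells U U' η (i + 1)))
      ((K : Ordinal.{u}) * η + ((i : ℕ) : Ordinal.{u})) (U' η i) = flatten (scanCells U U' η i) := by
  rw [update_flatten]
  congr 1
  funext η' s
  by_cases h : η' = η ∧ s = i
  · obtain ⟨rfl, rfl⟩ := h
    simp [scanCells]
  · rw [if_neg h, scanCells, scanCells]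
    congr 1
    apply propext
    have h2 : η' = η → (((i : ℕ) + 1 ≤ (s : ℕ)) ↔ (i : ℕ) ≤ s) := fun h1 => by
      have : (s : ℕ) ≠ i := fun h3 => h ⟨h1, Fin.ext h3⟩
      omega
    constructor
    · rintro (h1 | h1)
      · exact Or.inl h1
      · exact Or.inr ⟨h1.1, (h2 h1.1).1 h1.2⟩
    · rintro (h1 | h1)
      · exact Or.inl h1
      · exact Or.inr ⟨h1.1, (h2 h1.1).2 h1.2⟩

/-- The mids of a scan while it works on supercell `η`. -/
def ScanMid (n : Ordinal.{u}) (U U' : Ordinal.{u} → Fin K → WithBot A) (η : Ordinal.{u})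
    (s : Snapshot.{u} A) : Prop :=
  nodeStart A K n ≤ s.state ∧ (∃ i, s.tape = flatten (scanCells U U' η i)) ∧
    (s.state = nodeStart A K n → s.head = (K : Ordinal.{u}) * η)

theorem leads_scan_cell (hrun : IsRun P c) (hI : Implements P n I)
    (U U' : Ordinal.{u} → Fin K → WithBot A) (η : Ordinal.{u}) (hU : (I.g (U η)).1 = U' η) :
    Leads c ⟨flatten (scanCells U U' η K), nodeStart A K n, (K : Ordinal.{u}) * η⟩
      ⟨flatten (scanCells U U' (η + 1) K),
        (match (I.g (U η)).2 with
        | none => nodeState A K n (.forward 0)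
        | some b => nodeState A K n (.home b 0)), (K : Ordinal.{u}) * η⟩ (ScanMid n U U' η) := by
  have hΦ : ∀ ph i h, (ph = Phase.start A K → h = (K : Ordinal.{u}) * η) →
      ScanMid n U U' η ⟨flatten (scanCells U U' η i), nodeState A K n ph, h⟩ := fun ph i h h1 =>
    ⟨nodeStart_le _ _, ⟨i, rfl⟩, fun h2 => h1 (by
      by_contra h3
      exact nodeStart_ne h3 h2)⟩
  have h1 := leads_read hrun hI (scanCells U U' η K) η (Φ := ScanMid n U U' η) (fun ph h => hΦ ph K h)
  rw [scanCells_self] at h1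
  have hK := Nat.pos_of_ne_zero (NeZero.ne K)
  -- Writing runs from slot `K - 1` down to slot `0`, so the induction is on the number `d` of slots
  -- already written.
  have key : ∀ d i (hi : i < K), i + 1 + d = K → LeadsE c
      ⟨flatten (scanCells U U' η K), nodeStart A K n, (K : Ordinal.{u}) * η⟩
      ⟨flatten (scanCells U U' η (i + 1)), nodeState A K n (.write ⟨i, hi⟩ (I.g (U η))),
        (K : Ordinal.{u}) * η + (i : Ordinal.{u})⟩ (ScanMid n U U' η) := by
    intro d
    induction d with
    | zero =>
      intro i hi hd
      obtain rfl : i = K - 1 := by omega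
      have e : K - 1 + 1 = K := by omega
      rw [e]
      exact h1.toE
    | succ d ih =>
      intro i hi hd
      refine (ih (i + 1) (by omega) (by omega)).trans ?_
      have h2 := hrun.leads_step (T := flatten (scanCells U U' η (i + 1 + 1)))
        (q := nodeState A K n (.write ⟨i + 1, by omega⟩ (I.g (U η))))
        (hd := (K : Ordinal.{u}) * η + ((i + 1 : ℕ) : Ordinal.{u}))
        (q' := nodeState A K n (.write ⟨i, hi⟩ (I.g (U η)))) (σ' := U' η ⟨i + 1, by omega⟩)
        (m := .left) (Φ := ScanMid n U U' η)
        (by rw [hI, Instr.tr, if_neg (by simp), hU]; rfl) (hΦ _ _ _ (fun h => by cases h))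
      have h3 := scanCells_write U U' η ⟨i + 1, by omega⟩
      dsimp only at h3
      rw [h3] at h2
      have e2 : Motion.left.move ((K : Ordinal.{u}) * η + ((i + 1 : ℕ) : Ordinal.{u}))
        = (K : Ordinal.{u}) * η + (i : Ordinal.{u}) := by
        rw [Nat.cast_succ, ← add_assoc, move_left_add_one]
      rw [e2] at h2
      exact h2.toE
  refine (key (K - 1) 0 hK (by omega)).transS ?_
  have h2 := hrun.leads_step (T := flatten (scanCells U U' η (0 + 1)))
    (q := nodeState A K n (.write ⟨0, hK⟩ (I.g (U η))))
    (hd := (K : Ordinal.{u}) * η + ((0 : ℕ) : Ordinal.{u}))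
    (q' := (match (I.g (U η)).2 with
        | none => nodeState A K n (.forward 0)
        | some b => nodeState A K n (.home b 0))) (σ' := U' η ⟨0, hK⟩)
    (m := .stay) (Φ := ScanMid n U U' η)
    (by rw [hI, Instr.tr, if_pos rfl, hU]) (hΦ _ _ _ (fun h => by cases h))
  have h3 := scanCells_write U U' η ⟨0, hK⟩
  dsimp only at h3
  rw [h3, move_stay, scanCells_next] at h2
  simpa using h2

theorem leads_scan_step (hrun : IsRun P c) (hI : Implements P n I)
    (U U' : Ordinal.{u} → Fin K → WithBot A) (η : Ordinal.{u}) (hU : I.g (U η) = (U' η, none)) :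
    Leads c ⟨flatten (scanCells U U' η K), nodeStart A K n, (K : Ordinal.{u}) * η⟩
      ⟨flatten (scanCells U U' (η + 1) K), nodeStart A K n, (K : Ordinal.{u}) * (η + 1)⟩
      (ScanMid n U U' η) := by
  have h1 := leads_scan_cell hrun hI U U' η (by rw [hU])
  rw [hU] at h1
  dsimp only at h1
  have hΦ : ∀ ph h, ph ≠ Phase.start A K →
      ScanMid n U U' η ⟨flatten (scanCells U U' (η + 1) K), nodeState A K n ph, h⟩ := fun ph h h1 =>
    ⟨nodeStart_le _ _, ⟨0, by rw [scanCells_next]⟩, fun h2 => absurd h2 (nodeStart_ne h1)⟩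
  have key : ∀ i (hi : i < K + 1), LeadsE c
      ⟨flatten (scanCells U U' (η + 1) K), nodeState A K n (.forward 0), (K : Ordinal.{u}) * η⟩
      ⟨flatten (scanCells U U' (η + 1) K), nodeState A K n (.forward ⟨i, hi⟩),
        (K : Ordinal.{u}) * η + (i : Ordinal.{u})⟩ (ScanMid n U U' η) := by
    intro i
    induction i with
    | zero => intro hi; rw [Nat.cast_zero, add_zero]; exact LeadsE.refl
    | succ i ih =>
      intro hi
      have hi' : i < K := by omega
      refine (ih (by omega)).trans ?_
      have := hrun.leads_keep (T := flatten (scanCells U U' (η + 1) K))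
        (hd := (K : Ordinal.{u}) * η + (i : Ordinal.{u}))
        (m := .right) (Φ := ScanMid n U U' η) (q := nodeState A K n (.forward ⟨i, by omega⟩))
        (q' := nodeState A K n (.forward ⟨i + 1, hi⟩))
        (by rw [hI, Instr.tr, dif_pos hi']) (hΦ _ _ (fun h => by cases h))
      rw [move_right, add_assoc] at this
      exact_mod_cast this.toE
  have h2 := hrun.leads_keep (T := flatten (scanCells U U' (η + 1) K))
    (hd := (K : Ordinal.{u}) * η + (K : Ordinal.{u}))
    (m := .stay) (Φ := ScanMid n U U' η)
    (q := nodeState A K n (.forward ⟨K, Nat.lt_succ_self K⟩))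
    (q' := nodeStart A K n)
    (by rw [hI, Instr.tr, dif_neg (lt_irrefl K)]) (hΦ _ _ (fun h => by cases h))
  rw [move_stay] at h2
  rw [mul_add_one]
  exact h1.transE ((key K (Nat.lt_succ_self K)).trans h2.toE)

/-- A scan up to supercell `ν`. -/
theorem leadsE_scan (hrun : IsRun P c) (hI : Implements P n I)
    (U U' : Ordinal.{u} → Fin K → WithBot A) (ν : Ordinal.{u})
    (hU : ∀ η < ν, I.g (U η) = (U' η, none)) :
    LeadsE c ⟨flatten U, nodeStart A K n, 0⟩
      ⟨flatten (scanCells U U' ν K), nodeStart A K n, (K : Ordinal.{u}) * ν⟩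
      (fun s => ∃ η < ν, ScanMid n U U' η s) := by
  have h0 : scanCells U U' 0 K = U := by
    funext η s
    have : ¬ (K ≤ (s : ℕ)) := not_le.2 s.2
    simp [scanCells]
  have key := hrun.leadsE_loop ν
    (fun η => ⟨flatten (scanCells U U' η K), nodeStart A K n, (K : Ordinal.{u}) * η⟩)
    (ScanMid n U U') (fun s => ∃ η < ν, ScanMid n U U' η s)
    (fun η hη => leads_scan_step hrun hI U U' η (hU η hη)) ?_
    (fun η hη s hs => ⟨η, hη, hs⟩)
  · rw [h0, mul_zero] at key
    exact key
  intro l _ hl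
  have hN := mul_isNormal (natCast_pos' K : (0 : Ordinal.{u}) < (K : Ordinal.{u}))
  have hev : ∀ η', ∃ ν' < l, ∀ η i, ν' ≤ η → η < l → scanCells U U' η i η' = scanCells U U' l K η' := by
    intro η'
    rcases lt_or_ge η' l with h | h
    · refine ⟨η' + 1, hl.add_one_lt h, fun η i h1 h2 => ?_⟩
      rw [scanCells_lt _ _ _ h, scanCells_lt _ _ _ ((lt_add_one η').trans_le h1)]
    · refine ⟨0, hl.bot_lt, fun η i _ h2 => ?_⟩
      rw [scanCells_gt _ _ _ (h2.trans_le h)]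
      rcases h.lt_or_eq with h | rfl
      · rw [scanCells_gt _ _ _ h]
      · rw [scanCells_self]
  refine ⟨⟨0, hl.bot_lt, fun μ _ _ m hm => hm.1⟩, fun ν hν => ⟨ν, le_rfl, hν, rfl, ?_⟩, ?_, ?_, ?_⟩
  · dsimp only; gcongr
  · intro b hb
    obtain ⟨ν', h1, h2⟩ := (hN.lt_iff_exists_lt hl).1 hb
    refine ⟨ν', h1, fun μ h3 _ s hs hst => ?_⟩
    rw [hs.2.2 hst]
    exact h2.trans_le (by gcongr)
  · intro γ
    obtain ⟨η', i', rfl⟩ := exists_slot K γ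
    obtain ⟨ν', h1, h2⟩ := hev η'
    refine ⟨ν', h1, fun μ h3 h4 s hs => ?_⟩
    obtain ⟨i, hi⟩ := hs.2.1
    rw [hi, flatten_apply, h2 μ i h3 h4]
    exact (flatten_apply (scanCells U U' l K) η' i').le
  · intro γ ν1 hν1
    obtain ⟨η', i', rfl⟩ := exists_slot K γ
    obtain ⟨ν', h1, h2⟩ := hev η'
    have h3 := max_lt hν1 h1
    refine ⟨_, le_max_left _ _, h3, ?_⟩
    dsimp only
    rw [flatten_apply, flatten_apply, h2 _ K (le_max_right _ _) h3]

/-- Going home. -/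
theorem leads_go_home (hrun : IsRun P c) (hI : Implements P n I) (hh : I.homing = true) (b : Bool)
    (U : Ordinal.{u} → Fin K → WithBot A) (h0 : U 0 0 ≠ ⊥) (h1 : ∀ η, 0 < η → U η 0 = ⊥)
    (η : Ordinal.{u}) :
    Leads c ⟨flatten U, nodeState A K n (.home b 0), (K : Ordinal.{u}) * η⟩
      ⟨flatten U, I.exit b, 0⟩
      (fun s => nodeStart A K n ≤ s.state ∧ s.tape = flatten U) := by
  have hΦ : ∀ ph h, (fun s : Snapshot.{u} A => nodeStart A K n ≤ s.state ∧ s.tape = flatten U)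
      ⟨flatten U, nodeState A K n ph, h⟩ := fun ph h => ⟨nodeStart_le _ _, rfl⟩
  have hz : ((0 : Fin K) : ℕ) = 0 := by simp
  have hval : ∀ η, flatten U ((K : Ordinal.{u}) * η) = U η 0 := fun η => by
    have := flatten_apply U η 0
    rwa [hz, Nat.cast_zero, add_zero] at this
  have hK := Nat.pos_of_ne_zero (NeZero.ne K)
  induction η using WellFoundedLT.induction with
  | ind η ih =>
  rcases eq_or_ne η 0 with rfl | hη
  · have := hrun.leads_keep (T := flatten U) (hd := (K : Ordinal.{u}) * 0) (m := .stay)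
      (Φ := fun s => nodeStart A K n ≤ s.state ∧ s.tape = flatten U)
      (q := nodeState A K n (.home b 0)) (q' := I.exit b)
      (by rw [hI, Instr.tr, if_pos]; exact ⟨hz, Or.inl (by rw [hval]; exact h0)⟩) (hΦ _ _)
    rw [move_stay] at this
    convert this using 2
    rw [mul_zero]
  have hpos : 0 < η := Order.one_le_iff_pos.1 (Order.one_le_iff_ne_zero.2 hη)
  have first := hrun.leads_keep (T := flatten U) (hd := (K : Ordinal.{u}) * η) (m := .left)
      (Φ := fun s => nodeStart A K n ≤ s.state ∧ s.tape = flatten U)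
      (q := nodeState A K n (.home b 0)) (q' := nodeState A K n (.home b (0 + 1)))
      (by rw [hI, Instr.tr, if_neg]; rintro ⟨-, h2⟩; simp [hval, h1 η hpos, hh] at h2) (hΦ _ _)
  have walk : ∀ i, 0 < i → i ≤ K → Leads c
      ⟨flatten U, nodeState A K n (.home b 0), (K : Ordinal.{u}) * η⟩
      ⟨flatten U, nodeState A K n (.home b (Fin.ofNat K i)),
        (fun x => Motion.left.move x)^[i] ((K : Ordinal.{u}) * η)⟩
      (fun s => nodeStart A K n ≤ s.state ∧ s.tape = flatten U) := by
    intro i hi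
    induction i, hi using Nat.le_induction with
    | base =>
      intro _
      have e1 : Fin.ofNat K 1 = 0 + 1 := by apply Fin.ext; simp
      change Leads c _ ⟨_, nodeState A K n (.home b (Fin.ofNat K 1)), _⟩ _
      rw [e1]
      exact first
    | succ i hi ih =>
      intro hiK
      refine (ih (by omega)).trans ?_
      have := hrun.leads_keep (T := flatten U) (hd := (fun x => Motion.left.move x)^[i] ((K : Ordinal.{u}) * η))
        (m := .left) (Φ := fun s => nodeStart A K n ≤ s.state ∧ s.tape = flatten U)
        (q := nodeState A K n (.home b (Fin.ofNat K i)))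
        (q' := nodeState A K n (.home b (Fin.ofNat K i + 1)))
        (by
          rw [hI, Instr.tr, if_neg]
          rintro ⟨h2, -⟩
          rw [Fin.val_ofNat, Nat.mod_eq_of_lt (by omega)] at h2
          omega) (hΦ _ _)
      rw [Function.iterate_succ_apply']
      convert this using 4
      apply Fin.ext; simp [Fin.val_add]
  have last := walk K hK le_rfl
  have e0 : Fin.ofNat K K = 0 := by apply Fin.ext; simp
  rw [e0] at last
  -- From a successor supercell `K` left moves lead to the previous one. From a limit supercell the
  -- first move ends in cell `0`, and the others stay there; so the descent is well-founded.
  obtain ⟨η', h2, h3⟩ : ∃ η' < η, (fun x => Motion.left.move x)^[K] ((K : Ordinal.{u}) * η)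
      = (K : Ordinal.{u}) * η' := by
    rcases zero_or_succ_or_limit η with h2 | ⟨η', rfl⟩ | hl
    · exact absurd h2 hη
    · refine ⟨η', lt_add_one η', ?_⟩
      rw [mul_add_one]
      have : ∀ i, (fun x => Motion.left.move x)^[i] ((K : Ordinal.{u}) * η' + (i : Ordinal.{u}))
          = (K : Ordinal.{u}) * η' := by
        intro i
        induction i with
        | zero => simp
        | succ i ih =>
          rw [Function.iterate_succ_apply, Nat.cast_succ, ← add_assoc, move_left_add_one, ih]
      exact this K
    · refine ⟨0, hpos, ?_⟩
      have hN := mul_isNormal (natCast_pos' K : (0 : Ordinal.{u}) < (K : Ordinal.{u}))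
      have hlim : IsSuccLimit ((K : Ordinal.{u}) * η) := hN.map_isSuccLimit hl
      obtain ⟨k, rfl⟩ : ∃ k, K = k + 1 := ⟨K - 1, by omega⟩
      rw [mul_zero, Function.iterate_succ_apply, move_left_limit hlim]
      exact Function.iterate_fixed move_left_zero k
  rw [h3] at last
  exact last.trans (ih η' h2)

theorem scanMid_or {U U' : Ordinal.{u} → Fin K → WithBot A} {η : Ordinal.{u}} {s : Snapshot.{u} A}
    (h : ScanMid n U U' η s) : nodeStart A K n ≤ s.state ∧
      ∀ γ, s.tape γ = flatten U γ ∨ s.tape γ = flatten U' γ := by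
  obtain ⟨h2, ⟨i, h3⟩, -⟩ := h
  refine ⟨h2, fun γ => ?_⟩
  rw [h3]
  exact scanCells_or ..

/-- The scan of an instruction. -/
theorem leads_instr_scan (hrun : IsRun P c) (hI : Implements P n I)
    (U U' : Ordinal.{u} → Fin K → WithBot A) (ν : Ordinal.{u}) (b : Bool)
    (hU : ∀ η < ν, I.g (U η) = (U' η, none)) (hν : I.g (U ν) = (U' ν, some b))
    (hgt : ∀ η, ν < η → U' η = U η) :
    Leads c ⟨flatten U, nodeStart A K n, 0⟩
      ⟨flatten U', nodeState A K n (.home b 0), (K : Ordinal.{u}) * ν⟩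
      (fun s => nodeStart A K n ≤ s.state ∧
        ∀ γ, s.tape γ = flatten U γ ∨ s.tape γ = flatten U' γ) := by
  have h2 := leadsE_scan hrun hI U U' ν hU
  have h3 := leads_scan_cell hrun hI U U' ν (by rw [hν])
  rw [hν] at h3
  dsimp only at h3
  have e : scanCells U U' (ν + 1) K = U' := by
    funext η s
    rcases lt_or_ge η (ν + 1) with h | h
    · rw [scanCells_lt _ _ _ h]
    · have : U η = U' η := (hgt η (add_one_le_iff.1 h)).symm
      rcases scanCells_or U U' (ν + 1) K η s with h4 | h4
      · rw [h4, this]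
      · exact h4
  rw [e] at h3
  refine LeadsE.transS (h2.mono fun s hs => ?_) (h3.mono fun s hs => scanMid_or hs)
  obtain ⟨η, -, h5⟩ := hs
  exact scanMid_or h5

/-- The execution of an instruction. -/
theorem leads_instr (hrun : IsRun P c) (hI : Implements P n I) (hh : I.homing = true)
    (U U' : Ordinal.{u} → Fin K → WithBot A) (ν : Ordinal.{u}) (b : Bool)
    (hU : ∀ η < ν, I.g (U η) = (U' η, none)) (hν : I.g (U ν) = (U' ν, some b))
    (hgt : ∀ η, ν < η → U' η = U η) (h0 : U' 0 0 ≠ ⊥) (h1 : ∀ η, 0 < η → U' η 0 = ⊥) :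
    Leads c ⟨flatten U, nodeStart A K n, 0⟩ ⟨flatten U', I.exit b, 0⟩
      (fun s => nodeStart A K n ≤ s.state ∧
        ∀ γ, s.tape γ = flatten U γ ∨ s.tape γ = flatten U' γ) :=
  (leads_instr_scan hrun hI U U' ν b hU hν hgt).trans
    ((leads_go_home hrun hI hh b U' h0 h1 ν).mono
      fun s hs => ⟨hs.1, fun γ => Or.inr (by rw [hs.2])⟩)

/-- The execution of an instruction that does not go home. -/
theorem leads_instr_final (hrun : IsRun P c) (hI : Implements P n I) (hh : I.homing = false)
    (U U' : Ordinal.{u} → Fin K → WithBot A) (ν : Ordinal.{u}) (b : Bool)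
    (hU : ∀ η < ν, I.g (U η) = (U' η, none)) (hν : I.g (U ν) = (U' ν, some b))
    (hgt : ∀ η, ν < η → U' η = U η) :
    Leads c ⟨flatten U, nodeStart A K n, 0⟩ ⟨flatten U', I.exit b, (K : Ordinal.{u}) * ν⟩
      (fun s => nodeStart A K n ≤ s.state) := by
  have := hrun.leads_keep (T := flatten U') (hd := (K : Ordinal.{u}) * ν) (m := .stay)
    (Φ := fun s => nodeStart A K n ≤ s.state) (q := nodeState A K n (.home b 0)) (q' := I.exit b)
    (by rw [hI, Instr.tr, if_pos]; exact ⟨by simp, Or.inr hh⟩) (nodeStart_le _ _)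
  rw [move_stay] at this
  exact ((leads_instr_scan hrun hI U U' ν b hU hν hgt).mono fun s hs => hs.1).trans this

end Supercells

/-! ### A structured language on supercells and its semantics. -/

section Language

variable {A : Type v} [Fintype A] [LinearOrder A] {K : ℕ} [NeZero K] {V : Type}

/-- An assignment of slots to variables; slot `0` is reserved. -/
structure Layout (V : Type) (K : ℕ) [NeZero K] where
  pos : V → Fin K
  inj : Function.Injective pos
  ne_zero : ∀ v, pos v ≠ 0

/-- The contents of the variables. -/
abbrev Cfg (V : Type) (A : Type v) : Type (max (u + 1) v) := V → Ordinal.{u} → WithBot A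

open Classical in
/-- The supercells for given contents of the variables. The home cell is marked by `one`. -/
noncomputable def Layout.cells (ℓ : Layout V K) (one : A) (σ : Cfg.{u} V A) :
    Ordinal.{u} → Fin K → WithBot A :=
  fun η => Function.extend ℓ.pos (fun v => σ v η) fun s => if s = 0 ∧ η = 0 then (one : WithBot A) else ⊥

/-- The tape for given contents of the variables. -/
noncomputable def Layout.tape (ℓ : Layout V K) (one : A) (σ : Cfg.{u} V A) : Tape.{u} A :=
  flatten (ℓ.cells one σ)

theorem Layout.cells_pos (ℓ : Layout V K) (one : A) (σ : Cfg.{u} V A) (η : Ordinal.{u}) (v : V) :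
    ℓ.cells one σ η (ℓ.pos v) = σ v η := ℓ.inj.extend_apply _ _ _

theorem Layout.cells_of_ne (ℓ : Layout V K) (one : A) (σ : Cfg.{u} V A) (η : Ordinal.{u}) {s : Fin K}
    (h : ¬ ∃ v, ℓ.pos v = s) : ℓ.cells one σ η s = if s = 0 ∧ η = 0 then (one : WithBot A) else ⊥ :=
  Function.extend_apply' _ _ _ h

theorem Layout.cells_zero (ℓ : Layout V K) (one : A) (σ : Cfg.{u} V A) (η : Ordinal.{u}) :
    ℓ.cells one σ η 0 = if η = 0 then (one : WithBot A) else ⊥ := by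
  rw [ℓ.cells_of_ne one σ η (fun ⟨v, hv⟩ => ℓ.ne_zero v hv)]
  simp

theorem Layout.cells_mono (ℓ : Layout V K) (one : A) {σ σ' : Cfg.{u} V A} (h : σ ≤ σ') :
    ℓ.cells one σ ≤ ℓ.cells one σ' := by
  intro η s
  by_cases hs : ∃ v, ℓ.pos v = s
  · obtain ⟨v, rfl⟩ := hs
    rw [ℓ.cells_pos, ℓ.cells_pos]
    exact h v η
  · rw [ℓ.cells_of_ne _ _ _ hs, ℓ.cells_of_ne _ _ _ hs]

theorem Layout.tape_mono (ℓ : Layout V K) (one : A) {σ σ' : Cfg.{u} V A} (h : σ ≤ σ') :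
    ℓ.tape one σ ≤ ℓ.tape one σ' := flatten_mono (ℓ.cells_mono one h)

/-- The instruction on supercells for an instruction on variables. -/
noncomputable def Layout.instr (ℓ : Layout V K) (g : (V → WithBot A) → (V → WithBot A) × Option Bool)
    (ex : Bool → Ordinal.{u}) : Instr.{u} A K where
  g cell := (Function.extend ℓ.pos (g fun v => cell (ℓ.pos v)).1 cell, (g fun v => cell (ℓ.pos v)).2)
  exit := ex

variable {ℓ : Layout V K} {one : A} {P : Program.{u} A} {c : Ordinal.{u} → Snapshot.{u} A}

/-- A scan writes each cell at most once, directly from the old to the new content. So a common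
lower bound of the configurations before and after bounds the tape all the time. -/
theorem leads_layout_instr (hrun : IsRun P c) {n : Ordinal.{u}}
    {g : (V → WithBot A) → (V → WithBot A) × Option Bool} {ex : Bool → Ordinal.{u}}
    (hI : Implements P n (ℓ.instr g ex)) (σ σ' L : Cfg.{u} V A) (ν : Ordinal.{u}) (b : Bool)
    (h1 : ∀ η < ν, g (fun v => σ v η) = (fun v => σ' v η, none))
    (h2 : g (fun v => σ v ν) = (fun v => σ' v ν, some b))
    (h3 : ∀ η, ν < η → ∀ v, σ' v η = σ v η) (hL : L ≤ σ) (hL' : L ≤ σ') :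
    Leads c ⟨ℓ.tape one σ, nodeStart A K n, 0⟩ ⟨ℓ.tape one σ', ex b, 0⟩
      (fun s => nodeStart A K n ≤ s.state ∧ ℓ.tape one L ≤ s.tape) := by
  have hg : ∀ η b, g (fun v => σ v η) = (fun v => σ' v η, b) →
      (ℓ.instr g ex).g (ℓ.cells one σ η) = (ℓ.cells one σ' η, b) := by
    intro η b hb
    simp only [Layout.instr, ℓ.cells_pos, hb]
    congr 1
    funext s
    by_cases hs : ∃ v, ℓ.pos v = s
    · obtain ⟨v, rfl⟩ := hs
      rw [ℓ.inj.extend_apply, ℓ.cells_pos]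
    · rw [Function.extend_apply' _ _ _ hs, ℓ.cells_of_ne _ _ _ hs, ℓ.cells_of_ne _ _ _ hs]
  refine (leads_instr hrun hI rfl (ℓ.cells one σ) (ℓ.cells one σ') ν b (fun η hη => hg η _ (h1 η hη))
    (hg ν _ h2) (fun η hη => ?_) ?_ ?_).mono fun s hs => ⟨hs.1, fun γ => ?_⟩
  · funext s
    by_cases hs : ∃ v, ℓ.pos v = s
    · obtain ⟨v, rfl⟩ := hs
      rw [ℓ.cells_pos, ℓ.cells_pos, h3 η hη]
    · rw [ℓ.cells_of_ne _ _ _ hs, ℓ.cells_of_ne _ _ _ hs]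
  · rw [ℓ.cells_zero]; simp
  · intro η hη
    rw [ℓ.cells_zero, if_neg hη.ne']
  · rcases hs.2 γ with h | h <;> rw [h]
    · exact ℓ.tape_mono one hL γ
    · exact ℓ.tape_mono one hL' γ

/-- Commands of the register language. A primitive command rewrites the supercells from left to right
until it says to stop, and a test reads the supercells from left to right until it has a result. -/
inductive Cmd (V : Type) (A : Type v) : Type v
  | prim (g : (V → WithBot A) → (V → WithBot A) × Bool)
  | seq (a b : Cmd V A)
  | ite (t : (V → WithBot A) → Option Bool) (a b : Cmd V A)
  | whl (t : (V → WithBot A) → Option Bool) (a : Cmd V A)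

/-- The number of nodes of the code for a command. -/
def Cmd.size : Cmd V A → ℕ
  | prim _ => 1
  | seq a b => a.size + b.size
  | ite _ a b => 1 + a.size + b.size
  | whl _ a => 1 + a.size

/-- The instruction for a primitive command. -/
noncomputable def Layout.primInstr (ℓ : Layout V K) (g : (V → WithBot A) → (V → WithBot A) × Bool)
    (e : Ordinal.{u}) : Instr.{u} A K :=
  ℓ.instr (fun x => ((g x).1, if (g x).2 then some true else none)) fun _ => e

/-- The instruction for a test. -/
noncomputable def Layout.testInstr (ℓ : Layout V K) (t : (V → WithBot A) → Option Bool)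
    (e e' : Ordinal.{u}) : Instr.{u} A K :=
  ℓ.instr (fun x => (x, t x)) fun b => if b then e else e'

/-- The code for a command at node `b` is part of the program, with exit to state `e`. -/
def Installed (ℓ : Layout V K) (P : Program.{u} A) : Cmd V A → Ordinal.{u} → Ordinal.{u} → Prop
  | .prim g, b, e => Implements P b (ℓ.primInstr g e)
  | .seq a a', b, e =>
    Installed ℓ P a b (nodeStart A K (b + (a.size : Ordinal.{u}))) ∧
      Installed ℓ P a' (b + (a.size : Ordinal.{u})) e
  | .ite t a a', b, e =>
    Implements P b (ℓ.testInstr t (nodeStart A K (b + 1))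
      (nodeStart A K (b + 1 + (a.size : Ordinal.{u})))) ∧
    Installed ℓ P a (b + 1) e ∧ Installed ℓ P a' (b + 1 + (a.size : Ordinal.{u})) e
  | .whl t a, b, e =>
    Implements P b (ℓ.testInstr t (nodeStart A K (b + 1)) e) ∧
      Installed ℓ P a (b + 1) (nodeStart A K b)

/-- The code for a command. -/
noncomputable def Cmd.code (ℓ : Layout V K) :
    Cmd V A → Ordinal.{u} → Ordinal.{u} → Ordinal.{u} → Option (Instr.{u} A K)
  | prim g, b, e, n => if n = b then some (ℓ.primInstr g e) else none
  | seq a a', b, e, n =>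
    if n < b + (a.size : Ordinal.{u}) then
      code ℓ a b (nodeStart A K (b + (a.size : Ordinal.{u}))) n
    else code ℓ a' (b + (a.size : Ordinal.{u})) e n
  | ite t a a', b, e, n =>
    if n = b then some (ℓ.testInstr t (nodeStart A K (b + 1))
      (nodeStart A K (b + 1 + (a.size : Ordinal.{u}))))
    else if n < b + 1 + (a.size : Ordinal.{u}) then code ℓ a (b + 1) e n
    else code ℓ a' (b + 1 + (a.size : Ordinal.{u})) e n
  | whl t a, b, e, n =>
    if n = b then some (ℓ.testInstr t (nodeStart A K (b + 1)) e)
    else code ℓ a (b + 1) (nodeStart A K b) n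

theorem installed_of_code (a : Cmd V A) (b e : Ordinal.{u})
    (h : ∀ n, b ≤ n → n < b + (a.size : Ordinal.{u}) → ∀ I, a.code ℓ b e n = some I →
      Implements P n I) : Installed ℓ P a b e := by
  induction a generalizing b e with
  | prim g =>
    refine h b le_rfl ?_ _ (if_pos rfl)
    simp [Cmd.size]
  | seq a a' iha iha' =>
    have e1 : b + ((Cmd.seq a a').size : Ordinal.{u})
        = b + (a.size : Ordinal.{u}) + (a'.size : Ordinal.{u}) := by
      rw [Cmd.size, Nat.cast_add, add_assoc]
    rw [e1] at h
    refine ⟨iha _ _ fun n h1 h2 I hI => h n h1 (h2.trans_le le_self_add) I ?_,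
      iha' _ _ fun n h1 h2 I hI => h n (le_self_add.trans h1) h2 I ?_⟩
    · rw [Cmd.code, if_pos h2, hI]
    · rw [Cmd.code, if_neg (not_lt.2 h1), hI]
  | ite t a a' iha iha' =>
    have e1 : b + ((Cmd.ite t a a').size : Ordinal.{u})
        = b + 1 + (a.size : Ordinal.{u}) + (a'.size : Ordinal.{u}) := by
      rw [Cmd.size, Nat.cast_add, Nat.cast_add, Nat.cast_one, add_assoc, add_assoc, add_assoc]
    rw [e1] at h
    refine ⟨h b le_rfl (((lt_add_one b).trans_le le_self_add).trans_le le_self_add) _ (if_pos rfl),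
      iha _ _ fun n h1 h2 I hI => h n (le_self_add.trans h1) (h2.trans_le le_self_add) I ?_,
      iha' _ _ fun n h1 h2 I hI => h n ((le_self_add.trans le_self_add).trans h1) h2 I ?_⟩
    · rw [Cmd.code, if_neg (add_one_le_iff.1 h1).ne', if_pos h2, hI]
    · rw [Cmd.code, if_neg (add_one_le_iff.1 (le_self_add.trans h1)).ne', if_neg (not_lt.2 h1), hI]
  | whl t a iha =>
    have e1 : b + ((Cmd.whl t a).size : Ordinal.{u}) = b + 1 + (a.size : Ordinal.{u}) := by
      rw [Cmd.size, Nat.cast_add, Nat.cast_one, add_assoc]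
    rw [e1] at h
    refine ⟨h b le_rfl ((lt_add_one b).trans_le le_self_add) _ (if_pos rfl),
      iha _ _ fun n h1 h2 I hI => h n (le_self_add.trans h1) h2 I ?_⟩
    rw [Cmd.code, if_neg (add_one_le_iff.1 h1).ne', hI]

/-- The command `a` transforms `σ` into `σ'`, and all variables are at least `L` meanwhile. -/
def Sem (ℓ : Layout V K) (one : A) (a : Cmd V A) (σ σ' L : Cfg.{u} V A) : Prop :=
  L ≤ σ ∧ L ≤ σ' ∧
  ∀ (P : Program.{u} A) (c : Ordinal.{u} → Snapshot.{u} A) (b e : Ordinal.{u}), IsRun P c →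
    Installed ℓ P a b e →
    Leads c ⟨ℓ.tape one σ, nodeStart A K b, 0⟩ ⟨ℓ.tape one σ', e, 0⟩
      (fun s => nodeStart A K b ≤ s.state ∧ ℓ.tape one L ≤ s.tape)

/-- The test `t` has result `b`. -/
def Tst (t : (V → WithBot A) → Option Bool) (σ : Cfg.{u} V A) (b : Bool) : Prop :=
  ∃ ν, (∀ η < ν, t (fun v => σ v η) = none) ∧ t (fun v => σ v ν) = some b

variable {σ σ' σ'' L L' : Cfg.{u} V A} {a a' : Cmd V A} {t : (V → WithBot A) → Option Bool}

theorem Sem.mono (h : Sem ℓ one a σ σ' L) (hL : L' ≤ L) : Sem ℓ one a σ σ' L' :=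
  ⟨hL.trans h.1, hL.trans h.2.1, fun P c b e hrun hi => (h.2.2 P c b e hrun hi).mono fun s hs => ⟨hs.1, (ℓ.tape_mono one hL).trans hs.2⟩⟩

theorem sem_prim {g : (V → WithBot A) → (V → WithBot A) × Bool} (ν : Ordinal.{u})
    (h1 : ∀ η < ν, g (fun v => σ v η) = (fun v => σ' v η, false))
    (h2 : g (fun v => σ v ν) = (fun v => σ' v ν, true))
    (h3 : ∀ η, ν < η → ∀ v, σ' v η = σ v η) (hL : L ≤ σ) (hL' : L ≤ σ') :
    Sem ℓ one (.prim g) σ σ' L := ⟨hL, hL', fun P c b e hrun hi =>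
  leads_layout_instr hrun hi σ σ' L ν true (fun η hη => by simp [h1 η hη]) (by simp [h2]) h3 hL hL'⟩

theorem leads_test (hrun : IsRun P c) {b e e' : Ordinal.{u}} {r : Bool}
    (hi : Implements P b (ℓ.testInstr t e e')) (ht : Tst t σ r) (hL : L ≤ σ) :
    Leads c ⟨ℓ.tape one σ, nodeStart A K b, 0⟩ ⟨ℓ.tape one σ, if r then e else e', 0⟩
      (fun s => nodeStart A K b ≤ s.state ∧ ℓ.tape one L ≤ s.tape) := by
  obtain ⟨ν, h1, h2⟩ := ht
  exact leads_layout_instr hrun hi σ σ L ν r (fun η hη => by simp [h1 η hη]) (by simp [h2])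
    (fun _ _ _ => rfl) hL hL

theorem nodeStart_mono {b b' : Ordinal.{u}} (h : b ≤ b') : nodeStart A K b ≤ nodeStart A K b' :=
  nodeStart_isNormal.strictMono.monotone h

/-- The second part may assume `L ≤ σ'`, so in a chain of commands the bound is handed on and has to
be supplied only at the beginning. -/
theorem Sem.seq (h : Sem ℓ one a σ σ' L) (h' : L ≤ σ' → Sem ℓ one a' σ' σ'' L) :
    Sem ℓ one (.seq a a') σ σ'' L := ⟨h.1, (h' h.2.1).2.1, fun P c b e hrun hi =>
  (h.2.2 P c b _ hrun hi.1).trans (((h' h.2.1).2.2 P c _ e hrun hi.2).mono fun s hs =>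
    ⟨(nodeStart_mono le_self_add).trans hs.1, hs.2⟩)⟩

theorem Sem.ite_true (ht : Tst t σ true) (h : Sem ℓ one a σ σ' L) :
    Sem ℓ one (.ite t a a') σ σ' L := ⟨h.1, h.2.1, fun P c b e hrun hi =>
  (leads_test hrun hi.1 ht h.1).trans ((h.2.2 P c _ e hrun hi.2.1).mono fun s hs =>
    ⟨(nodeStart_mono le_self_add).trans hs.1, hs.2⟩)⟩

theorem Sem.ite_false (ht : Tst t σ false) (h : Sem ℓ one a' σ σ' L) :
    Sem ℓ one (.ite t a a') σ σ' L := ⟨h.1, h.2.1, fun P c b e hrun hi =>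
  (leads_test hrun hi.1 ht h.1).trans ((h.2.2 P c _ e hrun hi.2.2).mono fun s hs =>
    ⟨(nodeStart_mono (le_self_add.trans le_self_add)).trans hs.1, hs.2⟩)⟩

/-- All states of the loop are at least the first state of its node, and the loop heads are in this
state with the head on cell `0`; this fixes state and head at the limit. In round `μ` every cell is
at least the minimum of its contents at the heads `μ` and `μ + 1`, so the inferior limit over all
times equals the one over the loop heads. -/
theorem loopLimit_cfg {b : Ordinal.{u}} (s : Ordinal.{u} → Cfg.{u} V A) {l : Ordinal.{u}}
    (hl : IsSuccLimit l) (hlim : ∀ v η, TLim (fun μ => s μ v η) l (s l v η)) :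
    LoopLimit (fun μ => ⟨ℓ.tape one (s μ), nodeStart A K b, 0⟩)
      (fun μ m => nodeStart A K b ≤ m.state ∧ ℓ.tape one (s μ ⊓ s (μ + 1)) ≤ m.tape) l
      ⟨ℓ.tape one (s l), nodeStart A K b, 0⟩ := by
  have hT : ∀ γ, TLim (fun μ => ℓ.tape one (s μ) γ) l (ℓ.tape one (s l) γ) := by
    intro γ
    obtain ⟨η, i, rfl⟩ := exists_slot K γ
    simp only [Layout.tape, flatten_apply]
    by_cases hs : ∃ v, ℓ.pos v = i
    · obtain ⟨v, rfl⟩ := hs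
      simp only [ℓ.cells_pos]
      exact hlim v η
    · simp only [ℓ.cells_of_ne _ _ _ hs]
      exact tlim_const 0 hl.bot_lt (fun _ _ _ => rfl)
  have hinf : ∀ (σ σ' : Cfg.{u} V A) (γ : Ordinal.{u}),
      ℓ.tape one (σ ⊓ σ') γ = ℓ.tape one σ γ ⊓ ℓ.tape one σ' γ := by
    intro σ σ' γ
    obtain ⟨η, i, rfl⟩ := exists_slot K γ
    simp only [Layout.tape, flatten_apply]
    by_cases hs : ∃ v, ℓ.pos v = i
    · obtain ⟨v, rfl⟩ := hs
      simp only [ℓ.cells_pos, Pi.inf_apply]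
    · simp only [ℓ.cells_of_ne _ _ _ hs, inf_idem]
  refine ⟨⟨0, hl.bot_lt, fun μ _ _ m hm => hm.1⟩, fun ν hν => ⟨ν, le_rfl, hν, rfl, le_rfl⟩,
    fun b hb => absurd hb not_lt_zero, fun γ => ?_, fun γ ν hν => ?_⟩
  · obtain ⟨ν, h1, h2⟩ := (hT γ).1
    refine ⟨ν, h1, fun μ h3 h4 m hm => le_trans ?_ (hm.2 γ)⟩
    rw [hinf]
    exact le_inf (h2 μ h3 h4) (h2 _ (h3.trans (lt_add_one μ).le) (hl.add_one_lt h4))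
  · exact (hT γ).2 ν hν

theorem leads_whl_round (hrun : IsRun P c) {b e : Ordinal.{u}} (hi : Installed ℓ P (.whl t a) b e)
    (ht : Tst t σ true) (h : Sem ℓ one a σ σ' (σ ⊓ σ')) :
    Leads c ⟨ℓ.tape one σ, nodeStart A K b, 0⟩ ⟨ℓ.tape one σ', nodeStart A K b, 0⟩
      (fun m => nodeStart A K b ≤ m.state ∧ ℓ.tape one (σ ⊓ σ') ≤ m.tape) :=
  (leads_test hrun hi.1 ht inf_le_left).trans ((h.2.2 P c _ _ hrun hi.2).mono fun s hs =>
    ⟨(nodeStart_mono le_self_add).trans hs.1, hs.2⟩)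

/-- The loop as a whole may have a weak lower bound `L`, but each round has to respect the strongest
possible one, the minimum of the configurations before and after it. This is what makes
`loopLimit_cfg` applicable. -/
theorem sem_whl (s : Ordinal.{u} → Cfg.{u} V A) (Λ : Ordinal.{u})
    (ht : ∀ μ < Λ, Tst t (s μ) true) (hf : Tst t (s Λ) false)
    (hb : ∀ μ < Λ, Sem ℓ one a (s μ) (s (μ + 1)) (s μ ⊓ s (μ + 1)))
    (hlim : ∀ l ≤ Λ, IsSuccLimit l → ∀ v η, TLim (fun μ => s μ v η) l (s l v η))
    (hL : ∀ μ ≤ Λ, L ≤ s μ) : Sem ℓ one (.whl t a) (s 0) (s Λ) L := by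
  refine ⟨hL 0 zero_le, hL Λ le_rfl, fun P c b e hrun hi => ?_⟩
  have h1 := hrun.leadsE_loop Λ (fun μ => ⟨ℓ.tape one (s μ), nodeStart A K b, 0⟩)
    (fun μ m => nodeStart A K b ≤ m.state ∧ ℓ.tape one (s μ ⊓ s (μ + 1)) ≤ m.tape)
    (fun m => nodeStart A K b ≤ m.state ∧ ℓ.tape one L ≤ m.tape)
    (fun μ hμ => leads_whl_round hrun hi (ht μ hμ) (hb μ hμ))
    (fun l hl1 hl => loopLimit_cfg s hl (hlim l hl1 hl))
    (fun μ hμ m hm => ⟨hm.1, (ℓ.tape_mono one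
      (le_inf (hL μ hμ.le) (hL _ (add_one_le_of_lt hμ)))).trans hm.2⟩)
  exact h1.transS (leads_test hrun hi.1 hf (hL Λ le_rfl))

/-- A loop whose test never fails runs forever. -/
theorem whl_diverges (hrun : IsRun P c) {b e : Ordinal.{u}} (hi : Installed ℓ P (.whl t a) b e)
    (s : Ordinal.{u} → Cfg.{u} V A) (ht : ∀ μ, Tst t (s μ) true)
    (hb : ∀ μ, Sem ℓ one a (s μ) (s (μ + 1)) (s μ ⊓ s (μ + 1)))
    (hlim : ∀ l, IsSuccLimit l → ∀ v η, TLim (fun μ => s μ v η) l (s l v η))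
    (γ : Ordinal.{u}) (hγ : c γ = ⟨ℓ.tape one (s 0), nodeStart A K b, 0⟩) (ξ : Ordinal.{u})
    (hξ : γ ≤ ξ) : nodeStart A K b ≤ (c ξ).state := by
  -- A loop of `ξ + 1` rounds lasts at least `ξ + 1` steps, so these rounds cover the time `ξ`.
  obtain ⟨γ', h1, -, h3⟩ := hrun.loop (ξ + 1)
    (fun μ m => m = ⟨ℓ.tape one (s μ), nodeStart A K b, 0⟩)
    (fun μ m => nodeStart A K b ≤ m.state ∧ ℓ.tape one (s μ ⊓ s (μ + 1)) ≤ m.tape)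
    (fun μ hμ m hm => ⟨_, rfl, hm ▸ leads_whl_round hrun hi (ht μ) (hb μ)⟩)
    (fun l hl1 hl s' hs' => ⟨_, rfl, by
      obtain ⟨a1, a2, a3, a4, a5⟩ := loopLimit_cfg (ℓ := ℓ) (one := one) (b := b) s hl (hlim l hl)
      refine ⟨a1, fun ν hν => ?_, a3, a4, fun η ν hν => ?_⟩
      · obtain ⟨μ, b1, b2, b3⟩ := a2 ν hν
        exact ⟨μ, b1, b2, by rwa [hs' μ b2]⟩
      · obtain ⟨μ, b1, b2, b3⟩ := a5 η ν hν
        exact ⟨μ, b1, b2, by rwa [hs' μ b2]⟩⟩) γ hγ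
  obtain ⟨μ, -, h4⟩ := h3 ξ hξ ((lt_add_one ξ).trans_le (le_add_self.trans h1))
  exact h4.1

end Language

/-! ### Unary registers, tests, and ordinal addition and multiplication. -/

section Primitives

variable {A : Type v} [Fintype A] [LinearOrder A] {K : ℕ} [NeZero K] {V : Type} [DecidableEq V]

open Classical in
/-- The unary representation of an ordinal. -/
noncomputable def un (one : A) (ρ : Ordinal.{u}) : Ordinal.{u} → WithBot A :=
  fun η => if η < ρ then (one : WithBot A) else ⊥

theorem un_eq_bot {one : A} {ρ η : Ordinal.{u}} : un one ρ η = ⊥ ↔ ρ ≤ η := by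
  rw [un, ← not_lt]; split_ifs with h <;> simp [h]

theorem un_of_lt {one : A} {ρ η : Ordinal.{u}} (h : η < ρ) : un one ρ η = one := if_pos h

theorem un_of_le {one : A} {ρ η : Ordinal.{u}} (h : ρ ≤ η) : un one ρ η = ⊥ := un_eq_bot.2 h

theorem un_zero (one : A) : un one (0 : Ordinal.{u}) = ⊥ := funext fun η => un_of_le zero_le

theorem un_mono {one : A} {ρ ρ' : Ordinal.{u}} (h : ρ ≤ ρ') : un one ρ ≤ un one ρ' := by
  intro η
  rcases lt_or_ge η ρ with h1 | h1
  · rw [un_of_lt h1, un_of_lt (h1.trans_le h)]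
  · rw [un_of_le h1]; exact bot_le

theorem un_succ (one : A) (ρ : Ordinal.{u}) : Function.update (un one ρ) ρ one = un one (ρ + 1) := by
  funext η
  rw [Function.update_apply]
  split_ifs with h
  · rw [h, un_of_lt (lt_add_one ρ)]
  · rw [un, un]
    simp only [lt_add_one_iff, le_iff_lt_or_eq, h, or_false]

theorem RLim.tlim_un {one : A} {f : Ordinal.{u} → Ordinal.{u}} {l v : Ordinal.{u}} (h : RLim f l v)
    (hl : IsSuccLimit l) (η : Ordinal.{u}) : TLim (fun μ => un one (f μ) η) l (un one v η) :=
  h.tlim_unary hl.bot_lt η bot_le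

theorem le_up {L σ : Cfg.{u} V A} (h : L ≤ σ) {v : V} {x : Ordinal.{u} → WithBot A} (hx : L v ≤ x) :
    L ≤ Function.update σ v x := le_update_iff.2 ⟨hx, fun j _ => h j⟩

namespace Cmd

/-- The command that does nothing. -/
def nop : Cmd V A := prim fun x => (x, true)

/-- `r := 0` -/
def zero (r : V) : Cmd V A :=
  prim fun x => if x r = ⊥ then (x, true) else (Function.update x r ⊥, false)

/-- `r := r + 1` -/
def inc (one : A) (r : V) : Cmd V A :=
  prim fun x => if x r = ⊥ then (Function.update x r (one : WithBot A), true) else (x, false)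

/-- `r := r'` -/
def cpy (r r' : V) : Cmd V A :=
  prim fun x => if x r = ⊥ ∧ x r' = ⊥ then (x, true) else (Function.update x r (x r'), false)

/-- Apply `f` to the supercell with number `r`. -/
def upd (r : V) (f : (V → WithBot A) → V → WithBot A) : Cmd V A :=
  prim fun x => if x r = ⊥ then (f x, true) else (x, false)

/-- `v[r] := d` -/
def put (r v : V) (d : WithBot A) : Cmd V A := upd r fun x => Function.update x v d

/-- The test `r ≠ r'`. -/
def tNe (r r' : V) (x : V → WithBot A) : Option Bool :=
  if x r = ⊥ then some (decide (x r' ≠ ⊥)) else if x r' = ⊥ then some true else none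

/-- The test `p` on the supercell with number `r`. -/
def tAt (r : V) (p : (V → WithBot A) → Bool) (x : V → WithBot A) : Option Bool :=
  if x r = ⊥ then some (p x) else none

/-- The test `r = 0`. -/
def tZero (r : V) (x : V → WithBot A) : Option Bool := some (decide (x r = ⊥))

/-- Execute the command `F i` for the first `i` in the list for which `p i` holds in the supercell with
number `r`. -/
def sel {ι : Type*} (r : V) (p : ι → (V → WithBot A) → Bool) (F : ι → Cmd V A) : List ι → Cmd V A
  | [] => nop
  | i :: l => ite (tAt r (p i)) (F i) (sel r p F l)

end Cmd

open Cmd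

variable {ℓ : Layout V K} {one : A} {σ σ' σ'' L : Cfg.{u} V A} {a a' : Cmd V A} {r r' v w : V} {ρ ρ' : Ordinal.{u}}

theorem upd_apply {σ : Cfg.{u} V A} {r : V} {x : Ordinal.{u} → WithBot A} (η : Ordinal.{u}) :
    (fun v => Function.update σ r x v η) = Function.update (fun v => σ v η) r (x η) := by
  funext v
  rw [Function.update_apply, Function.update_apply]
  split_ifs <;> rfl

theorem sem_nop (hL : L ≤ σ) : Sem ℓ one nop σ σ L :=
  sem_prim 0 (fun η h => absurd h not_lt_zero) rfl (fun _ _ _ => rfl) hL hL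

theorem sem_zero (h : σ r = un one ρ) (hL : L ≤ σ) (hL' : L r ≤ ⊥) :
    Sem ℓ one (zero r) σ (Function.update σ r ⊥) L := by
  refine sem_prim ρ (fun η hη => ?_) ?_ (fun η hη v => ?_) hL (le_up hL hL')
  · rw [if_neg (by simp [h, un_eq_bot, hη]), upd_apply]; rfl
  · rw [if_pos (by simp [h, un_eq_bot]), upd_apply]
    congr 1
    rw [eq_comm, Function.update_eq_self_iff]
    simp [h, un_of_le]
  · rw [Function.update_apply]
    split_ifs with h1
    · simp [h1, h, un_of_le hη.le]
    · rfl

theorem sem_upd {f : (V → WithBot A) → V → WithBot A} (h : σ r = un one ρ)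
    (hσ' : ∀ v η, σ' v η = if η = ρ then f (fun v => σ v ρ) v else σ v η) (hL : L ≤ σ)
    (hL' : L ≤ σ') : Sem ℓ one (upd r f) σ σ' L := by
  refine sem_prim ρ (fun η hη => ?_) ?_ (fun η hη v => ?_) hL hL'
  · rw [if_neg (by simp [h, un_eq_bot, hη])]
    simp [hσ', hη.ne]
  · rw [if_pos (by simp [h, un_eq_bot])]
    simp [hσ']
  · rw [hσ', if_neg hη.ne']

theorem sem_put {d : WithBot A} (h : σ r = un one ρ) (hL : L ≤ σ)
    (hL' : L v ≤ Function.update (σ v) ρ d) :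
    Sem ℓ one (put r v d) σ (Function.update σ v (Function.update (σ v) ρ d)) L := by
  refine sem_upd h (fun w η => ?_) hL (le_up hL hL')
  by_cases hw : w = v
  · subst hw
    simp only [Function.update_self, Function.update_apply]
  · simp only [Function.update_of_ne hw]
    split_ifs with h1
    · rw [h1]
    · rfl

theorem sem_inc (h : σ r = un one ρ) (hL : L ≤ σ) :
    Sem ℓ one (inc one r) σ (Function.update σ r (un one (ρ + 1))) L := by
  have hle : un one ρ ≤ un one (ρ + 1) := un_mono (lt_add_one ρ).le
  have := sem_put (ℓ := ℓ) (v := r) (d := (one : WithBot A)) h hL (by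
    rw [h, un_succ]; exact (hL r).trans (h ▸ hle))
  rwa [h, un_succ] at this

theorem sem_cpy (h : σ r = un one ρ) (h' : σ r' = un one ρ') (hL : L ≤ σ) (hL' : L r ≤ un one ρ') :
    Sem ℓ one (cpy r r') σ (Function.update σ r (un one ρ')) L := by
  refine sem_prim (max ρ ρ') (fun η hη => ?_) ?_ (fun η hη v => ?_) hL (le_up hL hL')
  · rw [if_neg (by
      rintro ⟨h1, h2⟩
      dsimp only at h1 h2
      rw [h, un_eq_bot] at h1
      rw [h', un_eq_bot] at h2
      exact absurd hη (not_lt.2 (max_le h1 h2))), upd_apply]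
    dsimp only
    rw [h']
  · rw [if_pos ⟨by dsimp only; rw [h, un_of_le (le_max_left _ _)],
      by dsimp only; rw [h', un_of_le (le_max_right _ _)]⟩, upd_apply]
    congr 1
    rw [eq_comm, Function.update_eq_self_iff]
    rw [h, un_of_le (le_max_left _ _), un_of_le (le_max_right _ _)]
  · rw [Function.update_apply]
    split_ifs with h1
    · rw [h1, h, un_of_le ((le_max_left _ _).trans hη.le), un_of_le ((le_max_right _ _).trans hη.le)]
    · rfl

theorem tst_ne (h : σ r = un one ρ) (h' : σ r' = un one ρ') :
    Tst (tNe r r') σ (decide (ρ ≠ ρ')) := by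
  refine ⟨min ρ ρ', fun η hη => ?_, ?_⟩
  · rw [lt_min_iff] at hη
    rw [tNe, if_neg (by rw [h, un_eq_bot]; exact not_le.2 hη.1),
      if_neg (by rw [h', un_eq_bot]; exact not_le.2 hη.2)]
  · rcases lt_trichotomy ρ ρ' with h1 | h1 | h1
    · rw [min_eq_left h1.le, tNe, if_pos (by rw [h, un_of_le le_rfl])]
      simp [h', un_eq_bot, h1, h1.ne]
    · subst h1
      rw [min_self, tNe, if_pos (by rw [h, un_of_le le_rfl])]
      simp [h', un_eq_bot]
    · rw [min_eq_right h1.le, tNe, if_neg (by rw [h, un_eq_bot]; exact not_le.2 h1),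
        if_pos (by rw [h', un_of_le le_rfl])]
      simp [h1.ne']

theorem tst_at {p : (V → WithBot A) → Bool} (h : σ r = un one ρ) {b : Bool}
    (hb : p (fun v => σ v ρ) = b) : Tst (tAt r p) σ b := by
  refine ⟨ρ, fun η hη => ?_, ?_⟩
  · rw [tAt, if_neg (by rw [h, un_eq_bot]; exact not_le.2 hη)]
  · rw [tAt, if_pos (by rw [h, un_of_le le_rfl]), hb]

theorem tst_zero (h : σ r = un one ρ) : Tst (tZero r) σ (decide (ρ = 0)) := by
  refine ⟨0, fun η hη => absurd hη not_lt_zero, ?_⟩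
  rw [tZero]
  congr 1
  rw [h]
  simp only [un_eq_bot, le_zero_iff]

theorem sem_sel {ι : Type*} {p : ι → (V → WithBot A) → Bool} {F : ι → Cmd V A} (l : List ι)
    (h : σ r = un one ρ) {i : ι} (hi : i ∈ l) (hp : p i (fun v => σ v ρ) = true)
    (huniq : ∀ j ∈ l, p j (fun v => σ v ρ) = true → j = i) (hF : Sem ℓ one (F i) σ σ' L) :
    Sem ℓ one (sel r p F l) σ σ' L := by
  induction l with
  | nil => simp at hi
  | cons j l ih =>
    rcases hj : p j (fun v => σ v ρ) with _ | _
    · refine Sem.ite_false (tst_at h hj) (ih ?_ fun k hk => huniq k (List.mem_cons_of_mem _ hk))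
      rcases List.mem_cons.1 hi with rfl | h1
      · rw [hp] at hj; cases hj
      · exact h1
    · obtain rfl := huniq j List.mem_cons_self hj
      exact Sem.ite_true (tst_at h hj) hF

namespace Cmd

/-- `w[r'] := v[r]` -/
noncomputable def copyCell (r v r' w : V) : Cmd V A :=
  sel r (fun (d : WithBot A) x => decide (x v = d)) (fun d => put r' w d) Finset.univ.toList

/-- `r := r + r'`, with a counter `k` -/
def add (one : A) (r r' k : V) : Cmd V A :=
  seq (whl (tNe k r') (seq (inc one r) (inc one k))) (zero k)

/-- `r := s * r'` for `r = 0`, with counters `k`, `k'` -/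
def mul (one : A) (r s r' k k' : V) : Cmd V A :=
  seq (whl (tNe k' r') (seq (add one r s k) (inc one k'))) (zero k')

/-- Execute the commands `F i` for `i < n`. -/
def forTo (F : ℕ → Cmd V A) : ℕ → Cmd V A
  | 0 => nop
  | n + 1 => seq (forTo F n) (F n)

end Cmd

theorem sem_copyCell (h : σ r = un one ρ) (h' : σ r' = un one ρ') (hL : L ≤ σ)
    (hL' : L w ≤ Function.update (σ w) ρ' (σ v ρ)) :
    Sem ℓ one (copyCell r v r' w) σ (Function.update σ w (Function.update (σ w) ρ' (σ v ρ))) L :=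
  sem_sel _ h (i := σ v ρ) (Finset.mem_toList.2 (Finset.mem_univ _)) (by simp)
    (fun j _ hj => by simpa using (of_decide_eq_true hj).symm) (sem_put h' hL hL')

/-- `t` is the inferior limit of the contents `s μ` for `μ < l`. -/
def CLim (s : Ordinal.{u} → Cfg.{u} V A) (l : Ordinal.{u}) (t : Cfg.{u} V A) : Prop :=
  ∀ v η, TLim (fun μ => s μ v η) l (t v η)

theorem clim_const {l : Ordinal.{u}} (hl : IsSuccLimit l) (σ : Cfg.{u} V A) :
    CLim (fun _ => σ) l σ := fun v η => tlim_const 0 hl.bot_lt fun _ _ _ => rfl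

theorem CLim.update {s : Ordinal.{u} → Cfg.{u} V A} {l : Ordinal.{u}} {t : Cfg.{u} V A}
    (h : CLim s l t) {x : Ordinal.{u} → Ordinal.{u} → WithBot A} {y : Ordinal.{u} → WithBot A}
    (hx : ∀ η, TLim (fun μ => x μ η) l (y η)) (v : V) :
    CLim (fun μ => Function.update (s μ) v (x μ)) l (Function.update t v y) := by
  intro w η
  by_cases hw : w = v
  · subst hw
    simp only [Function.update_self]
    exact hx η
  · simp only [Function.update_of_ne hw]
    exact h w η

theorem Sem.to (h : Sem ℓ one a σ σ' L) (e : σ' = σ'') : Sem ℓ one a σ σ'' L := e ▸ h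

theorem Sem.of (h : Sem ℓ one a σ σ' L) (e : σ'' = σ) : Sem ℓ one a σ'' σ' L := e ▸ h

theorem sem_forTo {F : ℕ → Cmd V A} (s : ℕ → Cfg.{u} V A) (n : ℕ)
    (h : ∀ i < n, Sem ℓ one (F i) (s i) (s (i + 1)) L) (hL : L ≤ s 0) :
    Sem ℓ one (forTo F n) (s 0) (s n) L := by
  induction n with
  | zero => exact sem_nop hL
  | succ n ih => exact (ih fun i hi => h i (by omega)).seq fun _ => h n (by omega)

/-- A loop with a counter `k` that runs from `0` to the value of `s`. -/
theorem sem_count {s k : V} {ρs : Ordinal.{u}} {body : Cmd V A} (x : Ordinal.{u} → Cfg.{u} V A)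
    (hs : ∀ μ ≤ ρs, x μ s = un one ρs) (hk : ∀ μ ≤ ρs, x μ k = ⊥) (hsk : s ≠ k)
    (hb : ∀ μ < ρs, Sem ℓ one body (Function.update (x μ) k (un one μ))
      (Function.update (x (μ + 1)) k (un one μ))
      (Function.update (x μ) k (un one μ) ⊓ Function.update (x (μ + 1)) k (un one μ)))
    (hlim : ∀ l ≤ ρs, IsSuccLimit l → CLim x l (x l)) (hL : ∀ μ ≤ ρs, L ≤ x μ) :
    Sem ℓ one (seq (whl (tNe k s) (seq body (inc one k))) (zero k)) (x 0) (x ρs) L := by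
  have e : ∀ μ ≤ ρs, Function.update (x μ) k ⊥ = x μ := fun μ hμ => by
    rw [← hk μ hμ, Function.update_eq_self]
  have ht : ∀ μ ≤ ρs, Tst (tNe k s) (Function.update (x μ) k (un one μ)) (decide (μ ≠ ρs)) :=
    fun μ hμ => tst_ne (Function.update_self ..) (by rw [Function.update_of_ne hsk, hs μ hμ])
  have hle : ∀ {L' : Cfg.{u} V A} μ, μ ≤ ρs → L' ≤ x μ → L' ≤ Function.update (x μ) k (un one μ) :=
    fun μ hμ h => le_up h (((h k).trans (hk μ hμ).le).trans bot_le)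
  have h1 := sem_whl (ℓ := ℓ) (one := one) (L := L) (t := tNe k s) (a := seq body (inc one k))
    (fun μ => Function.update (x μ) k (un one μ)) ρs
    (fun μ hμ => by have := ht μ hμ.le; rwa [decide_eq_true hμ.ne] at this)
    (by simpa using ht ρs le_rfl) ?_ ?_ (fun μ hμ => hle μ hμ (hL μ hμ))
  · rw [un_zero, e 0 zero_le] at h1
    refine (h1.seq fun hL1 => sem_zero (Function.update_self ..) hL1 ?_).to ?_
    · exact (hL ρs le_rfl k).trans (hk ρs le_rfl).le
    · rw [Function.update_idem, e ρs le_rfl]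
  · intro μ hμ
    -- The bound for the loop involves the counter values `μ` and `μ + 1`. Their minimum is `μ`, the
    -- value that the counter has during the body.
    have hinf : Function.update (x μ) k (un one μ) ⊓ Function.update (x (μ + 1)) k (un one (μ + 1)) ≤
        Function.update (x μ) k (un one μ) ⊓ Function.update (x (μ + 1)) k (un one μ) := by
      refine le_inf inf_le_left fun v => ?_
      by_cases hv : v = k
      · subst hv
        rw [Function.update_self]
        exact inf_le_left.trans (Function.update_self ..).le
      · rw [Function.update_of_ne hv]
        exact inf_le_right.trans (Function.update_of_ne hv ..).le
    refine ((hb μ hμ).mono hinf).seq fun hL1 => (sem_inc (Function.update_self ..) hL1).to ?_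
    rw [Function.update_idem]
  · intro l hl1 hl
    exact (hlim l hl1 hl).update ((rlim_of_isNormal hl IsNormal.id).tlim_un hl) k

/-- Ordinal addition is continuous in its right argument. Repeated increments, with inferior limits
at limit times, therefore compute the sum, and since `r` only grows any lower bound is preserved. -/
theorem sem_add {s k : V} {ρs : Ordinal.{u}} (h : σ r = un one ρ) (hs : σ s = un one ρs)
    (hk : σ k = ⊥) (hrs : r ≠ s) (hrk : r ≠ k) (hsk : s ≠ k) (hL : L ≤ σ) :
    Sem ℓ one (add one r s k) σ (Function.update σ r (un one (ρ + ρs))) L := by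
  have hle : ∀ {L' : Cfg.{u} V A} μ, L' ≤ σ → L' ≤ Function.update σ r (un one (ρ + μ)) :=
    fun {L'} μ h' => le_up h' ((h ▸ h' r).trans (un_mono le_self_add))
  refine (sem_count (s := s) (k := k) (fun μ => Function.update σ r (un one (ρ + μ)))
    (fun μ _ => by rw [Function.update_of_ne hrs.symm, hs])
    (fun μ _ => by rw [Function.update_of_ne hrk.symm, hk]) hsk ?_
    (fun l _ hl => (clim_const hl σ).update ((rlim_of_isNormal hl (add_isNormal ρ)).tlim_un hl) r)
    (fun μ _ => hle μ hL)).of ?_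
  · intro μ hμ
    refine (sem_inc (ρ := ρ + μ) (by rw [Function.update_of_ne hrk, Function.update_self])
      inf_le_left).to ?_
    rw [Function.update_comm hrk.symm, Function.update_idem, add_assoc]
  · rw [add_zero, ← h, Function.update_eq_self]

/-- Multiplication with a positive left factor is continuous in the right argument, so iterated
addition is correct at limits as well. -/
theorem sem_mul {s k k' : V} {ρs : Ordinal.{u}} (h : σ r = ⊥) (hs : σ s = un one ρs)
    (hr' : σ r' = un one ρ') (hk : σ k = ⊥) (hk' : σ k' = ⊥) (hρ : 0 < ρs) (hrs : r ≠ s) (hrr' : r ≠ r')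
    (hrk : r ≠ k) (hsk : s ≠ k) (hrk' : r ≠ k') (hsk' : s ≠ k') (hne : r' ≠ k') (hkk' : k ≠ k')
    (hL : L ≤ σ) :
    Sem ℓ one (mul one r s r' k k') σ (Function.update σ r (un one (ρs * ρ'))) L := by
  have hle : ∀ {L' : Cfg.{u} V A} μ, L' ≤ σ → L' ≤ Function.update σ r (un one (ρs * μ)) :=
    fun {L'} μ h' => le_up h' ((h ▸ h' r).trans bot_le)
  refine (sem_count (s := r') (k := k') (fun μ => Function.update σ r (un one (ρs * μ)))
    (fun μ _ => by rw [Function.update_of_ne hrr'.symm, hr'])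
    (fun μ _ => by rw [Function.update_of_ne hrk'.symm, hk']) hne ?_
    (fun l _ hl => (clim_const hl σ).update ((rlim_of_isNormal hl (mul_isNormal hρ)).tlim_un hl) r)
    (fun μ _ => hle μ hL)).of ?_
  · intro μ hμ
    refine (sem_add (ρ := ρs * μ) (ρs := ρs)
      (by rw [Function.update_of_ne hrk', Function.update_self])
      (by rw [Function.update_of_ne hsk', Function.update_of_ne hrs.symm, hs])
      (by rw [Function.update_of_ne hkk', Function.update_of_ne hrk.symm, hk]) hrs hrk hsk
      inf_le_left).to ?_
    rw [Function.update_comm hrk'.symm, Function.update_idem, mul_add_one]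
  · rw [mul_zero, un_zero, ← h, Function.update_eq_self]

end Primitives

/-- The variables of the simulating programs: the input tracks, the simulated tape `X`, a copy `Y` of
the input, the table `TT` of head positions, and registers. -/
inductive Var (j : ℕ)
  | inp (i : Fin j)
  | X | Y | TT | th | st | u | hd | a | e | k | k' | p | q | f | nh | ct

noncomputable instance (j : ℕ) : DecidableEq (Var j) := Classical.decEq _

/-! ### Reading and writing the table of head positions. -/

section Macros

variable {A : Type v} [Fintype A] [LinearOrder A] {K : ℕ} [NeZero K] {j : ℕ}
  {ℓ : Layout (Var j) K} {one : A} {σ σ' L : Cfg.{u} (Var j) A}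

open Cmd Var

/-- The track that holds the ordinals `H α` for `α < θ`. -/
noncomputable def table (one : A) (θ : Ordinal.{u}) (H : Ordinal.{u} → Ordinal.{u}) :
    Ordinal.{u} → WithBot A := fun a => un one (H (a % θ)) (a / θ)

theorem table_apply {θ α : Ordinal.{u}} (hα : α < θ) (H : Ordinal.{u} → Ordinal.{u}) (η : Ordinal.{u}) :
    table one θ H (θ * η + α) = un one (H α) η := by
  have h0 : θ ≠ 0 := (zero_le.trans_lt hα).ne'
  rw [table, mul_add_mod_self, mod_eq_of_lt hα, mul_add_div _ h0, div_eq_zero_of_lt hα, add_zero]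

/-- `hd := H st` -/
noncomputable def findHead (one : A) : Cmd (Var j) A :=
  seq (whl (tZero f) (seq (cpy q p) (seq (add one q st k) (seq
    (ite (tAt q fun x => decide (x TT = ⊥)) (inc one f) (seq (add one p th k) (inc one hd)))
    (zero q))))) (seq (zero p) (zero f))

/-- The row of `α` consists of the places `θ * μ + α`, and it is marked exactly for `μ < H α`. The
loop walks along the row, with `p = θ * μ` and `hd = μ`, up to the first empty place. -/
theorem sem_findHead {θ α : Ordinal.{u}} {H : Ordinal.{u} → Ordinal.{u}} (hα : α < θ)
    (hTT : σ TT = table one θ H) (hst : σ st = un one α) (hth : σ th = un one θ)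
    (hp : σ p = ⊥) (hq : σ q = ⊥) (hk : σ k = ⊥) (hf : σ f = ⊥) (hhd : σ hd = ⊥) (hL : L ≤ σ) :
    Sem ℓ one (findHead one) σ (Function.update σ hd (un one (H α))) L := by
  have hθ : 0 < θ := zero_le.trans_lt hα
  set β := H α with hβ
  -- There are `β + 1` rounds. The last one finds the empty place and only sets the flag `f`, hence
  -- the minimum with `β`.
  set s : Ordinal.{u} → Cfg.{u} (Var j) A := fun μ =>
    Function.update (Function.update (Function.update σ p (un one (θ * min μ β))) hd
      (un one (min μ β))) f (un one (if μ ≤ β then 0 else 1)) with hs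
  have hle : ∀ {L' : Cfg.{u} (Var j) A} μ, L' ≤ σ → L' ≤ s μ := fun μ h =>
    le_up (le_up (le_up h ((h p).trans (hp.le.trans bot_le))) ((h hd).trans (hhd.le.trans bot_le)))
      ((h f).trans (hf.le.trans bot_le))
  have h1 := sem_whl (ℓ := ℓ) (one := one) (L := L) (t := tZero f)
    (a := seq (cpy q p) (seq (add one q st k) (seq
      (ite (tAt q fun x => decide (x TT = ⊥)) (inc one f) (seq (add one p th k) (inc one hd)))
      (zero q)))) s (β + 1) ?_ ?_ ?_ ?_ (fun μ _ => hle μ hL)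
  · have e0 : s 0 = σ := by
      funext v; cases v <;> simp [hs, un_zero, hp, hf, hhd]
    rw [e0] at h1
    refine (h1.seq fun hL1 => Sem.seq (sem_zero (ρ := θ * β) (by simp [hs]) hL1
      ((hL p).trans hp.le)) fun hL2 => sem_zero (ρ := 1) (by simp [hs]) hL2 ((hL f).trans hf.le)).to ?_
    funext v; cases v <;> simp [hs, hp, hf]
  · intro μ hμ
    have := tst_zero (σ := s μ) (r := f) (one := one) (ρ := 0) (by
      simp [hs, lt_add_one_iff.1 hμ])
    simpa using this
  · have := tst_zero (σ := s (β + 1)) (r := f) (one := one) (ρ := 1) (by simp [hs])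
    simpa using this
  · intro μ hμ
    have hμ' : μ ≤ β := lt_add_one_iff.1 hμ
    have hLq : (s μ ⊓ s (μ + 1)) q ≤ ⊥ := inf_le_left.trans (by simp [hs, hq])
    have hsp : s μ p = un one (θ * μ) := by simp [hs, hμ']
    have hsh : s μ hd = un one μ := by simp [hs, hμ']
    have hsf : s μ f = un one 0 := by simp [hs, hμ']
    have hsq : s μ q = un one 0 := by simp [hs, hq, un_zero]
    refine Sem.seq (sem_cpy hsq hsp inf_le_left (hLq.trans bot_le)) fun hL1 => ?_
    refine Sem.seq (sem_add (ρ := θ * μ) (ρs := α) (by simp) (by simp [hs, hst]) (by simp [hs, hk])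
      (by simp) (by simp) (by simp) hL1) fun hL2 => ?_
    rcases hμ'.lt_or_eq with hlt | heq
    · refine Sem.seq (Sem.ite_false (tst_at (one := one) (ρ := θ * μ + α) (by simp) (by
        simp [hs, hTT, table_apply hα, un_eq_bot, hlt, ← hβ])) (Sem.seq
        (sem_add (ρ := θ * μ) (ρs := θ) (by simp [hsp]) (by simp [hs, hth]) (by simp [hs, hk])
        (by simp) (by simp) (by simp) hL2) fun hL3 => sem_inc (ρ := μ) (by simp [hsh]) hL3))
        fun hL4 => ?_
      refine (sem_zero (ρ := θ * μ + α) (by simp) hL4 hLq).to ?_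
      have : μ + 1 ≤ β := add_one_le_of_lt hlt
      funext v; cases v <;> simp [hs, this, hμ', mul_add_one, hq]
    · refine Sem.seq (Sem.ite_true (tst_at (one := one) (ρ := θ * μ + α) (by simp) (by
        simp [hs, hTT, table_apply hα, un_eq_bot, heq, ← hβ]))
        (sem_inc (ρ := 0) (by simp [hsf]) hL2))
        fun hL4 => ?_
      refine (sem_zero (ρ := θ * μ + α) (by simp) hL4 hLq).to ?_
      have : β ≤ μ + 1 := by rw [heq]; exact (lt_add_one β).le
      funext v; cases v <;> simp [hs, heq, hq]
  · intro l hl1 hl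
    have hlβ : l ≤ β := by
      rcases hl1.lt_or_eq with h | h
      · exact lt_add_one_iff.1 h
      · exact absurd hl (h ▸ not_isSuccLimit_succ β)
    refine (((clim_const hl σ).update (fun η => ?_) p).update (fun η => ?_) hd).update (fun η => ?_) f
    · refine RLim.tlim_un ?_ hl η
      rw [min_eq_left hlβ]
      exact (rlim_of_isNormal hl (mul_isNormal hθ)).congr fun μ hμ => by
        rw [min_eq_left (hμ.le.trans hlβ)]
    · refine RLim.tlim_un ?_ hl η
      rw [min_eq_left hlβ]
      exact (rlim_of_isNormal hl IsNormal.id).congr fun μ hμ => by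
        rw [min_eq_left (hμ.le.trans hlβ)]; rfl
    · refine tlim_const 0 hl.bot_lt fun μ _ hμ => ?_
      rw [if_pos hlβ, if_pos (hμ.le.trans hlβ)]

theorem rlim_pred {l : Ordinal.{u}} (hl : IsSuccLimit l) : RLim (fun μ => Ordinal.pred μ) l l := by
  refine ⟨fun b hb => ⟨b + 1 + 1, hl.add_one_lt (hl.add_one_lt hb), fun μ h1 _ => ?_⟩,
    fun ν hν => ⟨ν, le_rfl, hν, (pred_le_self ν).trans hν.le⟩⟩
  rw [lt_pred_iff_succ_lt]
  exact (lt_add_one _).trans_le h1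

theorem pred_limit {l : Ordinal.{u}} (hl : IsSuccLimit l) : Ordinal.pred l = l :=
  pred_eq_iff_isSuccPrelimit.2 hl.isSuccPrelimit

theorem pred_add_one' (μ : Ordinal.{u}) : Ordinal.pred (μ + 1) = μ := by
  rw [← succ_eq_add_one]; simp

/-- Move `hd` to the left. -/
noncomputable def predHead (one : A) : Cmd (Var j) A :=
  seq (seq (whl (tNe ct hd) (seq (cpy nh ct) (inc one ct))) (zero ct))
    (seq (ite (tNe nh hd) (cpy hd nh) (zero hd)) (zero nh))

/-- The register `nh` follows the counter one step behind, so it ends with `pred β`. Since `pred`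
fixes `0` and all limits, `nh ≠ hd` says that `β` is a successor; in the other cases the head goes
to `0`. -/
theorem sem_predHead {β : Ordinal.{u}} (hhd : σ hd = un one β) (hnh : σ nh = ⊥) (hct : σ ct = ⊥)
    (hL : L ≤ σ) (hL' : L hd ≤ un one (Motion.left.move β)) :
    Sem ℓ one (predHead one) σ (Function.update σ hd (un one (Motion.left.move β))) L := by
  have hle : ∀ {L' : Cfg.{u} (Var j) A} μ, L' ≤ σ → L' ≤ Function.update σ nh (un one (Ordinal.pred μ)) :=
    fun μ h => le_up h ((h nh).trans (hnh.le.trans bot_le))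
  have h1 := sem_count (ℓ := ℓ) (one := one) (L := L) (s := hd) (k := ct) (ρs := β) (body := cpy nh ct)
    (fun μ => Function.update σ nh (un one (Ordinal.pred μ)))
    (fun μ _ => by simp [hhd]) (fun μ _ => by simp [hct]) (by simp) ?_ ?_ (fun μ _ => hle μ hL)
  · have e0 : Function.update σ nh (un one (Ordinal.pred 0)) = σ := by
      rw [Ordinal.pred_zero, un_zero, ← hnh, Function.update_eq_self]
    rw [e0] at h1
    refine h1.seq fun hL1 => ?_
    have hz : ∀ {τ : Cfg.{u} (Var j) A}, τ nh = un one (Ordinal.pred β) → L ≤ τ →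
        (Function.update τ nh ⊥ = Function.update σ hd (un one (Motion.left.move β))) →
        Sem ℓ one (zero nh) τ (Function.update σ hd (un one (Motion.left.move β))) L :=
      fun h1 h2 h3 => (sem_zero h1 h2 ((hL nh).trans hnh.le)).to h3
    have ht := tst_ne (one := one) (σ := Function.update σ nh (un one (Ordinal.pred β))) (r := nh) (r' := hd)
      (ρ := Ordinal.pred β) (ρ' := β) (by simp) (by simp [hhd])
    rcases zero_or_succ_or_limit β with rfl | ⟨α, rfl⟩ | hl
    · rw [Ordinal.pred_zero, decide_eq_false (by simp)] at ht
      rw [move_left_zero] at hL' hz ⊢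
      refine Sem.seq (Sem.ite_false (by rwa [Ordinal.pred_zero]) (sem_zero (ρ := 0) (by simp [hhd]) hL1
        (hL'.trans (un_zero one).le))) fun hL2 => hz (by simp) hL2 ?_
      funext v; cases v <;> simp [hnh, un_zero]
    · rw [decide_eq_true (by rw [pred_add_one']; exact (lt_add_one α).ne)] at ht
      rw [move_left_add_one] at hL' hz ⊢
      refine Sem.seq (Sem.ite_true ht (sem_cpy (ρ := α + 1) (ρ' := α) (by simp [hhd])
        (by simp) hL1 hL')) fun hL2 => hz (by simp) hL2 ?_
      funext v; cases v <;> simp [hnh]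
    · rw [decide_eq_false (by rw [pred_limit hl]; simp)] at ht
      rw [move_left_limit hl] at hL' hz ⊢
      refine Sem.seq (Sem.ite_false ht (sem_zero (ρ := β) (by simp [hhd]) hL1
        (hL'.trans (un_zero one).le))) fun hL2 => hz (by simp) hL2 ?_
      funext v; cases v <;> simp [hnh, un_zero]
  · intro μ hμ
    refine (sem_cpy (ρ := Ordinal.pred μ) (ρ' := μ) (by simp) (by simp) inf_le_left ?_).to ?_
    · exact inf_le_right.trans (by simp)
    · funext v; cases v <;> simp
  · intro l _ hl
    refine (clim_const hl σ).update (fun η => ?_) nh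
    exact RLim.tlim_un (by rw [pred_limit hl]; exact rlim_pred hl) hl η

open Classical in
theorem table_fill {θ α μ : Ordinal.{u}} {H : Ordinal.{u} → Ordinal.{u}} (hα : α < θ) :
    Function.update (table one θ (Function.update H α (max μ (H α)))) (θ * μ + α) (one : WithBot A) =
      table one θ (Function.update H α (max (μ + 1) (H α))) := by
  have h0 : θ ≠ 0 := (zero_le.trans_lt hα).ne'
  funext a
  by_cases ha : a = θ * μ + α
  · rw [ha, Function.update_self, table_apply hα, Function.update_self, un_of_lt]
    exact (lt_add_one μ).trans_le (le_max_left _ _)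
  rw [Function.update_of_ne ha, table, table]
  by_cases h1 : a % θ = α
  · rw [h1, Function.update_self, Function.update_self]
    have h2 : a / θ ≠ μ := fun h => ha (by rw [← h, ← h1, div_add_mod])
    have h3 : a / θ < max μ (H α) ↔ a / θ < max (μ + 1) (H α) := by
      rw [lt_max_iff, lt_max_iff, lt_add_one_iff, le_iff_lt_or_eq, or_iff_left h2]
    rw [un, un]
    simp only [h3]
  · rw [Function.update_of_ne h1, Function.update_of_ne h1]

theorem table_mono {θ : Ordinal.{u}} {H H' : Ordinal.{u} → Ordinal.{u}} (h : ∀ α, H α ≤ H' α) :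
    table one θ H ≤ table one θ H' := fun a => un_mono (h _) _

theorem rlim_max {l : Ordinal.{u}} (hl : IsSuccLimit l) (h : Ordinal.{u}) :
    RLim (fun μ => max μ h) l (max l h) := by
  refine ⟨fun b hb => ?_, fun ν hν => ⟨ν, le_rfl, hν, max_le_max_right h hν.le⟩⟩
  rcases lt_max_iff.1 hb with h1 | h1
  · exact ⟨b + 1, hl.add_one_lt h1, fun μ h2 _ =>
      (lt_add_one b).trans_le (h2.trans (le_max_left _ _))⟩
  · exact ⟨0, hl.bot_lt, fun μ _ _ => h1.trans_le (le_max_right _ _)⟩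

/-- Raise `H st` to `hd`. -/
noncomputable def fillRow (one : A) : Cmd (Var j) A :=
  seq (whl (tNe ct hd) (seq (seq (cpy q p) (seq (add one q st k) (seq (put q TT (one : WithBot A))
    (seq (zero q) (add one p th k))))) (inc one ct))) (zero ct)

-- Raising a row only adds marks, so the old table is a lower bound throughout. The final value `θ *
-- β` of `p` is the place from which `clearRow` continues.
open Classical in
theorem sem_fillRow {θ α β : Ordinal.{u}} {H : Ordinal.{u} → Ordinal.{u}} (hα : α < θ)
    (hTT : σ TT = table one θ H) (hst : σ st = un one α) (hth : σ th = un one θ)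
    (hhd : σ hd = un one β)
    (hp : σ p = ⊥) (hq : σ q = ⊥) (hk : σ k = ⊥) (hct : σ ct = ⊥) (hL : L ≤ σ) :
    Sem ℓ one (fillRow one) σ (Function.update (Function.update σ TT
      (table one θ (Function.update H α (max β (H α))))) p (un one (θ * β))) L := by
  have hθ : 0 < θ := zero_le.trans_lt hα
  have hmono : ∀ μ, table one θ H ≤ table one θ (Function.update H α (max μ (H α))) := fun μ =>
    table_mono fun α' => by
      by_cases h : α' = α
      · subst h; rw [Function.update_self]; exact le_max_right _ _
      · rw [Function.update_of_ne h]
  have hle : ∀ {L' : Cfg.{u} (Var j) A} μ, L' ≤ σ → L' ≤ Function.update (Function.update σ TT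
      (table one θ (Function.update H α (max μ (H α))))) p (un one (θ * μ)) :=
    fun μ h => le_up (le_up h ((h TT).trans (hTT.le.trans (hmono μ))))
      ((h p).trans (hp.le.trans bot_le))
  refine (sem_count (ℓ := ℓ) (one := one) (L := L) (s := hd) (k := ct) (ρs := β)
    (body := seq (cpy q p) (seq (add one q st k) (seq (put q TT (one : WithBot A))
      (seq (zero q) (add one p th k)))))
    (fun μ => Function.update (Function.update σ TT
      (table one θ (Function.update H α (max μ (H α))))) p (un one (θ * μ)))
    (fun μ _ => by simp [hhd]) (fun μ _ => by simp [hct]) (by simp) ?_ ?_ (fun μ _ => hle μ hL)).of ?_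
  · intro μ hμ
    refine Sem.seq (sem_cpy (ρ := 0) (ρ' := θ * μ) (by simp [hq, un_zero]) (by simp) inf_le_left
      (inf_le_left.trans (by simp [hq]))) fun hL1 => ?_
    refine Sem.seq (sem_add (ρ := θ * μ) (ρs := α) (by simp) (by simp [hst]) (by simp [hk])
      (by simp) (by simp) (by simp) hL1) fun hL2 => ?_
    refine Sem.seq (sem_put (ρ := θ * μ + α) (by simp) hL2
      (inf_le_right.trans (by simp [table_fill hα]))) fun hL3 => ?_
    refine Sem.seq (sem_zero (ρ := θ * μ + α) (by simp) hL3 (inf_le_left.trans (by simp [hq])))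
      fun hL4 => ?_
    refine (sem_add (ρ := θ * μ) (ρs := θ) (by simp) (by simp [hth]) (by simp [hk])
      (by simp) (by simp) (by simp) hL4).to ?_
    funext v; cases v <;> simp [hq, table_fill hα, mul_add_one]
  · intro l _ hl
    refine ((clim_const hl σ).update (fun a => ?_) TT).update
      ((rlim_of_isNormal hl (mul_isNormal hθ)).tlim_un hl) p
    simp only [table]
    by_cases h1 : a % θ = α
    · simp only [h1, Function.update_self]
      exact (rlim_max hl _).tlim_un hl _
    · simp only [Function.update_of_ne h1]
      exact tlim_const 0 hl.bot_lt fun _ _ _ => rfl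
  · funext v; cases v <;> simp [hp, hTT, un_zero]

/-- Lower `H st` to `η` for `p = θ * η`, and set `p := 0`. -/
noncomputable def clearRow (one : A) : Cmd (Var j) A :=
  seq (whl (tZero f) (seq (cpy q p) (seq (add one q st k) (seq
    (ite (tAt q fun x => decide (x TT = ⊥)) (inc one f) (seq (put q TT ⊥) (add one p th k)))
    (zero q))))) (seq (zero p) (zero f))

-- Marks are removed one after another from height `η₀` on, up to the first empty place of the row.
-- So the new row is a lower bound all the time.
open Classical in
theorem sem_clearRow {θ α η₀ : Ordinal.{u}} {H : Ordinal.{u} → Ordinal.{u}} (hα : α < θ)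
    (hTT : σ TT = table one θ H) (hst : σ st = un one α) (hth : σ th = un one θ)
    (hp : σ p = un one (θ * η₀)) (hq : σ q = ⊥) (hk : σ k = ⊥) (hf : σ f = ⊥) (hL : L ≤ σ)
    (hLp : L p ≤ ⊥) (hL' : L TT ≤ table one θ (Function.update H α (min η₀ (H α)))) :
    Sem ℓ one (clearRow one) σ (Function.update (Function.update σ TT
      (table one θ (Function.update H α (min η₀ (H α))))) p ⊥) L := by
  have hθ : 0 < θ := zero_le.trans_lt hα
  -- This is the number of marks to be removed; it is `0` if the row does not reach above `η₀`.
  set D := H α - η₀ with hD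
  set clr : Ordinal.{u} → Ordinal.{u} → WithBot A := fun μ a =>
    if a % θ = α ∧ η₀ ≤ a / θ ∧ a / θ < η₀ + μ then ⊥ else table one θ H a with hclr
  have hdiv : ∀ μ, (θ * μ + α) / θ = μ := fun μ => by
    rw [mul_add_div _ hθ.ne', div_eq_zero_of_lt hα, add_zero]
  have hmod : ∀ μ, (θ * μ + α) % θ = α := fun μ => by rw [mul_add_mod_self, mod_eq_of_lt hα]
  have clr_read : ∀ μ, clr μ (θ * (η₀ + μ) + α) = un one (H α) (η₀ + μ) := fun μ => by
    simp only [hclr]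
    rw [if_neg, table_apply hα]
    rintro ⟨-, -, h⟩
    rw [hdiv] at h
    exact lt_irrefl _ h
  have clr_write : ∀ μ, Function.update (clr μ) (θ * (η₀ + μ) + α) ⊥ = clr (μ + 1) := fun μ => by
    funext a
    by_cases ha : a = θ * (η₀ + μ) + α
    · rw [ha, Function.update_self]
      simp only [hclr]
      rw [if_pos]
      rw [hdiv, hmod]
      exact ⟨rfl, le_self_add, by rw [← add_assoc]; exact lt_add_one _⟩
    · rw [Function.update_of_ne ha]
      simp only [hclr]
      congr 1
      apply propext
      refine and_congr_right fun h1 => and_congr_right fun _ => ?_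
      have h2 : a / θ ≠ η₀ + μ := fun h => ha (by rw [← h, ← h1, div_add_mod])
      rw [← add_assoc, lt_add_one_iff, le_iff_lt_or_eq, or_iff_left h2]
  have clr_zero : clr 0 = table one θ H := by
    funext a
    simp only [hclr]
    rw [if_neg]
    rintro ⟨-, h1, h2⟩
    rw [add_zero] at h2
    exact absurd h2 (not_lt.2 h1)
  have clr_end : clr D = table one θ (Function.update H α (min η₀ (H α))) := by
    funext a
    simp only [hclr]
    by_cases h1 : a % θ = α
    · rw [table, table, h1, Function.update_self]
      split_ifs with h2
      · rw [un_of_le ((min_le_left _ _).trans h2.2.1)]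
      · rw [un, un]
        congr 1
        apply propext
        rw [lt_min_iff]
        constructor
        · intro h3
          refine ⟨?_, h3⟩
          by_contra! h4
          exact h2 ⟨rfl, h4, h3.trans_le (le_add_sub _ _)⟩
        · exact fun h3 => h3.2
    · rw [if_neg (fun h => h1 h.1), table, table, Function.update_of_ne h1]
  have clr_anti : ∀ μ, table one θ (Function.update H α (min η₀ (H α))) ≤ clr μ := by
    intro μ a
    simp only [hclr]
    split_ifs with h
    · rw [table, h.1, Function.update_self, un_of_le ((min_le_left _ _).trans h.2.1)]
    · refine table_mono (fun α' => ?_) a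
      by_cases h : α' = α
      · subst h; rw [Function.update_self]; exact min_le_right _ _
      · rw [Function.update_of_ne h]
  have clr_lim : ∀ l, IsSuccLimit l → ∀ a, TLim (fun μ => clr μ a) l (clr l a) := by
    intro l hl a
    by_cases h : a % θ = α ∧ η₀ ≤ a / θ ∧ a / θ < η₀ + l
    · obtain ⟨ν, h1, h2⟩ := ((add_isNormal η₀).lt_iff_exists_lt hl).1 h.2.2
      refine tlim_const ν h1 fun μ h3 h4 => ?_
      simp only [hclr]
      rw [if_pos h, if_pos ⟨h.1, h.2.1, h2.trans_le (by gcongr)⟩]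
    · refine tlim_const 0 hl.bot_lt fun μ _ h4 => ?_
      simp only [hclr]
      rw [if_neg h, if_neg]
      rintro ⟨h1, h2, h3⟩
      exact h ⟨h1, h2, h3.trans_le (by gcongr)⟩
  set s : Ordinal.{u} → Cfg.{u} (Var j) A := fun μ =>
    Function.update (Function.update (Function.update σ p (un one (θ * (η₀ + min μ D)))) TT
      (clr (min μ D))) f (un one (if μ ≤ D then 0 else 1)) with hs
  have hle : ∀ μ, L ≤ s μ := fun μ =>
    le_up (le_up (le_up hL (hLp.trans bot_le)) (hL'.trans (clr_anti _)))
      ((hL f).trans (hf.le.trans bot_le))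
  have h1 := sem_whl (ℓ := ℓ) (one := one) (L := L) (t := tZero f)
    (a := seq (cpy q p) (seq (add one q st k) (seq
      (ite (tAt q fun x => decide (x TT = ⊥)) (inc one f) (seq (put q TT ⊥) (add one p th k)))
      (zero q)))) s (D + 1) ?_ ?_ ?_ ?_ (fun μ _ => hle μ)
  · have e0 : s 0 = σ := by
      funext v; cases v <;> simp [hs, un_zero, hp, hf, hTT, clr_zero]
    rw [e0] at h1
    refine (h1.seq fun hL1 => Sem.seq (sem_zero (ρ := θ * (η₀ + D)) (by simp [hs]) hL1
      hLp) fun hL2 => sem_zero (ρ := 1) (by simp [hs]) hL2 ((hL f).trans hf.le)).to ?_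
    funext v; cases v <;> simp [hs, hf, clr_end]
  · intro μ hμ
    have := tst_zero (σ := s μ) (r := f) (one := one) (ρ := 0) (by
      simp [hs, lt_add_one_iff.1 hμ])
    simpa using this
  · have := tst_zero (σ := s (D + 1)) (r := f) (one := one) (ρ := 1) (by simp [hs])
    simpa using this
  · intro μ hμ
    have hμ' : μ ≤ D := lt_add_one_iff.1 hμ
    have hLq : (s μ ⊓ s (μ + 1)) q ≤ ⊥ := inf_le_left.trans (by simp [hs, hq])
    have hsp : s μ p = un one (θ * (η₀ + μ)) := by simp [hs, hμ']
    have hsT : s μ TT = clr μ := by simp [hs, hμ']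
    have hsf : s μ f = un one 0 := by simp [hs, hμ']
    have hsq : s μ q = un one 0 := by simp [hs, hq, un_zero]
    refine Sem.seq (sem_cpy hsq hsp inf_le_left (hLq.trans bot_le)) fun hL1 => ?_
    refine Sem.seq (sem_add (ρ := θ * (η₀ + μ)) (ρs := α) (by simp) (by simp [hs, hst])
      (by simp [hs, hk]) (by simp) (by simp) (by simp) hL1) fun hL2 => ?_
    rcases hμ'.lt_or_eq with hlt | heq
    · have hle1 : μ + 1 ≤ D := add_one_le_of_lt hlt
      refine Sem.seq (Sem.ite_false (tst_at (one := one) (ρ := θ * (η₀ + μ) + α) (by simp) (by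
        simp [hsT, clr_read, un_eq_bot, ← sub_le, ← hD, hlt])) (Sem.seq
        (sem_put (ρ := θ * (η₀ + μ) + α) (by simp) hL2 (inf_le_right.trans (by
          simp [hsT, clr_write]; simp [hs, hle1])))
        fun hL3 => sem_add (ρ := θ * (η₀ + μ)) (ρs := θ) (by simp [hsp]) (by simp [hs, hth])
        (by simp [hs, hk]) (by simp) (by simp) (by simp) hL3))
        fun hL4 => ?_
      refine (sem_zero (ρ := θ * (η₀ + μ) + α) (by simp) hL4 hLq).to ?_
      funext v; cases v <;> simp [hsT, clr_write]
      all_goals simp [hs, hle1, hμ', ← mul_add_one, hq, add_assoc]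
    · refine Sem.seq (Sem.ite_true (tst_at (one := one) (ρ := θ * (η₀ + μ) + α) (by simp) (by
        simp [hsT, clr_read, un_eq_bot, ← sub_le, ← hD, heq.ge]))
        (sem_inc (ρ := 0) (by simp [hsf]) hL2))
        fun hL4 => ?_
      refine (sem_zero (ρ := θ * (η₀ + μ) + α) (by simp) hL4 hLq).to ?_
      funext v; cases v <;> simp [hs, heq, hq]
  · intro l hl1 hl
    have hlD : l ≤ D := by
      rcases hl1.lt_or_eq with h | h
      · exact lt_add_one_iff.1 h
      · exact absurd hl (h ▸ not_isSuccLimit_succ D)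
    refine (((clim_const hl σ).update (fun η => ?_) p).update (fun η => ?_) TT).update (fun η => ?_) f
    · refine RLim.tlim_un ?_ hl η
      rw [min_eq_left hlD]
      exact (rlim_of_isNormal hl ((mul_isNormal hθ).comp (add_isNormal η₀))).congr fun μ hμ => by
        rw [min_eq_left (hμ.le.trans hlD)]; rfl
    · rw [min_eq_left hlD]
      exact (clr_lim l hl η).congr fun μ hμ => by rw [min_eq_left (hμ.le.trans hlD)]
    · refine tlim_const 0 hl.bot_lt fun μ _ hμ => ?_
      rw [if_pos hlD, if_pos (hμ.le.trans hlD)]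

/-- `H st := hd` and `hd := 0` -/
noncomputable def setRow (one : A) : Cmd (Var j) A :=
  seq (fillRow one) (seq (clearRow one) (zero hd))

-- The row is first raised to the maximum of its old and new heights and then lowered to the new
-- one. In this way the table never drops below the minimum of its old and new contents, as the
-- simulation loop requires; erasing the row first would ruin the inferior limits.
open Classical in
theorem sem_setRow {θ α β : Ordinal.{u}} {H : Ordinal.{u} → Ordinal.{u}} (hα : α < θ)
    (hTT : σ TT = table one θ H) (hst : σ st = un one α) (hth : σ th = un one θ)
    (hhd : σ hd = un one β) (hp : σ p = ⊥) (hq : σ q = ⊥) (hk : σ k = ⊥) (hct : σ ct = ⊥)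
    (hf : σ f = ⊥) (hL : L ≤ σ) (hLh : L hd ≤ ⊥) (hL' : L TT ≤ table one θ (Function.update H α β)) :
    Sem ℓ one (setRow one) σ (Function.update (Function.update σ TT
      (table one θ (Function.update H α β))) hd ⊥) L := by
  have e : Function.update (Function.update H α (max β (H α))) α
      (min β (Function.update H α (max β (H α)) α)) = Function.update H α β := by
    rw [Function.update_idem, Function.update_self, min_eq_left (le_max_left _ _)]
  refine Sem.seq (sem_fillRow hα hTT hst hth hhd hp hq hk hct hL) fun hL1 => ?_
  refine Sem.seq (sem_clearRow (η₀ := β) (H := Function.update H α (max β (H α))) hα (by simp)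
    (by simp [hst]) (by simp [hth]) (by simp) (by simp [hq]) (by simp [hk]) (by simp [hf]) hL1
    ((hL p).trans hp.le) (by rw [e]; exact hL')) fun hL2 => ?_
  refine (sem_zero (ρ := β) (by simp [hhd]) hL2 hLh).to ?_
  rw [e]
  funext v; cases v <;> simp [hp]

end Macros

/-! ### Simulation of a single step. -/

section Step

variable {A : Type v} [Fintype A] [LinearOrder A] {K : ℕ} [NeZero K] {j : ℕ}
  {ℓ : Layout (Var j) K} {one : A} {σ σ' L : Cfg.{u} (Var j) A}

open Cmd Var

variable (A) in
/-- All pairs of a content and a motion. -/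
noncomputable def actions : List (WithBot A × Motion) :=
  Finset.univ.toList.flatMap fun d => [(d, .left), (d, .stay), (d, .right)]

theorem mem_actions (r : WithBot A × Motion) : r ∈ actions A := by
  obtain ⟨d, m⟩ := r
  rw [actions, List.mem_flatMap]
  refine ⟨d, Finset.mem_toList.2 (Finset.mem_univ _), ?_⟩
  cases m <;> simp

/-- Move `hd`. -/
noncomputable def moveHead (one : A) : Motion → Cmd (Var j) A
  | .left => predHead one
  | .stay => nop
  | .right => inc one hd

theorem sem_moveHead {β : Ordinal.{u}} (m : Motion) (hhd : σ hd = un one β) (hnh : σ nh = ⊥)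
    (hct : σ ct = ⊥) (hL : L ≤ σ) (hL' : L hd ≤ ⊥) :
    Sem ℓ one (moveHead one m) σ (Function.update σ hd (un one (m.move β))) L := by
  cases m with
  | left => exact sem_predHead hhd hnh hct hL (hL'.trans bot_le)
  | stay =>
    refine (sem_nop hL).to ?_
    rw [move_stay, ← hhd, Function.update_eq_self]
  | right => exact sem_inc hhd hL

variable (fld : WithBot A → WithBot A → Motion → Fin j)

/-- Look up the transition for content `d` in the table, from `a` on, and execute it, except that the
new state is only stored in `e`. -/
noncomputable def transit (one : A) (d : WithBot A) : Cmd (Var j) A :=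
  seq (whl (tAt a fun x => decide (∀ r ∈ actions A, x (inp (fld d r.1 r.2)) ≠ (one : WithBot A)))
    (seq (inc one a) (inc one e)))
  (sel a (fun r x => decide (x (inp (fld d r.1 r.2)) = (one : WithBot A)))
    (fun r => seq (put hd X r.1) (moveHead one r.2)) (actions A))

/-- The entries for the state `α` begin at supercell `θ * α`. The transition on `d` is a function,
so exactly one entry is marked for `d`, at offset `δ`, in the field of the written content and the
motion. Counting the offset in `e` yields the new state. -/
theorem sem_transit {θ α β δ : Ordinal.{u}} {d d' : WithBot A} {m : Motion}
    (ha : σ a = un one (θ * α)) (he : σ e = ⊥) (hhd : σ hd = un one β) (hnh : σ nh = ⊥)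
    (hct : σ ct = ⊥)
    (htab : ∀ ι ≤ δ, ∀ d'' m', σ (inp (fld d d'' m')) (θ * α + ι) = (one : WithBot A) ↔
      (δ, d', m) = (ι, d'', m'))
    (hL : L ≤ σ) (hLa : L a ≤ ⊥) (hLh : L hd ≤ ⊥) (hLX : L X ≤ Function.update (σ X) β d') :
    Sem ℓ one (transit fld one d) σ (Function.update (Function.update (Function.update (Function.update σ
      a (un one (θ * α + δ))) e (un one δ)) X (Function.update (σ X) β d')) hd
      (un one (m.move β))) L := by
  set s : Ordinal.{u} → Cfg.{u} (Var j) A := fun μ =>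
    Function.update (Function.update σ a (un one (θ * α + μ))) e (un one μ) with hs
  have hsi : ∀ μ i, s μ (inp i) = σ (inp i) := fun μ i => by simp [hs]
  have h1 := sem_whl (ℓ := ℓ) (one := one) (L := L)
    (t := tAt a fun x => decide (∀ r ∈ actions A, x (inp (fld d r.1 r.2)) ≠ (one : WithBot A)))
    (a := seq (inc one a) (inc one e)) s δ ?_ ?_ ?_ ?_
    (fun μ _ => le_up (le_up hL (hLa.trans bot_le)) ((hL e).trans (he.le.trans bot_le)))
  · have e0 : s 0 = σ := by funext v; cases v <;> simp [hs, ha, he, un_zero]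
    rw [e0] at h1
    refine h1.seq fun hL1 => sem_sel (one := one) (ρ := θ * α + δ) _ (by simp [hs])
      (mem_actions (d', m)) ?_ ?_ ?_
    · simp only [hsi, decide_eq_true_eq]
      exact (htab δ le_rfl d' m).2 rfl
    · intro r _ hr
      simp only [hsi, decide_eq_true_eq] at hr
      have := (htab δ le_rfl r.1 r.2).1 hr
      simp only [Prod.mk.injEq, true_and] at this
      exact Prod.ext this.1.symm this.2.symm
    · refine Sem.seq (sem_put (one := one) (ρ := β) (by simp [hs, hhd]) hL1 (by simpa [hs] using hLX))
        fun hL2 => ?_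
      refine (sem_moveHead (β := β) m (by simp [hs, hhd]) (by simp [hs, hnh]) (by simp [hs, hct]) hL2
        hLh).to ?_
      funext v; cases v <;> simp [hs]
  · intro μ hμ
    refine tst_at (one := one) (ρ := θ * α + μ) (by simp [hs]) ?_
    rw [decide_eq_true_eq]
    intro r _ hr
    simp only [hsi] at hr
    have := (htab μ hμ.le r.1 r.2).1 hr
    simp only [Prod.mk.injEq] at this
    exact hμ.ne' this.1
  · refine tst_at (one := one) (ρ := θ * α + δ) (by simp [hs]) ?_
    rw [decide_eq_false_iff_not]
    intro h
    apply h (d', m) (mem_actions _)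
    simp only [hsi]
    exact (htab δ le_rfl d' m).2 rfl
  · intro μ hμ
    refine Sem.seq (sem_inc (ρ := θ * α + μ) (by simp [hs]) inf_le_left) fun hL1 => ?_
    refine (sem_inc (ρ := μ) (by simp [hs]) hL1).to ?_
    funext v; cases v <;> simp [hs, add_assoc]
  · intro l _ hl
    exact ((clim_const hl σ).update ((rlim_of_isNormal hl (add_isNormal _)).tlim_un hl) a).update
      ((rlim_of_isNormal hl IsNormal.id).tlim_un hl) e

/-- Simulate one step. -/
noncomputable def simStep (one : A) : Cmd (Var j) A :=
  seq (findHead one) (seq (mul one a th st k k') (seq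
    (sel hd (fun (d : WithBot A) x => decide (x X = d)) (transit fld one) Finset.univ.toList)
    (seq (cpy st e) (seq (zero a) (seq (zero e) (setRow one))))))

-- Only `X`, `st` and `TT` differ before and after a step, and each is changed without going below
-- the minimum of its two contents. The working registers are empty at both ends, so nothing is
-- demanded of them in between.
open Classical in
theorem sem_simStep {θ α β δ : Ordinal.{u}} {d' : WithBot A} {m : Motion}
    {H : Ordinal.{u} → Ordinal.{u}} (hα : α < θ) (hδ : δ < θ) (hH : H α = β)
    (hTT : σ TT = table one θ H) (hst : σ st = un one α) (hth : σ th = un one θ)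
    (htemp : ∀ v ∈ [hd, a, e, k, k', p, q, f, nh, ct], σ v = ⊥)
    (htab : ∀ ι ≤ δ, ∀ d'' m', σ (inp (fld (σ X β) d'' m')) (θ * α + ι) = (one : WithBot A) ↔
      (δ, d', m) = (ι, d'', m'))
    (hσ' : σ' = Function.update (Function.update (Function.update σ X (Function.update (σ X) β d'))
      st (un one δ)) TT (table one θ (Function.update H δ (m.move β))))
    (hL : L ≤ σ) (hL' : L ≤ σ') :
    Sem ℓ one (simStep fld one) σ σ' L := by
  simp only [List.mem_cons, List.not_mem_nil, or_false, forall_eq_or_imp, forall_eq] at htemp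
  obtain ⟨hhd, ha, he, hk, hk', hp, hq, hf, hnh, hct⟩ := htemp
  have hLt : ∀ v, σ v = ⊥ → L v ≤ ⊥ := fun v h => (hL v).trans h.le
  have hθ : 0 < θ := zero_le.trans_lt hα
  subst hσ'
  refine Sem.seq (sem_findHead hα hTT hst hth hp hq hk hf hhd hL) fun hL1 => ?_
  rw [hH] at hL1 ⊢
  refine Sem.seq (sem_mul (ρs := θ) (ρ' := α) (by simp [ha]) (by simp [hth]) (by simp [hst])
    (by simp [hk]) (by simp [hk']) hθ (by simp) (by simp) (by simp) (by simp) (by simp) (by simp)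
    (by simp) (by simp) hL1) fun hL2 => ?_
  refine Sem.seq (sem_sel (one := one) (ρ := β) (i := σ X β) _ (by simp)
    (Finset.mem_toList.2 (Finset.mem_univ _)) (by simp) (fun d _ hd => by
      have := of_decide_eq_true hd
      simpa using this.symm)
    (sem_transit fld (θ := θ) (α := α) (β := β) (δ := δ) (d' := d') (m := m) (by simp) (by simp [he])
      (by simp) (by simp [hnh]) (by simp [hct]) (by simpa using htab) hL2 (hLt _ ha) (hLt _ hhd)
      (by simpa using hL' X))) fun hL3 => ?_
  refine Sem.seq (sem_cpy (ρ := α) (ρ' := δ) (by simp [hst]) (by simp) hL3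
    (by simpa using hL' st)) fun hL4 => ?_
  refine Sem.seq (sem_zero (ρ := θ * α + δ) (by simp) hL4 (hLt _ ha)) fun hL5 => ?_
  refine Sem.seq (sem_zero (ρ := δ) (by simp) hL5 (hLt _ he)) fun hL6 => ?_
  refine (sem_setRow (θ := θ) (α := δ) (β := m.move β) (H := H) hδ (by simp [hTT]) (by simp)
    (by simp [hth]) (by simp) (by simp [hp]) (by simp [hq]) (by simp [hk]) (by simp [hct])
    (by simp [hf]) hL6 (hLt _ hhd) (by simpa using hL' TT)).to ?_
  funext v; cases v <;> simp [hhd, ha, he]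

end Step

/-! ### The inferior limits of head positions, state by state. -/

section HeadTable

variable {A : Type v} [Fintype A] [LinearOrder A]

/-- The inferior limit of the positions of the head at those times before `γ` at which the state
is `α`. -/
noncomputable def headLiminf (c : Ordinal.{u} → Snapshot.{u} A) (γ α : Ordinal.{u}) : Ordinal.{u} :=
  ordLiminf (l := γ) {ξ | (c ξ).state = α} fun ξ => (c ξ).head

/-- The existence clause accounts for `inf ∅ = 0`: a final segment without the state `α` contributes
nothing. -/
theorem lt_headLiminf {c : Ordinal.{u} → Snapshot.{u} A} {γ α b : Ordinal.{u}} :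
    b < headLiminf c γ α ↔ ∃ ζ < γ, (∃ ξ, ζ ≤ ξ ∧ ξ < γ ∧ (c ξ).state = α) ∧
      ∀ ξ, ζ ≤ ξ → ξ < γ → (c ξ).state = α → b < (c ξ).head := by
  rw [headLiminf, ordLiminf]
  constructor
  · intro h
    have hne : Nonempty (Set.Iio γ) := by
      by_contra hc
      rw [not_nonempty_iff] at hc
      rw [ciSup_of_empty, bot_eq_zero] at h
      exact absurd h not_lt_zero
    obtain ⟨ζ, hζ⟩ := exists_lt_of_lt_ciSup h
    have hS : ((fun ξ : Set.Iio γ => (c ξ).head) ''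
        {ξ | ξ ∈ {ξ : Set.Iio γ | (c ξ).state = α} ∧ ζ ≤ ξ}).Nonempty := by
      by_contra hc
      rw [Set.not_nonempty_iff_eq_empty] at hc
      rw [hc, Ordinal.sInf_empty] at hζ
      exact absurd hζ not_lt_zero
    refine ⟨ζ, ζ.2, ?_, fun ξ h1 h2 h3 => hζ.trans_le (csInf_le' ⟨⟨ξ, h2⟩, ⟨h3, h1⟩, rfl⟩)⟩
    obtain ⟨_, ξ, ⟨h1, h2⟩, -⟩ := hS
    exact ⟨ξ, h2, ξ.2, h1⟩
  · rintro ⟨ζ, h1, ⟨ξ, h2, h3, h4⟩, h5⟩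
    refine lt_of_lt_of_le ?_ (le_ciSup (bddAbove_range_Iio _) ⟨ζ, h1⟩)
    have hne : ((fun ξ : Set.Iio γ => (c ξ).head) ''
        {ξ | ξ ∈ {ξ : Set.Iio γ | (c ξ).state = α} ∧ (⟨ζ, h1⟩ : Set.Iio γ) ≤ ξ}).Nonempty :=
      ⟨_, ⟨ξ, h3⟩, ⟨h4, h2⟩, rfl⟩
    obtain ⟨x, ⟨h6, h7⟩, h8⟩ := csInf_mem hne
    rw [← h8]
    exact h5 x h7 x.2 h6

theorem headLiminf_succ_of_ne {c : Ordinal.{u} → Snapshot.{u} A} {γ α : Ordinal.{u}}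
    (h : (c γ).state ≠ α) : headLiminf c (γ + 1) α = headLiminf c γ α := by
  refine eq_of_forall_lt_iff fun b => ?_
  rw [lt_headLiminf, lt_headLiminf]
  have hlt : ∀ ξ, ξ < γ + 1 → (c ξ).state = α → ξ < γ := fun ξ h1 h2 =>
    (lt_add_one_iff.1 h1).lt_of_ne (fun h3 => h (h3 ▸ h2))
  constructor
  · rintro ⟨ζ, h1, ⟨ξ, h2, h3, h4⟩, h5⟩
    exact ⟨ζ, h2.trans_lt (hlt ξ h3 h4), ⟨ξ, h2, hlt ξ h3 h4, h4⟩,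
      fun ξ' h6 h7 h8 => h5 ξ' h6 (h7.trans (lt_add_one γ)) h8⟩
  · rintro ⟨ζ, h1, ⟨ξ, h2, h3, h4⟩, h5⟩
    exact ⟨ζ, h1.trans (lt_add_one γ), ⟨ξ, h2, h3.trans (lt_add_one γ), h4⟩,
      fun ξ' h6 h7 h8 => h5 ξ' h6 (hlt ξ' h7 h8) h8⟩

/-- The final segments of `γ + 1` shrink to the single time `γ`, so the current head position
replaces the old value. -/
theorem headLiminf_succ_self (c : Ordinal.{u} → Snapshot.{u} A) (γ : Ordinal.{u}) :
    headLiminf c (γ + 1) (c γ).state = (c γ).head := by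
  refine eq_of_forall_lt_iff fun b => ?_
  rw [lt_headLiminf]
  constructor
  · rintro ⟨ζ, h1, -, h5⟩
    exact h5 γ (lt_add_one_iff.1 h1) (lt_add_one γ) rfl
  · intro h
    refine ⟨γ, lt_add_one γ, ⟨γ, le_rfl, lt_add_one γ, rfl⟩, fun ξ h1 h2 _ => ?_⟩
    rwa [le_antisymm (lt_add_one_iff.1 h2) h1]

/-- This makes the head table compatible with limits: although its rows record only the past up to
`γ`, their inferior limits are the values that the limit rule asks for. -/
theorem rlim_headLiminf (c : Ordinal.{u} → Snapshot.{u} A) {l : Ordinal.{u}} (hl : IsSuccLimit l)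
    (α : Ordinal.{u}) : RLim (fun γ => headLiminf c (γ + 1) α) l (headLiminf c l α) := by
  constructor
  · intro b hb
    obtain ⟨ζ, h1, ⟨ξ, h2, h3, h4⟩, h5⟩ := lt_headLiminf.1 hb
    refine ⟨ξ, h3, fun γ h6 h7 => lt_headLiminf.2 ⟨ζ, ?_, ⟨ξ, h2, ?_, h4⟩, fun ξ' h8 h9 h10 =>
      h5 ξ' h8 ((lt_add_one_iff.1 h9).trans_lt h7) h10⟩⟩
    · exact lt_add_one_iff.2 (h2.trans h6)
    · exact lt_add_one_iff.2 h6
  · intro ν hν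
    -- If `α` occurs from `ν` on, take a time with the least head position; right after it the row
    -- has this value, a lower bound for all later positions. If not, the row does not change any
    -- more.
    by_cases hocc : ∃ ξ, ν ≤ ξ ∧ ξ < l ∧ (c ξ).state = α
    · let S : Set Ordinal.{u} := {h | ∃ ξ, ν ≤ ξ ∧ ξ < l ∧ (c ξ).state = α ∧ (c ξ).head = h}
      have hS : S.Nonempty := by
        obtain ⟨ξ, h1, h2, h3⟩ := hocc
        exact ⟨_, ξ, h1, h2, h3, rfl⟩
      obtain ⟨μ, h1, h2, h3, h4⟩ := csInf_mem hS
      refine ⟨μ, h1, h2, le_of_forall_lt fun b hb => ?_⟩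
      have e := headLiminf_succ_self c μ
      rw [h3] at e
      dsimp only at hb
      rw [e, h4] at hb
      exact lt_headLiminf.2 ⟨ν, hν, ⟨μ, h1, h2, h3⟩, fun ξ h5 h6 h7 =>
        hb.trans_le (csInf_le' ⟨ξ, h5, h6, h7, rfl⟩)⟩
    · push Not at hocc
      refine ⟨ν, le_rfl, hν, le_of_forall_lt fun b hb => ?_⟩
      obtain ⟨ζ, h1, ⟨ξ, h2, h3, h4⟩, h5⟩ := lt_headLiminf.1 hb
      have hνl : ν + 1 ≤ l := add_one_le_of_lt hν
      refine lt_headLiminf.2 ⟨ζ, h1.trans_le hνl, ⟨ξ, h2, h3.trans_le hνl, h4⟩, fun ξ' h6 h7 h8 =>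
        h5 ξ' h6 ?_ h8⟩
      by_contra! h9
      exact hocc ξ' ((lt_add_one ν).le.trans h9) h7 h8

end HeadTable

/-! ### Total transition functions and bounds on the states. -/

section Total

variable {A : Type v} [Fintype A] [LinearOrder A]

/-- The program `q`, made total by standing still. -/
def Program.next (q : Program.{u} A) (α : Ordinal.{u}) (d : WithBot A) :
    Ordinal.{u} × WithBot A × Motion := (q (α, d)).getD (α, d, .stay)

theorem succStep_eq_next (q : Program.{u} A) (s : Snapshot.{u} A) :
    succStep q s = ⟨Function.update s.tape s.head (q.next s.state (s.tape s.head)).2.1,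
      (q.next s.state (s.tape s.head)).1, (q.next s.state (s.tape s.head)).2.2.move s.head⟩ := by
  rw [succStep, Program.next]
  rcases h : q (s.state, s.tape s.head) with _ | ⟨δ, d, m⟩
  · simp [move_stay]
  · simp

/-- The set of the states up to `θ` is closed under the transitions of `q`. -/
def Program.ClosedUnder (q : Program.{u} A) (θ : Ordinal.{u}) : Prop :=
  ∀ α ≤ θ, ∀ d, (q.next α d).1 ≤ θ

variable {q : Program.{u} A} {c : Ordinal.{u} → Snapshot.{u} A} {θ : Ordinal.{u}}

theorem IsRun.rlim_state (h : IsRun q c) {l : Ordinal.{u}} (hl : IsSuccLimit l) :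
    RLim (fun γ => (c γ).state) l (c l).state := by
  rw [h.2 l hl]
  exact rlim_ordLiminf (fun γ => (c γ).state) hl.bot_lt

theorem IsRun.tlim_tape (h : IsRun q c) {l : Ordinal.{u}} (hl : IsSuccLimit l) (η : Ordinal.{u}) :
    TLim (fun γ => (c γ).tape η) l ((c l).tape η) := by
  rw [h.2 l hl]
  exact tlim_symLiminf hl.bot_lt fun γ => (c γ).tape η

theorem IsRun.head_limit (h : IsRun q c) {l : Ordinal.{u}} (hl : IsSuccLimit l) :
    (c l).head = headLiminf c l (c l).state := by
  rw [h.2 l hl]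
  rfl

theorem IsRun.state_le (h : IsRun q c) (hq : q.ClosedUnder θ) (h0 : (c 0).state ≤ θ)
    (γ : Ordinal.{u}) : (c γ).state ≤ θ := by
  induction γ using limitRecOn with
  | zero => exact h0
  | add_one γ ih =>
    rw [h.1, succStep_eq_next]
    exact hq _ ih _
  | limit l hl ih =>
    by_contra! hlt
    obtain ⟨ν, h1, h2⟩ := (h.rlim_state hl).1 θ hlt
    exact absurd (h2 ν le_rfl h1) (not_lt.2 (ih ν h1))

end Total

/-! ### The simulation loop. -/

section Simulation

variable {A : Type v} [Fintype A] [LinearOrder A] {K : ℕ} [NeZero K] {j : ℕ}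
  {ℓ : Layout (Var j) K} {one : A} {σ σ' L : Cfg.{u} (Var j) A}

open Cmd Var

variable (fld : WithBot A → WithBot A → Motion → Fin j) (one) in
/-- Simulate until state `u` is reached. -/
noncomputable def simulate : Cmd (Var j) A := whl (tNe st u) (simStep fld one)

/-- The contents of the variables in a simulation of the run `c` at time `γ`. -/
noncomputable def simCfg (one : A) (θ : Ordinal.{u}) (σ : Cfg.{u} (Var j) A)
    (c : Ordinal.{u} → Snapshot.{u} A) (γ : Ordinal.{u}) : Cfg.{u} (Var j) A :=
  Function.update (Function.update (Function.update σ X (c γ).tape) st (un one (c γ).state))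
    -- With `γ + 1` the table includes the time `γ`, so the row of the current state holds the
    -- current head position.
    TT (table one θ (headLiminf c (γ + 1)))

/-- The transition table of `q` on the input tracks. -/
def HasTable (one : A) (θ : Ordinal.{u}) (fld : WithBot A → WithBot A → Motion → Fin j)
    (q : Program.{u} A) (σ : Cfg.{u} (Var j) A) : Prop :=
  ∀ α < θ, ∀ ι < θ, ∀ d d' m, σ (inp (fld d d' m)) (θ * α + ι) = (one : WithBot A) ↔
    q.next α d = (ι, d', m)

variable {fld : WithBot A → WithBot A → Motion → Fin j} {q : Program.{u} A}
  {c : Ordinal.{u} → Snapshot.{u} A} {θ : Ordinal.{u}}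

theorem headLiminf_add_one (c : Ordinal.{u} → Snapshot.{u} A) (γ : Ordinal.{u}) :
    headLiminf c (γ + 1) = Function.update (headLiminf c γ) (c γ).state (c γ).head := by
  classical
  funext α
  rw [Function.update_apply]
  split_ifs with h
  · rw [h, headLiminf_succ_self]
  · exact headLiminf_succ_of_ne (Ne.symm h)

theorem sem_simStep_simCfg (hrun : IsRun q c) (hst : ∀ γ, (c γ).state < θ)
    (htab : HasTable one θ fld q σ) (hth : σ th = un one θ)
    (htemp : ∀ v ∈ [hd, a, e, k, k', Var.p, Var.q, f, nh, ct], σ v = ⊥) (γ : Ordinal.{u}) :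
    Sem ℓ one (simStep fld one) (simCfg one θ σ c γ) (simCfg one θ σ c (γ + 1))
      (simCfg one θ σ c γ ⊓ simCfg one θ σ c (γ + 1)) := by
  have hs := hrun.1 γ
  rw [succStep_eq_next] at hs
  have hθ' : (c (γ + 1)).state < θ := hst _
  rw [hs] at hθ'
  refine sem_simStep fld (θ := θ) (α := (c γ).state) (β := (c γ).head)
    (δ := (q.next (c γ).state ((c γ).tape (c γ).head)).1)
    (d' := (q.next (c γ).state ((c γ).tape (c γ).head)).2.1)
    (m := (q.next (c γ).state ((c γ).tape (c γ).head)).2.2)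
    (H := headLiminf c (γ + 1)) (hst γ) hθ' (headLiminf_succ_self c γ)
    (by simp [simCfg]) (by simp [simCfg]) (by simp [simCfg, hth]) ?_ ?_ ?_ inf_le_left inf_le_right
  · simpa [simCfg] using htemp
  · intro ι hι d'' m'
    simp only [simCfg, ne_eq, reduceCtorEq, not_false_eq_true, Function.update_of_ne,
      Function.update_self]
    exact htab _ (hst γ) _ (hι.trans_lt hθ') _ _ _
  · have e : headLiminf c (γ + 1 + 1) = Function.update (headLiminf c (γ + 1))
        (q.next (c γ).state ((c γ).tape (c γ).head)).1
        ((q.next (c γ).state ((c γ).tape (c γ).head)).2.2.move (c γ).head) := by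
      rw [headLiminf_add_one c (γ + 1), hs]
    simp only [simCfg]
    rw [e, hs]
    funext v; cases v <;> simp

/-- At a limit time `l` the head position is by definition the entry of the limit state in
`headLiminf c l`. So including the time `l` itself changes nothing, and the cellwise limit of the
tables is the table at `l`. -/
theorem clim_simCfg (hrun : IsRun q c) {l : Ordinal.{u}} (hl : IsSuccLimit l) :
    CLim (simCfg one θ σ c) l (simCfg one θ σ c l) := by
  refine (((clim_const hl σ).update (hrun.tlim_tape hl) X).update
    ((hrun.rlim_state hl).tlim_un hl) st).update (fun a => ?_) TT
  have e : headLiminf c (l + 1) (a % θ) = headLiminf c l (a % θ) := by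
    rw [headLiminf_add_one, hrun.head_limit hl, Function.update_eq_self]
  simp only [table]
  rw [e]
  exact (rlim_headLiminf c hl (a % θ)).tlim_un hl _

theorem tst_simCfg (hu : σ Var.u = un one 1) (γ : Ordinal.{u}) :
    Tst (tNe st Var.u) (simCfg one θ σ c γ) (decide ((c γ).state ≠ 1)) :=
  tst_ne (one := one) (by simp [simCfg]) (by simp [simCfg, hu])

theorem sem_simulate (hrun : IsRun q c) (hst : ∀ γ, (c γ).state < θ)
    (htab : HasTable one θ fld q σ) (hth : σ th = un one θ) (hu : σ Var.u = un one 1)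
    (htemp : ∀ v ∈ [hd, a, e, k, k', Var.p, Var.q, f, nh, ct], σ v = ⊥) {γ : Ordinal.{u}}
    (hγ : (c γ).state = 1) (hlt : ∀ ξ < γ, (c ξ).state ≠ 1) :
    Sem ℓ one (simulate one fld) (simCfg one θ σ c 0) (simCfg one θ σ c γ) ⊥ :=
  sem_whl (simCfg one θ σ c) γ (fun μ hμ => by simpa [hlt μ hμ] using tst_simCfg (θ := θ) (c := c) hu μ)
    (by simpa [hγ] using tst_simCfg (θ := θ) (c := c) hu γ) (fun μ _ => sem_simStep_simCfg hrun hst htab hth htemp μ)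
    (fun l _ hl => clim_simCfg hrun hl) fun _ _ => bot_le

theorem simulate_diverges (hrun : IsRun q c) (hst : ∀ γ, (c γ).state < θ)
    (htab : HasTable one θ fld q σ) (hth : σ th = un one θ) (hu : σ Var.u = un one 1)
    (htemp : ∀ v ∈ [hd, a, e, k, k', Var.p, Var.q, f, nh, ct], σ v = ⊥)
    (hne : ∀ γ, (c γ).state ≠ 1) {P : Program.{u} A} {c' : Ordinal.{u} → Snapshot.{u} A}
    (hrun' : IsRun P c') {b e' : Ordinal.{u}} (hi : Installed ℓ P (simulate one fld) b e')
    (γ : Ordinal.{u}) (hγ : c' γ = ⟨ℓ.tape one (simCfg one θ σ c 0), nodeStart A K b, 0⟩)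
    (ξ : Ordinal.{u}) (hξ : γ ≤ ξ) : nodeStart A K b ≤ (c' ξ).state :=
  whl_diverges hrun' hi (simCfg one θ σ c) (fun μ => by simpa [hne μ] using tst_simCfg (θ := θ) (c := c) hu μ)
    (fun μ => sem_simStep_simCfg hrun hst htab hth htemp μ)
    (fun l hl => clim_simCfg hrun hl) γ hγ ξ hξ

end Simulation

/-! ### Initial and final parts of tracks. -/

section Tracks

variable {A : Type v} [Fintype A] [LinearOrder A] {x : Ordinal.{u} → WithBot A}

open Classical in
/-- The content `x`, restricted to the cells below `γ`. -/
noncomputable def trunc (x : Ordinal.{u} → WithBot A) (γ : Ordinal.{u}) : Ordinal.{u} → WithBot A :=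
  fun η => if η < γ then x η else ⊥

open Classical in
/-- The content `x`, restricted to the cells from `γ` on. -/
noncomputable def above (x : Ordinal.{u} → WithBot A) (γ : Ordinal.{u}) : Ordinal.{u} → WithBot A :=
  fun η => if η < γ then ⊥ else x η

theorem trunc_zero : trunc x 0 = ⊥ := funext fun η => if_neg not_lt_zero

theorem above_zero : above x 0 = x := funext fun η => if_neg not_lt_zero

theorem trunc_mono {γ γ' : Ordinal.{u}} (h : γ ≤ γ') : trunc x γ ≤ trunc x γ' := by
  intro η
  simp only [trunc]
  split_ifs with h1 h2
  · exact le_rfl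
  · exact absurd (h1.trans_le h) h2
  · exact bot_le
  · exact le_rfl

theorem update_trunc (γ : Ordinal.{u}) :
    Function.update (trunc x γ) γ (x γ) = trunc x (γ + 1) := by
  funext η
  rw [Function.update_apply]
  split_ifs with h
  · rw [h, trunc, if_pos (lt_add_one γ)]
  · simp only [trunc, lt_add_one_iff, le_iff_lt_or_eq, h, or_false]

theorem update_above (γ : Ordinal.{u}) : Function.update (above x γ) γ ⊥ = above x (γ + 1) := by
  funext η
  rw [Function.update_apply]
  split_ifs with h
  · rw [h, above, if_pos (lt_add_one γ)]
  · simp only [above, lt_add_one_iff, le_iff_lt_or_eq, h, or_false]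

theorem trunc_eq {γ : Ordinal.{u}} (h : ∀ η, γ ≤ η → x η = ⊥) : trunc x γ = x := by
  funext η
  rw [trunc]
  split_ifs with h1
  · rfl
  · exact (h η (not_lt.1 h1)).symm

theorem above_eq_bot {γ : Ordinal.{u}} (h : ∀ η, γ ≤ η → x η = ⊥) : above x γ = ⊥ := by
  funext η
  rw [above]
  split_ifs with h1
  · rfl
  · exact h η (not_lt.1 h1)

theorem tlim_trunc {g : Ordinal.{u} → Ordinal.{u}} (hg : IsNormal g) {l : Ordinal.{u}}
    (hl : IsSuccLimit l) (η : Ordinal.{u}) : TLim (fun μ => trunc x (g μ) η) l (trunc x (g l) η) :=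
  (rlim_of_isNormal hl hg).tlim_unary hl.bot_lt η bot_le

theorem tlim_above {l : Ordinal.{u}} (hl : IsSuccLimit l) (η : Ordinal.{u}) :
    TLim (fun μ => above x μ η) l (above x l η) := by
  rcases lt_or_ge η l with h | h
  · refine tlim_const (η + 1) (hl.add_one_lt h) fun μ h1 h2 => ?_
    rw [above, above, if_pos h, if_pos (add_one_le_iff.1 h1)]
  · refine tlim_const 0 hl.bot_lt fun μ h1 h2 => ?_
    rw [above, above, if_neg (not_lt.2 h), if_neg (not_lt.2 (h2.le.trans h))]

end Tracks

/-! ### Copying and erasing words, and counting leading zeros. -/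

section Macros

variable {A : Type v} [Fintype A] [LinearOrder A] {K : ℕ} [NeZero K] {j : ℕ}
  {ℓ : Layout (Var j) K} {zr one : A} {σ σ' L : Cfg.{u} (Var j) A}

open Cmd Var

/-- Increase `r` until `t` fails in the supercell with number `r`. -/
noncomputable def skip (one : A) (r : Var j) (t : (Var j → WithBot A) → Bool) : Cmd (Var j) A :=
  whl (tAt r t) (inc one r)

theorem sem_skip {r : Var j} {t : (Var j → WithBot A) → Bool} (hr : σ r = ⊥) (Λ : Ordinal.{u})
    (ht : ∀ μ < Λ, t (fun v => Function.update σ r (un one μ) v μ) = true)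
    (hf : t (fun v => Function.update σ r (un one Λ) v Λ) = false) :
    Sem ℓ one (skip one r t) σ (Function.update σ r (un one Λ)) ⊥ := by
  refine (sem_whl (fun μ => Function.update σ r (un one μ)) Λ
    (fun μ hμ => tst_at (one := one) (by simp) (ht μ hμ)) (tst_at (one := one) (by simp) hf)
    (fun μ _ => (sem_inc (ρ := μ) (by simp) inf_le_left).to (by simp)) (fun l _ hl =>
      (clim_const hl σ).update ((rlim_of_isNormal hl IsNormal.id).tlim_un hl) r)
    fun _ _ => bot_le).of ?_
  rw [un_zero, ← hr, Function.update_eq_self]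

/-- Erase the track `v`, with counter `r`. -/
noncomputable def wipe (one : A) (r v : Var j) : Cmd (Var j) A :=
  seq (whl (tAt r fun x => decide (x v ≠ ⊥)) (seq (put r v ⊥) (inc one r))) (zero r)

theorem sem_wipe {r v : Var j} (hrv : r ≠ v) (hr : σ r = ⊥) (x : Word.{u} A) (hv : σ v = x.tape) :
    Sem ℓ one (wipe one r v) σ (Function.update σ v ⊥) ⊥ := by
  have h1 := sem_whl (ℓ := ℓ) (one := one) (L := ⊥) (t := tAt r fun x => decide (x v ≠ ⊥))
    (a := seq (put r v ⊥) (inc one r))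
    (fun μ => Function.update (Function.update σ v (above x.tape μ)) r (un one μ)) x.len
    ?_ ?_ ?_ ?_ fun _ _ => bot_le
  · rw [above_zero, ← hv, Function.update_eq_self, un_zero, ← hr, Function.update_eq_self] at h1
    refine (h1.seq fun hL1 => sem_zero (ρ := x.len) (by simp) hL1 le_rfl).to ?_
    rw [hv, above_eq_bot fun η hη => (x.eq_bot_iff η).2 hη, Function.update_idem]
    rw [Function.update_comm hrv.symm, ← hr, Function.update_eq_self]
  · intro μ hμ
    refine tst_at (one := one) (ρ := μ) (by simp) ?_
    simpa [hrv, hrv.symm, above, x.eq_bot_iff] using hμ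
  · refine tst_at (one := one) (ρ := x.len) (by simp) ?_
    simp [hrv, hrv.symm, above, x.eq_bot_iff]
  · intro μ hμ
    refine Sem.seq (sem_put (ρ := μ) (by simp) inf_le_left ?_) fun hL1 =>
      (sem_inc (ρ := μ) (by simp [hrv]) hL1).to ?_
    · refine inf_le_right.trans ?_
      simp [hrv.symm, update_above]
    · simp only [ne_eq, hrv.symm, not_false_eq_true, Function.update_of_ne, Function.update_self,
        update_above]
      rw [Function.update_comm hrv, Function.update_idem, Function.update_idem]
  · intro l _ hl
    exact ((clim_const hl σ).update (tlim_above hl) v).update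
      ((rlim_of_isNormal hl IsNormal.id).tlim_un hl) r

/-- Copy the word in `Y` from place `p` on to `X` at place `e`. -/
noncomputable def copy (one : A) : Cmd (Var j) A :=
  whl (tAt Var.p fun x => decide (x Y ≠ ⊥)) (seq (copyCell Var.p Y e X) (seq (inc one Var.p) (inc one e)))

/-- The target `y` is given in full, so that the stages of the copy are its truncations `trunc y (e₀
+ μ)`, which grow and are continuous in `μ`. The track `X` already holds the part below `e₀`. -/
theorem sem_copy (t : Word.{u} A) {y : Ordinal.{u} → WithBot A} {p₀ e₀ : Ordinal.{u}}
    (hY : σ Y = t.tape) (hp : σ Var.p = un one p₀) (he : σ e = un one e₀) (hX : σ X = trunc y e₀)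
    (hp₀ : p₀ ≤ t.len) (hy : ∀ μ, y (e₀ + μ) = t.tape (p₀ + μ)) :
    Sem ℓ one (copy one) σ (Function.update (Function.update (Function.update σ X y)
      Var.p (un one t.len)) e (un one (e₀ + (t.len - p₀)))) ⊥ := by
  have hlen : p₀ + (t.len - p₀) = t.len := Ordinal.add_sub_cancel_of_le hp₀
  have h1 := sem_whl (ℓ := ℓ) (one := one) (L := ⊥) (t := tAt Var.p fun x => decide (x Y ≠ ⊥))
    (a := seq (copyCell Var.p Y e X) (seq (inc one Var.p) (inc one e)))
    (fun μ => Function.update (Function.update (Function.update σ X (trunc y (e₀ + μ)))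
      Var.p (un one (p₀ + μ))) e (un one (e₀ + μ))) (t.len - p₀)
    ?_ ?_ ?_ ?_ fun _ _ => bot_le
  · refine (h1.to ?_).of ?_
    · rw [hlen, trunc_eq]
      intro η hη
      rw [← Ordinal.add_sub_cancel_of_le (le_self_add.trans hη), hy, t.eq_bot_iff, ← hlen]
      gcongr
      rwa [← add_le_add_iff_left e₀, Ordinal.add_sub_cancel_of_le (le_self_add.trans hη)]
    · funext v; cases v <;> simp [hX, hp, he]
  · intro μ hμ
    refine tst_at (one := one) (ρ := p₀ + μ) (by simp) ?_
    have : p₀ + μ < t.len := by rw [← hlen]; gcongr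
    simpa [hY, t.eq_bot_iff] using this
  · refine tst_at (one := one) (ρ := p₀ + (t.len - p₀)) (by simp) ?_
    simp [hY, t.eq_bot_iff, hlen]
  · intro μ hμ
    refine Sem.seq (sem_copyCell (ρ := p₀ + μ) (ρ' := e₀ + μ) (by simp) (by simp) inf_le_left ?_)
      fun hL1 => Sem.seq (sem_inc (ρ := p₀ + μ) (by simp) hL1) fun hL2 =>
      (sem_inc (ρ := e₀ + μ) (by simp) hL2).to ?_
    · refine inf_le_left.trans ?_
      simp only [ne_eq, reduceCtorEq, not_false_eq_true, Function.update_of_ne, Function.update_self,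
        hY, ← hy, update_trunc]
      exact trunc_mono (lt_add_one _).le
    · funext v; cases v <;> simp [hY, ← hy, update_trunc, add_assoc]
  · intro l _ hl
    exact (((clim_const hl σ).update (tlim_trunc (add_isNormal _) hl) X).update
      ((rlim_of_isNormal hl (add_isNormal _)).tlim_un hl) _).update
      ((rlim_of_isNormal hl (add_isNormal _)).tlim_un hl) e

/-- The number of the leading letters `zr`. -/
noncomputable def zeros (zr : A) (t : Word.{u} A) : Ordinal.{u} := sInf {μ | t.tape μ ≠ zr}

theorem tape_zeros (zr : A) (t : Word.{u} A) : t.tape (zeros zr t) ≠ zr :=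
  csInf_mem (s := {μ | t.tape μ ≠ zr}) ⟨t.len, by
    rw [Set.mem_ofPred_eq, (t.eq_bot_iff _).2 le_rfl]; exact WithBot.bot_ne_coe⟩

theorem tape_lt_zeros {t : Word.{u} A} {μ : Ordinal.{u}} (h : μ < zeros zr t) : t.tape μ = zr := by
  have := notMem_of_lt_csInf' h
  simpa using this

theorem zeros_eq {t : Word.{u} A} {μ : Ordinal.{u}} (h : t.tape μ ≠ zr)
    (h' : ∀ η < μ, t.tape η = zr) : zeros zr t = μ := by
  refine le_antisymm (csInf_le' h) (le_of_not_gt fun h1 => tape_zeros zr t (h' _ h1))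

/-- The machine can find the first place without `zr`. Whether that place is finite, and what it
holds, decides the case in the definition of `Word.tail`. -/
theorem isZeros_iff {t : Word.{u} A} :
    t.IsZeros zr ↔ zeros zr t < ω ∧ t.tape (zeros zr t) = ⊥ := by
  constructor
  · rintro ⟨h1, h2⟩
    have h3 : t.tape t.len = ⊥ := (t.eq_bot_iff _).2 le_rfl
    have h4 : zeros zr t = t.len := zeros_eq (by rw [h3]; exact WithBot.bot_ne_coe) h2
    rw [h4]
    exact ⟨h1, h3⟩
  · rintro ⟨h1, h2⟩
    rw [t.eq_bot_iff] at h2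
    exact ⟨h2.trans_lt h1, fun β hβ => tape_lt_zeros (hβ.trans_le h2)⟩

theorem startsZerosOne_iff (h01 : zr ≠ one) {t : Word.{u} A} :
    t.StartsZerosOne zr one ↔ zeros zr t < ω ∧ t.tape (zeros zr t) = one := by
  constructor
  · rintro ⟨n, h1, h2⟩
    have h4 : zeros zr t = n := by
      refine zeros_eq (by rw [h1]; exact fun h => h01 (WithBot.coe_inj.1 h).symm) fun η hη => ?_
      obtain ⟨m, rfl⟩ := lt_omega0.1 (hη.trans (natCast_lt_omega0 n))
      exact h2 m (by exact_mod_cast hη)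
    rw [h4]
    exact ⟨natCast_lt_omega0 n, h1⟩
  · rintro ⟨h1, h2⟩
    obtain ⟨n, hn⟩ := lt_omega0.1 h1
    refine ⟨n, hn ▸ h2, fun m hm => tape_lt_zeros ?_⟩
    rw [hn]
    exact_mod_cast hm

/-- `q` becomes the number of the leading letters `zr` in `Y`, and `k` becomes `1 + q`. -/
noncomputable def countZeros (zr one : A) : Cmd (Var j) A :=
  seq (inc one k) (whl (tAt Var.q fun x => decide (x Y = (zr : WithBot A))) (seq (inc one Var.q) (inc one k)))

theorem sem_countZeros (t : Word.{u} A) (hY : σ Y = t.tape) (hq : σ Var.q = ⊥) (hk : σ k = ⊥) :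
    Sem ℓ one (countZeros zr one) σ (Function.update (Function.update σ Var.q (un one (zeros zr t)))
      k (un one (1 + zeros zr t))) ⊥ := by
  refine Sem.seq (sem_inc (ρ := 0) (by simp [hk, un_zero]) bot_le) fun _ => ?_
  refine (sem_whl (fun μ => Function.update (Function.update σ Var.q (un one μ)) k (un one (1 + μ)))
    (zeros zr t) ?_ ?_ ?_ ?_ fun _ _ => bot_le).of ?_
  · intro μ hμ
    refine tst_at (one := one) (ρ := μ) (by simp) ?_
    simp [hY, tape_lt_zeros hμ]
  · refine tst_at (one := one) (ρ := zeros zr t) (by simp) ?_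
    simp [hY, tape_zeros]
  · intro μ hμ
    refine Sem.seq (sem_inc (ρ := μ) (by simp) inf_le_left) fun hL1 =>
      (sem_inc (ρ := 1 + μ) (by simp) hL1).to ?_
    funext v; cases v <;> simp [add_assoc]
  · intro l _ hl
    exact ((clim_const hl σ).update ((rlim_of_isNormal hl IsNormal.id).tlim_un hl) _).update
      ((rlim_of_isNormal hl (add_isNormal _)).tlim_un hl) k
  · funext v; cases v <;> simp [hq, un_zero]

/-- This is the finiteness test of the machine. It counts once from `0` and once from `1`, and at
`ω` the two counters become equal for good. -/
theorem one_add_ne_iff {μ : Ordinal.{u}} : μ ≠ 1 + μ ↔ μ < ω := by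
  constructor
  · intro h
    by_contra! hω
    exact h (one_add_of_omega0_le hω).symm
  · intro h e
    obtain ⟨n, rfl⟩ := lt_omega0.1 h
    have : n = 1 + n := by exact_mod_cast e
    omega

/-- Copy `Y` to `X`, with a letter `zr` in front. -/
noncomputable def copyCons (zr one : A) : Cmd (Var j) A :=
  seq (put e X (zr : WithBot A)) (seq (inc one e) (copy one))

/-- Copy `Y` without its first letter to `X`, but execute `c` if `Y` does not begin with `zr`. -/
noncomputable def copyDrop (one : A) (c : Cmd (Var j) A) : Cmd (Var j) A :=
  ite (tZero Var.q) c (seq (inc one Var.p) (copy one))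

/-- Execute `c` if `Y` is one of the words `zr … zr`, execute `c'` if `Y` begins with `zr … zr one`, and
otherwise copy `Y` to `X`. -/
noncomputable def byZeros (zr one : A) (c c' : Cmd (Var j) A) : Cmd (Var j) A :=
  seq (countZeros zr one) (ite (tNe Var.q k)
    (ite (tAt Var.q fun x => decide (x Y = ⊥)) c
      (ite (tAt Var.q fun x => decide (x Y = (one : WithBot A))) c' (copy one))) (copy one))

/-- Reset the pointers and `Y`. -/
noncomputable def resetCopy (one : A) : Cmd (Var j) A :=
  seq (zero Var.p) (seq (zero e) (seq (zero Var.q) (seq (zero k) (wipe one Var.p Y))))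

theorem sem_resetCopy (t : Word.{u} A) {y : Ordinal.{u} → WithBot A} (ρp ρe ρq ρk : Ordinal.{u})
    (hY : σ Y = t.tape) (hp : σ Var.p = ⊥) (hq : σ Var.q = ⊥) (hk : σ k = ⊥) :
    Sem ℓ one (resetCopy one) (Function.update (Function.update (Function.update (Function.update
      (Function.update σ X y) Var.p (un one ρp)) e (un one ρe)) Var.q (un one ρq)) k (un one ρk))
      (Function.update (Function.update (Function.update σ X y) Y ⊥) e ⊥) ⊥ := by
  refine Sem.seq (sem_zero (ρ := ρp) (by simp) bot_le le_rfl) fun hL1 => ?_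
  refine Sem.seq (sem_zero (ρ := ρe) (by simp) bot_le le_rfl) fun hL1 => ?_
  refine Sem.seq (sem_zero (ρ := ρq) (by simp) bot_le le_rfl) fun hL1 => ?_
  refine Sem.seq (sem_zero (ρ := ρk) (by simp) bot_le le_rfl) fun hL1 => ?_
  refine (sem_wipe (by simp) (by simp) t (by simp [hY])).to ?_
  funext v; cases v <;> simp [hp, hq, hk]

/-- Copy `tail Y` to `X` at place `e`. -/
noncomputable def copyTail (zr one : A) : Cmd (Var j) A :=
  seq (byZeros zr one (copyDrop one (put e X (one : WithBot A))) (copyCons zr one)) (resetCopy one)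

/-- Copy to `X` the word `w` for which `Y` is `tail w`. -/
noncomputable def copyUntail (zr one : A) : Cmd (Var j) A :=
  seq (byZeros zr one (copyCons zr one) (copyDrop one nop)) (resetCopy one)

end Macros

/-! ### Computing `tail` and its inverse. -/

section Tails

variable {A : Type v} [Fintype A] [LinearOrder A] {K : ℕ} [NeZero K] {j : ℕ}
  {ℓ : Layout (Var j) K} {zr one : A} {σ σ' L : Cfg.{u} (Var j) A}

open Cmd Var

/-- The contents of the variables during a copy. -/
noncomputable def copyCfg (one : A) (σ : Cfg.{u} (Var j) A) (y : Ordinal.{u} → WithBot A)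
    (ρp ρe ρq ρk : Ordinal.{u}) : Cfg.{u} (Var j) A :=
  Function.update (Function.update (Function.update (Function.update
      (Function.update σ X y) Var.p (un one ρp)) e (un one ρe)) Var.q (un one ρq)) k (un one ρk)

variable {t : Word.{u} A} {y : Ordinal.{u} → WithBot A} {p₀ e₀ z z' : Ordinal.{u}}

theorem sem_copy_copyCfg (hY : σ Y = t.tape) (hp₀ : p₀ ≤ t.len)
    (hy : ∀ μ, y (e₀ + μ) = t.tape (p₀ + μ)) :
    Sem ℓ one (copy one) (copyCfg one σ (trunc y e₀) p₀ e₀ z z')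
      (copyCfg one σ y t.len (e₀ + (t.len - p₀)) z z') ⊥ := by
  refine (sem_copy t (p₀ := p₀) (e₀ := e₀) (by simp [copyCfg, hY]) (by simp [copyCfg])
    (by simp [copyCfg]) (by simp [copyCfg]) hp₀ hy).to ?_
  funext v; cases v <;> simp [copyCfg]

theorem sem_copyCons (hY : σ Y = t.tape)
    (hy : ∀ μ, y (e₀ + μ) = ((Word.letter zr).append t).tape μ) :
    Sem ℓ one (copyCons zr one) (copyCfg one σ (trunc y e₀) 0 e₀ z z')
      (copyCfg one σ y t.len (e₀ + 1 + (t.len - 0)) z z') ⊥ := by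
  refine Sem.seq (sem_put (ρ := e₀) (by simp [copyCfg]) bot_le bot_le) fun _ =>
    Sem.seq (sem_inc (ρ := e₀) (by simp [copyCfg]) bot_le) fun _ =>
    (sem_copy_copyCfg (z := z) (z' := z') (p₀ := 0) (e₀ := e₀ + 1) hY zero_le fun μ => ?_).of ?_
  · rw [add_assoc, hy, Word.cons_one_add, zero_add]
  · have : (zr : WithBot A) = y e₀ := by rw [← add_zero e₀, hy, Word.cons_zero]
    funext v; cases v <;> simp [copyCfg, this, update_trunc]

theorem sem_copyDrop {c : Cmd (Var j) A} (hY : σ Y = t.tape) (ht : t.len ≠ 0) (hz : z ≠ 0)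
    (hy : ∀ μ, y (e₀ + μ) = t.dropFirst.tape μ) :
    Sem ℓ one (copyDrop one c) (copyCfg one σ (trunc y e₀) 0 e₀ z z')
      (copyCfg one σ y t.len (e₀ + (t.len - 1)) z z') ⊥ := by
  have ht' := tst_zero (one := one) (σ := copyCfg one σ (trunc y e₀) 0 e₀ z z') (r := Var.q) (ρ := z)
    (by simp [copyCfg])
  rw [decide_eq_false hz] at ht'
  refine Sem.ite_false ht' (Sem.seq (sem_inc (ρ := 0) (by simp [copyCfg]) bot_le) fun _ =>
    (sem_copy_copyCfg (z := z) (z' := z') (p₀ := 1) (e₀ := e₀) hY (one_le_iff_ne_zero.2 ht) hy).of ?_)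
  funext v; cases v <;> simp [copyCfg]

theorem sem_byZeros {c c' : Cmd (Var j) A} (h01 : zr ≠ one) (hY : σ Y = t.tape) (hp : σ Var.p = ⊥)
    (he : σ e = un one e₀) (hq : σ Var.q = ⊥) (hk : σ k = ⊥) (hX : σ X = trunc y e₀)
    (h1 : t.IsZeros zr → Sem ℓ one c (copyCfg one σ (trunc y e₀) 0 e₀ (zeros zr t)
      (1 + zeros zr t)) σ' ⊥)
    (h2 : t.StartsZerosOne zr one → Sem ℓ one c' (copyCfg one σ (trunc y e₀) 0 e₀ (zeros zr t)
      (1 + zeros zr t)) σ' ⊥)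
    (h3 : ¬ t.IsZeros zr → ¬ t.StartsZerosOne zr one → Sem ℓ one (copy one)
      (copyCfg one σ (trunc y e₀) 0 e₀ (zeros zr t) (1 + zeros zr t)) σ' ⊥) :
    Sem ℓ one (byZeros zr one c c') σ σ' ⊥ := by
  refine Sem.seq (sem_countZeros (zr := zr) t hY hq hk) fun _ => ?_
  have e1 : Function.update (Function.update σ Var.q (un one (zeros zr t))) k
      (un one (1 + zeros zr t)) = copyCfg one σ (trunc y e₀) 0 e₀ (zeros zr t) (1 + zeros zr t) := by
    funext v; cases v <;> simp [copyCfg, hp, he, hX, un_zero]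
  rw [e1]
  have ht := tst_ne (one := one) (σ := copyCfg one σ (trunc y e₀) 0 e₀ (zeros zr t) (1 + zeros zr t))
    (r := Var.q) (r' := k) (ρ := zeros zr t) (ρ' := 1 + zeros zr t) (by simp [copyCfg])
    (by simp [copyCfg])
  have hat : ∀ (d : WithBot A) (b : Bool), decide (t.tape (zeros zr t) = d) = b →
      Tst (tAt Var.q fun x => decide (x Y = d))
        (copyCfg one σ (trunc y e₀) 0 e₀ (zeros zr t) (1 + zeros zr t)) b := fun d b hb =>
    tst_at (one := one) (ρ := zeros zr t) (by simp [copyCfg]) (by simpa [copyCfg, hY] using hb)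
  by_cases hfin : zeros zr t < ω
  · rw [decide_eq_true (one_add_ne_iff.2 hfin)] at ht
    refine Sem.ite_true ht ?_
    by_cases hbot : t.tape (zeros zr t) = ⊥
    · exact Sem.ite_true (hat ⊥ true (by simp [hbot])) (h1 (isZeros_iff.2 ⟨hfin, hbot⟩))
    · refine Sem.ite_false (hat ⊥ false (by simp [hbot])) ?_
      by_cases hone : t.tape (zeros zr t) = one
      · exact Sem.ite_true (hat one true (by simp [hone]))
          (h2 ((startsZerosOne_iff h01).2 ⟨hfin, hone⟩))
      · exact Sem.ite_false (hat one false (by simp [hone])) (h3 (fun h => hbot (isZeros_iff.1 h).2)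
          fun h => hone ((startsZerosOne_iff h01).1 h).2)
  · rw [decide_eq_false (fun h => hfin (one_add_ne_iff.1 h))] at ht
    exact Sem.ite_false ht (h3 (fun h => hfin (isZeros_iff.1 h).1)
      fun h => hfin ((startsZerosOne_iff h01).1 h).1)

theorem zeros_ne_zero {t : Word.{u} A} (h : t.tape 0 = zr) : zeros zr t ≠ 0 := fun h0 =>
  tape_zeros zr t (h0 ▸ h)

/-- For words `zr … zr` the first letter is dropped, or `one` is written if there is none; for words
`zr … zr one …` a letter is put in front. The nonzero count of zeros tells whether there is a first
letter to drop. -/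
theorem sem_copyTail {w : Word.{u} A} (h01 : zr ≠ one) (hY : σ Y = w.tape) (hp : σ Var.p = ⊥)
    (he : σ e = un one e₀) (hq : σ Var.q = ⊥) (hk : σ k = ⊥) (hX : σ X = trunc y e₀)
    (hy : ∀ μ, y (e₀ + μ) = (w.tail zr one).tape μ) :
    Sem ℓ one (copyTail zr one) σ
      (Function.update (Function.update (Function.update σ X y) Y ⊥) e ⊥) ⊥ := by
  obtain ⟨ρp, ρe, ρq, ρk, h⟩ : ∃ ρp ρe ρq ρk : Ordinal.{u},
      Sem ℓ one (byZeros zr one (copyDrop one (put e X (one : WithBot A))) (copyCons zr one)) σ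
        (copyCfg one σ y ρp ρe ρq ρk) ⊥ := by
    rcases Word.tail_cases h01 w with ⟨h0, h1⟩ | ⟨h1, h2⟩ | ⟨h1, h2, -⟩ | ⟨h1, h2, h3⟩
    · have hzw : w.IsZeros zr := ⟨h0 ▸ omega0_pos, fun β hβ => by simp [h0] at hβ⟩
      have hz : zeros zr w = 0 := by
        refine zeros_eq ?_ fun η hη => absurd hη not_lt_zero
        rw [(w.eq_bot_iff 0).2 h0.le]
        exact WithBot.bot_ne_coe
      refine ⟨0, e₀, zeros zr w, 1 + zeros zr w, sem_byZeros h01 hY hp he hq hk hX (fun _ => ?_) (fun h => absurd hzw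
        (Word.not_isZeros_of_startsZerosOne h01 h)) (fun h => absurd hzw h)⟩
      have ht' := tst_zero (one := one) (σ := copyCfg one σ (trunc y e₀) 0 e₀ (zeros zr w)
        (1 + zeros zr w)) (r := Var.q) (ρ := zeros zr w) (by simp [copyCfg])
      rw [decide_eq_true hz] at ht'
      refine Sem.ite_true ht' ((sem_put (ρ := e₀) (by simp [copyCfg]) bot_le bot_le).to ?_)
      have e1 : (one : WithBot A) = y e₀ := by
        rw [← add_zero e₀, hy, h1]; simp [Word.letter]
      have e2 : trunc y (e₀ + 1) = y := by
        refine trunc_eq fun η hη => ?_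
        have e3 := Ordinal.add_sub_cancel_of_le hη
        rw [← e3, add_assoc, hy, h1]
        simp [Word.letter]
      funext v; cases v <;> simp [copyCfg, e1, update_trunc, e2]
    · have hw0 : w.tape 0 = zr := by rw [h1, Word.cons_zero]
      have hlen : w.len ≠ 0 := fun h => by
        rw [(w.eq_bot_iff 0).2 h.le] at hw0
        exact WithBot.bot_ne_coe hw0
      have hzw : w.IsZeros zr := by rw [h1]; exact Word.isZeros_cons.2 h2
      refine ⟨_, _, _, _, sem_byZeros h01 hY hp he hq hk hX (fun _ => sem_copyDrop hY hlen
        (zeros_ne_zero hw0) fun μ => ?_) (fun h => absurd hzw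
        (Word.not_isZeros_of_startsZerosOne h01 h)) (fun h => absurd hzw h)⟩
      rw [hy]
      conv_rhs => rw [h1, Word.dropFirst_cons]
    · have hnz := Word.not_isZeros_of_startsZerosOne h01 h1
      exact ⟨_, _, _, _, sem_byZeros h01 hY hp he hq hk hX (fun h => absurd h hnz)
        (fun _ => sem_copyCons hY fun μ => by rw [hy, h2]) (fun _ h => absurd h1 h)⟩
    · exact ⟨_, _, _, _, sem_byZeros h01 hY hp he hq hk hX (fun h => absurd h h1)
        (fun h => absurd h h2) (fun _ _ => sem_copy_copyCfg hY zero_le fun μ => by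
          rw [hy, h3, zero_add])⟩
  exact h.seq fun _ => sem_resetCopy w ρp ρe ρq ρk hY hp hq hk

/-- The map `tail` sends `zr … zr` with at least one letter to a word of the same kind with one
letter less, and preserves the kind `zr … zr one …` while adding a letter. So its inverse makes the
same case distinction, with adding and dropping interchanged. -/
theorem sem_copyUntail {w : Word.{u} A} (h01 : zr ≠ one) (hY : σ Y = (w.tail zr one).tape)
    (hp : σ Var.p = ⊥) (he : σ e = ⊥) (hq : σ Var.q = ⊥) (hk : σ k = ⊥) (hX : σ X = ⊥) :
    Sem ℓ one (copyUntail zr one) σ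
      (Function.update (Function.update σ X w.tape) Y ⊥) ⊥ := by
  have he' : σ e = un one 0 := by rw [he, un_zero]
  have hX' : σ X = trunc w.tape 0 := by rw [hX, trunc_zero]
  set t := w.tail zr one with ht
  obtain ⟨ρp, ρe, ρq, ρk, h⟩ : ∃ ρp ρe ρq ρk : Ordinal.{u},
      Sem ℓ one (byZeros zr one (copyCons zr one) (copyDrop one nop)) σ
        (copyCfg one σ w.tape ρp ρe ρq ρk) ⊥ := by
    rcases Word.tail_cases h01 w with ⟨h0, h1⟩ | ⟨h1, h2⟩ | ⟨h1, h2, h3⟩ | ⟨h1, h2, h3⟩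
    -- The empty word has the tail `one`, which is the only tail that begins with `one`. It falls
    -- under the kind `zr … zr one …` without any zeros, and then nothing is written.
    · have hs : t.StartsZerosOne zr one := by
        rw [ht, h1]; exact Word.letter_startsZerosOne zr one
      have hz : zeros zr t = 0 := by
        refine zeros_eq ?_ fun η hη => absurd hη not_lt_zero
        rw [ht, h1]
        simpa [Word.letter] using h01.symm
      refine ⟨0, 0, zeros zr t, 1 + zeros zr t, sem_byZeros h01 hY hp he' hq hk hX' (fun h => absurd h
        (Word.not_isZeros_of_startsZerosOne h01 hs)) (fun _ => ?_) (fun _ h => absurd hs h)⟩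
      have ht' := tst_zero (one := one) (σ := copyCfg one σ (trunc w.tape 0) 0 0 (zeros zr t)
        (1 + zeros zr t)) (r := Var.q) (ρ := zeros zr t) (by simp [copyCfg])
      rw [decide_eq_true hz] at ht'
      refine Sem.ite_true ht' ((sem_nop bot_le).to ?_)
      rw [trunc_eq fun η _ => (w.eq_bot_iff η).2 (h0.le.trans zero_le)]
    · exact ⟨_, _, _, _, sem_byZeros h01 hY hp he' hq hk hX' (fun _ => sem_copyCons hY fun μ => by
        rw [zero_add]; exact congrArg (fun x : Word.{u} A => x.tape μ) h1)
        (fun h => absurd h2 (Word.not_isZeros_of_startsZerosOne h01 h)) (fun h => absurd h2 h)⟩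
    · have ht0 : t.tape 0 = zr := by rw [ht, h2, Word.cons_zero]
      have hlen : t.len ≠ 0 := fun h => by
        rw [(t.eq_bot_iff 0).2 h.le] at ht0
        exact WithBot.bot_ne_coe ht0
      exact ⟨_, _, _, _, sem_byZeros h01 hY hp he' hq hk hX' (fun h => absurd h
        (Word.not_isZeros_of_startsZerosOne h01 h3)) (fun _ => sem_copyDrop hY hlen
        (zeros_ne_zero ht0) fun μ => by rw [ht, h2, Word.dropFirst_cons, zero_add])
        (fun _ h => absurd h3 h)⟩
    · rw [← ht] at h3
      exact ⟨_, _, _, _, sem_byZeros h01 hY hp he' hq hk hX' (fun h => absurd (h3 ▸ h) h1)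
        (fun h => absurd (h3 ▸ h) h2) (fun _ _ => sem_copy_copyCfg hY zero_le fun μ => by
          simp [h3])⟩
  refine (h.seq fun _ => sem_resetCopy t ρp ρe ρq ρk hY hp hq hk).to ?_
  funext v; cases v <;> simp [he]

end Tails

/-! ### Moving words between the input tracks and a single track. -/

section Transfer

variable {A : Type v} [Fintype A] [LinearOrder A] {K : ℕ} [NeZero K] {j : ℕ}
  {ℓ : Layout (Var j) K} {one : A} {σ σ' L : Cfg.{u} (Var j) A}

open Cmd Var

/-- Execute `F i` for all `i`. -/
def forFin (F : Fin j → Cmd (Var j) A) : Cmd (Var j) A :=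
  forTo (fun i => if h : i < j then F ⟨i, h⟩ else nop) j

theorem sem_forFin {F : Fin j → Cmd (Var j) A} (s : ℕ → Cfg.{u} (Var j) A)
    (h : ∀ i : Fin j, Sem ℓ one (F i) (s i) (s (i + 1)) L) (hL : L ≤ s 0) :
    Sem ℓ one (forFin F) (s 0) (s j) L :=
  sem_forTo s j (fun i hi => by simpa [hi] using h ⟨i, hi⟩) hL

/-- The number of supercells that are needed for the word `x`. -/
noncomputable def width (j : ℕ) (x : Word.{u} A) : Ordinal.{u} := sInf {μ | x.len ≤ j * μ}

theorem le_mul_width (hj : 0 < j) (x : Word.{u} A) : x.len ≤ j * width j x :=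
  csInf_mem (s := {μ | x.len ≤ j * μ}) ⟨x.len, Ordinal.le_mul_right _ (by exact_mod_cast hj)⟩

theorem mul_lt_of_lt_width {x : Word.{u} A} {μ : Ordinal.{u}} (h : μ < width j x) :
    (j : Ordinal.{u}) * μ < x.len := by
  have := notMem_of_lt_csInf' h
  simpa using this

/-- Copy the word in the input tracks, from supercell `a` on, to `Y`. -/
noncomputable def load [NeZero j] (one : A) : Cmd (Var j) A :=
  seq (whl (tAt a fun x => decide (x (inp 0) ≠ ⊥))
    (seq (forFin fun i => seq (copyCell a (inp i) e Y) (inc one e)) (inc one a)))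
    (seq (zero a) (zero e))

/-- The letters are interleaved: number `j * μ + i` is in track `i` of supercell `b + μ`. So the
word reaches this supercell exactly if track `0` is not empty there, that is, for `μ < width j t`.
-/
theorem sem_load [NeZero j] {b : Ordinal.{u}} (t : Word.{u} A) (ha : σ a = un one b) (he : σ e = ⊥)
    (hY : σ Y = ⊥) (hinp : ∀ i μ, σ (inp i) (b + μ) = t.tape (j * μ + (i : ℕ))) :
    Sem ℓ one (load one) σ (Function.update (Function.update σ a ⊥) Y t.tape) ⊥ := by
  have hj : 0 < j := Nat.pos_of_neZero j
  have hj' : (0 : Ordinal.{u}) < j := by exact_mod_cast hj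
  set s : Ordinal.{u} → Cfg.{u} (Var j) A := fun μ =>
    Function.update (Function.update (Function.update σ a (un one (b + μ))) e (un one (j * μ))) Y
      (trunc t.tape (j * μ)) with hs
  have h1 := sem_whl (ℓ := ℓ) (one := one) (L := ⊥) (t := tAt a fun x => decide (x (inp 0) ≠ ⊥))
    (a := seq (forFin fun i => seq (copyCell a (inp i) e Y) (inc one e)) (inc one a)) s (width j t)
    ?_ ?_ ?_ ?_ fun _ _ => bot_le
  · have e0 : s 0 = σ := by
      funext v; cases v <;> simp [hs, ha, he, hY, un_zero, trunc_zero]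
    rw [e0] at h1
    refine (h1.seq fun _ => Sem.seq (sem_zero (ρ := b + width j t) (by simp [hs]) bot_le le_rfl)
      fun _ => sem_zero (ρ := j * width j t) (by simp [hs]) bot_le le_rfl).to ?_
    have e1 : trunc t.tape (j * width j t) = t.tape :=
      trunc_eq fun η hη => (t.eq_bot_iff η).2 ((le_mul_width hj t).trans hη)
    funext v; cases v <;> simp [hs, e1, he]
  · intro μ hμ
    refine tst_at (one := one) (ρ := b + μ) (by simp [hs]) ?_
    simpa [hs, hinp, t.eq_bot_iff] using mul_lt_of_lt_width hμ
  · refine tst_at (one := one) (ρ := b + width j t) (by simp [hs]) ?_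
    simpa [hs, hinp, t.eq_bot_iff] using le_mul_width hj t
  · intro μ hμ
    -- The configurations inside a round, after `i` of its `j` places. All changes are increases, so
    -- the configuration at the beginning of the round is a lower bound.
    set s' : ℕ → Cfg.{u} (Var j) A := fun i =>
      Function.update (Function.update (Function.update σ a (un one (b + μ))) e
        (un one (j * μ + i))) Y (trunc t.tape (j * μ + i)) with hs'
    have e0 : s μ = s' 0 := by simp [hs, hs']
    have hle : ∀ i, s μ ≤ s' i := fun i => by
      rw [e0]
      intro v
      cases v <;> simp [hs', un_mono, trunc_mono]
    have h2 := sem_forFin (ℓ := ℓ) (one := one) (L := s μ ⊓ s (μ + 1))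
      (F := fun i => seq (copyCell a (inp i) e Y) (inc one e)) s' (fun i => ?_)
      (inf_le_left.trans (hle 0))
    · rw [← e0] at h2
      refine h2.seq fun hL1 => (sem_inc (ρ := b + μ) (by simp [hs']) hL1).to ?_
      funext v; cases v <;> simp [hs', hs, mul_add_one, add_assoc]
    · refine Sem.seq (sem_copyCell (ρ := b + μ) (ρ' := j * μ + (i : ℕ)) (by simp [hs']) (by simp [hs'])
        (inf_le_left.trans (hle i)) ?_) fun hL1 => (sem_inc (ρ := j * μ + (i : ℕ)) (by simp [hs'])
        hL1).to ?_
      · refine ((inf_le_left : s μ ⊓ s (μ + 1) ≤ s μ) Y).trans ((hle (i + 1) Y).trans ?_)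
        simp [hs', hinp, update_trunc, add_assoc]
      · funext v; cases v <;> simp [hs', hinp, update_trunc, add_assoc]
  · intro l _ hl
    exact (((clim_const hl σ).update ((rlim_of_isNormal hl (add_isNormal _)).tlim_un hl) a).update
      ((rlim_of_isNormal hl (mul_isNormal hj')).tlim_un hl) e).update
      (tlim_trunc (mul_isNormal hj') hl) Y

/-- Replace the contents of the input tracks. -/
def setInp (σ : Cfg.{u} (Var j) A) (F : Fin j → Ordinal.{u} → WithBot A) : Cfg.{u} (Var j) A
  | inp i => F i
  | v => σ v

theorem clim_setInp {l : Ordinal.{u}} {s : Ordinal.{u} → Cfg.{u} (Var j) A}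
    {σ : Cfg.{u} (Var j) A} (h : CLim s l σ)
    {F : Ordinal.{u} → Fin j → Ordinal.{u} → WithBot A} {G : Fin j → Ordinal.{u} → WithBot A}
    (hF : ∀ i η, TLim (fun μ => F μ i η) l (G i η)) :
    CLim (fun μ => setInp (s μ) (F μ)) l (setInp σ G) := by
  intro v η
  cases v with
  | inp i => exact hF i η
  | _ => exact h _ η

/-- Copy the word in `X` to the input tracks and erase `X`. -/
noncomputable def output (one : A) : Cmd (Var j) A :=
  seq (whl (tAt e fun x => decide (x X ≠ ⊥))
    (seq (forFin fun i => seq (copyCell e X a (inp i)) (inc one e)) (inc one a)))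
    (seq (zero a) (seq (zero e) (wipe one e X)))

theorem sem_output [NeZero j] (r : Word.{u} A) (ha : σ a = ⊥) (he : σ e = ⊥) (hX : σ X = r.tape)
    (hinp : ∀ i, σ (inp i) = ⊥) :
    Sem ℓ one (output one) σ (setInp (Function.update σ X ⊥) fun i μ => r.tape (j * μ + (i : ℕ))) ⊥ := by
  have hj : 0 < j := Nat.pos_of_neZero j
  have hj' : (0 : Ordinal.{u}) < j := by exact_mod_cast hj
  set F : Fin j → Ordinal.{u} → WithBot A := fun i μ => r.tape (j * μ + (i : ℕ)) with hF
  set s : Ordinal.{u} → Cfg.{u} (Var j) A := fun μ =>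
    setInp (Function.update (Function.update σ a (un one μ)) e (un one (j * μ))) fun i =>
      trunc (F i) μ with hs
  have h1 := sem_whl (ℓ := ℓ) (one := one) (L := ⊥) (t := tAt e fun x => decide (x X ≠ ⊥))
    (a := seq (forFin fun i => seq (copyCell e X a (inp i)) (inc one e)) (inc one a)) s (width j r)
    ?_ ?_ ?_ ?_ fun _ _ => bot_le
  · have e0 : s 0 = σ := by
      funext v; cases v <;> simp [hs, setInp, ha, he, hinp, un_zero, trunc_zero]
    rw [e0] at h1
    refine (h1.seq fun _ => Sem.seq (sem_zero (ρ := width j r) (by simp [hs, setInp]) bot_le le_rfl)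
      fun _ => Sem.seq (sem_zero (ρ := j * width j r) (by simp [hs, setInp]) bot_le le_rfl)
      fun _ => sem_wipe (by simp) (by simp) r (by simp [hs, setInp, hX])).to ?_
    have e1 : ∀ i, trunc (F i) (width j r) = F i := fun i =>
      trunc_eq fun η hη => (r.eq_bot_iff _).2 ((le_mul_width hj r).trans
        ((by gcongr : (j : Ordinal.{u}) * width j r ≤ j * η).trans le_self_add))
    funext v; cases v <;> simp [hs, setInp, e1, he, ha]
  · intro μ hμ
    refine tst_at (one := one) (ρ := j * μ) (by simp [hs, setInp]) ?_
    simpa [hs, setInp, hX, r.eq_bot_iff] using mul_lt_of_lt_width hμ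
  · refine tst_at (one := one) (ρ := j * width j r) (by simp [hs, setInp]) ?_
    simpa [hs, setInp, hX, r.eq_bot_iff] using le_mul_width hj r
  · intro μ hμ
    -- Inside a round the tracks `i < n` have already received their content at `μ`.
    set s' : ℕ → Cfg.{u} (Var j) A := fun n =>
      setInp (Function.update (Function.update σ a (un one μ)) e (un one (j * μ + n))) fun i =>
        trunc (F i) (if (i : ℕ) < n then μ + 1 else μ) with hs'
    have e0 : s μ = s' 0 := by simp [hs, hs']
    have hle : ∀ n, s μ ≤ s' n := fun n => by
      rw [e0]
      intro v
      cases v with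
      | inp i =>
        simp only [hs', setInp]
        apply trunc_mono
        split_ifs
        · exact absurd ‹(i : ℕ) < 0› (Nat.not_lt_zero _)
        · exact absurd ‹(i : ℕ) < 0› (Nat.not_lt_zero _)
        · exact (lt_add_one μ).le
        · exact le_rfl
      | _ => simp [hs', setInp, un_mono]
    have h2 := sem_forFin (ℓ := ℓ) (one := one) (L := s μ ⊓ s (μ + 1))
      (F := fun i => seq (copyCell e X a (inp i)) (inc one e)) s' (fun i => ?_)
      (inf_le_left.trans (hle 0))
    · rw [← e0] at h2
      refine h2.seq fun hL1 => (sem_inc (ρ := μ) (by simp [hs', setInp]) hL1).to ?_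
      funext v; cases v <;> simp [hs', hs, setInp, mul_add_one]
    · have e2 : Function.update (s' i (inp i)) μ (s' i X (j * μ + (i : ℕ))) = s' (i + 1) (inp i) := by
        simp only [hs', setInp, lt_irrefl, if_false, lt_add_one, if_true]
        rw [← update_trunc]
        simp [hX, hF]
      refine Sem.seq (sem_copyCell (ρ := j * μ + (i : ℕ)) (ρ' := μ) (by simp [hs', setInp])
        (by simp [hs', setInp]) (inf_le_left.trans (hle i)) ?_) fun hL1 =>
        (sem_inc (ρ := j * μ + (i : ℕ)) (by simp [hs', setInp]) hL1).to ?_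
      · rw [e2]
        exact ((inf_le_left : s μ ⊓ s (μ + 1) ≤ s μ) _).trans (hle (i + 1) _)
      · rw [e2]
        funext v
        cases v with
        | inp i' =>
          rw [Function.update_of_ne (by simp)]
          by_cases hi : i' = i
          · rw [hi, Function.update_self]
          · rw [Function.update_of_ne (by simpa using hi)]
            have : (i' : ℕ) < i ↔ (i' : ℕ) < i + 1 := by
              have : (i' : ℕ) ≠ i := fun h => hi (Fin.ext h)
              omega
            simp only [hs', setInp, this]
        | _ => simp [hs', setInp, add_assoc]
  · intro l _ hl
    exact clim_setInp (((clim_const hl σ).update ((rlim_of_isNormal hl IsNormal.id).tlim_un hl)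
      a).update ((rlim_of_isNormal hl (mul_isNormal hj')).tlim_un hl) e) fun i η =>
      tlim_trunc IsNormal.id hl η

/-- Erase the input tracks. -/
noncomputable def clearInp [NeZero j] (one : A) : Cmd (Var j) A :=
  seq (whl (tAt a fun x => decide (x (inp 0) ≠ ⊥)) (seq (upd a fun x v => match v with
    | inp _ => ⊥
    | v => x v) (inc one a))) (zero a)

theorem sem_clearInp [NeZero j] (x : Word.{u} A) (ha : σ a = ⊥)
    (hinp : ∀ i μ, σ (inp i) μ = x.tape (j * μ + (i : ℕ))) :
    Sem ℓ one (clearInp one) σ (setInp σ ⊥) ⊥ := by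
  have hj : 0 < j := Nat.pos_of_neZero j
  set s : Ordinal.{u} → Cfg.{u} (Var j) A := fun μ =>
    setInp (Function.update σ a (un one μ)) fun i => above (σ (inp i)) μ with hs
  have h1 := sem_whl (ℓ := ℓ) (one := one) (L := ⊥) (t := tAt a fun x => decide (x (inp 0) ≠ ⊥))
    (a := seq (upd a fun x v => match v with
      | inp _ => ⊥
      | v => x v) (inc one a)) s (width j x) ?_ ?_ ?_ ?_ fun _ _ => bot_le
  · have e0 : s 0 = σ := by
      funext v; cases v <;> simp [hs, setInp, ha, un_zero, above_zero]
    rw [e0] at h1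
    refine (h1.seq fun _ => sem_zero (ρ := width j x) (by simp [hs, setInp]) bot_le le_rfl).to ?_
    have e1 : ∀ i, above (σ (inp i)) (width j x) = ⊥ := fun i =>
      above_eq_bot fun η hη => by
        rw [hinp, x.eq_bot_iff]
        exact (le_mul_width hj x).trans
          ((by gcongr : (j : Ordinal.{u}) * width j x ≤ j * η).trans le_self_add)
    funext v; cases v <;> simp [hs, setInp, e1, ha]
  · intro μ hμ
    refine tst_at (one := one) (ρ := μ) (by simp [hs, setInp]) ?_
    simpa [hs, setInp, hinp, above, x.eq_bot_iff] using mul_lt_of_lt_width hμ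
  · refine tst_at (one := one) (ρ := width j x) (by simp [hs, setInp]) ?_
    simpa [hs, setInp, hinp, above, x.eq_bot_iff] using le_mul_width hj x
  · intro μ hμ
    refine Sem.seq (sem_upd (ρ := μ) (σ' := setInp (s μ) fun i => above (σ (inp i)) (μ + 1))
      (by simp [hs, setInp]) ?_ inf_le_left ?_) fun hL1 =>
      (sem_inc (ρ := μ) (by simp [hs, setInp]) hL1).to ?_
    · intro v η
      cases v with
      | inp i =>
        simp only [hs, setInp, ← update_above, Function.update_apply]
      | _ =>
        simp only [hs, setInp]
        split_ifs with h
        · rw [h]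
        · rfl
    · intro v
      cases v with
      | inp i => exact inf_le_right
      | _ => exact inf_le_left
    · funext v; cases v <;> simp [hs, setInp]
  · intro l _ hl
    exact clim_setInp ((clim_const hl σ).update ((rlim_of_isNormal hl IsNormal.id).tlim_un hl) a)
      fun i η => tlim_above hl η

/-- Erase the table of head positions. -/
noncomputable def clearTable (one : A) : Cmd (Var j) A :=
  seq (zero st) (seq (whl (tNe st th) (seq (clearRow one) (inc one st))) (zero st))

-- The rows are lowered to height `0` one after another, with `st` as the counter; every column
-- index is a remainder modulo `θ`, so after `θ` rounds the table is empty.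
open Classical in
theorem sem_clearTable {θ α : Ordinal.{u}} {H : Ordinal.{u} → Ordinal.{u}} (hθ : 0 < θ)
    (hTT : σ TT = table one θ H) (hst : σ st = un one α) (hth : σ th = un one θ)
    (hp : σ Var.p = ⊥) (hq : σ Var.q = ⊥) (hk : σ k = ⊥) (hf : σ f = ⊥) :
    Sem ℓ one (clearTable one) σ (Function.update (Function.update σ st ⊥) TT ⊥) ⊥ := by
  set H' : Ordinal.{u} → Ordinal.{u} → Ordinal.{u} := fun μ α => if α < μ then 0 else H α with hH'
  refine Sem.seq (sem_zero hst bot_le le_rfl) fun _ => ?_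
  refine ((sem_count (s := th) (k := st) (ρs := θ) (fun μ => Function.update (Function.update σ st ⊥) TT
    (table one θ (H' μ))) (fun μ _ => by simp [hth]) (fun μ _ => by simp) (by simp) ?_ ?_
    fun _ _ => bot_le).to ?_).of ?_
  · intro μ hμ
    have e1 : Function.update (H' μ) μ (min 0 (H' μ μ)) = H' (μ + 1) := by
      funext α
      rw [Function.update_apply]
      by_cases h1 : α = μ
      · simp [hH', h1]
      · simp only [hH', lt_add_one_iff, le_iff_lt_or_eq, h1, if_false, or_false]
    refine (sem_clearRow (θ := θ) (α := μ) (η₀ := 0) (H := H' μ) hμ (by simp) (by simp) (by simp [hth])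
      (by simp [hp, un_zero]) (by simp [hq]) (by simp [hk]) (by simp [hf]) inf_le_left
      (inf_le_left.trans (by simp [hp])) (inf_le_right.trans (by rw [e1]; simp))).to ?_
    rw [e1]
    funext v; cases v <;> simp [hp]
  · intro l _ hl
    refine (clim_const hl _).update (fun η => ?_) TT
    simp only [table, hH']
    refine RLim.tlim_un ?_ hl _
    rcases lt_or_ge (η % θ) l with h | h
    · refine rlim_const hl (η % θ + 1) (hl.add_one_lt h) fun μ h1 h2 => ?_
      rw [if_pos h, if_pos (add_one_le_iff.1 h1)]
    · refine rlim_const hl 0 hl.bot_lt fun μ h1 h2 => ?_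
      rw [if_neg (not_lt.2 h), if_neg (not_lt.2 (h2.le.trans h))]
  · have : table one θ (H' θ) = ⊥ := by
      funext η
      simp only [table, hH', if_pos (mod_lt η hθ.ne')]
      rw [un_zero]; rfl
    rw [this]
  · have : H' 0 = H := by funext α; simp [hH']
    rw [this, ← hTT]
    funext v; cases v <;> simp

end Transfer

/-! ### The standard layout and the assembly of complete programs. -/

section Frame

variable {A : Type v} [Fintype A] [LinearOrder A] {j : ℕ} [NeZero j]

instance : NeZero (2 * j) := ⟨by have := NeZero.ne j; omega⟩

/-- The slot of a variable: the input tracks have odd slots. -/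
def Var.slot : Var j → ℕ
  | inp i => 2 * i + 1
  | X => 2
  | Y => 4
  | TT => 6
  | th => 8
  | st => 10
  | u => 12
  | hd => 14
  | a => 16
  | e => 18
  | k => 20
  | k' => 22
  | p => 24
  | q => 26
  | f => 28
  | nh => 30
  | ct => 32

/-- The variables other than the input tracks use even slots up to `32`, whence the bound `17 ≤ j`.
-/
theorem Var.slot_lt (hj : 17 ≤ j) (v : Var j) : v.slot < 2 * j := by
  cases v <;> simp only [slot] <;> omega

theorem Var.slot_inj {v w : Var j} (h : v.slot = w.slot) : v = w := by
  cases v <;> cases w <;> simp only [slot] at h <;>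
    first
    | rfl
    | (exfalso; omega)
    | (rw [Var.inp.injEq]; apply Fin.ext; omega)

theorem Var.slot_ne_zero (v : Var j) : v.slot ≠ 0 := by
  cases v <;> simp [slot]

/-- The standard layout. -/
def stdLayout (hj : 17 ≤ j) : Layout (Var j) (2 * j) where
  pos v := ⟨v.slot, v.slot_lt hj⟩
  inj v w h := Var.slot_inj (Fin.mk.inj_iff.1 h)
  ne_zero v h := v.slot_ne_zero (Fin.mk.inj_iff.1 h)

/-- The slot `2 * i`. -/
def evenSlot (i : Fin j) : Fin (2 * j) := ⟨2 * i, by omega⟩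

/-- The slot `2 * i + 1`. -/
def oddSlot (i : Fin j) : Fin (2 * j) := ⟨2 * i + 1, by omega⟩

theorem slot_cases (s : Fin (2 * j)) : (∃ i, s = evenSlot i) ∨ ∃ i, s = oddSlot i := by
  rcases Nat.even_or_odd' (s : ℕ) with ⟨m, hm | hm⟩
  · exact Or.inl ⟨⟨m, by omega⟩, Fin.ext hm⟩
  · exact Or.inr ⟨⟨m, by omega⟩, Fin.ext hm⟩

/-- With `2 * j` slots per supercell the parity of a cell is that of its slot. So the letters in the
odd cells of the tape are exactly the contents of the `j` interleaved input tracks. -/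
theorem evenSlot_cell (η : Ordinal.{u}) (i : Fin j) :
    ((2 * j : ℕ) : Ordinal.{u}) * η + ((evenSlot i : ℕ) : Ordinal.{u}) = 2 * (j * η + (i : ℕ)) := by
  rw [evenSlot, mul_add, ← mul_assoc]
  push_cast
  rfl

theorem oddSlot_cell (η : Ordinal.{u}) (i : Fin j) :
    ((2 * j : ℕ) : Ordinal.{u}) * η + ((oddSlot i : ℕ) : Ordinal.{u})
      = 2 * (j * η + (i : ℕ)) + 1 := by
  rw [oddSlot, mul_add, ← mul_assoc, add_assoc]
  push_cast
  rfl

/-- The input tracks contain the word `x`, and everything else is empty. -/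
def inpCfg (x : Word.{u} A) : Cfg.{u} (Var j) A := setInp ⊥ fun i μ => x.tape (j * μ + (i : ℕ))

theorem cells_inpCfg_odd (hj : 17 ≤ j) (one : A) (x : Word.{u} A) (η : Ordinal.{u}) (i : Fin j) :
    (stdLayout hj).cells one (inpCfg x) η (oddSlot i) = x.tape (j * η + (i : ℕ)) :=
  (stdLayout hj).cells_pos one (inpCfg x) η (.inp i)

theorem cells_inpCfg_even (hj : 17 ≤ j) (one : A) (x : Word.{u} A) (η : Ordinal.{u}) (i : Fin j)
    (hi : i ≠ 0 ∨ η ≠ 0) : (stdLayout hj).cells one (inpCfg x) η (evenSlot i) = ⊥ := by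
  by_cases hs : ∃ v, (stdLayout hj).pos v = evenSlot i
  · obtain ⟨v, hv⟩ := hs
    rw [← hv, Layout.cells_pos]
    cases v with
    | inp i' =>
      have := congrArg Fin.val hv
      simp only [stdLayout, Var.slot, evenSlot] at this
      omega
    | _ => rfl
  · rw [Layout.cells_of_ne _ _ _ _ hs, if_neg]
    rintro ⟨h1, h2⟩
    have h3 : 2 * (i : ℕ) = 0 := congrArg Fin.val h1
    rcases hi with h | h
    · exact h (Fin.ext (by simpa using h3))
    · exact h h2

/-- No copying is needed after spreading: the spread word with the mark in cell `0` already is the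
tape of a configuration with the input in its tracks. -/
theorem tape_inpCfg (hj : 17 ≤ j) (one : A) (x : Word.{u} A) :
    (stdLayout hj).tape one (inpCfg x) = Function.update (spread x.tape) 0 one := by
  funext γ
  obtain ⟨η, s, rfl⟩ := exists_slot (2 * j) γ
  rw [Layout.tape, flatten_apply]
  rcases slot_cases s with ⟨i, rfl⟩ | ⟨i, rfl⟩
  · rw [evenSlot_cell]
    by_cases h : i = 0 ∧ η = 0
    · obtain ⟨rfl, rfl⟩ := h
      have : evenSlot (0 : Fin j) = 0 := rfl
      rw [this, Layout.cells_zero]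
      simp
    · rw [cells_inpCfg_even hj one x η i (not_and_or.1 h), Function.update_of_ne, spread_even]
      intro h0
      apply h
      rw [mul_eq_zero, Ordinal.add_eq_zero_iff, mul_eq_zero] at h0
      obtain ⟨h1, h2⟩ := h0.resolve_left two_ne_zero
      refine ⟨Fin.ext (by simpa using h2), h1.resolve_left ?_⟩
      exact_mod_cast NeZero.ne j
  · rw [oddSlot_cell, cells_inpCfg_odd, Function.update_of_ne (by simp), spread_odd]

/-- The instruction that moves the word in the input tracks to the even slots and erases everything
else, and then starts to compress. -/
noncomputable def finalInstr (A : Type v) [Fintype A] [LinearOrder A] (j : ℕ) [NeZero j] :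
    Instr.{u} A (2 * j) where
  g cell := if cell (oddSlot 0) = ⊥ then (⊥, some (decide (cell 0 ≠ ⊥)))
    else (fun s => if (s : ℕ) % 2 = 0 then cell (oddSlot ⟨s / 2, by omega⟩) else ⊥, none)
  exit b := if b then CompressState.num (A := A) .scan else CompressState.num (A := A) .back
  homing := false

variable {P : Program.{u} A} {c : Ordinal.{u} → Snapshot.{u} A} {one : A}

/-- The last scan also erases the home mark, so it cannot be followed by a return to that mark. The
return is left to the state `back`: in the gapped word no two letters are adjacent, but in cell `0`
a left move stays, and the same letter is read twice. -/
theorem exists_final (hrun : IsRun P c) {e : Ordinal.{u}}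
    (hD : ∀ (s : CompressState A) d, P ((s.num : Ordinal.{u}), d) = some (s.tr e d))
    (hj : 17 ≤ j) {n : Ordinal.{u}} (hI : Implements P n (finalInstr A j)) (r : Word.{u} A)
    (γ : Ordinal.{u})
    (hγ : c γ = ⟨(stdLayout hj).tape one (inpCfg r), nodeStart A (2 * j) n, 0⟩) :
    ∃ γ' h, γ ≤ γ' ∧ c γ' = ⟨r.tape, e, h⟩ ∧ ∀ ξ, γ ≤ ξ → ξ < γ' → (c ξ).state ≠ 1 := by
  have hj0 : 0 < j := by omega
  set U' : Ordinal.{u} → Fin (2 * j) → WithBot A := fun η s =>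
    if (s : ℕ) % 2 = 0 then r.tape (j * η + ((s / 2 : ℕ) : Ordinal.{u})) else ⊥ with hU'
  have hbot : ∀ η (i : ℕ), width j r ≤ η → r.tape (j * η + i) = ⊥ := fun η i h =>
    (r.eq_bot_iff _).2 ((le_mul_width hj0 r).trans
      ((by gcongr : (j : Ordinal.{u}) * width j r ≤ j * η).trans le_self_add))
  have hU'bot : ∀ η, width j r ≤ η → U' η = ⊥ := fun η h => by
    funext s
    simp only [hU', hbot η _ h, ite_self]
    rfl
  have hflat : flatten U' = gapped r.tape := by
    funext γ
    obtain ⟨η, s, rfl⟩ := exists_slot (2 * j) γ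
    rw [flatten_apply]
    rcases slot_cases s with ⟨i, rfl⟩ | ⟨i, rfl⟩
    · rw [evenSlot_cell, gapped_even]
      simp [hU', evenSlot]
    · rw [oddSlot_cell, gapped_odd]
      simp [hU', oddSlot, Nat.add_mod]
  -- The result of the scan tells whether it has stopped in supercell `0`, where the home mark is
  -- still visible. This happens exactly for the empty word; then the head already is on cell `0`,
  -- and there is no letter to be found by going back.
  have h1 := leads_instr_final hrun hI rfl ((stdLayout hj).cells one (inpCfg r)) U' (width j r)
    (decide (width j r = 0)) ?_ ?_ ?_
  · obtain ⟨γ1, h2, h3, h4⟩ := h1 γ hγ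
    rw [hflat] at h3
    have h5 : ∃ γ' h, γ1 ≤ γ' ∧ c γ' = ⟨r.tape, e, h⟩ ∧ ∀ ξ, γ1 ≤ ξ → ξ < γ' → (c ξ).state ≠ 1 := by
      by_cases hw : width j r = 0
      · rw [hw, mul_zero] at h3
        exact compress_correct hrun hD r γ1 (by simpa [finalInstr] using h3)
      · have h6 := mul_lt_of_lt_width (pos_iff_ne_zero.2 hw)
        rw [mul_zero] at h6
        exact compress_correct_back hrun hD r h6 γ1 _ (by simpa [finalInstr, hw] using h3)
    obtain ⟨γ', h, h6, h7, h8⟩ := h5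
    refine ⟨γ', h, h2.le.trans h6, h7, fun ξ h9 h10 => ?_⟩
    rcases lt_or_ge ξ γ1 with h11 | h11
    · exact ((one_lt_nodeStart n).trans_le (h4 ξ h9 h11)).ne'
    · exact h8 ξ h11 h10
  · intro η hη
    have h2 : (stdLayout hj).cells one (inpCfg r) η (oddSlot 0) ≠ ⊥ := by
      rw [cells_inpCfg_odd, Ne, r.eq_bot_iff, not_le]
      simpa using mul_lt_of_lt_width hη
    simp only [finalInstr]
    rw [if_neg h2]
    simp only [cells_inpCfg_odd, hU']
  · have h2 : (stdLayout hj).cells one (inpCfg r) (width j r) (oddSlot 0) = ⊥ := by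
      rw [cells_inpCfg_odd, hbot _ _ le_rfl]
    rw [hU'bot _ le_rfl]
    simp only [finalInstr, if_pos h2, Layout.cells_zero]
    simp
  · intro η hη
    rw [hU'bot η hη.le]
    funext s
    rcases slot_cases s with ⟨i, rfl⟩ | ⟨i, rfl⟩
    · rw [cells_inpCfg_even hj one r η i (Or.inr (zero_le.trans_lt hη).ne')]
      rfl
    · rw [cells_inpCfg_odd, hbot η _ hη.le]
      rfl

theorem SpreadState.num_lt (s : SpreadState A) : s.num < 8 + 3 * Fintype.card A := by
  cases s with
  | look a => have := idx_lt a; simp only [num]; omega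
  | peek a => have := idx_lt a; simp only [num]; omega
  | push a => have := idx_lt a; simp only [num]; omega
  | _ => simp only [num]; omega

theorem SpreadState.num_injective : Function.Injective (SpreadState.num (A := A)) := by
  intro s t h
  have := idx_lt (A := A)
  cases s <;> cases t <;> simp only [num] at h <;>
    first
    | rfl
    | (exfalso; omega)
    | (rename_i x y; congr 1; exact idx_injective (by omega))
    | (rename_i x y; have := idx_lt x; have := idx_lt y; exfalso; omega)

theorem CompressState.num_lt (s : CompressState A) : s.num < 15 + 4 * Fintype.card A := by
  cases s with
  | put a => have := idx_lt a; simp only [num]; omega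
  | _ => simp only [num]; omega

theorem CompressState.num_injective : Function.Injective (CompressState.num (A := A)) := by
  intro s t h
  cases s <;> cases t <;> simp only [num] at h <;>
    first
    | rfl
    | (exfalso; omega)
    | (rename_i x y; congr 1; exact idx_injective (by omega))

variable (one) in
open Classical in
/-- The program that spreads its input, executes the given nodes from node `0` on, can compress and
enter state `e`, and otherwise executes `ext`. -/
noncomputable def assemble (nodes : Ordinal.{u} → Option (Instr.{u} A (2 * j))) (e : Ordinal.{u})
    (ext : Program.{u} A) : Program.{u} A := fun x =>
  if h : ∃ s : SpreadState A, (s.num : Ordinal.{u}) = x.1 then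
    some (h.choose.tr one (nodeStart A (2 * j) 0) x.2)
  else if h : ∃ s : CompressState A, (s.num : Ordinal.{u}) = x.1 then some (h.choose.tr e x.2)
  else if h : ∃ y : Ordinal.{u} × Phase A (2 * j), nodes y.1 ≠ none ∧
      nodeState A (2 * j) y.1 y.2 = x.1 then
    (nodes h.choose.1).map fun I => I.tr h.choose.1 h.choose.2 x.2
  else ext x

variable {nodes : Ordinal.{u} → Option (Instr.{u} A (2 * j))} {e : Ordinal.{u}} {ext : Program.{u} A}

theorem assemble_spread (s : SpreadState A) (d : WithBot A) :
    assemble one nodes e ext ((s.num : Ordinal.{u}), d)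
      = some (s.tr one (nodeStart A (2 * j) 0) d) := by
  have h : ∃ t : SpreadState A, (t.num : Ordinal.{u}) = (s.num : Ordinal.{u}) := ⟨s, rfl⟩
  rw [assemble, dif_pos h, SpreadState.num_injective (Nat.cast_inj.1 h.choose_spec)]

theorem not_spread {x : Ordinal.{u}} (hx : ((8 + 3 * Fintype.card A : ℕ) : Ordinal.{u}) ≤ x) :
    ¬ ∃ t : SpreadState A, (t.num : Ordinal.{u}) = x := by
  rintro ⟨t, rfl⟩
  exact absurd t.num_lt (not_lt.2 (Nat.cast_le.1 hx))

theorem not_compress {x : Ordinal.{u}} (hx : ((15 + 4 * Fintype.card A : ℕ) : Ordinal.{u}) ≤ x) :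
    ¬ ∃ t : CompressState A, (t.num : Ordinal.{u}) = x := by
  rintro ⟨t, rfl⟩
  exact absurd t.num_lt (not_lt.2 (Nat.cast_le.1 hx))

theorem assemble_compress (s : CompressState A) (d : WithBot A) :
    assemble one nodes e ext ((s.num : Ordinal.{u}), d) = some (s.tr e d) := by
  have h : ∃ t : CompressState A, (t.num : Ordinal.{u}) = (s.num : Ordinal.{u}) := ⟨s, rfl⟩
  rw [assemble, dif_neg (not_spread s.le_num), dif_pos h,
    CompressState.num_injective (Nat.cast_inj.1 h.choose_spec)]

theorem not_spread' {x : Ordinal.{u}} (hx : ((15 + 4 * Fintype.card A : ℕ) : Ordinal.{u}) ≤ x) :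
    ¬ ∃ t : SpreadState A, (t.num : Ordinal.{u}) = x :=
  not_spread (le_trans (Nat.cast_le.2 (by omega)) hx)

theorem assemble_node {n : Ordinal.{u}} {I : Instr.{u} A (2 * j)} (h : nodes n = some I) :
    Implements (assemble one nodes e ext) n I := by
  intro ph d
  have hle : ((15 + 4 * Fintype.card A : ℕ) : Ordinal.{u}) ≤ nodeState A (2 * j) n ph := le_self_add
  have h1 : ∃ y : Ordinal.{u} × Phase A (2 * j), nodes y.1 ≠ none ∧
      nodeState A (2 * j) y.1 y.2 = nodeState A (2 * j) n ph := ⟨(n, ph), by simp [h], rfl⟩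
  obtain ⟨h2, h3⟩ := nodeState_inj h1.choose_spec.2
  rw [assemble, dif_neg (not_spread' hle), dif_neg (not_compress hle), dif_pos h1, h2, h3, h]
  rfl

theorem nodeState_lt {n N : Ordinal.{u}} (h : n < N) (ph : Phase A (2 * j)) :
    nodeState A (2 * j) n ph < nodeStart A (2 * j) N := by
  refine lt_of_lt_of_le ?_ (nodeStart_isNormal.strictMono.monotone (add_one_le_of_lt h))
  rw [nodeState, nodeStart_eq, mul_add_one]
  gcongr
  exact Fin.is_lt _

theorem assemble_ext {N x : Ordinal.{u}} (hN : ∀ n, nodes n ≠ none → n < N)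
    (hx : nodeStart A (2 * j) N ≤ x) (d : WithBot A) :
    assemble one nodes e ext (x, d) = ext (x, d) := by
  have hle : ((15 + 4 * Fintype.card A : ℕ) : Ordinal.{u}) ≤ x := by
    refine le_trans ?_ hx
    rw [nodeStart_eq]
    exact le_self_add
  rw [assemble, dif_neg (not_spread' hle), dif_neg (not_compress hle), dif_neg]
  rintro ⟨y, h1, h2⟩
  exact absurd (nodeState_lt (hN _ h1) y.2) (not_lt.2 (hx.trans h2.ge))

theorem assemble_dom {N : Ordinal.{u}} (hN : ∀ n, nodes n ≠ none → n < N)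
    {x : Ordinal.{u} × WithBot A} (hx : assemble one nodes e ext x ≠ none) :
    x.1 < nodeStart A (2 * j) N ∨ ext x ≠ none := by
  by_contra! h
  rw [← Prod.mk.eta (p := x), assemble_ext hN h.1] at hx
  exact hx h.2

theorem leadsE_input (hj : 17 ≤ j) (hrun : IsRun P c)
    (hC : ∀ (s : SpreadState A) d,
      P ((s.num : Ordinal.{u}), d) = some (s.tr one (nodeStart A (2 * j) 0) d)) (x : Word.{u} A) :
    LeadsE c ⟨x.tape, 0, 0⟩ ⟨(stdLayout hj).tape one (inpCfg x), nodeStart A (2 * j) 0, 0⟩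
      (fun s => s.state ≠ 1) := by
  rw [tape_inpCfg]
  exact leadsE_spread x hrun hC

end Frame

/-! ### Values of the interpretation. -/

section Interp

variable {A : Type v} [Fintype A] [LinearOrder A] {P : Program.{u} A} {x y : Tape.{u} A}

theorem interp_eq_some {γ : Ordinal.{u}} (h1 : (computation P ⟨x, 0, 0⟩ γ).state = 1)
    (h2 : ∀ ξ < γ, (computation P ⟨x, 0, 0⟩ ξ).state ≠ 1)
    (h3 : (computation P ⟨x, 0, 0⟩ γ).tape = y) : interp P x = Part.some y := by
  have hγ : sInf (haltTimes P x) = γ := by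
    refine le_antisymm (csInf_le' h1) (le_of_not_gt fun h => h2 _ h ?_)
    exact csInf_mem (s := haltTimes P x) ⟨γ, h1⟩
  rw [Part.eq_some_iff]
  refine ⟨⟨γ, h1⟩, ?_⟩
  change (computation P ⟨x, 0, 0⟩ (sInf (haltTimes P x))).tape = y
  rw [hγ, h3]

theorem interp_eq_none (h : ∀ γ, (computation P ⟨x, 0, 0⟩ γ).state ≠ 1) : interp P x = Part.none := by
  rw [Part.eq_none_iff']
  rintro ⟨γ, hγ⟩
  exact h γ hγ

theorem interp_cases (P : Program.{u} A) (x : Tape.{u} A) :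
    (∃ γ, (computation P ⟨x, 0, 0⟩ γ).state = 1 ∧ (∀ ξ < γ, (computation P ⟨x, 0, 0⟩ ξ).state ≠ 1) ∧
      interp P x = Part.some (computation P ⟨x, 0, 0⟩ γ).tape) ∨
    ((∀ γ, (computation P ⟨x, 0, 0⟩ γ).state ≠ 1) ∧ interp P x = Part.none) := by
  by_cases h : (haltTimes P x).Nonempty
  · have h1 := csInf_mem h
    have h2 : ∀ ξ < sInf (haltTimes P x), (computation P ⟨x, 0, 0⟩ ξ).state ≠ 1 := fun ξ hξ =>
      notMem_of_lt_csInf' (s := haltTimes P x) hξ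
    exact Or.inl ⟨_, h1, h2, interp_eq_some h1 h2 rfl⟩
  · have h1 : ∀ γ, (computation P ⟨x, 0, 0⟩ γ).state ≠ 1 := fun γ hγ => h ⟨γ, hγ⟩
    exact Or.inr ⟨h1, interp_eq_none h1⟩

end Interp

/-! ### The transition table as a parameter. -/

section Parameter

variable {A : Type v} [Fintype A] [LinearOrder A]

instance : Finite Motion := by
  refine Finite.of_injective (β := Fin 3) (fun m => match m with
    | .left => 0
    | .stay => 1
    | .right => 2) fun m m' h => ?_
  cases m <;> cases m' <;> simp_all

variable (A) in
/-- The fields of an entry of the transition table: the transitions and some marks. -/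
abbrev Field : Type v := (WithBot A × WithBot A × Motion) ⊕ Fin 10

variable (A) in
/-- The number of fields. -/
noncomputable def fieldCount : ℕ := Nat.card (Field A)

variable (A) in
/-- The numbering of fields. -/
noncomputable def fieldEquiv : Field A ≃ Fin (fieldCount A) := Finite.equivFin _

-- Only two of the ten marks carry information. The others ensure that `2 * fieldCount A` tracks are
-- enough for the layout, which needs `17`.
variable (A) in
theorem ten_le_fieldCount : 10 ≤ fieldCount A := by
  have := Nat.card_le_card_of_injective (Sum.inr : Fin 10 → Field A) Sum.inr_injective
  rwa [Nat.card_fin] at this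

instance : NeZero (fieldCount A) := ⟨by have := ten_le_fieldCount A; omega⟩

/-- The input track of a field. -/
noncomputable def fieldTrack (t : Field A) : Fin (2 * fieldCount A) := oddSlot (fieldEquiv A t)

variable (q : Program.{u} A) (θ : Ordinal.{u}) (zr one : A)

/-- The entries of the transition table. -/
def tableBit (a : Ordinal.{u}) : Field A → Prop
  | .inl (d, d', m) => q.next (a / θ) d = (a % θ, d', m)
  | .inr i => (i = 0 ∧ a = θ) ∨ (i = 1 ∧ a = θ * θ)

open Classical in
/-- The parameter that contains the transition table. -/
noncomputable def tableWord : Word.{u} A where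
  tape γ := if γ < fieldCount A * (θ * θ + 1) then
    (if tableBit q θ (γ / fieldCount A) ((fieldEquiv A).symm (slotOf (fieldCount A) γ)) then
      (one : WithBot A) else (zr : WithBot A)) else ⊥
  len := fieldCount A * (θ * θ + 1)
  ne_bot_iff γ := by
    split_ifs with h h' <;> simp [h]

variable {q θ zr one}

open Classical in
theorem tableWord_apply {a : Ordinal.{u}} (ha : a < θ * θ + 1) (t : Field A) :
    (tableWord q θ zr one).tape (fieldCount A * a + ((fieldEquiv A t : ℕ) : Ordinal.{u})) =
      if tableBit q θ a t then (one : WithBot A) else (zr : WithBot A) := by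
  have h : (fieldCount A : Ordinal.{u}) * a + ((fieldEquiv A t : ℕ) : Ordinal.{u})
      < fieldCount A * (θ * θ + 1) := by
    refine lt_of_lt_of_le ?_ (by gcongr; exact lt_add_one_iff.1 ha :
      (fieldCount A : Ordinal.{u}) * (a + 1) ≤ _)
    rw [mul_add_one]
    gcongr
    exact Fin.is_lt _
  simp only [tableWord, if_pos h, mul_add_fin_div, slotOf_mul_add, Equiv.symm_apply_apply]

/-- The pairing puts letter `n` of the parameter into cell `2 * n + 1` of the input. With `2 *
fieldCount A` input tracks, entry `a` of the table thus fills the odd tracks of supercell `a`, one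
for each field. -/
theorem star_field (w : Word.{u} A) {a : Ordinal.{u}} (ha : a < θ * θ + 1) (t : Field A)
    (h01 : zr ≠ one) :
    inpCfg (Word.star zr one (tableWord q θ zr one) w) (.inp (fieldTrack t)) a = (one : WithBot A) ↔
      tableBit q θ a t := by
  have e : ((2 * fieldCount A : ℕ) : Ordinal.{u}) * a + ((fieldTrack t : ℕ) : Ordinal.{u})
      = 2 * (fieldCount A * a + ((fieldEquiv A t : ℕ) : Ordinal.{u})) + 1 := oddSlot_cell _ _
  have hlt : (fieldCount A : Ordinal.{u}) * a + ((fieldEquiv A t : ℕ) : Ordinal.{u})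
      < (tableWord q θ zr one).len := by
    rw [← Word.ne_bot_iff, tableWord_apply ha]
    split_ifs <;> simp
  simp only [inpCfg, setInp]
  rw [e, Word.star_odd hlt, tableWord_apply ha]
  split_ifs with h
  · simp [h]
  · simpa [h] using h01

/-- The parameter consists of `θ * θ + 1` entries of full length, so its marked version fills whole
supercells, and the rest of the input starts at the beginning of supercell `θ * θ + 1`. -/
theorem star_tail (w : Word.{u} A) (i : Fin (2 * fieldCount A)) (μ : Ordinal.{u}) :
    inpCfg (Word.star zr one (tableWord q θ zr one) w) (.inp i) (θ * θ + 1 + μ) =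
      (w.tail zr one).tape (((2 * fieldCount A : ℕ) : Ordinal.{u}) * μ + ((i : ℕ) : Ordinal.{u})) := by
  rw [← Word.star_rest (tableWord q θ zr one)]
  simp only [inpCfg, setInp]
  congr 1
  rw [mul_add, ← add_assoc]
  congr 2
  simp only [tableWord]
  push_cast
  rw [mul_assoc]

-- The domain is small, so the states that occur as values are bounded. Where `q` is undefined its
-- total version keeps the state.
variable (q) in
theorem exists_closedUnder (hq : q.IsTransfinite) : ∃ θ, 1 ≤ θ ∧ q.ClosedUnder θ := by
  have : Small.{u} q.dom := hq
  have hS : BddAbove ((fun x => (q.next x.1 x.2).1) '' q.dom) := Ordinal.bddAbove_of_small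
  obtain ⟨B, hB⟩ := hS
  refine ⟨max 1 B, le_max_left _ _, fun α hα d => ?_⟩
  by_cases h : (α, d) ∈ q.dom
  · exact (hB ⟨(α, d), h, rfl⟩).trans (le_max_right _ _)
  · have : q (α, d) = none := by simpa [Program.dom] using h
    rwa [Program.next, this]

end Parameter

/-! ### Symmetrically computable functions are Koepke computable. -/

section Koepke

variable {A : Type v} [Fintype A] [LinearOrder A]

open Cmd Var

/-- The transition fields. -/
noncomputable def transTrack (d d' : WithBot A) (m : Motion) : Fin (2 * fieldCount A) :=
  fieldTrack (.inl (d, d', m))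

/-- Read the parameter and the input. -/
noncomputable def koepkePre (zr one : A) : Cmd (Var (2 * fieldCount A)) A :=
  seq (skip one th fun x => decide (x (inp (fieldTrack (.inr 0))) ≠ (one : WithBot A)))
  (seq (skip one a fun x => decide (x (inp (fieldTrack (.inr 1))) ≠ (one : WithBot A)))
  (seq (inc one a) (seq (load one) (seq (copyUntail zr one) (inc one Var.u)))))

/-- Clean up and write the output. -/
noncomputable def koepkePost (one : A) : Cmd (Var (2 * fieldCount A)) A :=
  seq (clearTable one) (seq (clearInp one) (seq (zero th) (seq (zero Var.u) (output one))))

/-- The simulation of a program whose transition table is given as a parameter. -/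
noncomputable def koepkeCmd (zr one : A) : Cmd (Var (2 * fieldCount A)) A :=
  seq (koepkePre zr one) (seq (simulate one transTrack) (koepkePost one))

variable {K : ℕ} [NeZero K] {ℓ : Layout (Var (2 * fieldCount A)) K} {zr one : A}
  {q : Program.{u} A} {θ : Ordinal.{u}}

/-- The contents of the variables that a simulation does not change. -/
noncomputable def koepkeCfg (q : Program.{u} A) (θ : Ordinal.{u}) (zr one : A) (w : Word.{u} A) :
    Cfg.{u} (Var (2 * fieldCount A)) A :=
  Function.update (Function.update (inpCfg (Word.star zr one (tableWord q θ zr one) w)) th (un one θ))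
    Var.u (un one 1)

theorem hasTable_koepkeCfg (h01 : zr ≠ one) (w : Word.{u} A) :
    HasTable one θ transTrack q (koepkeCfg q θ zr one w) := by
  intro α hα ι hι d d' m
  have h0 : θ ≠ 0 := (zero_le.trans_lt hα).ne'
  have hlt : θ * α + ι < θ * θ + 1 := by
    refine lt_of_lt_of_le ?_ (le_self_add)
    refine lt_of_lt_of_le ?_ (by gcongr; exact add_one_le_of_lt hα : θ * (α + 1) ≤ θ * θ)
    rw [mul_add_one]
    gcongr
  have := star_field (q := q) (zr := zr) w hlt (.inl (d, d', m)) h01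
  simp only [tableBit, mul_add_div _ h0, div_eq_zero_of_lt hι, add_zero, mul_add_mod_self,
    mod_eq_of_lt hι] at this
  simpa [koepkeCfg, transTrack] using this

theorem headLiminf_zero (c : Ordinal.{u} → Snapshot.{u} A) : headLiminf c 0 = 0 := by
  funext α
  rw [headLiminf, ordLiminf]
  have : IsEmpty (Set.Iio (0 : Ordinal.{u})) := ⟨fun x => (not_lt_zero : ¬ x.1 < 0) x.2⟩
  rw [ciSup_of_empty]
  rfl

/-- The marks sit at the entries `θ` and `θ * θ`, so finding them loads these ordinals into
registers. The second one, plus one, is where the tail of the proper input begins, and undoing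
`tail` gives the initial tape of `q`. -/
theorem sem_koepkePre (h01 : zr ≠ one) (hθ : 1 ≤ θ) (w : Word.{u} A) :
    Sem ℓ one (koepkePre zr one) (inpCfg (Word.star zr one (tableWord q θ zr one) w))
      (simCfg one θ (koepkeCfg q θ zr one w) (computation q ⟨w.tape, 0, 0⟩) 0) ⊥ := by
  have hθ0 : 0 < θ := zero_lt_one.trans_le hθ
  have hle : θ ≤ θ * θ := Ordinal.le_mul_left _ hθ0
  set σ : Cfg.{u} (Var (2 * fieldCount A)) A :=
    inpCfg (Word.star zr one (tableWord q θ zr one) w) with hσ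
  have hbot : ∀ v, (∀ i, v ≠ inp i) → σ v = ⊥ := fun v hv => by
    cases v with
    | inp i => exact absurd rfl (hv i)
    | _ => rfl
  have hbit : ∀ a t, a ≤ θ * θ → (σ (inp (fieldTrack t)) a = (one : WithBot A) ↔ tableBit q θ a t) :=
    fun a t ha => star_field w (lt_add_one_iff.2 ha) t h01
  refine Sem.seq (sem_skip (hbot _ (by simp)) θ (fun μ hμ => ?_) ?_) fun _ => ?_
  · simp [hbit μ (.inr 0) (hμ.le.trans hle), tableBit, hμ.ne]
  · simp [hbit θ (.inr 0) hle, tableBit]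
  refine Sem.seq (sem_skip (by simp [hbot]) (θ * θ) (fun μ hμ => ?_) ?_) fun _ => ?_
  · simp [hbit μ (.inr 1) hμ.le, tableBit, hμ.ne]
  · simp [hbit (θ * θ) (.inr 1) le_rfl, tableBit]
  refine Sem.seq (sem_inc (ρ := θ * θ) (by simp) bot_le) fun _ => ?_
  refine Sem.seq (sem_load (b := θ * θ + 1) (w.tail zr one) (by simp) (by simp [hbot])
    (by simp [hbot]) fun i μ => ?_) fun _ => ?_
  · simpa using star_tail (q := q) (θ := θ) (zr := zr) (one := one) w i μ
  refine Sem.seq (sem_copyUntail (w := w) h01 (by simp) (by simp [hbot]) (by simp [hbot])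
    (by simp [hbot]) (by simp [hbot]) (by simp [hbot])) fun _ => ?_
  refine (sem_inc (ρ := 0) (by simp [hbot, un_zero]) bot_le).to ?_
  -- At time `0` the head of `q` is on cell `0` and no other state has occurred, so the initial
  -- table is empty and needs no preparation.
  have hT : table one θ (headLiminf (computation q ⟨w.tape, 0, 0⟩) (0 + 1)) = ⊥ := by
    rw [headLiminf_add_one, computation_zero, headLiminf_zero]
    funext η
    simp only [table]
    have : Function.update (0 : Ordinal.{u} → Ordinal.{u}) 0 0 (η % θ) = 0 := by
      rw [Function.update_apply]; split_ifs <;> rfl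
    rw [this, un_zero]; rfl
  funext v
  cases v <;> simp [simCfg, koepkeCfg, ← hσ, hbot, hT, computation_zero, un_zero]
  simpa using hT.symm

/-- All variables except the input tracks have to be emptied, and the tracks have to be cleared of
the parameter, because the final instruction expects exactly the tape of `inpCfg r`. -/
theorem sem_koepkePost {c : Ordinal.{u} → Snapshot.{u} A} (hθ : 0 < θ) (w r : Word.{u} A)
    {γ : Ordinal.{u}} (hr : (c γ).tape = r.tape) :
    Sem ℓ one (koepkePost one) (simCfg one θ (koepkeCfg q θ zr one w) c γ) (inpCfg r) ⊥ := by
  refine Sem.seq (sem_clearTable (H := headLiminf c (γ + 1)) (α := (c γ).state) hθ (by simp [simCfg])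
    (by simp [simCfg]) (by simp [simCfg, koepkeCfg]) (by simp [simCfg, koepkeCfg, inpCfg, setInp])
    (by simp [simCfg, koepkeCfg, inpCfg, setInp]) (by simp [simCfg, koepkeCfg, inpCfg, setInp])
    (by simp [simCfg, koepkeCfg, inpCfg, setInp])) fun _ => ?_
  refine Sem.seq (sem_clearInp (Word.star zr one (tableWord q θ zr one) w)
    (by simp [simCfg, koepkeCfg, inpCfg, setInp]) fun i μ => by
      simp [simCfg, koepkeCfg, inpCfg, setInp]) fun _ => ?_
  refine Sem.seq (sem_zero (ρ := θ) (by simp [simCfg, koepkeCfg, setInp]) bot_le le_rfl) fun _ => ?_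
  refine Sem.seq (sem_zero (ρ := 1) (by simp [simCfg, koepkeCfg, setInp]) bot_le le_rfl) fun _ => ?_
  refine (sem_output r (by simp [simCfg, koepkeCfg, inpCfg, setInp])
    (by simp [simCfg, koepkeCfg, inpCfg, setInp]) (by simp [simCfg, koepkeCfg, setInp, hr])
    (fun i => by simp [setInp])).to ?_
  funext v
  cases v <;> simp [simCfg, koepkeCfg, inpCfg, setInp]

open Classical in
/-- The nodes of the code for `koepkeCmd`, and a final node. -/
noncomputable def koepkeNodes (zr one : A) (h : 17 ≤ 2 * fieldCount A) (n : Ordinal.{u}) :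
    Option (Instr.{u} A (2 * (2 * fieldCount A))) :=
  if n < ((koepkeCmd zr one).size : Ordinal.{u}) then
    (koepkeCmd zr one).code (stdLayout h) 0 (nodeStart A (2 * (2 * fieldCount A)) ((koepkeCmd zr one).size : Ordinal.{u})) n
  else if n = ((koepkeCmd zr one).size : Ordinal.{u}) then some (finalInstr A (2 * fieldCount A)) else none

theorem lt_of_koepkeNodes {h : 17 ≤ 2 * fieldCount A} {n : Ordinal.{u}}
    (hn : koepkeNodes zr one h n ≠ none) : n < (((koepkeCmd zr one).size + 1 : ℕ) : Ordinal.{u}) := by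
  rw [koepkeNodes] at hn
  push_cast
  rw [lt_add_one_iff]
  by_contra! h1
  rw [if_neg (not_lt.2 h1.le), if_neg h1.ne'] at hn
  exact hn rfl

/-- The finite program that simulates a program given by its transition table. -/
noncomputable def koepkeProgram (zr one : A) (h : 17 ≤ 2 * fieldCount A) : Program.{u} A :=
  assemble one (koepkeNodes zr one h) 1 fun _ => none

theorem koepkeProgram_isFinite {h : 17 ≤ 2 * fieldCount A} :
    (koepkeProgram.{u} zr one h).IsFinite := by
  set N := (koepkeCmd zr one).size + 1 with hN
  have hlt : ∀ x ∈ (koepkeProgram.{u} zr one h).dom, x.1 < nodeStart A (2 * (2 * fieldCount A)) N := by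
    intro x hx
    exact (assemble_dom (fun n hn => lt_of_koepkeNodes hn) hx).resolve_right fun h => h rfl
  -- Finitely many nodes have finitely many phases each, and the alphabet is finite.
  obtain ⟨M, hM⟩ : ∃ M : ℕ, nodeStart A (2 * (2 * fieldCount A)) (N : Ordinal.{u}) = M :=
    ⟨_, by rw [nodeStart_eq]; exact_mod_cast rfl⟩
  rw [hM] at hlt
  refine Set.Finite.subset (((Set.finite_range fun i : Fin M => ((i : ℕ) : Ordinal.{u})).prod
    (Set.finite_univ (α := WithBot A)))) fun x hx => ⟨?_, trivial⟩
  have h1 := hlt x hx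
  obtain ⟨n, hn⟩ := lt_omega0.1 (h1.trans (natCast_lt_omega0 M))
  rw [hn, Nat.cast_lt] at h1
  exact ⟨⟨n, h1⟩, hn.symm⟩

theorem koepkeProgram_installed {h : 17 ≤ 2 * fieldCount A} :
    Installed (stdLayout h) (koepkeProgram.{u} zr one h) (koepkeCmd zr one) 0
      (nodeStart A (2 * (2 * fieldCount A)) ((koepkeCmd zr one).size : Ordinal.{u})) := by
  refine installed_of_code _ _ _ fun n _ h2 I hI => assemble_node ?_
  rw [zero_add] at h2
  rw [koepkeNodes, if_pos h2, hI]

theorem koepkeProgram_final {h : 17 ≤ 2 * fieldCount A} :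
    Implements (koepkeProgram.{u} zr one h) ((koepkeCmd zr one).size : Ordinal.{u})
      (finalInstr A (2 * fieldCount A)) := by
  refine assemble_node ?_
  rw [koepkeNodes, if_neg (lt_irrefl _), if_pos rfl]

/-- The run is composed of spreading, reading, simulating, writing and compressing, and none of
these segments meets the state `1` before its end. If `q` does not halt, the simulation loop never
ends. The output must be a word, because only words can be moved to the tracks and compressed. -/
theorem interp_koepkeProgram {h : 17 ≤ 2 * fieldCount A} (h01 : zr ≠ one) (hθ : 1 ≤ θ)
    (hq : q.ClosedUnder θ) (w : Word.{u} A)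
    (hw : ∀ y, interp q w.tape = Part.some y → ∃ r : Word.{u} A, r.tape = y) :
    interp (koepkeProgram zr one h) (Word.star zr one (tableWord q (θ + 1) zr one) w).tape =
      interp q w.tape := by
  set x := Word.star zr one (tableWord q (θ + 1) zr one) w with hx
  set c := computation q ⟨w.tape, 0, 0⟩ with hc
  have hrun : IsRun q c := isRun_computation _ _
  have hrun' := isRun_computation (koepkeProgram zr one h) ⟨x.tape, 0, 0⟩
  -- The states are at most `θ`, so the table is taken for the ordinal `θ + 1`, strictly above all
  -- of them.
  have hst : ∀ γ, (c γ).state < θ + 1 := fun γ => lt_add_one_iff.2 (hrun.state_le hq (by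
    rw [hc, computation_zero]; exact zero_le) γ)
  have htemp : ∀ v ∈ [hd, a, e, k, k', Var.p, Var.q, f, nh, ct],
      koepkeCfg q (θ + 1) zr one w v = ⊥ := by
    simp [koepkeCfg, inpCfg, setInp]
  have htab := hasTable_koepkeCfg (q := q) (θ := θ + 1) h01 w
  have hth : koepkeCfg q (θ + 1) zr one w th = un one (θ + 1) := by simp [koepkeCfg]
  have hu : koepkeCfg q (θ + 1) zr one w Var.u = un one 1 := by simp [koepkeCfg]
  have hθ' : 1 ≤ θ + 1 := hθ.trans (lt_add_one θ).le
  obtain ⟨γ1, -, h2, h3⟩ := leadsE_input h hrun' assemble_spread x 0 (computation_zero _ _)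
  have hi := koepkeProgram_installed (zr := zr) (one := one) (h := h)
  have hpre := sem_koepkePre (ℓ := stdLayout h) (q := q) h01 hθ' w
  obtain ⟨γ2, h4, h5, h6⟩ := hpre.2.2 _ _ _ _ hrun' hi.1 γ1 h2
  have hbefore : ∀ ξ < γ2, (computation (koepkeProgram zr one h) ⟨x.tape, 0, 0⟩ ξ).state ≠ 1 := by
    intro ξ hξ
    rcases lt_or_ge ξ γ1 with h7 | h7
    · exact h3 ξ zero_le h7
    · exact ((one_lt_nodeStart _).trans_le (h6 ξ h7 hξ).1).ne'
  rcases interp_cases q w.tape with ⟨γ, hγ, hγ', hval⟩ | ⟨hne, hval⟩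
  · obtain ⟨r, hr⟩ := hw _ hval
    rw [hval, ← hr]
    have hmain := (sem_simulate (ℓ := stdLayout h) hrun hst htab hth hu htemp hγ hγ').seq fun _ =>
      sem_koepkePost (zero_lt_one.trans_le hθ') w r hr.symm
    obtain ⟨γ3, h7, h8, h9⟩ := hmain.2.2 _ _ _ _ hrun' hi.2 γ2 h5
    obtain ⟨γ4, hd', h10, h11, h12⟩ := exists_final hrun' assemble_compress h koepkeProgram_final r γ3 h8
    refine interp_eq_some (γ := γ4) (by rw [h11]) (fun ξ hξ => ?_) (by rw [h11])
    rcases lt_or_ge ξ γ2 with h13 | h13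
    · exact hbefore ξ h13
    rcases lt_or_ge ξ γ3 with h14 | h14
    · exact ((one_lt_nodeStart _).trans_le (h9 ξ h13 h14).1).ne'
    · exact h12 ξ h14 hξ
  · rw [hval]
    refine interp_eq_none fun ξ => ?_
    rcases lt_or_ge ξ γ2 with h13 | h13
    · exact hbefore ξ h13
    · exact ((one_lt_nodeStart _).trans_le (simulate_diverges hrun hst htab hth hu htemp hne hrun'
        hi.2.1 γ2 h5 ξ h13)).ne'

theorem koepkeComputableIn_of_symmetricallyComputable (h01 : zr ≠ one)
    {F : Word.{u} A →. Word.{u} A} (hF : SymmetricallyComputable F) :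
    ∃ p : Word.{u} A, KoepkeComputableIn zr one p F := by
  obtain ⟨q, hq, hF⟩ := hF
  obtain ⟨θ, hθ, hθ'⟩ := exists_closedUnder q hq
  have h : 17 ≤ 2 * fieldCount A := by have := ten_le_fieldCount A; omega
  refine ⟨tableWord q (θ + 1) zr one, koepkeProgram zr one h, koepkeProgram_isFinite, fun w => ?_⟩
  rw [interp_koepkeProgram h01 hθ hθ' w, hF]
  intro y hy
  rw [hF] at hy
  obtain ⟨r, -, hr⟩ := (Part.mem_map_iff _).1 (Part.eq_some_iff.1 hy)
  exact ⟨r, hr⟩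

end Koepke

/-! ### First visits of states, by comparison with programs that get stuck. -/

section FirstVisit

variable {A : Type v} [Fintype A] [LinearOrder A]

open Classical in
/-- The program without the transitions from state `v`. -/
noncomputable def Program.remove (P : Program.{u} A) (v : Ordinal.{u}) : Program.{u} A := fun x =>
  if x.1 = v then none else P x

variable {P : Program.{u} A} {v : Ordinal.{u}} {s t : Snapshot.{u} A}
  {c : Ordinal.{u} → Snapshot.{u} A}

theorem Program.remove_of_ne {x : Ordinal.{u} × WithBot A} (h : x.1 ≠ v) : P.remove v x = P x :=
  if_neg h

/-- An undefined transition repeats the snapshot, and a sequence that is eventually constant has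
this constant as its limit, in the head component too, since the limit state is then attained. -/
theorem IsRun.stuck (hrun : IsRun (P.remove v) c) {γ : Ordinal.{u}} (h : (c γ).state = v)
    (ξ : Ordinal.{u}) : γ ≤ ξ → c ξ = c γ := by
  induction ξ using limitRecOn with
  | zero => intro h1; rw [le_zero_iff.1 h1]
  | add_one ξ ih =>
    intro h1
    rcases h1.lt_or_eq with h2 | h2
    · have h3 := ih (lt_add_one_iff.1 h2)
      rw [hrun.1, h3, succStep]
      have : P.remove v ((c γ).state, (c γ).tape (c γ).head) = none := if_pos h
      rw [this]
    · rw [h2]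
  | limit l hl ih =>
    intro h1
    rcases h1.lt_or_eq with h2 | h2
    · refine hrun.limit_eq hl _ ⟨γ, h2, fun ξ h3 h4 => ?_⟩ (fun ν hν => ?_)
        (fun b hb => ⟨γ, h2, fun ξ h3 h4 _ => ?_⟩) fun η => tlim_const γ h2 fun ξ h3 h4 => ?_
      · rw [ih ξ h4 h3]
      · refine ⟨max γ ν, le_max_right _ _, max_lt h2 hν, ?_⟩
        rw [ih _ (max_lt h2 hν) (le_max_left _ _)]
        exact ⟨rfl, le_rfl⟩
      · rwa [ih ξ h4 h3]
      · rw [ih ξ h4 h3]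
    · rw [h2]

theorem computation_remove {T : Ordinal.{u}} (h : ∀ ξ < T, (computation P s ξ).state ≠ v)
    (ξ : Ordinal.{u}) : ξ ≤ T → computation (P.remove v) s ξ = computation P s ξ := by
  induction ξ using limitRecOn with
  | zero => intro _; rw [computation_zero, computation_zero]
  | add_one ξ ih =>
    intro h1
    have h2 : ξ < T := add_one_le_iff.1 h1
    rw [(isRun_computation _ _).1, (isRun_computation _ _).1, ih h2.le, succStep, succStep,
      Program.remove_of_ne (h ξ h2)]
  | limit l hl ih =>
    intro h1
    rw [(isRun_computation _ _).2 l hl, (isRun_computation _ _).2 l hl]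
    congr 1
    funext ξ
    exact ih ξ ξ.2 (ξ.2.le.trans h1)

/-- Let `N` be a set of states that have not been visited before time `δ`. If the snapshot `t` with
state in `N` is reached by all programs that get stuck in a state from `N`, then `t` is reached before
any other visit of `N`. -/
theorem exists_first_visit {N : Set Ordinal.{u}} (ht : t.state ∈ N) {δ : Ordinal.{u}}
    (hδ : ∀ ξ < δ, (computation P s ξ).state ∉ N) {Φ : Snapshot.{u} A → Prop}
    (H : ∀ v ∈ N, computation (P.remove v) s δ = computation P s δ →
      ∃ γ, δ ≤ γ ∧ computation (P.remove v) s γ = t ∧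
        ∀ ξ, δ ≤ ξ → ξ < γ → Φ (computation (P.remove v) s ξ)) :
    ∃ T, δ ≤ T ∧ computation P s T = t ∧ (∀ ξ < T, (computation P s ξ).state ∉ N) ∧
      ∀ ξ, δ ≤ ξ → ξ < T → Φ (computation P s ξ) := by
  have hag : ∀ v ∈ N, computation (P.remove v) s δ = computation P s δ := fun v hv =>
    computation_remove (fun ξ hξ h => hδ ξ hξ (h ▸ hv)) δ le_rfl
  obtain ⟨γ, h1, h2, h3⟩ := H _ ht (hag _ ht)
  let S : Set Ordinal.{u} := {ξ | (computation P s ξ).state = t.state}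
  have hS : ∃ ξ ≤ γ, ξ ∈ S := by
    by_contra! hc
    have := computation_remove (P := P) (v := t.state) (T := γ)
      (fun ξ hξ => hc ξ hξ.le) γ le_rfl
    exact hc γ le_rfl (by change (computation P s γ).state = t.state; rw [← this, h2])
  -- Up to `T` the program `P` agrees with `P.remove t.state`, which gets stuck at `T` and later is
  -- in `t`. So the snapshot at `T` already is `t`.
  set T := sInf S with hT
  have hTS : (computation P s T).state = t.state := csInf_mem (s := S) ⟨_, hS.choose_spec.2⟩
  have hTlt : ∀ ξ < T, (computation P s ξ).state ≠ t.state := fun ξ hξ =>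
    notMem_of_lt_csInf' (s := S) hξ
  have hTγ : T ≤ γ := (csInf_le' hS.choose_spec.2).trans hS.choose_spec.1
  have heq := computation_remove hTlt
  have hδT : δ ≤ T := by
    by_contra! h
    exact hδ T h (hTS ▸ ht)
  refine ⟨T, hδT, ?_, fun ξ hξ hv => ?_, fun ξ h4 h5 => ?_⟩
  · have h4 := (isRun_computation (P.remove t.state) s).stuck (γ := T)
      (by rw [heq T le_rfl, hTS]) γ hTγ
    rw [heq T le_rfl] at h4
    exact h4.symm.trans h2
  -- Suppose that a state `v` from `N` occurs before `T`, first at `T'`. The program `P.remove v`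
  -- agrees with `P` up to `T'` and is stuck from then on, but it reaches `t`. Whether this happens
  -- before or after `T'`, the state of `t` occurs before `T`, a contradiction.
  · set v := (computation P s ξ).state with hvdef
    let S' : Set Ordinal.{u} := {ξ | (computation P s ξ).state = v}
    have hS'ξ : ξ ∈ S' := rfl
    set T' := sInf S' with hT'
    have hTS' : (computation P s T').state = v := csInf_mem (s := S') ⟨_, hS'ξ⟩
    have hTlt' : ∀ ξ < T', (computation P s ξ).state ≠ v := fun ξ hξ =>
      notMem_of_lt_csInf' (s := S') hξ
    have hT'T : T' < T := (csInf_le' hS'ξ).trans_lt hξ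
    have heq' := computation_remove hTlt'
    obtain ⟨γ', h6, h7, -⟩ := H v hv (hag v hv)
    rcases le_or_gt T' γ' with h8 | h8
    · have h9 := (isRun_computation (P.remove v) s).stuck (γ := T')
        (by rw [heq' T' le_rfl, hTS']) γ' h8
      rw [h7, heq' T' le_rfl] at h9
      exact hTlt T' hT'T (by rw [h9])
    · refine hTlt γ' (h8.trans hT'T) ?_
      rw [← heq' γ' h8.le, h7]
  · rw [← heq ξ h5.le]
    exact h3 ξ h4 (h5.trans_le hTγ)

theorem RLim.unique {g : Ordinal.{u} → Ordinal.{u}} {l a b : Ordinal.{u}} (h : RLim g l a)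
    (h' : RLim g l b) : a = b := by
  have key : ∀ {a b : Ordinal.{u}}, RLim g l a → RLim g l b → a ≤ b := by
    intro a b h h'
    by_contra! hlt
    obtain ⟨ν, h1, h2⟩ := h.1 b hlt
    obtain ⟨μ, h3, h4, h5⟩ := h'.2 ν h1
    exact absurd (h2 μ h3 h4) (not_lt.2 h5)
  exact le_antisymm (key h h') (key h' h)

/-- A limit snapshot whose state is new. -/
theorem IsRun.limit_fresh (hrun : IsRun P c) {l : Ordinal.{u}} (hl : IsSuccLimit l)
    (t : Snapshot.{u} A) (hst : RLim (fun ξ => (c ξ).state) l t.state)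
    (hfresh : ∀ ξ < l, (c ξ).state ≠ t.state) (hhd : t.head = 0)
    (htp : ∀ η, TLim (fun ξ => (c ξ).tape η) l (t.tape η)) : c l = t := by
  have h1 : (c l).state = t.state := (hrun.rlim_state hl).unique hst
  have h2 : (c l).tape = t.tape := funext fun η => (hrun.tlim_tape hl η).unique (htp η)
  have h3 : (c l).head = t.head := by
    rw [hhd, hrun.head_limit hl, h1]
    by_contra h
    obtain ⟨ζ, -, ⟨ξ, -, h4, h5⟩, -⟩ := lt_headLiminf.1 (pos_iff_ne_zero.2 h)
    exact hfresh ξ h4 h5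
  obtain ⟨a1, a2, a3⟩ := t
  rcases h : c l with ⟨b1, b2, b3⟩
  rw [h] at h1 h2 h3
  simp_all

end FirstVisit

/-! ### The transfinite program that writes the pairing. -/

section Symmetric

variable {A : Type v} [Fintype A] [LinearOrder A] {j : ℕ} [NeZero j]

open Cmd Var

/-- Read the input. -/
noncomputable def symPre (one : A) : Cmd (Var j) A := seq (load one) (clearInp one)

/-- Copy the tail of the input and write the output. -/
noncomputable def symPost (zr one : A) : Cmd (Var j) A := seq (copyTail zr one) (output one)

/-- The rule that appends the content `d` to `X`. -/
noncomputable def appendRule (one : A) (d : WithBot A) (x : Var j → WithBot A) : (Var j → WithBot A) × Bool :=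
  if x e = ⊥ then (Function.update (Function.update x X d) e (one : WithBot A), true) else (x, false)

variable (hj : 17 ≤ j) (zr one : A) (p : Word.{u} A)

/-- The node at which the copy of the marked parameter is complete. -/
noncomputable def symMid (zr one : A) (j : ℕ) [NeZero j] (p : Word.{u} A) : Ordinal.{u} :=
  ((symPre (j := j) one).size : Ordinal.{u}) + (p.marked one).len

/-- The final node. -/
noncomputable def symEnd (zr one : A) (j : ℕ) [NeZero j] (p : Word.{u} A) : Ordinal.{u} :=
  symMid zr one j p + ((symPost (j := j) zr one).size : Ordinal.{u})

open Classical in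
/-- The nodes of the program that writes the pairing of `p` and its input. -/
noncomputable def symNodes (n : Ordinal.{u}) : Option (Instr.{u} A (2 * j)) :=
  if n < ((symPre (j := j) one).size : Ordinal.{u}) then
    (symPre one).code (stdLayout hj) 0 (nodeStart A (2 * j) ((symPre (j := j) one).size : Ordinal.{u})) n
  else if n < symMid zr one j p then
    some ((stdLayout hj).primInstr
      (appendRule one ((p.marked one).tape (n - ((symPre (j := j) one).size : Ordinal.{u}))))
      (nodeStart A (2 * j) (n + 1)))
  else if n < symEnd zr one j p then
    (symPost zr one).code (stdLayout hj) (symMid zr one j p) (nodeStart A (2 * j) (symEnd zr one j p)) n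
  else if n = symEnd zr one j p then some (finalInstr A j) else none

/-- The state in which the pairing is complete. -/
noncomputable def symIdle (zr one : A) (j : ℕ) [NeZero j] (p : Word.{u} A) : Ordinal.{u} :=
  nodeStart A (2 * j) (symEnd zr one j p + 1)

/-- The state in which the simulation starts. -/
noncomputable def symBase (zr one : A) (j : ℕ) [NeZero j] (p : Word.{u} A) : Ordinal.{u} :=
  symIdle zr one j p + ω

open Classical in
/-- Wait for `ω` steps and then simulate `q`. -/
noncomputable def symExt (j : ℕ) [NeZero j] (q : Program.{u} A) : Program.{u} A := fun x =>
  if x.1 < symBase zr one j p then some (x.1 + 1, x.2, .stay)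
  else if x.1 - symBase zr one j p = 1 then some (1, x.2, .stay)
  else (q (x.1 - symBase zr one j p, x.2)).map fun r => (symBase zr one j p + r.1, r.2)

/-- The transfinite program that writes the pairing of `p` and its input, and then simulates `q`. -/
noncomputable def symProgram (q : Program.{u} A) : Program.{u} A :=
  assemble one (symNodes hj zr one p) (symIdle zr one j p) (symExt zr one p j q)

variable {hj zr one p} {q P : Program.{u} A}

theorem lt_of_symNodes {n : Ordinal.{u}} (hn : symNodes hj zr one p n ≠ none) :
    n < symEnd zr one j p + 1 := by
  by_contra! h
  have h1 : symEnd zr one j p < n := add_one_le_iff.1 h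
  have h2 : symMid zr one j p ≤ n := le_self_add.trans h1.le
  have h3 : ((symPre (j := j) one).size : Ordinal.{u}) ≤ n := le_self_add.trans h2
  apply hn
  rw [symNodes, if_neg (not_lt.2 h3), if_neg (not_lt.2 h2), if_neg (not_lt.2 h1.le), if_neg h1.ne']

/-- `P` and `symProgram` agree on the states below `M`. -/
def Agrees (hj : 17 ≤ j) (zr one : A) (p : Word.{u} A) (q P : Program.{u} A) (M : Ordinal.{u}) : Prop :=
  ∀ x : Ordinal.{u} × WithBot A, x.1 < M → P x = symProgram hj zr one p q x

/-- Removing the transitions from `v` does not affect the states below `v`. So all code located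
before `v` still works, which is what `exists_first_visit` needs. -/
theorem Agrees.remove {M v : Ordinal.{u}} (h : Agrees hj zr one p q P M) (hv : v ≤ M) :
    Agrees hj zr one p q (P.remove v) v := fun x hx => by
  rw [Program.remove_of_ne hx.ne, h x (hx.trans_le hv)]

theorem Agrees.node {n M : Ordinal.{u}} {I : Instr.{u} A (2 * j)} (h : Agrees hj zr one p q P M)
    (hI : symNodes hj zr one p n = some I) (hM : nodeStart A (2 * j) (n + 1) ≤ M) :
    Implements P n I := fun ph d => by
  rw [h _ ((nodeState_lt (lt_add_one n) ph).trans_le hM)]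
  exact assemble_node hI ph d

theorem Agrees.spread {n M : Ordinal.{u}} (h : Agrees hj zr one p q P M)
    (hM : nodeStart A (2 * j) n ≤ M) (s : SpreadState A) (d : WithBot A) :
    P ((s.num : Ordinal.{u}), d) = some (s.tr one (nodeStart A (2 * j) 0) d) := by
  rw [h]
  · exact assemble_spread s d
  · refine lt_of_lt_of_le ?_ hM
    rw [nodeStart_eq]
    refine lt_of_lt_of_le ?_ le_self_add
    exact Nat.cast_lt.2 (s.num_lt.trans_le (by omega))

theorem Agrees.compress {n M : Ordinal.{u}} (h : Agrees hj zr one p q P M)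
    (hM : nodeStart A (2 * j) n ≤ M) (s : CompressState A) (d : WithBot A) :
    P ((s.num : Ordinal.{u}), d) = some (s.tr (symIdle zr one j p) d) := by
  rw [h]
  · exact assemble_compress s d
  · refine lt_of_lt_of_le ?_ hM
    rw [nodeStart_eq]
    refine lt_of_lt_of_le ?_ le_self_add
    exact Nat.cast_lt.2 s.num_lt

variable (one p) in
/-- The contents of the variables when `μ` letters of the pairing have been written. -/
noncomputable def appendCfg (zr : A) (w : Word.{u} A) (μ : Ordinal.{u}) : Cfg.{u} (Var j) A :=
  Function.update (Function.update (Function.update ⊥ Y w.tape) X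
    (trunc (Word.star zr one p w).tape μ)) e (un one μ)

theorem sem_symPre {ℓ : Layout (Var j) (2 * j)} (w : Word.{u} A) :
    Sem ℓ one (symPre one) (inpCfg w) (appendCfg one p zr w 0) ⊥ := by
  refine Sem.seq (sem_load (b := 0) w (by simp [inpCfg, setInp, un_zero]) (by simp [inpCfg, setInp])
    (by simp [inpCfg, setInp]) (fun i μ => by simp [inpCfg, setInp])) fun _ => ?_
  refine (sem_clearInp w (by simp) (fun i μ => by simp [inpCfg, setInp])).to ?_
  funext v
  cases v <;> simp [inpCfg, setInp, appendCfg, trunc_zero, un_zero]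

theorem sem_append {ℓ : Layout (Var j) (2 * j)} (w : Word.{u} A) {μ : Ordinal.{u}}
    (hμ : μ < (p.marked one).len) :
    Sem ℓ one (.prim (appendRule one ((p.marked one).tape μ))) (appendCfg one p zr w μ)
      (appendCfg one p zr w (μ + 1)) (appendCfg one p zr w μ ⊓ appendCfg one p zr w (μ + 1)) := by
  have e1 : (p.marked one).tape μ = (Word.star zr one p w).tape μ := (if_pos hμ).symm
  refine sem_upd (r := e) (ρ := μ)
    (f := fun x => Function.update (Function.update x X ((p.marked one).tape μ)) e (one : WithBot A))
    (by simp [appendCfg]) (fun v η => ?_) inf_le_left inf_le_right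
  by_cases h : η = μ
  · subst h
    rw [if_pos rfl]
    cases v <;> simp [appendCfg, trunc, e1, un_of_lt]
  · rw [if_neg h]
    have h2 : η < μ + 1 ↔ η < μ := by
      rw [lt_add_one_iff, le_iff_lt_or_eq]; simp [h]
    cases v <;> simp [appendCfg, trunc, un, h2]

theorem sem_symPost {ℓ : Layout (Var j) (2 * j)} (h01 : zr ≠ one) (w : Word.{u} A) :
    Sem ℓ one (symPost zr one) (appendCfg one p zr w (p.marked one).len)
      (inpCfg (Word.star zr one p w)) ⊥ := by
  refine Sem.seq (sem_copyTail (e₀ := (p.marked one).len) (y := (Word.star zr one p w).tape) (w := w)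
    h01 (by simp [appendCfg]) (by simp [appendCfg]) (by simp [appendCfg]) (by simp [appendCfg])
    (by simp [appendCfg]) (by simp [appendCfg]) fun μ => Word.star_rest p w μ) fun _ => ?_
  refine (sem_output (Word.star zr one p w) (by simp [appendCfg]) (by simp) (by simp)
    (fun i => by simp [appendCfg])).to ?_
  funext v
  cases v <;> simp [inpCfg, setInp, appendCfg]

theorem clim_appendCfg (w : Word.{u} A) {l : Ordinal.{u}} (hl : IsSuccLimit l) :
    CLim (appendCfg (j := j) one p zr w) l (appendCfg one p zr w l) :=
  ((clim_const hl _).update (tlim_trunc IsNormal.id hl) X).update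
    ((rlim_of_isNormal hl IsNormal.id).tlim_un hl) e

theorem Agrees.installed_pre {M : Ordinal.{u}} (h : Agrees hj zr one p q P M)
    (hM : nodeStart A (2 * j) ((symPre (j := j) one).size : Ordinal.{u}) ≤ M) :
    Installed (stdLayout hj) P (symPre one) 0
      (nodeStart A (2 * j) ((symPre (j := j) one).size : Ordinal.{u})) := by
  refine installed_of_code _ _ _ fun n _ h2 I hI => h.node ?_ ((nodeStart_mono ?_).trans hM)
  · rw [zero_add] at h2
    rw [symNodes, if_pos h2, hI]
  · rw [zero_add] at h2
    exact add_one_le_of_lt h2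

theorem Agrees.installed_append {M μ : Ordinal.{u}} (h : Agrees hj zr one p q P M)
    (hμ : μ < (p.marked one).len)
    (hM : nodeStart A (2 * j) (((symPre (j := j) one).size : Ordinal.{u}) + (μ + 1)) ≤ M) :
    Installed (stdLayout hj) P (.prim (appendRule one ((p.marked one).tape μ)))
      (((symPre (j := j) one).size : Ordinal.{u}) + μ)
      (nodeStart A (2 * j) (((symPre (j := j) one).size : Ordinal.{u}) + (μ + 1))) := by
  rw [← add_assoc] at hM ⊢
  refine h.node ?_ hM
  rw [symNodes, if_neg (not_lt.2 le_self_add), if_pos (by rw [symMid]; gcongr), Ordinal.add_sub_cancel]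

theorem Agrees.installed_post {M : Ordinal.{u}} (h : Agrees hj zr one p q P M)
    (hM : nodeStart A (2 * j) (symEnd zr one j p) ≤ M) :
    Installed (stdLayout hj) P (symPost zr one) (symMid zr one j p)
      (nodeStart A (2 * j) (symEnd zr one j p)) := by
  refine installed_of_code _ _ _ fun n h1 h2 I hI => h.node ?_ ((nodeStart_mono ?_).trans hM)
  · rw [symNodes, if_neg (not_lt.2 (le_self_add.trans h1)), if_neg (not_lt.2 h1), if_pos (show n < symEnd zr one j p from h2), hI]
  · exact add_one_le_of_lt h2

/-- The letters are written at the nodes `s₁ + μ`. When a limit `μ` is approached, the states of the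
nodes increase to the first state of node `s₁ + μ`, by continuity of `nodeStart`. As this state is
new, the head is on cell `0`, as required at the start of a node. The invariant of the iteration
therefore includes that the first states of the nodes ahead have not been visited. -/
theorem exists_appended {M : Ordinal.{u}} (h : Agrees hj zr one p q P M)
    (hM : nodeStart A (2 * j) (symMid zr one j p) ≤ M) (w : Word.{u} A) :
    ∃ γ, computation P ⟨w.tape, 0, 0⟩ γ =
      ⟨(stdLayout hj).tape one (appendCfg one p zr w (p.marked one).len),
        nodeStart A (2 * j) (symMid zr one j p), 0⟩ ∧
      ∀ ξ < γ, (computation P ⟨w.tape, 0, 0⟩ ξ).state ≠ 1 := by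
  set s₁ : Ordinal.{u} := ((symPre (j := j) one).size : Ordinal.{u}) with hs₁
  set Λ : Ordinal.{u} := (p.marked one).len with hΛ
  set ρ : Ordinal.{u} → Ordinal.{u} := fun μ => nodeStart A (2 * j) (s₁ + μ) with hρ
  have hρn : IsNormal ρ := nodeStart_isNormal.comp (add_isNormal s₁)
  have hρM : ∀ ν ≤ Λ, ρ ν ≤ M := fun ν hν => (hρn.strictMono.monotone hν).trans hM
  set snap : Ordinal.{u} → Snapshot.{u} A := fun μ =>
    ⟨(stdLayout hj).tape one (appendCfg one p zr w μ), ρ μ, 0⟩ with hsnap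
  set s : Snapshot.{u} A := ⟨w.tape, 0, 0⟩ with hs
  set c := computation P s with hc
  have hrun : IsRun P c := isRun_computation _ _
  -- Spreading and reading the input only use code before every `ρ ν`, so they also work when one of
  -- these states is removed; hence `ρ 0` is the first of them to be visited.
  obtain ⟨γ₀, -, h1, h2, h3⟩ := exists_first_visit (P := P) (s := s) (t := snap 0)
    (N := {x | ∃ ν ≤ Λ, x = ρ ν}) (δ := 0) ⟨0, zero_le, rfl⟩ (fun ξ hξ => absurd hξ not_lt_zero)
    (Φ := fun m => m.state ≠ 1) (by
      rintro v ⟨ν, hν, rfl⟩ -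
      have hag := h.remove (hρM ν hν)
      have hrun' := isRun_computation (P.remove (ρ ν)) s
      refine ((leadsE_input hj hrun' (hag.spread (n := s₁ + ν) le_rfl) w).trans
        (((sem_symPre (p := p) (zr := zr) w).2.2 _ _ _ _ hrun' (hag.installed_pre (nodeStart_mono le_self_add))).mono
        fun m hm => ((one_lt_nodeStart _).trans_le hm.1).ne').toE) 0 ?_ |>.imp fun γ hγ => ?_
      · rw [computation_zero]
      · simpa [hsnap, hρ] using hγ)
  refine (exists_iterate (fun δ : Ordinal.{u} => δ) Λ γ₀
    (fun μ δ => c δ = snap μ ∧ ∀ ξ < δ, ∀ ν, μ ≤ ν → ν ≤ Λ → (c ξ).state ≠ ρ ν)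
    (fun μ δ => ρ μ ≤ (c δ).state ∧ (stdLayout hj).tape one
      (appendCfg one p zr w μ ⊓ appendCfg one p zr w (μ + 1)) ≤ (c δ).tape)
    ⟨h1, fun ξ hξ ν _ hν h6 => h2 ξ hξ ⟨ν, hν, h6⟩⟩ ?_ ?_).elim fun γ hγ => ?_
  · rintro μ hμ δ - ⟨hδ, hδ'⟩
    -- Node `s₁ + μ` lies below every `ρ ν` with `μ + 1 ≤ ν`. It is executed correctly even if `ρ ν`
    -- is removed, so `ρ (μ + 1)` is visited before all later ones.
    obtain ⟨T, h6, h7, h8, h9⟩ := exists_first_visit (P := P) (s := s) (t := snap (μ + 1))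
      (N := {x | ∃ ν, μ + 1 ≤ ν ∧ ν ≤ Λ ∧ x = ρ ν}) (δ := δ)
      ⟨μ + 1, le_rfl, add_one_le_of_lt hμ, rfl⟩
      (fun ξ hξ ⟨ν, h6, h7, h8⟩ => hδ' ξ hξ ν ((lt_add_one μ).le.trans h6) h7 h8)
      (Φ := fun m => ρ μ ≤ m.state ∧ (stdLayout hj).tape one
        (appendCfg one p zr w μ ⊓ appendCfg one p zr w (μ + 1)) ≤ m.tape) (by
      rintro v ⟨ν, h6, h7, rfl⟩ h8
      have hag := h.remove (hρM ν h7)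
      have hrun' := isRun_computation (P.remove (ρ ν)) s
      obtain ⟨γ, h9, h10, h11⟩ := (sem_append w hμ).2.2 _ _ _ _ hrun'
        (hag.installed_append hμ (hρn.strictMono.monotone h6)) δ (h8.trans hδ)
      exact ⟨γ, h9.le, h10, h11⟩)
    refine ⟨T, h6.lt_of_ne ?_, ⟨h7, fun ξ hξ ν h10 h11 h12 => h8 ξ hξ ⟨ν, h10, h11, h12⟩⟩, h9⟩
    rintro rfl
    have h10 : snap μ = snap (μ + 1) := hδ.symm.trans h7
    exact (hρn.strictMono (lt_add_one μ)).ne (congrArg Snapshot.state h10)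
  · intro l hlΛ hl τ hτ τ0 hI hΦ
    have hcof : ∀ ν < τ l, ∃ ν' < l, ν < τ ν' := fun ν hν => (hτ.lt_iff_exists_lt hl).1 hν
    have hmid : ∀ ν < l, ∀ ξ, τ ν ≤ ξ → ξ < τ l → ∃ μ, ν ≤ μ ∧ μ < l ∧ ρ μ ≤ (c ξ).state ∧
        (stdLayout hj).tape one (appendCfg one p zr w μ ⊓ appendCfg one p zr w (μ + 1)) ≤
          (c ξ).tape := by
      intro ν hν ξ h6 h7
      obtain ⟨μ, h8, h9⟩ := hτ.exists_map_le_lt_map_succ (x := ξ)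
        ((hτ.strictMono.monotone bot_le).trans h6)
      have h10 : μ < l := hτ.strictMono.lt_iff_lt.1 (h8.trans_lt h7)
      have h11 : ν < succ μ := hτ.strictMono.lt_iff_lt.1 (h6.trans_lt h9)
      exact ⟨μ, lt_succ_iff.1 h11, h10, hΦ μ h10 ξ h8 h9⟩
    -- Every time before `τ l` is before some `τ μ` with `μ < l`, and the invariant at `μ` excludes
    -- all nodes from `l` on.
    have hfresh : ∀ ξ < τ l, ∀ ν, l ≤ ν → ν ≤ Λ → (c ξ).state ≠ ρ ν := by
      intro ξ hξ ν h6 h7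
      obtain ⟨μ, h8, h9⟩ := hcof ξ hξ
      exact (hI μ h8).2 ξ h9 ν (h8.le.trans h6) h7
    obtain ⟨-, -, -, a4, a5⟩ := loopLimit_cfg (ℓ := stdLayout hj) (one := one) (b := 0)
      (appendCfg one p zr w) hl (clim_appendCfg w hl)
    refine ⟨hrun.limit_fresh (hτ.map_isSuccLimit hl) (snap l) ⟨fun b hb => ?_, fun ν hν => ?_⟩
      (fun ξ hξ => hfresh ξ hξ l le_rfl hlΛ) rfl fun η => ⟨?_, fun ν hν => ?_⟩, hfresh⟩
    · obtain ⟨ν, h6, h7⟩ := (hρn.lt_iff_exists_lt hl).1 hb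
      refine ⟨τ ν, hτ.strictMono h6, fun ξ h8 h9 => ?_⟩
      obtain ⟨μ, h10, -, h11, -⟩ := hmid ν h6 ξ h8 h9
      exact h7.trans_le ((hρn.strictMono.monotone h10).trans h11)
    · obtain ⟨μ, h6, h7⟩ := hcof ν hν
      refine ⟨τ μ, h7.le, hτ.strictMono h6, ?_⟩
      dsimp only
      rw [(hI μ h6).1]
      exact hρn.strictMono.monotone h6.le
    · obtain ⟨ν, h6, h7⟩ := a4 η
      refine ⟨τ ν, hτ.strictMono h6, fun ξ h8 h9 => ?_⟩
      obtain ⟨μ, h10, h11, h12, h13⟩ := hmid ν h6 ξ h8 h9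
      exact h7 μ h10 h11 (c ξ) ⟨(nodeStart_mono zero_le).trans h12, h13⟩
    · obtain ⟨ν', h6, h7⟩ := hcof ν hν
      obtain ⟨μ, h8, h9, h10⟩ := a5 η ν' h6
      refine ⟨τ μ, h7.le.trans (hτ.strictMono.monotone h8), hτ.strictMono h9, ?_⟩
      dsimp only
      rw [(hI μ h9).1]
      exact h10
  · obtain ⟨-, ⟨h4, -⟩, h5⟩ := hγ
    refine ⟨γ, h4, fun ξ hξ => ?_⟩
    rcases lt_or_ge ξ γ₀ with h6 | h6
    · exact h3 ξ zero_le h6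
    · obtain ⟨μ, -, h7, -⟩ := h5 ξ h6 hξ
      exact ((one_lt_nodeStart _).trans_le h7).ne'

theorem exists_paired {M : Ordinal.{u}} (h01 : zr ≠ one) (h : Agrees hj zr one p q P M)
    (hM : symIdle zr one j p ≤ M) (w : Word.{u} A) :
    ∃ γ β, computation P ⟨w.tape, 0, 0⟩ γ =
      ⟨(Word.star zr one p w).tape, symIdle zr one j p, β⟩ ∧
      ∀ ξ < γ, (computation P ⟨w.tape, 0, 0⟩ ξ).state ≠ 1 := by
  have hrun := isRun_computation P ⟨w.tape, 0, 0⟩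
  have hM1 : nodeStart A (2 * j) (symEnd zr one j p) ≤ M :=
    (nodeStart_mono (lt_add_one _).le).trans hM
  obtain ⟨γ1, h1, h2⟩ := exists_appended h ((nodeStart_mono le_self_add).trans hM1) w
  obtain ⟨γ2, h3, h4, h5⟩ := (sem_symPost h01 w).2.2 _ _ _ _ hrun (h.installed_post hM1) γ1 h1
  have hmid : symMid zr one j p ≤ symEnd zr one j p := le_self_add
  have hpre : ((symPre (j := j) one).size : Ordinal.{u}) ≤ symMid zr one j p := le_self_add
  have hI : symNodes hj zr one p (symEnd zr one j p) = some (finalInstr A j) := by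
    rw [symNodes, if_neg (not_lt.2 (hpre.trans hmid)), if_neg (not_lt.2 hmid),
      if_neg (lt_irrefl _), if_pos rfl]
  obtain ⟨γ3, β, h6, h7, h8⟩ := exists_final hrun (h.compress hM1) hj (h.node hI hM) _ γ2 h4
  refine ⟨γ3, β, h7, fun ξ hξ => ?_⟩
  rcases lt_or_ge ξ γ1 with h9 | h9
  · exact h2 ξ h9
  rcases lt_or_ge ξ γ2 with h10 | h10
  · exact ((one_lt_nodeStart _).trans_le (h5 ξ h9 h10).1).ne'
  · exact h8 ξ h10 hξ

end Symmetric

/-! ### Shifted limits, and the imitation of one program by another. -/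

section Shift

theorem RLim.shift {f : Ordinal.{u} → Ordinal.{u}} {T l v : Ordinal.{u}} (hl : IsSuccLimit l)
    (h : RLim (fun ξ => f (T + ξ)) l v) : RLim f (T + l) v := by
  refine ⟨fun b hb => ?_, fun ν hν => ?_⟩
  · obtain ⟨ν, h1, h2⟩ := h.1 b hb
    refine ⟨T + ν, by gcongr, fun μ h3 h4 => ?_⟩
    obtain ⟨μ, rfl⟩ := le_iff_exists_add.1 (le_self_add.trans h3)
    exact h2 μ ((add_le_add_iff_left T).1 h3) ((add_lt_add_iff_left T).1 h4)
  · obtain ⟨μ, h1, h2, h3⟩ := h.2 (ν - T) (Ordinal.sub_lt_of_lt_add hν hl.bot_lt)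
    exact ⟨T + μ, Ordinal.sub_le.1 h1, by gcongr, h3⟩

theorem TLim.shift {S : Type v} [LE S] {f : Ordinal.{u} → S} {T l : Ordinal.{u}} {v : S}
    (hl : IsSuccLimit l) (h : TLim (fun ξ => f (T + ξ)) l v) : TLim f (T + l) v := by
  refine ⟨?_, fun ν hν => ?_⟩
  · obtain ⟨ν, h1, h2⟩ := h.1
    refine ⟨T + ν, by gcongr, fun μ h3 h4 => ?_⟩
    obtain ⟨μ, rfl⟩ := le_iff_exists_add.1 (le_self_add.trans h3)
    exact h2 μ ((add_le_add_iff_left T).1 h3) ((add_lt_add_iff_left T).1 h4)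
  · obtain ⟨μ, h1, h2, h3⟩ := h.2 (ν - T) (Ordinal.sub_lt_of_lt_add hν hl.bot_lt)
    exact ⟨T + μ, Ordinal.sub_le.1 h1, by gcongr, h3⟩

theorem RLim.add_left {f : Ordinal.{u} → Ordinal.{u}} {l v : Ordinal.{u}} (hl : IsSuccLimit l)
    (h : RLim f l v) (a : Ordinal.{u}) : RLim (fun ξ => a + f ξ) l (a + v) := by
  refine ⟨fun b hb => ?_, fun ν hν => ?_⟩
  · rcases lt_or_ge b a with h1 | h1
    · exact ⟨0, hl.bot_lt, fun μ _ _ => h1.trans_le le_self_add⟩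
    · obtain ⟨b, rfl⟩ := le_iff_exists_add.1 h1
      obtain ⟨ν, h2, h3⟩ := h.1 b ((add_lt_add_iff_left a).1 hb)
      exact ⟨ν, h2, fun μ h4 h5 => (add_lt_add_iff_left a).2 (h3 μ h4 h5)⟩
  · obtain ⟨μ, h1, h2, h3⟩ := h.2 ν hν
    exact ⟨μ, h1, h2, (add_le_add_iff_left a).2 h3⟩

variable {A : Type v} [Fintype A] [LinearOrder A] {P q : Program.{u} A}
  {c c' : Ordinal.{u} → Snapshot.{u} A}

theorem Snapshot.ext' {s t : Snapshot.{u} A} (h1 : s.tape = t.tape) (h2 : s.state = t.state)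
    (h3 : s.head = t.head) : s = t := by
  cases s; cases t; simp_all

/-- If `P` behaves on the states `base + α` like `q` on the states `α`, and a run of `P` enters these
states for the first time at time `T`, then from there on it imitates `q`. -/
theorem IsRun.imitate (hrun : IsRun P c) (hrun' : IsRun q c') {T base : Ordinal.{u}}
    (h0 : c T = ⟨(c' 0).tape, base + (c' 0).state, (c' 0).head⟩)
    (hfresh : ∀ ξ < T, ∀ α, (c ξ).state ≠ base + α)
    (hP : ∀ α, α ≠ 1 → ∀ d, P (base + α, d) = (q (α, d)).map fun r => (base + r.1, r.2))
    (γ : Ordinal.{u}) : (∀ ξ < γ, (c' ξ).state ≠ 1) →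
      c (T + γ) = ⟨(c' γ).tape, base + (c' γ).state, (c' γ).head⟩ := by
  induction γ using limitRecOn with
  | zero => intro _; rw [add_zero, h0]
  | add_one γ ih =>
    intro h
    have h1 := ih fun ξ hξ => h ξ (hξ.trans (lt_add_one γ))
    rw [← add_assoc, hrun.1, hrun'.1, h1, succStep, succStep]
    simp only [hP _ (h γ (lt_add_one γ))]
    rcases q ((c' γ).state, (c' γ).tape (c' γ).head) with _ | ⟨δ, d, m⟩ <;> rfl
  | limit l hl ih =>
    intro h
    have ih' : ∀ ξ < l, c (T + ξ) = ⟨(c' ξ).tape, base + (c' ξ).state, (c' ξ).head⟩ :=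
      fun ξ hξ => ih ξ hξ fun ζ hζ => h ζ (hζ.trans hξ)
    have hl' : IsSuccLimit (T + l) := (add_isNormal T).map_isSuccLimit hl
    have hst : (c (T + l)).state = base + (c' l).state := by
      refine (hrun.rlim_state hl').unique (RLim.shift hl ?_)
      exact ((hrun'.rlim_state hl).add_left hl base).congr fun μ hμ => by rw [ih' μ hμ]
    refine Snapshot.ext' (funext fun η => ?_) hst ?_
    · refine (hrun.tlim_tape hl' η).unique (TLim.shift hl ?_)
      exact (hrun'.tlim_tape hl η).congr fun μ hμ => by rw [ih' μ hμ]
    · dsimp only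
      rw [hrun.head_limit hl', hst, hrun'.head_limit hl]
      refine eq_of_forall_lt_iff fun b => ?_
      rw [lt_headLiminf, lt_headLiminf]
      constructor
      · rintro ⟨ζ, h1, ⟨ξ, h2, h3, h4⟩, h5⟩
        -- The states `base + α` have not occurred before `T`, so the earlier part of the run has no
        -- influence on the head position at the limit, even though it is shorter than the limit
        -- time.
        have hTξ : T ≤ ξ := not_lt.1 fun h6 => hfresh ξ h6 _ h4
        obtain ⟨ξ, rfl⟩ := le_iff_exists_add.1 hTξ
        have hξ : ξ < l := (add_lt_add_iff_left T).1 h3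
        rw [ih' ξ hξ] at h4
        refine ⟨ζ - T, Ordinal.sub_lt_of_lt_add h1 hl.bot_lt,
          ⟨ξ, Ordinal.sub_le.2 h2, hξ, (add_right_inj base).1 h4⟩, fun μ h6 h7 h8 => ?_⟩
        have := h5 (T + μ) (Ordinal.sub_le.1 h6) (by gcongr) (by rw [ih' μ h7, h8])
        rwa [ih' μ h7] at this
      · rintro ⟨ζ, h1, ⟨ξ, h2, h3, h4⟩, h5⟩
        refine ⟨T + ζ, by gcongr, ⟨T + ξ, by gcongr, by gcongr, by rw [ih' ξ h3, h4]⟩,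
          fun μ h6 h7 h8 => ?_⟩
        obtain ⟨μ, rfl⟩ := le_iff_exists_add.1 (le_self_add.trans h6)
        have hμ : μ < l := (add_lt_add_iff_left T).1 h7
        rw [ih' μ hμ] at h8 ⊢
        exact h5 μ ((add_le_add_iff_left T).1 h6) hμ ((add_right_inj base).1 h8)

end Shift

/-! ### Koepke computable functions are symmetrically computable. -/

section Symmetric

variable {A : Type v} [Fintype A] [LinearOrder A] {j : ℕ} [NeZero j] {hj : 17 ≤ j} {zr one : A}
  {p : Word.{u} A} {q P : Program.{u} A}

theorem symProgram_eq_symExt {x : Ordinal.{u}} (hx : symIdle zr one j p ≤ x) (d : WithBot A) :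
    symProgram hj zr one p q (x, d) = symExt zr one p j q (x, d) :=
  assemble_ext (fun n hn => lt_of_symNodes hn) hx d

theorem one_lt_symIdle : 1 < symIdle zr one j p := one_lt_nodeStart _

theorem symIdle_add_lt (n : ℕ) : symIdle zr one j p + n < symBase zr one j p := by
  rw [symBase]
  gcongr
  exact natCast_lt_omega0 n

theorem symIdle_le (α : Ordinal.{u}) : symIdle zr one j p ≤ symBase zr one j p + α :=
  le_trans (show _ ≤ symBase zr one j p from le_self_add) le_self_add

/-- After compressing, the head is on some cell `β`. Standing still for `ω` steps in the states
`symIdle + n` leads to the limit state `symBase`, which has not occurred before, and a new limit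
state puts the head on cell `0`. -/
theorem exists_base (h01 : zr ≠ one) (h : Agrees hj zr one p q P (symBase zr one j p))
    (w : Word.{u} A) :
    ∃ T, computation P ⟨w.tape, 0, 0⟩ T = ⟨(Word.star zr one p w).tape, symBase zr one j p, 0⟩ ∧
      ∀ ξ < T, (computation P ⟨w.tape, 0, 0⟩ ξ).state ≠ 1 := by
  set x := (Word.star zr one p w).tape with hx
  set s : Snapshot.{u} A := ⟨w.tape, 0, 0⟩ with hs
  set B := symBase zr one j p with hB
  obtain ⟨T, -, h1, -, h2⟩ := exists_first_visit (P := P) (s := s) (t := ⟨x, B, 0⟩) (N := {B})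
    (δ := 0) rfl (fun ξ hξ => absurd hξ not_lt_zero) (Φ := fun m => m.state ≠ 1) (by
      rintro v rfl -
      have hag := h.remove le_rfl
      have hrun := isRun_computation (P.remove B) s
      obtain ⟨γ, β, h1, h2⟩ := exists_paired h01 hag le_self_add w
      set c := computation (P.remove B) s with hc
      have hidle : ∀ n : ℕ, c (γ + n) = ⟨x, symIdle zr one j p + n, β⟩ := by
        intro n
        induction n with
        | zero => simpa using h1
        | succ n ih =>
          have hlt := symIdle_add_lt (zr := zr) (one := one) (j := j) (p := p) n
          have h3 := hrun.step_eq (s' := symIdle zr one j p + n + 1) (σ' := x β) (m := .stay) ih (by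
            rw [hag _ hlt, symProgram_eq_symExt le_self_add, symExt, if_pos hlt])
          rw [Nat.cast_succ, ← add_assoc, ← add_assoc, h3, Function.update_eq_self, move_stay]
      have hstate : ∀ ξ < γ + ω, (c ξ).state ≠ B ∧ (c ξ).state ≠ 1 := by
        intro ξ hξ
        rcases lt_or_ge ξ γ with h3 | h3
        -- If the removed state `B` had occurred before `γ`, the run would be stuck in it, but at
        -- `γ` it is in the smaller state `symIdle`.
        · refine ⟨fun h4 => ?_, h2 ξ h3⟩
          have h5 := congrArg Snapshot.state (hrun.stuck h4 γ h3.le)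
          rw [h1, h4] at h5
          have h6 := symIdle_add_lt (zr := zr) (one := one) (j := j) (p := p) 0
          rw [Nat.cast_zero, add_zero] at h6
          exact h6.ne h5
        · obtain ⟨n, rfl⟩ := exists_nat_add h3 hξ
          rw [hidle]
          exact ⟨(symIdle_add_lt n).ne, (one_lt_symIdle.trans_le le_self_add).ne'⟩
      refine ⟨γ + ω, zero_le, ?_, fun ξ _ hξ => (hstate ξ hξ).2⟩
      refine hrun.limit_fresh ((add_isNormal γ).map_isSuccLimit isSuccLimit_omega0) _
        (RLim.shift isSuccLimit_omega0 ?_) (fun ξ hξ => (hstate ξ hξ).1) rfl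
        fun η => TLim.shift isSuccLimit_omega0 ?_
      · refine (rlim_of_isNormal isSuccLimit_omega0 (add_isNormal (symIdle zr one j p))).congr
          fun μ hμ => ?_
        obtain ⟨n, rfl⟩ := lt_omega0.1 hμ
        rw [hidle]
      · refine tlim_const 0 omega0_pos fun μ _ hμ => ?_
        obtain ⟨n, rfl⟩ := lt_omega0.1 hμ
        rw [hidle])
  exact ⟨T, h1, fun ξ hξ => h2 ξ zero_le hξ⟩

theorem symProgram_base {α : Ordinal.{u}} (hα : α ≠ 1) (d : WithBot A) :
    symProgram hj zr one p q (symBase zr one j p + α, d) =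
      (q (α, d)).map fun r => (symBase zr one j p + r.1, r.2) := by
  rw [symProgram_eq_symExt (symIdle_le _), symExt, if_neg (not_lt.2 le_self_add),
    Ordinal.add_sub_cancel, if_neg hα]

theorem symProgram_halt (d : WithBot A) :
    symProgram hj zr one p q (symBase zr one j p + 1, d) = some (1, d, .stay) := by
  rw [symProgram_eq_symExt (symIdle_le _), symExt, if_neg (not_lt.2 le_self_add),
    Ordinal.add_sub_cancel, if_pos rfl]

/-- Preparing the tape works no matter which state `B + α` is removed, so `B` is the first of these
states to be visited, with the pairing on the tape and the head on cell `0`. From there on the run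
imitates that of `q`. -/
theorem interp_symProgram (h01 : zr ≠ one) (w : Word.{u} A) :
    interp (symProgram hj zr one p q) w.tape = interp q (Word.star zr one p w).tape := by
  set P := symProgram hj zr one p q with hP
  set x := (Word.star zr one p w).tape with hx
  set B := symBase zr one j p with hB
  have hag : Agrees hj zr one p q P B := fun _ _ => rfl
  obtain ⟨T, -, h1, h2, h3⟩ := exists_first_visit (P := P) (s := ⟨w.tape, 0, 0⟩) (t := ⟨x, B, 0⟩)
    (N := {v | ∃ α, v = B + α}) (δ := 0) ⟨0, (add_zero B).symm⟩
    (fun ξ hξ => absurd hξ not_lt_zero) (Φ := fun m => m.state ≠ 1) (by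
      rintro v ⟨α, rfl⟩ -
      obtain ⟨T, h1, h2⟩ := exists_base h01 (P := P.remove (B + α)) (fun y hy => by
        rw [Program.remove_of_ne (hy.trans_le le_self_add).ne]) w
      exact ⟨T, zero_le, h1, fun ξ _ hξ => h2 ξ hξ⟩)
  have hrun := isRun_computation P ⟨w.tape, 0, 0⟩
  set c := computation P ⟨w.tape, 0, 0⟩ with hc
  have hrun' := isRun_computation q ⟨x, 0, 0⟩
  have hmain := hrun.imitate hrun' (T := T) (base := B) (by
    rw [computation_zero, h1, add_zero]) (fun ξ hξ α h4 => h2 ξ hξ ⟨α, h4⟩)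
    fun α hα d => symProgram_base hα d
  have hB1 : ∀ α, B + α ≠ 1 := fun α =>
    (one_lt_symIdle.trans_le (symIdle_le α)).ne'
  rcases interp_cases q x with ⟨γ, h4, h5, h6⟩ | ⟨h4, h5⟩
  · rw [h6]
    have h7 := hmain γ h5
    rw [h4] at h7
    have h8 := hrun.step_eq h7 (symProgram_halt _)
    -- The copy of the halting state is `B + 1`; one more step, which does not change the tape,
    -- leads from it to the state `1`.
    refine interp_eq_some (γ := T + γ + 1) (congrArg Snapshot.state h8) (fun ξ hξ => ?_)
      ((congrArg Snapshot.tape h8).trans (Function.update_eq_self _ _))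
    rcases lt_or_ge ξ T with h9 | h9
    · exact h3 ξ zero_le h9
    · obtain ⟨ξ, rfl⟩ := le_iff_exists_add.1 h9
      have h10 : ξ ≤ γ := (add_le_add_iff_left T).1 (lt_add_one_iff.1 hξ)
      change (c (T + ξ)).state ≠ 1
      rw [hmain ξ fun ζ hζ => h5 ζ (hζ.trans_le h10)]
      exact hB1 _
  · rw [h5]
    refine interp_eq_none fun ξ => ?_
    rcases lt_or_ge ξ T with h9 | h9
    · exact h3 ξ zero_le h9
    · obtain ⟨ξ, rfl⟩ := le_iff_exists_add.1 h9
      change (c (T + ξ)).state ≠ 1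
      rw [hmain ξ fun ζ _ => h4 ζ]
      exact hB1 _

/-- Above `symBase` the program is defined only for copies of the finitely many states of `q` and
for `symBase + 1`. So the states in its domain are bounded, and a bounded class of ordinals is a
set. -/
theorem symProgram_isTransfinite (hq : q.IsFinite) :
    (symProgram hj zr one p q).IsTransfinite := by
  obtain ⟨b, hb⟩ := (hq.image Prod.fst).bddAbove
  set B := symBase zr one j p with hB
  have hsub : (symProgram hj zr one p q).dom ⊆
      Set.Iio (B + (max b 1 + 1)) ×ˢ (Set.univ : Set (WithBot A)) := by
    intro y hy
    refine ⟨?_, trivial⟩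
    by_contra h
    rw [Set.mem_Iio, not_lt] at h
    obtain ⟨δ, hδ⟩ := le_iff_exists_add.1 h
    obtain ⟨y1, d⟩ := y
    dsimp only at hδ
    rw [add_assoc] at hδ
    have h1 : max b 1 < max b 1 + 1 + δ := (lt_add_one _).trans_le le_self_add
    have h2 : q (max b 1 + 1 + δ, d) = none := by
      by_contra h3
      exact absurd (hb ⟨_, h3, rfl⟩) (not_le.2 ((le_max_left _ _).trans_lt h1))
    apply hy
    rw [hδ, symProgram_base ((le_max_right _ _).trans_lt h1).ne', h2, Option.map_none]
  haveI : Small.{u} (Set.Iio (B + (max b 1 + 1)) ×ˢ (Set.univ : Set (WithBot A)) :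
      Set (Ordinal.{u} × WithBot A)) :=
    small_map (Equiv.Set.prod _ _)
  exact small_subset hsub

theorem symmetricallyComputable_of_koepkeComputableIn (h01 : zr ≠ one)
    {F : Word.{u} A →. Word.{u} A} (hF : KoepkeComputableIn zr one p F) :
    SymmetricallyComputable F := by
  obtain ⟨q, hq, hF⟩ := hF
  exact ⟨symProgram (le_refl 17) zr one p q, symProgram_isTransfinite hq, fun w => by
    rw [interp_symProgram h01, hF]⟩

end Symmetric

end OrdTM

/-- A partial function on words of ordinal length over a finite ordered alphabet with two distinguished
letters `zero ≠ one` is symmetrically computable if and only if it is Koepke computable in some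
parameter. -/
theorem proposition5p2 {A : Type v} [Fintype A] [LinearOrder A] (zero one : A) (h01 : zero ≠ one)
    (f : OrdTM.Word.{u} A →. OrdTM.Word.{u} A) :
    OrdTM.SymmetricallyComputable f ↔
      ∃ p : OrdTM.Word.{u} A, OrdTM.KoepkeComputableIn zero one p f := by
  refine ⟨OrdTM.koepkeComputableIn_of_symmetricallyComputable h01, ?_⟩
  rintro ⟨p, hp⟩
  exact OrdTM.symmetricallyComputable_of_koepkeComputableIn h01 hp
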